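/- **Setting.** Let $n\ge 1$, let $p$ be a prime and $s\in\mathbb F_p$ (represented in $\{0,\dots,p-1\}$). Number the nodes of the balanced binary tree with $n$ nodes level by level, the root being node $0$. Put a bit $d_i$ on the edge from node $i$ to its parent ($1\le i\le n-1$), and let $h(d)_i$ be the parity of the edge bits on the path from the root to node $i$. The *poor man's GHZ state* on $2n-1$ qubits ($n-1$ edge qubits, $n-1$ vertex qubits, one root qubit, the last two kinds being called the $n$ vertex qubits) is $$|\mathrm{BPM}_n\rangle=\sum_{d\in\{0,1\}^{n-1}}2^{-(n-1)/2}\,|d\rangle\otimes\tfrac1{\sqrt2}\big(|h(d)\,0\rangle+|\overline{h(d)}\,1\rangle\big).$$ For $k\ge1$ let $A_{k,\theta}|x_1,\dots,x_k\rangle=\bigotimes_{j}e^{i\theta x_{j-1}X}|x_j\rangle$ (indices cyclic), let $C_k|x_1,\dots,x_k\rangle=|x_2,\dots,x_k,x_1\rangle$, and let $B_k\subset\{0,1\}^k$ be any set containing exactly one of $x,\overline x$ for every $x$. The unitary $U_{k,\theta}$ is obtained from $A_{k,\theta}$ by Gram–Schmidt: $U_{k,\theta}|x\rangle=A_{k,\theta}|x\rangle$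 for $x\in B_k$ and $$U_{k,\theta}|x\rangle=\frac{A_{k,\theta}|x\rangle-(-i)^{k+2|x|}\sin^k(\theta)\,A_{k,\theta}|\overline x\rangle}{\sqrt{1-\sin^{2k}\theta}}\qquad(x\notin B_k).$$ Fix a constant $c\in(0,1/3]$, put $m=\lceil 2/c+1\rceil$, and cut the $n-1$ non-root vertex qubits into consecutive blocks of length $m$, the last block also taking the $(n-1)\bmod m$ left-over qubits. The target distribution $D_{n,p,s}$ on $\{0,1\}^{2n-1}$ is the Born distribution (measurement of all qubits in the computational basis) of the state obtained from $|\mathrm{BPM}_n\rangle$ by applying Hadamard gates to all $n$ vertex qubits, then $U_{k,\pi/p}^\dagger$ to every block ($k$ being its length) and $\exp(-iX(\frac\pi4-\frac{\pi s}p))$ to the root qubit, and then $C_k$ to every block. A *learner* is a deterministic program for a random access machine (natural-number registers, indirectly addressed memory, unit-cost addition, truncated subtraction, and tests for zero). It is given $n$, $p$, $M$ and $M$ samples and outputs a string. A *circuit description* is a string listing the layers of a circuit and, for every gate, the one or two qubits on which it acts and its matrix entries, whose real and imaginary parts are closed-form expressions built from natural numbers, $\cos(\pi a/b)$ and $\sin(\pi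 a/b)$ ($a,b\in\mathbb N$) by $-$, $+$, $\times$, inversion and real square roots. **Theorem.** There is an absolute constant $C>0$ such that for every $c\in(0,1/3]$ and every choice of the sets $B_k$ there are a learner and a depth bound $\Delta$ for which the following holds. For all $a,K>0$ there are $p_0,T\in\mathbb N$ such that for all $n$ and all primes $p\ge p_0$ with $a\,n^{c}\le p\le K\,n^{1/3}$, all $s\in\mathbb F_p$ and all $\delta\in(0,1)$, with $M=\lceil C\,p^4\log(p/\delta)\rceil$: 1. on every sequence of $M$ strings in $\{0,1\}^{2n-1}$ the learner halts after at most $T\,(n+\log(1/\delta))^{T}$ steps; 2. given $M$ independent samples of $D_{n,p,s}$, with probability at least $1-\delta$ the learner outputs $s$ followed by a description of a quantum circuit on $2n-1$ qubits, started in the all-zeros state, which has at most $\Delta$ layers, each consisting of unitary one- and two-qubit gates on disjoint qubits, and whose Born distribution $D'$ satisfies $d_{TV}(D_{n,p,s},D')=0$. -/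

import Mathlib

namespace ShallowLearning

/-! ### Qubits, gates and circuits -/

/-- Bit strings of length `q`; they label the computational basis of `q` qubits. -/
abbrev Bits (q : ℕ) : Type := Fin q → Bool

/-- The bits of `x`, indexed by all naturals (`false` beyond the end). -/
def Bits.at {q : ℕ} (x : Bits q) (i : ℕ) : Bool :=
  if h : i < q then x ⟨i, h⟩ else false

/-- Number of ones. -/
def Bits.weight {q : ℕ} (x : Bits q) : ℕ := (Finset.univ.filter fun i => x i = true).card

/-- Bitwise complement. -/
def Bits.compl {q : ℕ} (x : Bits q) : Bits q := fun i => !(x i)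

/-- A (not necessarily normalised) vector in the space of `q` qubits. -/
abbrev QState (q : ℕ) : Type := Bits q → ℂ

/-- A gate: a matrix acting on an ordered tuple of qubits, `mat y x` being the entry `⟨y| U |x⟩`. -/
structure Gate where
  arity : ℕ
  wires : Fin arity → ℕ
  mat : Matrix (Bits arity) (Bits arity) ℂ

/-- The gate as an operator on `q` qubits (the identity on the other qubits). -/
noncomputable def Gate.apply {q : ℕ} (g : Gate) (ψ : QState q) : QState q := fun x =>
  ∑ b : Bits g.arity,
    g.mat (fun j => x.at (g.wires j)) b * ψ (fun v => Function.extend g.wires b x.at v)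

/-- A genuine unitary gate on distinct qubits of a register of `q` qubits. -/
def Gate.IsValid (q : ℕ) (g : Gate) : Prop :=
  Function.Injective g.wires ∧ (∀ j, g.wires j < q) ∧
    g.mat ∈ Matrix.unitaryGroup (Bits g.arity) ℂ

/-- A circuit is a list of layers, applied in order; a layer is a list of gates. -/
abbrev Circuit : Type := List (List Gate)

/-- The number of layers. -/
def Circuit.depth (c : Circuit) : ℕ := c.length

/-- Every gate is a unitary on at most two qubits, and gates in one layer act on disjoint qubits. -/
def Circuit.IsValid (q : ℕ) (c : Circuit) : Prop :=
  ∀ layer ∈ c,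
    (∀ g ∈ layer, g.arity ≤ 2 ∧ g.IsValid q) ∧
    layer.Pairwise fun g g' => Disjoint (Set.range g.wires) (Set.range g'.wires)

/-- The operator of a circuit. -/
noncomputable def Circuit.apply {q : ℕ} (c : Circuit) (ψ : QState q) : QState q :=
  c.flatten.foldl (fun φ g => g.apply φ) ψ

/-- The all-zeros basis state. -/
noncomputable def zeroState (q : ℕ) : QState q := Pi.single (fun _ => false) 1

/-- Outcome probabilities of a measurement of all qubits in the computational basis. -/
noncomputable def born {q : ℕ} (ψ : QState q) : Bits q → ℝ := fun x => ‖ψ x‖ ^ 2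

/-- The Born distribution of a circuit run on the all-zeros state of `q` qubits. -/
noncomputable def Circuit.bornDist (q : ℕ) (c : Circuit) : Bits q → ℝ :=
  born (c.apply (zeroState q))

/-- Total variation distance of two distributions on a finite set. -/
noncomputable def tvDist {α : Type*} [Fintype α] (P Q : α → ℝ) : ℝ := (1 / 2) * ∑ x, |P x - Q x|

/-- Probability of an event over `M` independent draws from `D`. -/
noncomputable def iidProb {α : Type*} [Fintype α] (D : α → ℝ) (M : ℕ)
    (E : Set (Fin M → α)) : ℝ :=
  ∑ ω : Fin M → α, E.indicator (fun ω => ∏ i, D (ω i)) ω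

/-! ### The target distributions

The register has `2 n - 1` qubits: edge qubits `0, …, n - 2`, vertex qubits `n - 1, …, 2 n - 3`
and last the root qubit `2 n - 2` (also counted among the `n` vertex qubits). -/

/-- Nodes of the balanced binary tree are numbered level by level, the root being `0`, so node
`t + 1` has parent `t / 2`; bit `d t` sits on the edge from node `t + 1` to its parent.
`pathSum d v` is the parity of the edge bits on the path from the root to node `v`. -/
def pathSum (d : ℕ → Bool) : ℕ → Bool
  | 0 => false
  | t + 1 => xor (d t) (pathSum d (t / 2))
decreasing_by omega

/-- The binary tree poor man's GHZ state
`∑_d 2^{-(n-1)/2} |d⟩ ⊗ (|h(d) 0⟩ + |\overline{h(d)} 1⟩) / √2`. -/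
noncomputable def bpmState (n : ℕ) : QState (2 * n - 1) := fun z =>
  open Classical in
  if ∀ i < n - 1, z.at (n - 1 + i) = xor (pathSum z.at (i + 1)) (z.at (2 * n - 2))
  then (1 / (Real.sqrt 2 : ℂ)) ^ (n - 1) * (1 / (Real.sqrt 2 : ℂ)) else 0

/-- `⟨y| exp(i φ X) |x⟩`, using `exp(i φ X) = cos φ + i sin φ X`. -/
noncomputable def expX (φ : ℝ) (y x : Bool) : ℂ :=
  if y = x then (Real.cos φ : ℂ) else Complex.I * (Real.sin φ : ℂ)

/-- `⟨y| H |x⟩` for the Hadamard gate. -/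
noncomputable def hadamard (y x : Bool) : ℂ :=
  (if y && x then -1 else 1) / (Real.sqrt 2 : ℂ)

/-- `A_{k,θ} |x_1, …, x_k⟩ = ⨂_j exp(i θ x_{j-1} X) |x_j⟩`, indices cyclic. -/
noncomputable def cyclicA (k : ℕ) (θ : ℝ) : Matrix (Bits k) (Bits k) ℂ := fun y x =>
  ∏ j, expX (if x ((finRotate k).symm j) then θ else 0) (y j) (x j)

/-- `B` contains exactly one of `x` and its complement, for every string `x`. -/
def IsHalf {k : ℕ} (B : Set (Bits k)) : Prop := ∀ x, x ∈ B ↔ x.compl ∉ B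

/-- The unitary `U_{k,θ}` obtained from the columns of `A_{k,θ}` by Gram-Schmidt: columns in `B`
are kept, and a column `x` outside `B` has its component along the column of the complement of `x`
removed. That component is `⟨A x̄, A x⟩ = (-i)^(k + 2 |x|) sin^k θ`. -/
noncomputable def blockU (k : ℕ) (θ : ℝ) (B : Set (Bits k)) : Matrix (Bits k) (Bits k) ℂ :=
  fun y x =>
    open Classical in
    if x ∈ B then cyclicA k θ y x
    else ((Real.sqrt (1 - Real.sin θ ^ (2 * k)) : ℝ) : ℂ)⁻¹ *
      (cyclicA k θ y x -
        (-Complex.I) ^ (k + 2 * x.weight) * (Real.sin θ : ℂ) ^ k * cyclicA k θ y x.compl)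

/-- `C_k |x_1, x_2, …, x_k⟩ = |x_2, …, x_k, x_1⟩`. -/
noncomputable def cyclicC (k : ℕ) : Matrix (Bits k) (Bits k) ℂ := fun y x =>
  if y = (fun j => x (finRotate k j)) then 1 else 0

/-- Offset and length of the consecutive blocks into which the first `n - 1` vertex qubits are cut:
length `m`, except that the last block also takes the `(n - 1) % m` left-over qubits. -/
def blocks (n m : ℕ) : List (ℕ × ℕ) :=
  (List.range ((n - 1) / m)).map fun j =>
    (j * m, if j + 1 = (n - 1) / m then n - 1 - j * m else m)

/-- A one-qubit gate. -/
def gate1 (w : ℕ) (U : Bool → Bool → ℂ) : Gate := ⟨1, fun _ => w, fun y x => U (y 0) (x 0)⟩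

/-- The layers which produce the target distribution from the poor man's GHZ state: Hadamard gates
on all vertex qubits; `U_{k,π/p}†` on every block and `exp(-i X (π/4 - π s/p))` on the root qubit;
`C_k` on every block. -/
noncomputable def targetLayers (B : (k : ℕ) → Set (Bits k)) (m n p s : ℕ) : Circuit :=
  [ (List.range n).map (fun i => gate1 (n - 1 + i) hadamard),
    gate1 (2 * n - 2) (expX (-(Real.pi / 4 - Real.pi * s / p))) ::
      (blocks n m).map (fun b =>
        ⟨b.2, fun j => n - 1 + b.1 + j, (blockU b.2 (Real.pi / p) (B b.2)).conjTranspose⟩),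
    (blocks n m).map (fun b => ⟨b.2, fun j => n - 1 + b.1 + j, cyclicC b.2⟩) ]

/-- The target distribution `D_{n,p,s}` on `2 n - 1` bits, with block length `m`. -/
noncomputable def targetDist (B : (k : ℕ) → Set (Bits k)) (m n p : ℕ) (s : ZMod p) :
    Bits (2 * n - 1) → ℝ :=
  born ((targetLayers B m n p s.val).apply (bpmState n))

/-! ### Finite descriptions of circuits -/

/-- Closed-form expressions for real numbers. -/
inductive RealTerm : Type
  | nat (k : ℕ)
  | cosPi (a b : ℕ)
  | sinPi (a b : ℕ)
  | neg (e : RealTerm)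
  | plus (e f : RealTerm)
  | times (e f : RealTerm)
  | inv (e : RealTerm)
  | sqrt (e : RealTerm)

/-- The real number denoted; `cosPi a b` is `cos (π a / b)` and `sinPi a b` is `sin (π a / b)`. -/
noncomputable def RealTerm.eval : RealTerm → ℝ
  | nat k => k
  | cosPi a b => Real.cos (Real.pi * a / b)
  | sinPi a b => Real.sin (Real.pi * a / b)
  | neg e => -e.eval
  | plus e f => e.eval + f.eval
  | times e f => e.eval * f.eval
  | inv e => e.eval⁻¹
  | sqrt e => Real.sqrt e.eval

/-- Expressions as strings of naturals, in prefix notation. -/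
def RealTerm.encode : RealTerm → List ℕ
  | nat k => [0, k]
  | cosPi a b => [1, a, b]
  | sinPi a b => [2, a, b]
  | neg e => 3 :: e.encode
  | plus e f => 4 :: (e.encode ++ f.encode)
  | times e f => 5 :: (e.encode ++ f.encode)
  | inv e => 6 :: e.encode
  | sqrt e => 7 :: e.encode

/-- A complex number given by its real and imaginary part. -/
structure ComplexTerm : Type where
  re : RealTerm
  im : RealTerm

noncomputable def ComplexTerm.eval (z : ComplexTerm) : ℂ := ⟨z.re.eval, z.im.eval⟩

def ComplexTerm.encode (z : ComplexTerm) : List ℕ := z.re.encode ++ z.im.encode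

/-- A one- or two-qubit gate given by its qubits and its matrix entries `U y x = ⟨y| U |x⟩`. -/
inductive GateDesc : Type
  | one (w : ℕ) (U : Bool → Bool → ComplexTerm)
  | two (w₁ w₂ : ℕ) (U : Bool × Bool → Bool × Bool → ComplexTerm)

noncomputable def GateDesc.toGate : GateDesc → Gate
  | one w U => ⟨1, ![w], fun y x => (U (y 0) (x 0)).eval⟩
  | two w₁ w₂ U => ⟨2, ![w₁, w₂], fun y x => (U (y 0, y 1) (x 0, x 1)).eval⟩

def GateDesc.encode : GateDesc → List ℕ
  | one w U => 1 :: w ::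
      [false, true].flatMap fun y => [false, true].flatMap fun x => (U y x).encode
  | two w₁ w₂ U => 2 :: w₁ :: w₂ ::
      ([false, true].product [false, true]).flatMap fun y =>
        ([false, true].product [false, true]).flatMap fun x => (U y x).encode

/-- A description of a circuit of one- and two-qubit gates: its layers. -/
abbrev CircuitDesc : Type := List (List GateDesc)

/-- The circuit described. -/
noncomputable def CircuitDesc.toCircuit (c : CircuitDesc) : Circuit :=
  List.map (List.map GateDesc.toGate) c

/-- Circuit descriptions as strings of naturals; lists are preceded by their length. -/
def CircuitDesc.encode (c : CircuitDesc) : List ℕ :=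
  c.length :: c.flatMap fun layer => layer.length :: layer.flatMap GateDesc.encode

/-! ### Algorithms

Structured programs for a random access machine that adds and subtracts natural numbers at unit cost
(no multiplication), a model polynomially equivalent to Turing machines. -/

/-- Memory contents: registers (direct access), a random access memory
(indirect access), and the output written so far. -/
structure RamState : Type where
  reg : ℕ → ℕ
  mem : ℕ → ℕ
  out : List ℕ

inductive Program : Type
  /-- `r := k` -/
  | const (r k : ℕ)
  /-- `r := a + b` -/
  | plus (r a b : ℕ)
  /-- `r := a - b`, truncated at `0` -/
  | minus (r a b : ℕ)
  /-- `r := mem[a]` -/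
  | load (r a : ℕ)
  /-- `mem[a] := r` -/
  | store (a r : ℕ)
  /-- append `r` to the output -/
  | emit (r : ℕ)
  | seq (P Q : Program)
  /-- if `r ≠ 0` then `P` else `Q` -/
  | cond (r : ℕ) (P Q : Program)
  /-- while `r ≠ 0` do `P` -/
  | loop (r : ℕ) (P : Program)

/-- `Exec P σ t τ`: started in `σ`, the program `P` halts in `τ` after exactly `t` steps. -/
inductive Exec : Program → RamState → ℕ → RamState → Prop
  | const (σ : RamState) (r k : ℕ) :
      Exec (.const r k) σ 1 { σ with reg := Function.update σ.reg r k }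
  | plus (σ : RamState) (r a b : ℕ) :
      Exec (.plus r a b) σ 1 { σ with reg := Function.update σ.reg r (σ.reg a + σ.reg b) }
  | minus (σ : RamState) (r a b : ℕ) :
      Exec (.minus r a b) σ 1 { σ with reg := Function.update σ.reg r (σ.reg a - σ.reg b) }
  | load (σ : RamState) (r a : ℕ) :
      Exec (.load r a) σ 1 { σ with reg := Function.update σ.reg r (σ.mem (σ.reg a)) }
  | store (σ : RamState) (a r : ℕ) :
      Exec (.store a r) σ 1 { σ with mem := Function.update σ.mem (σ.reg a) (σ.reg r) }
  | emit (σ : RamState) (r : ℕ) :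
      Exec (.emit r) σ 1 { σ with out := σ.out ++ [σ.reg r] }
  | seq {P Q : Program} {σ τ υ : RamState} {t u : ℕ} :
      Exec P σ t τ → Exec Q τ u υ → Exec (.seq P Q) σ (t + u) υ
  | cond_true {r : ℕ} {P Q : Program} {σ τ : RamState} {t : ℕ} :
      σ.reg r ≠ 0 → Exec P σ t τ → Exec (.cond r P Q) σ (t + 1) τ
  | cond_false {r : ℕ} {P Q : Program} {σ τ : RamState} {t : ℕ} :
      σ.reg r = 0 → Exec Q σ t τ → Exec (.cond r P Q) σ (t + 1) τ
  | loop_stop {r : ℕ} {P : Program} {σ : RamState} :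
      σ.reg r = 0 → Exec (.loop r P) σ 1 σ
  | loop_step {r : ℕ} {P : Program} {σ τ υ : RamState} {t u : ℕ} :
      σ.reg r ≠ 0 → Exec P σ t τ → Exec (.loop r P) τ u υ → Exec (.loop r P) σ (t + u + 1) υ

/-- Initial state: `n`, `p`, `M` in registers `0`, `1`, `2`, the `M` samples of `2 n - 1` bits one
after the other in the memory, everything else `0`, nothing written. -/
def initState (n p M : ℕ) (ω : Fin M → Bits (2 * n - 1)) : RamState where
  reg := fun r => if r = 0 then n else if r = 1 then p else if r = 2 then M else 0
  mem := fun a =>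
    if h : a / (2 * n - 1) < M then ((ω ⟨a / (2 * n - 1), h⟩).at (a % (2 * n - 1))).toNat else 0
  out := []

/-- On input `n`, `p` and the samples `ω`, the program halts after `t` steps with output `o`. -/
def Program.Runs (P : Program) {M : ℕ} (n p : ℕ) (ω : Fin M → Bits (2 * n - 1)) (t : ℕ)
    (o : List ℕ) : Prop :=
  ∃ τ : RamState, Exec P (initState n p M ω) t τ ∧ τ.out = o

end ShallowLearning

/-!
The learner computes, for every candidate `t`, a score of the samples, outputs the candidate with
the largest score, and then writes a fixed pattern of layers in which only `n`, `p` and the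
candidate enter. When the candidate is `s`, the circuit prepares the target state exactly, so that
the distance between the two distributions is `0`.

*The circuit.* The poor man's GHZ state is a uniform superposition over the bits on the nodes, where
each edge bit is the sum of the bits at its ends; Hadamard gates and five layers of controlled
negations prepare it (`treeLayers_apply`). The block unitaries have a bounded number of qubits, and
their entries are closed forms in `cos (π / p)` and `sin (π / p)`. Every such family of unitaries is
a product of a fixed number of one- and two-qubit gates with closed-form entries
(`InG.of_unitary`): controlled phases are built from controlled negations and square roots of
phases, they give transpositions of basis states, these give two-level rotations, and a unitary is
reduced column by column by rank-one phase rotations. The case distinctions that elimination needs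
are available because closed forms with `0⁻¹ = 0` can express the indicator of a zero. All blocks
but the last have the same length, so the same pattern serves for all of them; altogether there is
a constant number of layer templates (`exists_layers`).

*The statistics.* The matrix `A` of the block unitaries is close to unitary, with errors of the
order of `sin (π / p) ^ m`, and the lower bound on `p` makes the total error of the `n` blocks
small compared with `1 / p ^ 2` (`sum_abs_targetDist_sub_le`, `exists_forall_error_le`). With `A` in
place of `U` everything is a product operator, and the outcome distribution is explicit
(`norm_idealGates_eq_idealDist`): the weight of `y` is proportional to
`1 - σ(y) sin (2 π (S(y) - s) / p)`, where `σ(y)` is the parity sign of the vertex bits and `S(y)`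
is the sum of the shifted vertex bits with the signs of the paths. For uniformly random bits `S` is
nearly uniform modulo `p`, since its nonzero Fourier modes are at most `cos (π / p) ^ (n - 1)`
(`abs_sum_treeSum_sub_le`). The score of `t` is `-σ(y)` when `S(y) - t` lies in the half circle
where the sine is positive, and `0` otherwise. Its expectation is largest for `t = s`, with a gap of
`1 / p ^ 2` (`sum_score_sub_le`); an exponential moment bound and the union bound over the
candidates show that `16 p ^ 4 log (p / δ)` samples suffice (`one_sub_le_iidProb`).

*The program.* `Reach P σ T Q` says that `P` halts within `T` steps in a state with property `Q`.
Loops are treated by invariants indexed by the number of rounds. The search takes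
`O(p M n)` steps (`reach_searchProg`), writing the layers takes `O(n)` steps (`reach_layersProg`),
and `reach_learner` puts the parts together.
-/


section
open scoped Matrix
namespace ShallowLearning

/-! ### Calculus of gates on a register -/

/-- The bits of `x` on the wires `w`. -/
def Bits.get {q a : ℕ} (w : Fin a → ℕ) (x : Bits q) : Bits a := fun j => x.at (w j)

/-- The string `x` with the bits on the wires `w` replaced by `b`. -/
noncomputable def Bits.put {q a : ℕ} (w : Fin a → ℕ) (x : Bits q) (b : Bits a) : Bits q :=
  fun v => Function.extend w b x.at v

theorem Bits.at_val {q : ℕ} (x : Bits q) (v : Fin q) : x.at v = x v := by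
  simp [Bits.at]

theorem Bits.at_of_lt {q : ℕ} (x : Bits q) {v : ℕ} (h : v < q) : x.at v = x ⟨v, h⟩ := by
  simp [Bits.at, h]

theorem Gate.apply_eq {q : ℕ} (g : Gate) (ψ : QState q) (x : Bits q) :
    g.apply ψ x = ∑ b, g.mat (x.get g.wires) b * ψ (x.put g.wires b) := rfl

section wires
variable {q a : ℕ} {w : Fin a → ℕ}

theorem Bits.put_of_mem (hw : Function.Injective w) (b : Bits a) (x : Bits q) (j : Fin a)
    (v : Fin q) (hv : (v : ℕ) = w j) : x.put w b v = b j := by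
  simp [Bits.put, hv, hw.extend_apply]

theorem Bits.put_of_notMem (b : Bits a) (x : Bits q) (v : Fin q)
    (hv : (v : ℕ) ∉ Set.range w) : x.put w b v = x v := by
  rw [Bits.put, Function.extend_apply' _ _ _ (by simpa using hv), Bits.at_val]

theorem Bits.at_put_of_mem (hw : Function.Injective w) (hq : ∀ j, w j < q) (b : Bits a)
    (x : Bits q) (j : Fin a) : (x.put w b).at (w j) = b j := by
  rw [Bits.at_of_lt _ (hq j)]
  exact Bits.put_of_mem hw b x j _ rfl

theorem Bits.at_put_of_notMem (b : Bits a) (x : Bits q) (v : ℕ)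
    (hv : v ∉ Set.range w) : (x.put w b).at v = x.at v := by
  unfold Bits.at
  split_ifs with h
  · exact Bits.put_of_notMem b x ⟨v, h⟩ hv
  · rfl

theorem Bits.get_put (hw : Function.Injective w) (hq : ∀ j, w j < q) (b : Bits a) (x : Bits q) :
    (x.put w b).get w = b := by
  funext j
  exact Bits.at_put_of_mem hw hq b x j

theorem Bits.put_get (hw : Function.Injective w) (x : Bits q) :
    x.put w (x.get w) = x := by
  funext v
  by_cases hv : (v : ℕ) ∈ Set.range w
  · obtain ⟨j, hj⟩ := hv
    rw [Bits.put_of_mem hw _ _ j v hj.symm, Bits.get, hj, Bits.at_val]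
  · exact Bits.put_of_notMem _ _ _ hv

theorem Bits.put_put (hw : Function.Injective w) (b c : Bits a) (x : Bits q) :
    (x.put w c).put w b = x.put w b := by
  funext v
  by_cases hv : (v : ℕ) ∈ Set.range w
  · obtain ⟨j, hj⟩ := hv
    rw [Bits.put_of_mem hw _ _ j v hj.symm, Bits.put_of_mem hw _ _ j v hj.symm]
  · simp [Bits.put_of_notMem, hv]

/-- Exchanging the bits of `x` on the wires with a detached string `b` is an involution. -/
theorem sum_put_get (hw : Function.Injective w) (hq : ∀ j, w j < q) {E : Type*} [AddCommMonoid E]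
    (F : Bits q → Bits a → E) :
    ∑ x : Bits q, ∑ b, F (x.put w b) (x.get w) = ∑ x, ∑ b, F x b := by
  rw [← Fintype.sum_prod_type', ← Fintype.sum_prod_type']
  have hinv : Function.Involutive
      (fun z : Bits q × Bits a => (z.1.put w z.2, z.1.get w)) := by
    rintro ⟨x, b⟩
    simp [Bits.put_put hw, Bits.put_get hw, Bits.get_put hw hq]
  exact Equiv.sum_comp (hinv.toPerm _) (fun z : Bits q × Bits a => F z.1 z.2)

end wires

/-- The gate with the conjugate transposed matrix. -/
noncomputable def Gate.adj (g : Gate) : Gate := ⟨g.arity, g.wires, g.mat.conjTranspose⟩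

theorem Gate.apply_sub {q : ℕ} (g : Gate) (φ ψ : QState q) :
    g.apply (φ - ψ) = g.apply φ - g.apply ψ := by
  funext x
  simp [Gate.apply_eq, mul_sub, Finset.sum_sub_distrib]

theorem Gate.adjoint {q : ℕ} (g : Gate) (hw : Function.Injective g.wires)
    (hq : ∀ j, g.wires j < q) (u v : QState q) :
    star (g.apply u) ⬝ᵥ v = star u ⬝ᵥ g.adj.apply v := by
  simp only [dotProduct, Pi.star_apply, Gate.apply_eq, star_sum, Finset.sum_mul, Finset.mul_sum,
    star_mul']
  rw [← sum_put_get hw hq]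
  refine Finset.sum_congr rfl fun x _ => Finset.sum_congr rfl fun b _ => ?_
  simp only [Bits.get_put hw hq, Bits.put_put hw, Bits.put_get hw, Gate.adj,
    Matrix.conjTranspose_apply]
  ring

theorem apply_mul {q a : ℕ} {w : Fin a → ℕ} (hw : Function.Injective w)
    (hq : ∀ j, w j < q) (M N : Matrix (Bits a) (Bits a) ℂ) (ψ : QState q) :
    (Gate.mk a w M).apply ((Gate.mk a w N).apply ψ) = (Gate.mk a w (M * N)).apply ψ := by
  funext x
  simp only [Gate.apply_eq, Matrix.mul_apply, Finset.sum_mul, Finset.mul_sum, Bits.get_put hw hq,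
    Bits.put_put hw]
  rw [Finset.sum_comm]
  simp only [mul_assoc]

theorem apply_one {q a : ℕ} {w : Fin a → ℕ} (hw : Function.Injective w) (ψ : QState q) :
    (Gate.mk a w 1).apply ψ = ψ := by
  funext x
  simp [Gate.apply_eq, Matrix.one_apply, Bits.put_get hw]

/-- The Hilbert space norm of a state. -/
noncomputable def stateNorm {q : ℕ} (ψ : QState q) : ℝ := ‖WithLp.toLp 2 ψ‖

theorem stateNorm_sq {q : ℕ} (ψ : QState q) : stateNorm ψ ^ 2 = ∑ x, ‖ψ x‖ ^ 2 := by
  simp [stateNorm, EuclideanSpace.norm_sq_eq]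

theorem stateNorm_nonneg {q : ℕ} (ψ : QState q) : 0 ≤ stateNorm ψ := norm_nonneg _

theorem stateNorm_add_le {q : ℕ} (φ ψ : QState q) :
    stateNorm (φ + ψ) ≤ stateNorm φ + stateNorm ψ := by
  simpa [stateNorm] using norm_add_le (WithLp.toLp 2 φ) (WithLp.toLp 2 ψ)

theorem dot_self {q : ℕ} (ψ : QState q) : star ψ ⬝ᵥ ψ = ((stateNorm ψ ^ 2 : ℝ) : ℂ) := by
  rw [stateNorm_sq]
  simp only [dotProduct, Pi.star_apply, Complex.ofReal_sum]
  refine Finset.sum_congr rfl fun x _ => ?_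
  rw [Complex.ofReal_pow, ← Complex.conj_mul']
  rfl

theorem Gate.IsValid.stateNorm_apply {q : ℕ} {g : Gate} (hg : g.IsValid q) (ψ : QState q) :
    stateNorm (g.apply ψ) = stateNorm ψ := by
  have h : star (g.apply ψ) ⬝ᵥ g.apply ψ = star ψ ⬝ᵥ ψ := by
    rw [g.adjoint hg.1 hg.2.1]
    congr 1
    obtain ⟨a, w, M⟩ := g
    rw [Gate.adj, apply_mul hg.1 hg.2.1]
    have h1 : M.conjTranspose * M = 1 := Matrix.mem_unitaryGroup_iff'.1 hg.2.2
    simp only [h1]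
    exact apply_one hg.1 ψ
  rw [dot_self, dot_self, Complex.ofReal_inj] at h
  exact (sq_eq_sq₀ (stateNorm_nonneg _) (stateNorm_nonneg _)).1 h

/-- A gate whose matrix has entries of size at most `e` has operator norm at most
`2 ^ arity * e`. -/
theorem stateNorm_apply_le {q : ℕ} {g : Gate} (hw : Function.Injective g.wires)
    (hq : ∀ j, g.wires j < q) {e : ℝ} (he : 0 ≤ e) (hM : ∀ y x, ‖g.mat y x‖ ≤ e) (ψ : QState q) :
    stateNorm (g.apply ψ) ≤ 2 ^ g.arity * e * stateNorm ψ := by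
  refine le_of_sq_le_sq ?_ (by have := stateNorm_nonneg ψ; positivity)
  rw [mul_pow, stateNorm_sq, stateNorm_sq]
  have hcard : (Finset.univ : Finset (Bits g.arity)).card = 2 ^ g.arity := by
    simp [Finset.card_univ]
  calc ∑ x, ‖g.apply ψ x‖ ^ 2
      ≤ ∑ x : Bits q, ∑ b : Bits g.arity, (2 ^ g.arity * e ^ 2) * ‖ψ (x.put g.wires b)‖ ^ 2 := by
        refine Finset.sum_le_sum fun x _ => ?_
        rw [Gate.apply_eq]
        calc ‖∑ b, g.mat (x.get g.wires) b * ψ (x.put g.wires b)‖ ^ 2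
            ≤ (∑ b, e * ‖ψ (x.put g.wires b)‖) ^ 2 := by
              refine pow_le_pow_left₀ (norm_nonneg _) (norm_sum_le_of_le _ fun b _ => ?_) 2
              rw [norm_mul]
              exact mul_le_mul_of_nonneg_right (hM _ _) (norm_nonneg _)
          _ ≤ (Finset.univ : Finset (Bits g.arity)).card *
                ∑ b, (e * ‖ψ (x.put g.wires b)‖) ^ 2 := sq_sum_le_card_mul_sum_sq
          _ = _ := by
              rw [hcard, Finset.mul_sum]
              refine Finset.sum_congr rfl fun b _ => ?_
              push_cast
              ring
    _ = ∑ x : Bits q, ∑ _b : Bits g.arity, (2 ^ g.arity * e ^ 2) * ‖ψ x‖ ^ 2 :=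
        sum_put_get hw hq (fun x _ => (2 ^ g.arity * e ^ 2) * ‖ψ x‖ ^ 2)
    _ = (2 ^ g.arity * e) ^ 2 * ∑ x, ‖ψ x‖ ^ 2 := by
        simp only [Finset.sum_const, hcard, nsmul_eq_mul, Finset.mul_sum]
        refine Finset.sum_congr rfl fun b _ => ?_
        push_cast
        ring

/-- Gates on disjoint wires commute. -/
theorem Gate.apply_comm {q : ℕ} {g h : Gate}
    (hd : Disjoint (Set.range g.wires) (Set.range h.wires)) (hg : Function.Injective g.wires)
    (hh : Function.Injective h.wires) (ψ : QState q) :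
    g.apply (h.apply ψ) = h.apply (g.apply ψ) := by
  have key : ∀ {g h : Gate}, Disjoint (Set.range g.wires) (Set.range h.wires) →
      ∀ (x : Bits q) b, (x.put g.wires b).get h.wires = x.get h.wires := by
    intro g h hd x b
    funext j
    exact Bits.at_put_of_notMem _ _ _ fun hm => Set.disjoint_left.1 hd hm ⟨j, rfl⟩
  have hput : ∀ (x : Bits q) b c,
      (x.put g.wires b).put h.wires c = (x.put h.wires c).put g.wires b := by
    intro x b c
    funext v
    by_cases h1 : (v : ℕ) ∈ Set.range g.wires
    · have h2 : (v : ℕ) ∉ Set.range h.wires := Set.disjoint_left.1 hd h1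
      obtain ⟨j, hj⟩ := h1
      rw [Bits.put_of_notMem _ _ _ h2, Bits.put_of_mem hg _ _ j v hj.symm,
        Bits.put_of_mem hg _ _ j v hj.symm]
    · rw [Bits.put_of_notMem (w := g.wires) _ _ _ h1]
      by_cases h2 : (v : ℕ) ∈ Set.range h.wires
      · obtain ⟨j, hj⟩ := h2
        rw [Bits.put_of_mem hh _ _ j v hj.symm, Bits.put_of_mem hh _ _ j v hj.symm]
      · simp only [Bits.put_of_notMem _ _ _ h2, Bits.put_of_notMem _ _ _ h1]
  funext x
  simp only [Gate.apply_eq, Finset.mul_sum, key hd, key hd.symm, hput]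
  rw [Finset.sum_comm]
  refine Finset.sum_congr rfl fun c _ => Finset.sum_congr rfl fun b _ => ?_
  ring

/-- The operator of a list of gates applied in order. -/
noncomputable def applyList {q : ℕ} (l : List Gate) (ψ : QState q) : QState q :=
  l.foldl (fun φ g => g.apply φ) ψ

theorem applyList_nil {q : ℕ} (ψ : QState q) : applyList [] ψ = ψ := rfl

theorem applyList_cons {q : ℕ} (g : Gate) (l : List Gate) (ψ : QState q) :
    applyList (g :: l) ψ = applyList l (g.apply ψ) := rfl

theorem applyList_append {q : ℕ} (l l' : List Gate) (ψ : QState q) :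
    applyList (l ++ l') ψ = applyList l' (applyList l ψ) := by
  simp [applyList]

theorem applyList_adjoint {q : ℕ} (l : List Gate)
    (hl : ∀ g ∈ l, Function.Injective g.wires ∧ ∀ j, g.wires j < q) (u v : QState q) :
    star u ⬝ᵥ applyList l v = star (applyList (l.reverse.map Gate.adj) u) ⬝ᵥ v := by
  induction l generalizing u v with
  | nil => rfl
  | cons g l ih =>
    have hg := hl g (by simp)
    rw [applyList_cons, ih (fun g' h' => hl g' (by simp [h'])), List.reverse_cons, List.map_append,
      applyList_append]
    simp only [List.map_cons, List.map_nil, applyList_cons, applyList_nil]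
    rw [Gate.adjoint g.adj hg.1 hg.2]
    simp [Gate.adj]

theorem stateNorm_applyList {q : ℕ} (l : List Gate) (hl : ∀ g ∈ l, g.IsValid q) (ψ : QState q) :
    stateNorm (applyList l ψ) = stateNorm ψ := by
  induction l generalizing ψ with
  | nil => rfl
  | cons g l ih =>
    rw [applyList_cons, ih (fun g' h' => hl g' (by simp [h'])),
      (hl g (by simp)).stateNorm_apply]

theorem applyList_apply_comm {q : ℕ} (g : Gate) (hg : Function.Injective g.wires) (l : List Gate)
    (hl : ∀ h ∈ l, Function.Injective h.wires ∧
      Disjoint (Set.range g.wires) (Set.range h.wires)) (ψ : QState q) :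
    applyList l (g.apply ψ) = g.apply (applyList l ψ) := by
  induction l generalizing ψ with
  | nil => rfl
  | cons h l ih =>
    rw [applyList_cons, applyList_cons, ← ih (fun h' m => hl h' (by simp [m])),
      Gate.apply_comm (hl h (by simp)).2 hg (hl h (by simp)).1]

theorem applyList_comm {q : ℕ} (l l' : List Gate)
    (hl : ∀ g ∈ l, Function.Injective g.wires) (hl' : ∀ g ∈ l', Function.Injective g.wires)
    (hd : ∀ g ∈ l, ∀ h ∈ l', Disjoint (Set.range g.wires) (Set.range h.wires)) (ψ : QState q) :
    applyList l (applyList l' ψ) = applyList l' (applyList l ψ) := by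
  induction l generalizing ψ with
  | nil => rfl
  | cons g l ih =>
    rw [applyList_cons, applyList_cons, ← ih (fun h' m => hl h' (by simp [m]))
      (fun g' m => hd g' (by simp [m])), applyList_apply_comm g (hl g (by simp)) l'
      (fun h hm => ⟨hl' h hm, hd g (by simp) h hm⟩)]

/-- A layered product of gates acting on disjoint groups of wires may be evaluated group by group:
`F l j` is the gate of layer `l` in group `j`. -/
theorem applyList_layers {q : ℕ} {ι κ : Type*} (Ls : List ι) (js : List κ)
    (F : ι → κ → Gate) (hF : ∀ l ∈ Ls, ∀ j ∈ js, Function.Injective (F l j).wires)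
    (hd : js.Pairwise fun j j' => ∀ l ∈ Ls, ∀ l' ∈ Ls,
      Disjoint (Set.range (F l j).wires) (Set.range (F l' j').wires)) (ψ : QState q) :
    applyList (Ls.flatMap fun l => js.map (F l)) ψ =
      applyList (js.flatMap fun j => Ls.map fun l => F l j) ψ := by
  induction js generalizing ψ with
  | nil =>
    have : (Ls.flatMap fun l => ([] : List κ).map (F l)) = [] := by simp
    rw [this]; rfl
  | cons j js ih =>
    rw [List.pairwise_cons] at hd
    rw [List.flatMap_cons, applyList_append, ← ih (fun l hl j hj => hF l hl j (by simp [hj])) hd.2]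
    clear ih
    have hd1 := hd.1
    clear hd
    induction Ls generalizing ψ with
    | nil => rfl
    | cons l Ls ihL =>
      simp only [List.flatMap_cons, List.map_cons, List.cons_append, applyList_cons,
        applyList_append] at ihL ⊢
      rw [ihL (fun l' hl j hj => hF l' (by simp [hl]) j hj) _
        (fun j' hj' l1 h1 l2 h2 => hd1 j' hj' l1 (by simp [h1]) l2 (by simp [h2]))]
      congr 1
      refine (applyList_comm _ _ ?_ ?_ ?_ _).symm
      · intro g hg
        obtain ⟨j', hj', rfl⟩ := List.mem_map.1 hg
        exact hF l (by simp) j' (by simp [hj'])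
      · intro g hg
        obtain ⟨l', hl', rfl⟩ := List.mem_map.1 hg
        exact hF l' (by simp [hl']) j (by simp)
      · intro g hg h hh
        obtain ⟨j', hj', rfl⟩ := List.mem_map.1 hg
        obtain ⟨l', hl', rfl⟩ := List.mem_map.1 hh
        exact (hd1 j' hj' l' (by simp [hl']) l (by simp)).symm

/-! ### Product vectors -/

/-- The product vector with factor `f v` on qubit `v`. -/
def prodVec (q : ℕ) (f : ℕ → Bool → ℂ) : QState q := fun z => ∏ v : Fin q, f v (z v)

open Classical in
theorem prod_wires {q a : ℕ} {w : Fin a → ℕ} (hw : Function.Injective w) (hq : ∀ j, w j < q)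
    (F : Fin q → ℂ) :
    ∏ v, F v = (∏ j, F ⟨w j, hq j⟩) *
      ∏ v ∈ Finset.univ.filter (fun v : Fin q => (v : ℕ) ∉ Set.range w), F v := by
  classical
  rw [← Finset.prod_filter_mul_prod_filter_not Finset.univ (fun v : Fin q => (v : ℕ) ∈ Set.range w)]
  congr 1
  symm
  refine Finset.prod_bij (fun j _ => (⟨w j, hq j⟩ : Fin q)) (by simp)
    (fun j _ j' _ h => hw (by simpa using h)) ?_ (fun _ _ => rfl)
  intro v hv
  obtain ⟨j, hj⟩ := (Finset.mem_filter.1 hv).2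
  exact ⟨j, Finset.mem_univ _, Fin.ext hj⟩

/-- A gate which maps the product of the factors on its own wires to a product maps product vectors
to product vectors. -/
theorem Gate.apply_prodVec {q : ℕ} {g : Gate} (hw : Function.Injective g.wires)
    (hq : ∀ j, g.wires j < q) {f f' : ℕ → Bool → ℂ}
    (hin : ∀ y, ∑ b, g.mat y b * ∏ j, f (g.wires j) (b j) = ∏ j, f' (g.wires j) (y j))
    (hout : ∀ v, v ∉ Set.range g.wires → f' v = f v) :
    g.apply (prodVec q f) = prodVec q f' := by
  classical
  funext x
  rw [Gate.apply_eq, prodVec, prod_wires hw hq]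
  have h1 : ∀ j, x ⟨g.wires j, hq j⟩ = x.get g.wires j := fun j => by
    rw [Bits.get, Bits.at_of_lt]
  simp only [h1]
  rw [← hin, Finset.sum_mul]
  refine Finset.sum_congr rfl fun b _ => ?_
  rw [prodVec, prod_wires hw hq, mul_assoc]
  congr 2
  · refine Finset.prod_congr rfl fun j _ => ?_
    rw [Bits.put_of_mem hw b x j _ rfl]
  · refine Finset.prod_congr rfl fun v hv => ?_
    have hv' := (Finset.mem_filter.1 hv).2
    rw [Bits.put_of_notMem _ _ _ hv', hout _ hv']

/-- A layer of gates on disjoint wires maps a product vector to a product vector, provided that each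
gate does so on its own wires. -/
theorem applyList_prodVec {q : ℕ} (l : List Gate) (f f' : ℕ → Bool → ℂ)
    (hd : l.Pairwise fun g g' => Disjoint (Set.range g.wires) (Set.range g'.wires))
    (hv : ∀ g ∈ l, Function.Injective g.wires ∧ ∀ j, g.wires j < q)
    (hin : ∀ g ∈ l, ∀ y, ∑ b, g.mat y b * ∏ j, f (g.wires j) (b j) = ∏ j, f' (g.wires j) (y j))
    (hout : ∀ v, (∀ g ∈ l, v ∉ Set.range g.wires) → f' v = f v) :
    applyList l (prodVec q f) = prodVec q f' := by
  classical
  induction l generalizing f with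
  | nil =>
    have : f' = f := funext fun v => hout v (by simp)
    rw [this]; rfl
  | cons g l ih =>
    rw [List.pairwise_cons] at hd
    have hg := hv g (by simp)
    set f1 : ℕ → Bool → ℂ := fun v => if v ∈ Set.range g.wires then f' v else f v with hf1
    have h1 : g.apply (prodVec q f) = prodVec q f1 := by
      refine Gate.apply_prodVec hg.1 hg.2 (fun y => ?_) (fun v hv => by simp only [hf1, if_neg hv])
      rw [hin g (by simp) y]
      refine Finset.prod_congr rfl fun j _ => ?_
      simp [hf1]
    rw [applyList_cons, h1]
    refine ih f1 hd.2 (fun g' h' => hv g' (by simp [h'])) ?_ ?_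
    · intro g' h' y
      rw [← hin g' (by simp [h']) y]
      refine Finset.sum_congr rfl fun b _ => ?_
      congr 1
      refine Finset.prod_congr rfl fun j _ => ?_
      have : g'.wires j ∉ Set.range g.wires :=
        fun hm => Set.disjoint_left.1 (hd.1 g' h') hm ⟨j, rfl⟩
      simp only [hf1, if_neg this]
    · intro v hv'
      by_cases h : v ∈ Set.range g.wires
      · simp only [hf1, if_pos h]
      · simp only [hf1, if_neg h]
        refine hout v fun g' h' => ?_
        rcases List.mem_cons.1 h' with rfl | h'
        · exact h
        · exact hv' g' h'

end ShallowLearning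
end

section
open scoped Matrix
namespace ShallowLearning

/-! ### Closed forms that depend on registers -/

/-- A number to be written by a program: a constant, or the content of a register plus a
constant. -/
inductive Tok : Type
  | const (k : ℕ)
  | reg (r k : ℕ)

/-- The number denoted under the register contents `ρ`. -/
def Tok.eval (ρ : ℕ → ℕ) : Tok → ℕ
  | const k => k
  | reg r k => ρ r + k

/-- Register contents in which register `1`, which holds the prime, is at least `3`. -/
abbrev Env : Type := {ρ : ℕ → ℕ // 3 ≤ ρ 1}

/-- The family `f` of reals has a closed form whose encoding is a fixed list of tokens. -/
def CF (f : Env → ℝ) : Prop :=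
  ∃ (F : (ℕ → ℕ) → RealTerm) (toks : List Tok),
    (∀ ρ, (F ρ).encode = toks.map (Tok.eval ρ)) ∧ ∀ ρ : Env, (F ρ).eval = f ρ

namespace CF
variable {f g h : Env → ℝ}

theorem tok (t : Tok) : CF fun ρ => (t.eval ρ : ℝ) :=
  ⟨fun ρ => .nat (t.eval ρ), [.const 0, t], fun _ => rfl, fun _ => rfl⟩

theorem nat (k : ℕ) : CF fun _ => (k : ℝ) := tok (.const k)

theorem zero : CF fun _ => (0 : ℝ) := by simpa using nat 0

theorem one : CF fun _ => (1 : ℝ) := by simpa using nat 1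

theorem cosPi (a b : Tok) : CF fun ρ => Real.cos (Real.pi * (a.eval ρ : ℕ) / (b.eval ρ : ℕ)) :=
  ⟨fun ρ => .cosPi (a.eval ρ) (b.eval ρ), [.const 1, a, b], fun _ => rfl, fun _ => rfl⟩

theorem sinPi (a b : Tok) : CF fun ρ => Real.sin (Real.pi * (a.eval ρ : ℕ) / (b.eval ρ : ℕ)) :=
  ⟨fun ρ => .sinPi (a.eval ρ) (b.eval ρ), [.const 2, a, b], fun _ => rfl, fun _ => rfl⟩

theorem neg (hf : CF f) : CF fun ρ => -f ρ := by
  obtain ⟨F, t, h1, h2⟩ := hf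
  exact ⟨fun ρ => .neg (F ρ), .const 3 :: t, fun ρ => by simp [RealTerm.encode, h1, Tok.eval],
    fun ρ => by simp [RealTerm.eval, h2]⟩

theorem add (hf : CF f) (hg : CF g) : CF fun ρ => f ρ + g ρ := by
  obtain ⟨F, t, h1, h2⟩ := hf
  obtain ⟨G, u, h3, h4⟩ := hg
  exact ⟨fun ρ => .plus (F ρ) (G ρ), .const 4 :: (t ++ u),
    fun ρ => by simp [RealTerm.encode, h1, h3, Tok.eval],
    fun ρ => by simp [RealTerm.eval, h2, h4]⟩

theorem mul (hf : CF f) (hg : CF g) : CF fun ρ => f ρ * g ρ := by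
  obtain ⟨F, t, h1, h2⟩ := hf
  obtain ⟨G, u, h3, h4⟩ := hg
  exact ⟨fun ρ => .times (F ρ) (G ρ), .const 5 :: (t ++ u),
    fun ρ => by simp [RealTerm.encode, h1, h3, Tok.eval],
    fun ρ => by simp [RealTerm.eval, h2, h4]⟩

theorem inv (hf : CF f) : CF fun ρ => (f ρ)⁻¹ := by
  obtain ⟨F, t, h1, h2⟩ := hf
  exact ⟨fun ρ => .inv (F ρ), .const 6 :: t, fun ρ => by simp [RealTerm.encode, h1, Tok.eval],
    fun ρ => by simp [RealTerm.eval, h2]⟩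

theorem sqrt (hf : CF f) : CF fun ρ => √(f ρ) := by
  obtain ⟨F, t, h1, h2⟩ := hf
  exact ⟨fun ρ => .sqrt (F ρ), .const 7 :: t, fun ρ => by simp [RealTerm.encode, h1, Tok.eval],
    fun ρ => by simp [RealTerm.eval, h2]⟩

theorem sub (hf : CF f) (hg : CF g) : CF fun ρ => f ρ - g ρ := by
  simpa only [sub_eq_add_neg] using hf.add hg.neg

theorem pow (hf : CF f) (k : ℕ) : CF fun ρ => f ρ ^ k := by
  induction k with
  | zero => simpa using one
  | succ k ih => simpa only [pow_succ] using ih.mul hf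

/-- Inversion with `0⁻¹ = 0` makes the indicator of a zero a closed form, so that closed forms may
be defined by cases on whether a closed form vanishes. -/
theorem ite_zero (hf : CF f) (hg : CF g) (hh : CF h) :
    CF fun ρ => if f ρ = 0 then g ρ else h ρ := by
  have h1 := ((one.sub (hf.mul hf.inv)).mul hg).add ((hf.mul hf.inv).mul hh)
  convert h1 using 2 with ρ
  split_ifs with h0
  · simp [h0]
  · simp [mul_inv_cancel₀ h0]

end CF

/-- A family of complex numbers with closed real and imaginary parts. -/
def CFC (f : Env → ℂ) : Prop := (CF fun ρ => (f ρ).re) ∧ CF fun ρ => (f ρ).im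

namespace CFC
variable {f g h : Env → ℂ}

theorem ofReal {f : Env → ℝ} (hf : CF f) : CFC fun ρ => (f ρ : ℂ) := by
  simpa [CFC] using And.intro hf CF.zero

theorem zero : CFC fun _ => (0 : ℂ) := by simpa using ofReal CF.zero

theorem one : CFC fun _ => (1 : ℂ) := by simpa using ofReal CF.one

theorem I : CFC fun _ => Complex.I := by simpa [CFC] using And.intro CF.zero CF.one

theorem neg (hf : CFC f) : CFC fun ρ => -f ρ := by
  simpa [CFC] using And.intro hf.1.neg hf.2.neg

theorem add (hf : CFC f) (hg : CFC g) : CFC fun ρ => f ρ + g ρ := by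
  simpa [CFC] using And.intro (hf.1.add hg.1) (hf.2.add hg.2)

theorem sub (hf : CFC f) (hg : CFC g) : CFC fun ρ => f ρ - g ρ := by
  simpa only [sub_eq_add_neg] using hf.add hg.neg

theorem mul (hf : CFC f) (hg : CFC g) : CFC fun ρ => f ρ * g ρ := by
  simpa [CFC] using And.intro ((hf.1.mul hg.1).sub (hf.2.mul hg.2))
    ((hf.1.mul hg.2).add (hf.2.mul hg.1))

theorem conj (hf : CFC f) : CFC fun ρ => star (f ρ) := by
  simpa [CFC] using And.intro hf.1 hf.2.neg

theorem normSq (hf : CFC f) : CF fun ρ => Complex.normSq (f ρ) := by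
  simpa [Complex.normSq_apply] using (hf.1.mul hf.1).add (hf.2.mul hf.2)

theorem norm (hf : CFC f) : CF fun ρ => ‖f ρ‖ := by
  simpa only [Complex.norm_def] using hf.normSq.sqrt

theorem inv (hf : CFC f) : CFC fun ρ => (f ρ)⁻¹ := by
  simp only [Complex.inv_def]
  exact hf.conj.mul (ofReal hf.normSq.inv)

theorem div (hf : CFC f) (hg : CFC g) : CFC fun ρ => f ρ / g ρ := by
  simpa only [div_eq_mul_inv] using hf.mul hg.inv

theorem pow (hf : CFC f) (k : ℕ) : CFC fun ρ => f ρ ^ k := by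
  induction k with
  | zero => simpa using one
  | succ k ih => simpa only [pow_succ] using ih.mul hf

theorem sum {ι : Type*} (s : Finset ι) {f : ι → Env → ℂ} (hf : ∀ i, CFC (f i)) :
    CFC fun ρ => ∑ i ∈ s, f i ρ := by
  classical
  induction s using Finset.induction_on with
  | empty => simpa using zero
  | insert a s ha ih => simpa [Finset.sum_insert ha] using (hf a).add ih

theorem prod {ι : Type*} (s : Finset ι) {f : ι → Env → ℂ} (hf : ∀ i, CFC (f i)) :
    CFC fun ρ => ∏ i ∈ s, f i ρ := by
  classical
  induction s using Finset.induction_on with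
  | empty => simpa using one
  | insert a s ha ih => simpa [Finset.prod_insert ha] using (hf a).mul ih

theorem ite_zero (hf : CFC f) (hg : CFC g) (hh : CFC h) :
    CFC fun ρ => if f ρ = 0 then g ρ else h ρ := by
  have key : ∀ ρ, f ρ = 0 ↔ Complex.normSq (f ρ) = 0 := fun ρ => by simp
  simp only [key]
  constructor
  · simpa only [apply_ite Complex.re] using hf.normSq.ite_zero hg.1 hh.1
  · simpa only [apply_ite Complex.im] using hf.normSq.ite_zero hg.2 hh.2

/-- Closed forms of unit complex numbers have square roots: `√u = (1 + u) / |1 + u|`, except at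
`u = -1`, where `i` is taken. -/
theorem exists_unit_sqrt (hf : CFC f) (h1 : ∀ ρ, ‖f ρ‖ = 1) :
    ∃ g : Env → ℂ, CFC g ∧ (∀ ρ, ‖g ρ‖ = 1) ∧ ∀ ρ, g ρ * g ρ = f ρ := by
  have hs := one.add hf
  refine ⟨fun ρ => if 1 + f ρ = 0 then Complex.I else (1 + f ρ) * ((‖1 + f ρ‖⁻¹ : ℝ) : ℂ),
    hs.ite_zero I (hs.mul (ofReal hs.norm.inv)), fun ρ => ?_, fun ρ => ?_⟩
  · simp only
    split_ifs with h0
    · simp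
    · have : ‖1 + f ρ‖ ≠ 0 := norm_ne_zero_iff.2 h0
      simp [this]
  · simp only
    split_ifs with h0
    · rw [Complex.I_mul_I]; linear_combination -h0
    · have h2 : ((‖1 + f ρ‖ : ℝ) : ℂ) ≠ 0 := by exact_mod_cast norm_ne_zero_iff.2 h0
      have h3 : (‖1 + f ρ‖ : ℂ) ^ 2 = (starRingEnd ℂ) (1 + f ρ) * (1 + f ρ) :=
        (Complex.conj_mul' _).symm
      have h4 : (starRingEnd ℂ) (f ρ) * f ρ = 1 := by
        rw [Complex.conj_mul', h1]; simp
      rw [map_add, map_one] at h3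
      rw [Complex.ofReal_inv]
      field_simp
      rw [h3]
      linear_combination (-(1 + f ρ)) * h4

end CFC

/-! ### Gate templates -/

/-- A gate description depending on registers, with the tokens that spell it out. -/
structure GateTmpl : Type where
  desc : (ℕ → ℕ) → GateDesc
  toks : List Tok
  enc : ∀ ρ, (desc ρ).encode = toks.map (Tok.eval ρ)

theorem CFC.exists_term {f : Env → ℂ} (hf : CFC f) :
    ∃ (F : (ℕ → ℕ) → ComplexTerm) (toks : List Tok),
      (∀ ρ, (F ρ).encode = toks.map (Tok.eval ρ)) ∧ ∀ ρ : Env, (F ρ).eval = f ρ := by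
  obtain ⟨⟨F, t, h1, h2⟩, G, u, h3, h4⟩ := hf
  refine ⟨fun ρ => ⟨F ρ, G ρ⟩, t ++ u, fun ρ => by simp [ComplexTerm.encode, h1, h3], fun ρ => ?_⟩
  apply Complex.ext <;> simp [ComplexTerm.eval, h2, h4]

theorem exists_tmpl_one (w : Tok) (U : Bool → Bool → Env → ℂ) (hU : ∀ y x, CFC (U y x)) :
    ∃ g : GateTmpl, ∀ ρ : Env,
      (g.desc ρ).toGate = ⟨1, fun _ => w.eval ρ, fun y x => U (y 0) (x 0) ρ⟩ := by
  choose F toks h1 h2 using fun y x => (hU y x).exists_term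
  refine ⟨⟨fun ρ => .one (w.eval ρ) fun y x => F y x ρ, .const 1 :: w ::
    [false, true].flatMap fun y => [false, true].flatMap fun x => toks y x, fun ρ => ?_⟩,
    fun ρ => ?_⟩
  · simp [GateDesc.encode, h1, Tok.eval]
  · simp only [GateDesc.toGate, h2]
    congr 1
    funext j
    fin_cases j
    rfl

theorem exists_tmpl_two (w₁ w₂ : Tok) (U : Bits 2 → Bits 2 → Env → ℂ)
    (hU : ∀ y x, CFC (U y x)) :
    ∃ g : GateTmpl, ∀ ρ : Env,
      (g.desc ρ).toGate = ⟨2, ![w₁.eval ρ, w₂.eval ρ], fun y x => U y x ρ⟩ := by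
  choose F toks h1 h2 using fun y x => (hU y x).exists_term
  refine ⟨⟨fun ρ => .two (w₁.eval ρ) (w₂.eval ρ) fun y x => F ![y.1, y.2] ![x.1, x.2] ρ,
    .const 2 :: w₁ :: w₂ :: ([false, true].product [false, true]).flatMap fun y =>
      ([false, true].product [false, true]).flatMap fun x => toks ![y.1, y.2] ![x.1, x.2],
      fun ρ => ?_⟩, fun ρ => ?_⟩
  · simp [GateDesc.encode, h1, Tok.eval, List.product]
  · have h3 : ∀ y : Bits 2, ![y 0, y 1] = y := fun y => by
      funext j
      fin_cases j <;> rfl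
    simp only [GateDesc.toGate, h2, h3]

/-! ### Gates inside a block -/

/-- The matrix on `k` qubits of a gate on the qubits `w`. -/
noncomputable def liftMat {a k : ℕ} (w : Fin a → Fin k) (M : Matrix (Bits a) (Bits a) ℂ) :
    Matrix (Bits k) (Bits k) ℂ := fun y x =>
  open Classical in
  if ∀ i, i ∉ Set.range w → y i = x i then M (fun j => y (w j)) (fun j => x (w j)) else 0

/-- A gate on some of the qubits of a block acts like a gate on the whole block, with the lifted
matrix. -/
theorem lift_apply {a k q base : ℕ} {w : Fin a → Fin k} (hw : Function.Injective w)
    (M : Matrix (Bits a) (Bits a) ℂ) (ψ : QState q) :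
    (Gate.mk a (fun j => base + w j) M).apply ψ =
      (Gate.mk k (fun j => base + j) (liftMat w M)).apply ψ := by
  classical
  funext x
  have hW : Function.Injective fun j : Fin k => base + (j : ℕ) := fun i j h => by
    simpa [Fin.ext_iff] using h
  have hw' : Function.Injective fun j : Fin a => base + (w j : ℕ) := fun i j h => hw (hW h)
  simp only [Gate.apply_eq, liftMat, ite_mul, zero_mul]
  rw [← Finset.sum_filter]
  -- the columns of the lifted matrix which contribute are those that agree with `x` outside of `w`
  refine Finset.sum_nbij' (fun c i => Function.extend w c (x.get fun j : Fin k => base + (j : ℕ)) i)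
    (fun b j => b (w j)) ?_ (by simp) ?_ ?_ ?_
  · intro c _
    simp only [Finset.mem_filter, Finset.mem_univ, true_and]
    intro i hi
    rw [Function.extend_apply' _ _ _ (by simpa using hi)]
  · intro c _
    funext j
    exact hw.extend_apply _ _ _
  · intro b hb
    have hb' := (Finset.mem_filter.1 hb).2
    funext i
    by_cases hi : i ∈ Set.range w
    · obtain ⟨j, rfl⟩ := hi
      rw [hw.extend_apply]
    · rw [Function.extend_apply' _ _ _ (by simpa using hi), hb' i hi]
  · intro c _
    have h1 : (fun j => Function.extend w c
        (x.get fun j : Fin k => base + (j : ℕ)) (w j)) = c := by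
      funext j
      rw [hw.extend_apply]
    rw [h1]
    congr 2
    funext v
    by_cases hv : (v : ℕ) ∈ Set.range fun j : Fin k => base + (j : ℕ)
    · obtain ⟨i, hi⟩ := hv
      rw [Bits.put_of_mem hW _ _ i v hi.symm]
      by_cases hi' : i ∈ Set.range w
      · obtain ⟨j, rfl⟩ := hi'
        rw [hw.extend_apply, Bits.put_of_mem hw' _ _ j v hi.symm]
      · rw [Function.extend_apply' _ _ _ (by simpa using hi'), Bits.put_of_notMem]
        · change x v = x.at (base + i)
          simp only at hi
          rw [hi, Bits.at_val]
        · rintro ⟨j, hj⟩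
          refine hi' ⟨j, hW ?_⟩
          simp only at hi hj ⊢
          rw [hi, hj]
    · rw [Bits.put_of_notMem _ _ _ hv, Bits.put_of_notMem]
      rintro ⟨j, hj⟩
      exact hv ⟨w j, hj⟩

theorem apply_all {k : ℕ} (M : Matrix (Bits k) (Bits k) ℂ) (ψ : QState k) :
    (Gate.mk k (fun j => (0 : ℕ) + (j : ℕ)) M).apply ψ = M *ᵥ ψ := by
  funext x
  have hW : Function.Injective fun j : Fin k => 0 + (j : ℕ) := fun i j h => by
    simpa [Fin.ext_iff] using h
  simp only [Gate.apply_eq, Matrix.mulVec, dotProduct]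
  refine Finset.sum_congr rfl fun b _ => ?_
  congr 1
  · congr 1
    funext j
    simp [Bits.get, Bits.at]
  · congr 1
    funext v
    rw [Bits.put_of_mem hW b x v v (by simp)]

theorem liftMat_mulVec {a k : ℕ} {w : Fin a → Fin k} (hw : Function.Injective w)
    (M : Matrix (Bits a) (Bits a) ℂ) (ψ : QState k) :
    liftMat w M *ᵥ ψ = (Gate.mk a (fun j => 0 + (w j : ℕ)) M).apply ψ := by
  rw [lift_apply hw, apply_all]

theorem liftMat_mul {a k : ℕ} {w : Fin a → Fin k} (hw : Function.Injective w)
    (M N : Matrix (Bits a) (Bits a) ℂ) : liftMat w M * liftMat w N = liftMat w (M * N) := by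
  refine Matrix.ext_iff_mulVec.2 fun ψ => ?_
  rw [← Matrix.mulVec_mulVec, liftMat_mulVec hw, liftMat_mulVec hw, liftMat_mulVec hw, apply_mul]
  · intro i j h
    exact hw (by simpa [Fin.ext_iff] using h)
  · intro j
    simp

theorem liftMat_one {a k : ℕ} {w : Fin a → Fin k} (hw : Function.Injective w) :
    liftMat w (1 : Matrix (Bits a) (Bits a) ℂ) = 1 := by
  refine Matrix.ext_iff_mulVec.2 fun ψ => ?_
  rw [liftMat_mulVec hw, apply_one, Matrix.one_mulVec]
  intro i j h
  exact hw (by simpa [Fin.ext_iff] using h)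

theorem liftMat_star {a k : ℕ} (w : Fin a → Fin k) (M : Matrix (Bits a) (Bits a) ℂ) :
    star (liftMat w M) = liftMat w (star M) := by
  ext y x
  simp only [Matrix.star_apply, liftMat, eq_comm (a := x _)]
  split_ifs <;> simp

theorem liftMat_mem {a k : ℕ} {w : Fin a → Fin k} (hw : Function.Injective w)
    {M : Matrix (Bits a) (Bits a) ℂ} (hM : M ∈ Matrix.unitaryGroup (Bits a) ℂ) :
    liftMat w M ∈ Matrix.unitaryGroup (Bits k) ℂ := by
  rw [Matrix.mem_unitaryGroup_iff, liftMat_star, liftMat_mul hw, Matrix.mem_unitaryGroup_iff.1 hM,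
    liftMat_one hw]

/-- The family `M` of operators on a block of `k` qubits, which starts at the qubit held in
register `41`, is a product of unitary one- and two-qubit gate templates inside the block. -/
def Realizable (k : ℕ) (M : Env → Matrix (Bits k) (Bits k) ℂ) : Prop :=
  ∃ L : List GateTmpl, ∀ ρ : Env,
    (∀ g ∈ L, (g.desc ρ).toGate.arity ≤ 2 ∧ Function.Injective (g.desc ρ).toGate.wires ∧
      (∀ j, ρ.1 41 ≤ (g.desc ρ).toGate.wires j ∧ (g.desc ρ).toGate.wires j < ρ.1 41 + k) ∧
      (g.desc ρ).toGate.mat ∈ Matrix.unitaryGroup _ ℂ) ∧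
    ∀ (q : ℕ), ρ.1 41 + k ≤ q → ∀ ψ : QState q,
      applyList (L.map fun g => (g.desc ρ).toGate) ψ =
        (Gate.mk k (fun j => ρ.1 41 + j) (M ρ)).apply ψ

theorem block_injective {k : ℕ} (base : ℕ) :
    Function.Injective fun j : Fin k => base + (j : ℕ) := fun i j h => by
  simpa [Fin.ext_iff] using h

theorem Realizable.mul {k : ℕ} {M N : Env → Matrix (Bits k) (Bits k) ℂ} (hM : Realizable k M)
    (hN : Realizable k N) : Realizable k fun ρ => M ρ * N ρ := by
  obtain ⟨L, hL⟩ := hM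
  obtain ⟨L', hL'⟩ := hN
  refine ⟨L' ++ L, fun ρ => ⟨fun g hg => ?_, fun q hq ψ => ?_⟩⟩
  · rcases List.mem_append.1 hg with h | h
    exacts [(hL' ρ).1 g h, (hL ρ).1 g h]
  · rw [List.map_append, applyList_append, (hL' ρ).2 q hq, (hL ρ).2 q hq,
      apply_mul (block_injective _)]
    intro j
    omega

theorem Realizable.one {k : ℕ} : Realizable k fun _ => 1 :=
  ⟨[], fun ρ => ⟨by simp, fun q _ ψ => (apply_one (block_injective _) ψ).symm⟩⟩

/-- The families of unitaries with closed-form entries that are, together with their inverses,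
products of templates. -/
structure InG {k : ℕ} (M : Env → Matrix (Bits k) (Bits k) ℂ) : Prop where
  unitary : ∀ ρ, M ρ ∈ Matrix.unitaryGroup (Bits k) ℂ
  cf : ∀ y x, CFC fun ρ => M ρ y x
  real : Realizable k M
  realStar : Realizable k fun ρ => star (M ρ)

namespace InG
variable {k : ℕ} {M N : Env → Matrix (Bits k) (Bits k) ℂ}

theorem mul (hM : InG M) (hN : InG N) : InG fun ρ => M ρ * N ρ where
  unitary ρ := mul_mem (hM.unitary ρ) (hN.unitary ρ)
  cf y x := by
    simp only [Matrix.mul_apply]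
    exact CFC.sum _ fun i => (hM.cf y i).mul (hN.cf i x)
  real := hM.real.mul hN.real
  realStar := by simpa only [star_mul] using hN.realStar.mul hM.realStar

theorem star (hM : InG M) : InG fun ρ => star (M ρ) where
  unitary ρ := Unitary.star_mem (hM.unitary ρ)
  cf y x := by
    simp only [Matrix.star_apply]
    exact (hM.cf x y).conj
  real := hM.realStar
  realStar := by simpa only [star_star] using hM.real

theorem one : InG (fun _ => (1 : Matrix (Bits k) (Bits k) ℂ)) where
  unitary _ := one_mem _
  cf y x := by
    by_cases h : y = x
    · subst h; simpa using CFC.one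
    · simpa [Matrix.one_apply_ne h] using CFC.zero
  real := Realizable.one
  realStar := by simpa only [star_one] using Realizable.one

end InG

theorem InG.of_lift {a k : ℕ} {w : Fin a → Fin k} (hw : Function.Injective w)
    {M : Env → Matrix (Bits a) (Bits a) ℂ} (hM : ∀ ρ, M ρ ∈ Matrix.unitaryGroup (Bits a) ℂ)
    (hcf : ∀ y x, CFC fun ρ => M ρ y x)
    (ha : a ≤ 2) (ht : ∀ M : Env → Matrix (Bits a) (Bits a) ℂ, (∀ y x, CFC fun ρ => M ρ y x) →
      ∃ g : GateTmpl, ∀ ρ : Env,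
        (g.desc ρ).toGate = ⟨a, fun j => ρ.1 41 + (w j : ℕ), M ρ⟩) :
    InG fun ρ => liftMat w (M ρ) := by
  have key : ∀ M : Env → Matrix (Bits a) (Bits a) ℂ, (∀ ρ, M ρ ∈ Matrix.unitaryGroup (Bits a) ℂ) →
      (∀ y x, CFC fun ρ => M ρ y x) → Realizable k fun ρ => liftMat w (M ρ) := by
    intro M hM hcf
    obtain ⟨g, hg⟩ := ht M hcf
    refine ⟨[g], fun ρ => ⟨fun g' hg' => ?_, fun q hq ψ => ?_⟩⟩
    · rw [List.mem_singleton.1 hg', hg ρ]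
      refine ⟨ha, fun i j h => hw (block_injective (ρ.1 41) h), fun j => ?_, hM ρ⟩
      exact ⟨by simp, by simp⟩
    · simp only [List.map_cons, List.map_nil, applyList_cons, applyList_nil, hg ρ]
      exact lift_apply hw _ _
  refine ⟨fun ρ => liftMat_mem hw (hM ρ), fun y x => ?_, key M hM hcf, ?_⟩
  · by_cases h : ∀ i, i ∉ Set.range w → y i = x i
    · simpa only [liftMat, if_pos h] using hcf _ _
    · simpa only [liftMat, if_neg h] using CFC.zero
  · simp only [liftMat_star]
    refine key _ (fun ρ => Unitary.star_mem (hM ρ)) fun y x => ?_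
    simp only [Matrix.star_apply]
    exact (hcf x y).conj

theorem InG.lift_one {k : ℕ} (i : Fin k) {M : Env → Matrix (Bits 1) (Bits 1) ℂ}
    (hM : ∀ ρ, M ρ ∈ Matrix.unitaryGroup (Bits 1) ℂ) (hcf : ∀ y x, CFC fun ρ => M ρ y x) :
    InG fun ρ => liftMat (fun _ : Fin 1 => i) (M ρ) := by
  refine InG.of_lift (fun _ _ _ => Subsingleton.elim _ _) hM hcf (by norm_num) fun M hcf => ?_
  obtain ⟨g, hg⟩ := exists_tmpl_one (.reg 41 i) (fun y x ρ => M ρ (fun _ => y) (fun _ => x))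
    (fun y x => hcf _ _)
  refine ⟨g, fun ρ => ?_⟩
  rw [hg ρ]
  have h1 : ∀ y : Bits 1, (fun _ => y 0) = y := fun y => by
    funext j
    rw [Subsingleton.elim j 0]
  simp only [h1, Tok.eval]

theorem InG.lift_two {k : ℕ} {i j : Fin k} (hij : i ≠ j) {M : Env → Matrix (Bits 2) (Bits 2) ℂ}
    (hM : ∀ ρ, M ρ ∈ Matrix.unitaryGroup (Bits 2) ℂ) (hcf : ∀ y x, CFC fun ρ => M ρ y x) :
    InG fun ρ => liftMat ![i, j] (M ρ) := by
  refine InG.of_lift ?_ hM hcf le_rfl fun M hcf => ?_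
  · intro a b h
    fin_cases a <;> fin_cases b <;> simp_all
  · obtain ⟨g, hg⟩ := exists_tmpl_two (.reg 41 i) (.reg 41 j) (fun y x ρ => M ρ y x) hcf
    refine ⟨g, fun ρ => ?_⟩
    rw [hg ρ]
    congr 1
    funext a
    fin_cases a <;> rfl

end ShallowLearning
end

section
open scoped Matrix
namespace ShallowLearning

/-! ### Matrices of permutations and reflections -/

section matrices
variable {α : Type*} [DecidableEq α]

/-- The matrix of the permutation `σ` of the basis states. -/
def permMat (σ : Equiv.Perm α) : Matrix α α ℂ := fun y x => if y = σ x then 1 else 0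

theorem star_permMat (σ : Equiv.Perm α) : star (permMat σ) = permMat σ⁻¹ := by
  ext y x
  simp only [Matrix.star_apply, permMat, Equiv.Perm.eq_inv_iff_eq, eq_comm (a := x)]
  split_ifs <;> simp

variable [Fintype α]

theorem permMat_mulVec (σ : Equiv.Perm α) (v : α → ℂ) : permMat σ *ᵥ v = fun y => v (σ⁻¹ y) := by
  funext y
  simp only [Matrix.mulVec, dotProduct, permMat, ite_mul, one_mul, zero_mul]
  rw [Finset.sum_eq_single (σ⁻¹ y)]
  · simp
  · intro b _ hb
    rw [if_neg fun h => hb (by rw [h]; simp)]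
  · simp

theorem permMat_mul (σ τ : Equiv.Perm α) : permMat (σ * τ) = permMat σ * permMat τ := by
  refine Matrix.ext_iff_mulVec.2 fun v => ?_
  rw [← Matrix.mulVec_mulVec, permMat_mulVec, permMat_mulVec, permMat_mulVec]
  simp

theorem permMat_one : permMat (1 : Equiv.Perm α) = 1 := by
  refine Matrix.ext_iff_mulVec.2 fun v => ?_
  rw [permMat_mulVec, Matrix.one_mulVec]
  simp

theorem permMat_mem (σ : Equiv.Perm α) : permMat σ ∈ Matrix.unitaryGroup α ℂ := by
  rw [Matrix.mem_unitaryGroup_iff, star_permMat, ← permMat_mul, mul_inv_cancel, permMat_one]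

theorem permMat_conj_diagonal (σ : Equiv.Perm α) (f : α → ℂ) :
    permMat σ * (Matrix.diagonal f * permMat σ⁻¹) = Matrix.diagonal fun x => f (σ⁻¹ x) := by
  refine Matrix.ext_iff_mulVec.2 fun v => ?_
  rw [← Matrix.mulVec_mulVec, ← Matrix.mulVec_mulVec, permMat_mulVec, permMat_mulVec]
  funext y
  simp [Matrix.mulVec_diagonal]

/-- The operator with eigenvalue `u` on the unit vector `v` and `1` on its complement. -/
def refl (v : α → ℂ) (u : ℂ) : Matrix α α ℂ := 1 + (u - 1) • Matrix.vecMulVec v (star v)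

theorem refl_mulVec (v : α → ℂ) (u : ℂ) (w : α → ℂ) :
    refl v u *ᵥ w = w + ((u - 1) * (star v ⬝ᵥ w)) • v := by
  rw [refl, Matrix.add_mulVec, Matrix.one_mulVec, Matrix.smul_mulVec, Matrix.vecMulVec_mulVec]
  funext i
  simp
  ring

theorem refl_conj {g : Matrix α α ℂ} (hg : g ∈ Matrix.unitaryGroup α ℂ) (v : α → ℂ) (u : ℂ) :
    g * refl v u * star g = refl (g *ᵥ v) u := by
  have h1 : star v ᵥ* star g = star (g *ᵥ v) := by
    rw [Matrix.star_mulVec, Matrix.star_eq_conjTranspose]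
  rw [refl, refl, mul_add, add_mul, mul_one, Matrix.mem_unitaryGroup_iff.1 hg, mul_smul_comm,
    Matrix.mul_vecMulVec, smul_mul_assoc, Matrix.vecMulVec_mul, h1]

theorem refl_single (y : α) (u : ℂ) :
    refl (Pi.single y 1) u = Matrix.diagonal fun x => if x = y then u else 1 := by
  refine Matrix.ext_iff_mulVec.2 fun v => ?_
  rw [refl_mulVec]
  funext x
  rw [Matrix.mulVec_diagonal]
  by_cases h : x = y
  · subst h
    simp
    ring
  · simp [h]

theorem refl_smul (v : α → ℂ) {c : ℂ} (hc : ‖c‖ = 1) (u : ℂ) : refl (c • v) u = refl v u := by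
  have h1 : (starRingEnd ℂ) c * c = 1 := by rw [Complex.conj_mul', hc]; simp
  rw [refl, refl]
  congr 2
  ext i j
  simp only [Matrix.vecMulVec_apply, Pi.smul_apply, Pi.star_apply, smul_eq_mul, star_mul',
    RCLike.star_def]
  linear_combination (v i * (starRingEnd ℂ) (v j)) * h1

theorem star_mulVec_dot {g : Matrix α α ℂ} (hg : g ∈ Matrix.unitaryGroup α ℂ) (v w : α → ℂ) :
    star (g *ᵥ v) ⬝ᵥ (g *ᵥ w) = star v ⬝ᵥ w := by
  rw [Matrix.star_mulVec, Matrix.dotProduct_mulVec, Matrix.vecMul_vecMul,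
    ← Matrix.star_eq_conjTranspose, Matrix.mem_unitaryGroup_iff'.1 hg, Matrix.vecMul_one]

end matrices

theorem liftMat_diagonal {a k : ℕ} (w : Fin a → Fin k) (f : Bits a → ℂ) :
    liftMat w (Matrix.diagonal f) = Matrix.diagonal fun x => f fun j => x (w j) := by
  ext y x
  simp only [liftMat, Matrix.diagonal_apply]
  by_cases h : y = x
  · subst h; simp
  · rw [if_neg h]
    split_ifs with h1 h2
    · refine absurd (funext fun i => ?_) h
      by_cases hi : i ∈ Set.range w
      · obtain ⟨j, rfl⟩ := hi
        exact congrFun h2 j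
      · exact h1 i hi
    · rfl
    · rfl

/-! ### Phases on basis states -/

variable {k : ℕ}

theorem diagonal_mem_unitaryGroup {α : Type*} [Fintype α] [DecidableEq α] {f : α → ℂ}
    (hf : ∀ x, ‖f x‖ = 1) : Matrix.diagonal f ∈ Matrix.unitaryGroup α ℂ := by
  rw [Matrix.mem_unitaryGroup_iff, Matrix.star_eq_conjTranspose, Matrix.diagonal_conjTranspose,
    Matrix.diagonal_mul_diagonal, ← Matrix.diagonal_one]
  congr 1
  funext x
  simp [Complex.mul_conj', hf]

theorem CFC.ite {f g : Env → ℂ} (P : Prop) [Decidable P] (hf : CFC f) (hg : CFC g) :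
    CFC fun ρ => if P then f ρ else g ρ := by
  split_ifs <;> assumption

theorem CFC.ite_one (P : Prop) [Decidable P] : CFC fun _ => if P then (1 : ℂ) else 0 :=
  CFC.ite P CFC.one CFC.zero

theorem CFC.diagonal {α : Type*} [DecidableEq α] {f : Env → α → ℂ}
    (hf : ∀ x, CFC fun ρ => f ρ x) (y x : α) : CFC fun ρ => Matrix.diagonal (f ρ) y x := by
  simp only [Matrix.diagonal_apply]
  exact CFC.ite _ (hf y) CFC.zero

theorem InG.phase_one (i : Fin k) (c : Bool) {u : Env → ℂ} (hu : CFC u) (h1 : ∀ ρ, ‖u ρ‖ = 1) :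
    InG fun ρ => Matrix.diagonal fun x : Bits k => if x i = c then u ρ else 1 := by
  have := InG.lift_one i (M := fun ρ => Matrix.diagonal fun x : Bits 1 =>
    if x 0 = c then u ρ else 1) (fun ρ => diagonal_mem_unitaryGroup fun x => ?_)
    (CFC.diagonal fun x => CFC.ite _ hu CFC.one)
  · simpa only [liftMat_diagonal] using this
  · split_ifs <;> simp [h1]

/-- The permutation of the basis states effected by a controlled negation. -/
def cnotPerm {i j : Fin k} (hij : i ≠ j) : Equiv.Perm (Bits k) :=
  Function.Involutive.toPerm (fun x => Function.update x j (xor (x i) (x j))) fun x => by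
    funext l
    by_cases h : l = j
    · subst h; simp [hij]
    · simp [h]

theorem cnotPerm_apply {i j : Fin k} (hij : i ≠ j) (x : Bits k) :
    cnotPerm hij x = Function.update x j (xor (x i) (x j)) := rfl

theorem cnotPerm_inv {i j : Fin k} (hij : i ≠ j) : (cnotPerm hij)⁻¹ = cnotPerm hij := rfl

theorem lift_cnot {i j : Fin k} (hij : i ≠ j) :
    liftMat ![i, j] (permMat (cnotPerm (zero_ne_one : (0 : Fin 2) ≠ 1))) =
      permMat (cnotPerm hij) := by
  ext y x
  have key : ((∀ l, l ∉ Set.range ![i, j] → y l = x l) ∧ (fun l => y (![i, j] l)) =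
      Function.update (fun l => x (![i, j] l)) 1 (xor (x i) (x j))) ↔
      y = Function.update x j (xor (x i) (x j)) := by
    constructor
    · rintro ⟨h1, h2⟩
      have h3 := congrFun h2 0
      have h4 := congrFun h2 1
      simp at h3 h4
      funext l
      by_cases hl : l = j
      · subst hl; simp [h4]
      · rw [Function.update_of_ne hl]
        by_cases hl' : l = i
        · subst hl'; exact h3
        · exact h1 l (by simp [Ne.symm hl, Ne.symm hl', eq_comm])
    · rintro rfl
      refine ⟨fun l hl => ?_, ?_⟩
      · simp only [Matrix.range_cons, Matrix.range_empty, Set.union_empty, Set.mem_union,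
          Set.mem_singleton_iff, not_or] at hl
        rw [Function.update_of_ne hl.2]
      · funext l
        fin_cases l <;> simp [hij]
  simp only [liftMat, permMat, cnotPerm_apply]
  by_cases hP : ∀ l, l ∉ Set.range ![i, j] → y l = x l
  · rw [if_pos hP]
    exact if_congr ⟨fun h => key.1 ⟨hP, h⟩, fun h => (key.2 h).2⟩ rfl rfl
  · rw [if_neg hP]
    exact (if_neg fun h => hP (key.2 h).1).symm

theorem InG.cnot {i j : Fin k} (hij : i ≠ j) : InG fun _ => permMat (cnotPerm hij) := by
  have := InG.lift_two hij (M := fun _ => permMat (cnotPerm (zero_ne_one : (0 : Fin 2) ≠ 1)))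
    (fun _ => permMat_mem _) fun y x => CFC.ite_one _
  simpa only [lift_cnot hij] using this

/-- Phases controlled by several qubits, by induction on their number: with `v ^ 2 = u`, the
identity `2 a b = a + b - (a xor b)` for bits reduces a phase `u` on `a b` to phases `v` and `v⁻¹`
on `a`, `b` and `a xor b`, and a controlled negation turns `a xor b` into a single qubit. -/
theorem InG.phase (T : Finset (Fin k)) (hT : T.Nonempty) (y : Bits k) {u : Env → ℂ} (hu : CFC u)
    (h1 : ∀ ρ, ‖u ρ‖ = 1) :
    InG fun ρ => Matrix.diagonal fun x : Bits k => if ∀ i ∈ T, x i = y i then u ρ else 1 := by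
  classical
  induction T using Finset.strongInduction generalizing y u with
  | H T ih =>
    obtain ⟨i, hi⟩ := hT
    by_cases hT1 : T = {i}
    · subst hT1
      simpa using InG.phase_one i (y i) hu h1
    obtain ⟨j, hj, hji⟩ : ∃ j ∈ T, j ≠ i := by
      by_contra! h
      exact hT1 (Finset.eq_singleton_iff_unique_mem.2 ⟨hi, h⟩)
    obtain ⟨v, hv, hv1, hvv⟩ := hu.exists_unit_sqrt h1
    have hij : i ≠ j := hji.symm
    -- conjunction of the conditions on `i` and `j`: phase `v` for each of them, and phase `v⁻¹`
    -- when exactly one of them holds, which after a controlled negation is a condition on `j` alone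
    have hA := ih (T.erase j) (Finset.erase_ssubset hj) ⟨i, by simp [hi, hij]⟩ y hv hv1
    have hB := ih (T.erase i) (Finset.erase_ssubset hi) ⟨j, by simp [hj, hji]⟩ y hv hv1
    have hC := ih (T.erase i) (Finset.erase_ssubset hi) ⟨j, by simp [hj, hji]⟩
      (Function.update y j (!(xor (y i) (y j)))) hv.conj (fun ρ => by simp [hv1])
    have hD := (InG.cnot hij).mul (hC.mul (InG.cnot hij))
    have hE := (hA.mul hB).mul hD
    convert hE using 2 with ρ
    nth_rewrite 2 [← cnotPerm_inv hij]
    rw [permMat_conj_diagonal, Matrix.diagonal_mul_diagonal, Matrix.diagonal_mul_diagonal,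
      cnotPerm_inv]
    congr 1
    funext x
    have hvc : v ρ * (starRingEnd ℂ) (v ρ) = 1 := by
      rw [Complex.mul_conj', hv1]; simp
    set R := (T.erase i).erase j with hR
    -- all conditions in terms of the bits `i` and `j` and of the conditions on the other bits
    have e1 : (∀ l ∈ T, x l = y l) ↔ (x i = y i ∧ x j = y j) ∧ ∀ l ∈ R, x l = y l := by
      constructor
      · intro h
        exact ⟨⟨h i hi, h j hj⟩, fun l hl => h l (Finset.mem_of_mem_erase
            (Finset.mem_of_mem_erase hl))⟩
      · rintro ⟨⟨h1, h2⟩, h3⟩ l hl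
        by_cases h4 : l = i
        · rw [h4, h1]
        by_cases h5 : l = j
        · rw [h5, h2]
        exact h3 l (by simp [hR, h4, h5, hl])
    have e2 : (∀ l ∈ T.erase j, x l = y l) ↔ x i = y i ∧ ∀ l ∈ R, x l = y l := by
      constructor
      · intro h
        refine ⟨h i (by simp [hi, hij]), fun l hl => h l ?_⟩
        simp only [hR, Finset.mem_erase] at hl ⊢
        tauto
      · rintro ⟨h1, h3⟩ l hl
        by_cases h4 : l = i
        · rw [h4, h1]
        exact h3 l (by simp only [hR, Finset.mem_erase] at hl ⊢; tauto)
    have e3 : (∀ l ∈ T.erase i, x l = y l) ↔ x j = y j ∧ ∀ l ∈ R, x l = y l := by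
      constructor
      · intro h
        refine ⟨h j (by simp [hj, hji]), fun l hl => h l ?_⟩
        simp only [hR, Finset.mem_erase] at hl ⊢
        tauto
      · rintro ⟨h1, h3⟩ l hl
        by_cases h4 : l = j
        · rw [h4, h1]
        exact h3 l (by simp only [hR, Finset.mem_erase] at hl ⊢; tauto)
    have e4 : (∀ l ∈ T.erase i, cnotPerm hij x l =
        Function.update y j (!(xor (y i) (y j))) l) ↔
        (xor (x i) (x j) = !(xor (y i) (y j))) ∧ ∀ l ∈ R, x l = y l := by
      constructor
      · intro h
        refine ⟨by simpa [cnotPerm_apply] using h j (by simp [hj, hji]), fun l hl => ?_⟩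
        have hl' : l ≠ j := by simp only [hR, Finset.mem_erase] at hl; tauto
        simpa [cnotPerm_apply, hl'] using h l (by simp only [hR, Finset.mem_erase] at hl ⊢; tauto)
      · rintro ⟨h1, h3⟩ l hl
        by_cases h4 : l = j
        · simpa [cnotPerm_apply, h4] using h1
        simpa [cnotPerm_apply, h4] using
          h3 l (by simp only [hR, Finset.mem_erase] at hl ⊢; tauto)
    simp only [e1, e2, e3, e4, ← hvv]
    clear e1 e2 e3 e4
    by_cases hRR : ∀ l ∈ R, x l = y l
    · simp only [eq_true hRR, and_true]
      generalize x i = a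
      generalize x j = b
      generalize y i = c
      generalize y j = d
      cases a <;> cases b <;> cases c <;> cases d <;> simp [hvc]
    · simp [hRR]

/-! ### Rotations of two basis states -/

/-- All phases along the unit vector `v` are products of templates. -/
def Good (v : Env → Bits k → ℂ) : Prop :=
  ∀ u : Env → ℂ, CFC u → (∀ ρ, ‖u ρ‖ = 1) → InG fun ρ => refl (v ρ) (u ρ)

theorem good_single (hk : 0 < k) (y : Bits k) : Good fun _ => Pi.single y 1 := by
  intro u hu h1
  have : Nonempty (Fin k) := ⟨⟨0, hk⟩⟩
  have := InG.phase Finset.univ Finset.univ_nonempty y hu h1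
  have key : ∀ x : Bits k, (∀ i ∈ Finset.univ, x i = y i) ↔ x = y := fun x => by
    simp [funext_iff]
  simp only [key] at this
  simpa only [refl_single] using this

theorem Good.map {v : Env → Bits k → ℂ} (hv : Good v) {g : Env → Matrix (Bits k) (Bits k) ℂ}
    (hg : InG g) : Good fun ρ => g ρ *ᵥ v ρ := by
  intro u hu h1
  have := (hg.mul (hv u hu h1)).mul hg.star
  simpa only [refl_conj (hg.unitary _)] using this

/-- The string `x` with bit `i` flipped. -/
def flip (i : Fin k) (x : Bits k) : Bits k := Function.update x i (!(x i))

theorem flip_ne (i : Fin k) (x : Bits k) : flip i x ≠ x := fun h => by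
  have := congrFun h i
  simp [flip] at this

/-- The rotation `exp (i φ X)` as a one-qubit matrix. -/
noncomputable def expMat (φ : ℝ) : Matrix (Bits 1) (Bits 1) ℂ := fun y x => expX φ (y 0) (x 0)

theorem expMat_mem (φ : ℝ) : expMat φ ∈ Matrix.unitaryGroup (Bits 1) ℂ := by
  have hs : ((Real.sin φ : ℝ) : ℂ) ^ 2 + ((Real.cos φ : ℝ) : ℂ) ^ 2 = 1 := by
    exact_mod_cast Real.sin_sq_add_cos_sq φ
  rw [Matrix.mem_unitaryGroup_iff]
  ext y x
  rw [Matrix.mul_apply, ← (Equiv.funUnique (Fin 1) Bool).symm.sum_comp, Fintype.sum_bool,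
    Matrix.one_apply]
  have hyx : y = x ↔ y 0 = x 0 := ⟨fun h => by rw [h], fun h => funext fun j => by
    rw [Subsingleton.elim j 0, h]⟩
  simp only [Matrix.star_apply, Equiv.funUnique_symm_apply, hyx, uniqueElim_const, expMat, expX]
  generalize y 0 = a
  generalize x 0 = b
  cases a <;> cases b <;> simp [-Complex.ofReal_sin, -Complex.ofReal_cos] <;> ring_nf <;>
    simp [-Complex.ofReal_sin, -Complex.ofReal_cos] <;> linear_combination hs

theorem CF.half : CF fun _ => √(1 / 2 : ℝ) := by
  have := (CF.nat 2).inv.sqrt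
  simpa [one_div] using this

theorem CFC.half : CFC fun _ => ((√(1 / 2 : ℝ) : ℝ) : ℂ) := CFC.ofReal CF.half

theorem half_mul_half : ((√(1 / 2 : ℝ) : ℝ) : ℂ) * ((√(1 / 2 : ℝ) : ℝ) : ℂ) = 1 / 2 := by
  rw [← Complex.ofReal_mul, Real.mul_self_sqrt (by norm_num)]
  norm_num

theorem sqrt_half_eq : √(1 / 2 : ℝ) = √2 / 2 := by
  rw [Real.sqrt_div (by norm_num), Real.sqrt_one, div_eq_div_iff (by simp) (by norm_num), one_mul,
    Real.mul_self_sqrt (by norm_num)]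

/-- The rotation by `π / 4` of qubit `i` takes a basis vector to a superposition of two basis
vectors which differ in this qubit. -/
theorem good_flip (hk : 0 < k) (i : Fin k) (x : Bits k) :
    Good fun _ => ((√(1 / 2 : ℝ) : ℝ) : ℂ) •
      ((Pi.single x 1 : Bits k → ℂ) + Complex.I • Pi.single (flip i x) 1) := by
  have hV : InG fun _ : Env => liftMat (fun _ : Fin 1 => i)
      (expMat (Real.pi / 4)) := by
    refine InG.lift_one i (fun _ => expMat_mem _) fun y x => ?_
    simp only [expMat, expX, Real.cos_pi_div_four, Real.sin_pi_div_four, ← sqrt_half_eq]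
    exact CFC.ite _ CFC.half (CFC.I.mul CFC.half)
  convert (good_single hk x).map hV using 2 with ρ
  rw [Matrix.mulVec_single_one]
  funext y
  simp only [Matrix.col_apply, liftMat, expMat, expX, Real.cos_pi_div_four, Real.sin_pi_div_four,
    ← sqrt_half_eq, Pi.smul_apply, Pi.add_apply, smul_eq_mul]
  by_cases h1 : y = x
  · subst h1
    simp [(flip_ne i y).symm]
  · by_cases h2 : y = flip i x
    · subst h2
      rw [if_pos, if_neg]
      · simp [flip_ne]; ring
      · simp [flip]
      · intro l hl
        have : l ≠ i := fun h => hl ⟨0, h.symm⟩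
        simp [flip, this]
    · rw [if_neg]
      · simp [h1, h2]
      · intro h
        have h3 : ∀ l, l ≠ i → y l = x l := fun l hl => h l (by rintro ⟨_, rfl⟩; exact hl rfl)
        by_cases h4 : y i = x i
        · exact h1 (funext fun l => by
            by_cases hl : l = i
            · rw [hl, h4]
            · exact h3 l hl)
        · refine h2 (funext fun l => ?_)
          by_cases hl : l = i
          · subst hl
            simp only [flip, Function.update_self]
            generalize y l = a at h4 ⊢
            generalize x l = b at h4 ⊢
            cases a <;> cases b <;> simp_all
          · rw [h3 l hl, flip, Function.update_of_ne hl]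

/-- All rotations in the plane of the basis states `x` and `y` are products of templates. -/
def TwoLevel (x y : Bits k) : Prop :=
  ∀ α β : Env → ℝ, CF α → CF β → (∀ ρ, α ρ ^ 2 + β ρ ^ 2 = 1) →
    ∃ h : Env → Matrix (Bits k) (Bits k) ℂ, InG h ∧
      (∀ ρ, h ρ *ᵥ Pi.single x 1 =
        (α ρ : ℂ) • Pi.single x 1 + (β ρ : ℂ) • Pi.single y 1) ∧
      ∀ ρ z, z ≠ x → z ≠ y → h ρ *ᵥ Pi.single z 1 = Pi.single z 1

/-- With `u = (α + iβ)²`, the phase `u` along `(x + iy)/√2` takes `x` to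
`(α + iβ)(α x - β y)`; phases on `x` and `y` then correct the coefficients. -/
theorem twoLevel_flip (hk : 0 < k) (i : Fin k) (x : Bits k) : TwoLevel x (flip i x) := by
  intro α β hα hβ h1
  set y := flip i x with hy
  have hyx : y ≠ x := flip_ne i x
  -- the phase is `w ^ 2` along the superposition, and `w⁻¹`, `-w⁻¹` on the two basis vectors
  have hw : CFC fun ρ => (α ρ : ℂ) + Complex.I * β ρ :=
    (CFC.ofReal hα).add (CFC.I.mul (CFC.ofReal hβ))
  have hwn : ∀ ρ, ‖(α ρ : ℂ) + Complex.I * β ρ‖ = 1 := fun ρ => by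
    rw [mul_comm, Complex.norm_add_mul_I, h1, Real.sqrt_one]
  have hww : ∀ ρ, star ((α ρ : ℂ) + Complex.I * β ρ) * ((α ρ : ℂ) + Complex.I * β ρ) = 1 :=
    fun ρ => by rw [RCLike.star_def, Complex.conj_mul', hwn]; simp
  have hR := good_flip hk i x _ (hw.mul hw) (fun ρ => by rw [norm_mul, hwn, one_mul])
  have hX := good_single hk x _ hw.conj (fun ρ => by rw [norm_star, hwn])
  have hY := good_single hk y _ hw.conj.neg (fun ρ => by rw [norm_neg, norm_star, hwn])
  refine ⟨_, (hX.mul hY).mul hR, fun ρ => ?_, fun ρ z hzx hzy => ?_⟩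
  · have hc := h1 ρ
    have hcc : (α ρ : ℂ) ^ 2 + (β ρ : ℂ) ^ 2 = 1 := by exact_mod_cast hc
    have hI := Complex.I_mul_I
    have hhh := half_mul_half
    have hw1 := hww ρ
    rw [← Matrix.mulVec_mulVec, ← Matrix.mulVec_mulVec, refl_single, refl_single, refl_mulVec,
      ← hy]
    funext z
    simp only [Matrix.mulVec_diagonal]
    have hdot : star (((√(1 / 2 : ℝ) : ℝ) : ℂ) •
      ((Pi.single x 1 : Bits k → ℂ) + Complex.I • Pi.single y 1)) ⬝ᵥ
        Pi.single x 1 = ((√(1 / 2 : ℝ) : ℝ) : ℂ) := by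
      simp [hyx.symm, -one_div]
    rw [hdot]
    generalize ((√(1 / 2 : ℝ) : ℝ) : ℂ) = r at hhh ⊢
    generalize star ((α ρ : ℂ) + Complex.I * β ρ) = w' at hw1 ⊢
    simp only [Pi.add_apply, Pi.smul_apply, smul_eq_mul]
    by_cases hzx : z = x
    · subst hzx
      simp [hyx.symm]
      linear_combination (w' * ((α ρ : ℂ) ^ 2 + 2 * Complex.I * α ρ * β ρ +
        Complex.I ^ 2 * (β ρ) ^ 2 - 1)) * hhh + (α ρ : ℂ) * hw1 +
        (w' * (β ρ : ℂ) ^ 2 / 2) * hI + (- w' / 2) * hcc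
    · by_cases hzy : z = y
      · subst hzy
        simp [hyx]
        linear_combination (-w' * Complex.I * ((α ρ : ℂ) ^ 2 + 2 * Complex.I * α ρ * β ρ +
          Complex.I ^ 2 * (β ρ) ^ 2 - 1)) * hhh + (β ρ : ℂ) * hw1 +
          (-w' * Complex.I * (β ρ : ℂ) ^ 2 / 2 - w' * α ρ * β ρ) * hI + (-w' * Complex.I / 2) * hcc
      · simp [hzx, hzy]
  · rw [← Matrix.mulVec_mulVec, ← Matrix.mulVec_mulVec, refl_single, refl_single, refl_mulVec]
    have hdot : star (((√(1 / 2 : ℝ) : ℝ) : ℂ) •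
      ((Pi.single x 1 : Bits k → ℂ) + Complex.I • Pi.single y 1)) ⬝ᵥ
        Pi.single z 1 = 0 := by
      simp [hzx, hzy]
    rw [← hy, hdot]
    funext l
    by_cases hl : l = z
    · subst hl
      simp [Matrix.mulVec_diagonal, hzx, hzy]
    · simp [Matrix.mulVec_diagonal, hl]

end ShallowLearning
end

section
open scoped Matrix
namespace ShallowLearning

variable {k : ℕ}

/-! ### Products of templates exhaust the closed-form unitaries -/

theorem permMat_swap_mulVec {α : Type*} [DecidableEq α] [Fintype α] (σ : Equiv.Perm α) (x : α) :
    permMat σ *ᵥ Pi.single x 1 = Pi.single (σ x) 1 := by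
  rw [permMat_mulVec]
  funext y
  simp only [Pi.single_apply, Equiv.Perm.inv_eq_iff_eq]

/-- The transposition of two basis states is the phase `-1` along their difference. -/
theorem TwoLevel.swap (hk : 0 < k) {x y : Bits k} (hxy : x ≠ y) (h : TwoLevel x y) :
    InG fun _ => permMat (Equiv.swap x y) := by
  obtain ⟨g, hg, hgx, -⟩ := h (fun _ => √(1 / 2 : ℝ)) (fun _ => -√(1 / 2 : ℝ)) CF.half CF.half.neg
    (fun _ => by rw [neg_sq, Real.sq_sqrt (by norm_num)]; norm_num)
  have := (good_single hk x).map hg (fun _ => -1) CFC.one.neg (by simp)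
  convert this using 2 with ρ
  change _ = refl (g ρ *ᵥ Pi.single x 1) (-1)
  rw [hgx]
  refine Matrix.ext_iff_mulVec.2 fun v => ?_
  rw [permMat_mulVec, refl_mulVec]
  have hhh := half_mul_half
  have hdot : star (((√(1 / 2 : ℝ) : ℝ) : ℂ) • (Pi.single x 1 : Bits k → ℂ) +
      ((-√(1 / 2 : ℝ) : ℝ) : ℂ) • Pi.single y 1) ⬝ᵥ v =
      ((√(1 / 2 : ℝ) : ℝ) : ℂ) * (v x - v y) := by
    have h1 : star (Pi.single x 1 : Bits k → ℂ) = Pi.single x 1 := by simp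
    have h2 : star (Pi.single y 1 : Bits k → ℂ) = Pi.single y 1 := by simp
    rw [star_add, star_smul, star_smul, h1, h2, add_dotProduct, smul_dotProduct, smul_dotProduct,
      single_one_dotProduct, single_one_dotProduct]
    simp [-one_div]
    ring
  rw [hdot, Complex.ofReal_neg]
  generalize ((√(1 / 2 : ℝ) : ℝ) : ℂ) = r at hhh
  funext z
  simp only [Equiv.swap_inv, Pi.add_apply, Pi.smul_apply, smul_eq_mul]
  by_cases hzx : z = x
  · subst hzx
    simp [hxy]
    linear_combination 2 * (v z - v y) * hhh
  · by_cases hzy : z = y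
    · subst hzy
      simp [hzx]
      linear_combination (-2) * (v x - v z) * hhh
    · simp [hzx, hzy, Equiv.swap_apply_of_ne_of_ne]

/-- The permutations of the basis states that are products of templates. -/
def permGroup (k : ℕ) : Subgroup (Equiv.Perm (Bits k)) where
  carrier := {σ | InG fun _ => permMat σ}
  mul_mem' := fun {σ τ} hσ hτ => by
    simp only [Set.mem_ofPred_eq, permMat_mul] at *
    exact hσ.mul hτ
  one_mem' := by
    simp only [Set.mem_ofPred_eq, permMat_one]
    exact InG.one
  inv_mem' := fun {σ} hσ => by
    simp only [Set.mem_ofPred_eq, ← star_permMat] at *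
    exact hσ.star

theorem swap_mem_permGroup (hk : 0 < k) (x y : Bits k) : Equiv.swap x y ∈ permGroup k := by
  classical
  have key : ∀ S : Finset (Fin k), Equiv.swap x (S.piecewise y x) ∈ permGroup k := by
    intro S
    induction S using Finset.induction_on with
    | empty =>
      rw [Finset.piecewise_empty, Equiv.swap_self]
      exact one_mem (permGroup k)
    | insert i S hi ih =>
      rw [Finset.piecewise_insert]
      refine SubmonoidClass.swap_mem_trans (permGroup k) ih ?_
      set z := S.piecewise y x
      by_cases h : y i = z i
      · rw [h, Function.update_eq_self, Equiv.swap_self]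
        exact one_mem _
      · have h1 : y i = !(z i) := by
          generalize y i = a at h ⊢
          generalize z i = b at h ⊢
          cases a <;> cases b <;> simp_all
        rw [h1]
        exact (twoLevel_flip hk i z).swap hk (flip_ne i z).symm
  simpa using key Finset.univ

/-- Rotations in the plane of any two basis states, by conjugating with a transposition which takes
one of them to a state that differs from the other one in a single bit. -/
theorem twoLevel (hk : 0 < k) {x y : Bits k} (hxy : x ≠ y) : TwoLevel x y := by
  intro α β hα hβ h1
  set x' := flip ⟨0, hk⟩ x with hx'
  obtain ⟨h, hh, hx, hz⟩ := twoLevel_flip hk ⟨0, hk⟩ x α β hα hβ h1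
  have hp : InG fun _ => permMat (Equiv.swap x' y) := swap_mem_permGroup hk x' y
  have hpx : Equiv.swap x' y x = x :=
    Equiv.swap_apply_of_ne_of_ne (flip_ne _ x).symm hxy
  refine ⟨_, (hp.mul hh).mul hp, fun ρ => ?_, fun ρ z hzx hzy => ?_⟩
  · rw [← Matrix.mulVec_mulVec, ← Matrix.mulVec_mulVec, permMat_swap_mulVec, hpx, hx,
      Matrix.mulVec_add, Matrix.mulVec_smul, Matrix.mulVec_smul, permMat_swap_mulVec,
      permMat_swap_mulVec, hpx, Equiv.swap_apply_left]
  · rw [← Matrix.mulVec_mulVec, ← Matrix.mulVec_mulVec, permMat_swap_mulVec, hz,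
      permMat_swap_mulVec, Equiv.swap_apply_self]
    · intro h
      rw [Equiv.swap_apply_eq_iff, hpx] at h
      exact hzx h
    · intro h
      rw [Equiv.swap_apply_eq_iff, Equiv.swap_apply_left] at h
      exact hzy h

theorem InG.mulVec_cf {g : Env → Matrix (Bits k) (Bits k) ℂ} (hg : InG g) {v : Env → Bits k → ℂ}
    (hv : ∀ x, CFC fun ρ => v ρ x) (x : Bits k) : CFC fun ρ => (g ρ *ᵥ v ρ) x := by
  simp only [Matrix.mulVec, dotProduct]
  exact CFC.sum _ fun i => (hg.cf x i).mul (hv i)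

theorem exists_unit_phase {f : Env → ℂ} (hf : CFC f) :
    ∃ u : Env → ℂ, CFC u ∧ (∀ ρ, ‖u ρ‖ = 1) ∧ ∀ ρ, u ρ * f ρ = (‖f ρ‖ : ℂ) := by
  refine ⟨fun ρ => if f ρ = 0 then 1 else star (f ρ) * ((‖f ρ‖⁻¹ : ℝ) : ℂ),
    hf.ite_zero CFC.one (hf.conj.mul (CFC.ofReal hf.norm.inv)), fun ρ => ?_, fun ρ => ?_⟩
  · simp only
    split_ifs with h
    · simp
    · have : ‖f ρ‖ ≠ 0 := norm_ne_zero_iff.2 h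
      simp [this]
  · simp only
    split_ifs with h
    · simp [h]
    · have h2 : ((‖f ρ‖ : ℝ) : ℂ) ≠ 0 := by exact_mod_cast norm_ne_zero_iff.2 h
      rw [Complex.ofReal_inv, RCLike.star_def]
      field_simp
      rw [Complex.conj_mul']

/-- A product of templates moves the coefficient of `y` to `x`. -/
theorem exists_eliminate (hk : 0 < k) {x y : Bits k} (hxy : x ≠ y) {v : Env → Bits k → ℂ}
    (hv : ∀ x, CFC fun ρ => v ρ x) :
    ∃ g : Env → Matrix (Bits k) (Bits k) ℂ, InG g ∧
      ∀ ρ, (g ρ *ᵥ v ρ) y = 0 ∧ ∀ z, z ≠ x → z ≠ y → (g ρ *ᵥ v ρ) z = v ρ z := by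
  -- phases make both coefficients nonnegative, and a rotation by the angle of the pair of
  -- coefficients does the rest; if both vanish, the angle is arbitrary
  obtain ⟨s, hs, hs1, hsv⟩ := exists_unit_phase (hv x)
  obtain ⟨t, ht, ht1, htv⟩ := exists_unit_phase (hv y)
  have hS := good_single hk x s hs hs1
  have hT := good_single hk y t ht ht1
  set r : Env → ℝ := fun ρ => √(‖v ρ x‖ ^ 2 + ‖v ρ y‖ ^ 2) with hr
  have hrc : CF r := (((hv x).norm.pow 2).add ((hv y).norm.pow 2)).sqrt
  have hr2 : ∀ ρ, r ρ ^ 2 = ‖v ρ x‖ ^ 2 + ‖v ρ y‖ ^ 2 := fun ρ =>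
    Real.sq_sqrt (by positivity)
  obtain ⟨h, hh, hx, hz⟩ := twoLevel hk hxy
    (fun ρ => if r ρ = 0 then 1 else ‖v ρ x‖ * (r ρ)⁻¹)
    (fun ρ => if r ρ = 0 then 0 else ‖v ρ y‖ * (r ρ)⁻¹)
    (hrc.ite_zero CF.one ((hv x).norm.mul hrc.inv))
    (hrc.ite_zero CF.zero ((hv y).norm.mul hrc.inv)) (fun ρ => by
      split_ifs with h0
      · simp
      · rw [mul_pow, mul_pow, ← add_mul, ← hr2, inv_pow, mul_inv_cancel₀ (pow_ne_zero 2 h0)])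
  have hprod : InG fun ρ => star (h ρ) * (refl (Pi.single y 1) (t ρ) * refl (Pi.single x 1)
      (s ρ)) :=
    hh.star.mul (hT.mul hS)
  refine ⟨_, hprod, fun ρ => ?_⟩
  -- after the phases the vector is `r • h x` plus the untouched remainder
  set w : Bits k → ℂ := fun z => if z = x then 0 else if z = y then 0 else v ρ z with hw
  have hdec : refl (Pi.single y 1) (t ρ) *ᵥ (refl (Pi.single x 1) (s ρ) *ᵥ v ρ) =
      (r ρ : ℂ) • (h ρ *ᵥ Pi.single x 1) + w := by
    rw [hx, refl_single, refl_single]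
    funext z
    simp only [Matrix.mulVec_diagonal, Pi.add_apply, Pi.smul_apply, smul_eq_mul, hw]
    have hrx : ((r ρ : ℝ) : ℂ) * ((if r ρ = 0 then 1 else ‖v ρ x‖ * (r ρ)⁻¹ : ℝ) : ℂ) =
        (‖v ρ x‖ : ℂ) := by
      rw [← Complex.ofReal_mul]
      congr 1
      split_ifs with h0
      · have h5 := hr2 ρ
        rw [h0] at h5 ⊢
        have : ‖v ρ x‖ ^ 2 = 0 := by nlinarith [sq_nonneg ‖v ρ x‖, sq_nonneg ‖v ρ y‖]
        simpa [eq_comm] using this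
      · field_simp
    have hry : ((r ρ : ℝ) : ℂ) * ((if r ρ = 0 then 0 else ‖v ρ y‖ * (r ρ)⁻¹ : ℝ) : ℂ) =
        (‖v ρ y‖ : ℂ) := by
      rw [← Complex.ofReal_mul]
      congr 1
      split_ifs with h0
      · have h5 := hr2 ρ
        rw [h0] at h5 ⊢
        have : ‖v ρ y‖ ^ 2 = 0 := by nlinarith [sq_nonneg ‖v ρ x‖, sq_nonneg ‖v ρ y‖]
        simpa [eq_comm] using this
      · field_simp
    by_cases hzx : z = x
    · subst hzx
      simp only [hxy, if_false, if_true, one_mul, Pi.single_eq_same, mul_one, hsv,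
        Pi.single_apply, mul_zero, add_zero]
      exact hrx.symm
    · by_cases hzy : z = y
      · subst hzy
        simp only [hzx, if_false, if_true, one_mul, mul_one, htv,
          Pi.single_apply, mul_zero, add_zero, zero_add]
        exact hry.symm
      · simp [hzx, hzy]
  have hfix : h ρ *ᵥ w = w := by
    have hdecw : w = ∑ z, w z • (Pi.single z 1 : Bits k → ℂ) := by
      funext i
      simp [Finset.sum_apply, Pi.single_apply]
    conv_lhs => rw [hdecw]
    rw [Matrix.mulVec_sum]
    conv_rhs => rw [hdecw]
    refine Finset.sum_congr rfl fun z _ => ?_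
    rw [Matrix.mulVec_smul]
    by_cases hzx : z = x
    · simp [hw, hzx]
    · by_cases hzy : z = y
      · simp [hw, hzy]
      · rw [hz ρ z hzx hzy]
  have hfin : (star (h ρ) * (refl (Pi.single y 1) (t ρ) * refl (Pi.single x 1) (s ρ))) *ᵥ v ρ =
      (r ρ : ℂ) • Pi.single x 1 + w := by
    rw [← Matrix.mulVec_mulVec, ← Matrix.mulVec_mulVec, hdec]
    conv_lhs => rw [← hfix, ← Matrix.mulVec_smul, ← Matrix.mulVec_add, Matrix.mulVec_mulVec,
      Matrix.mem_unitaryGroup_iff'.1 (hh.unitary ρ), Matrix.one_mulVec]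
  rw [hfin]
  refine ⟨by simp [hw, hxy.symm], fun z hzx hzy => by simp [hw, hzx, hzy]⟩

theorem exists_eliminate_finset (hk : 0 < k) (x : Bits k) {v : Env → Bits k → ℂ}
    (hv : ∀ x, CFC fun ρ => v ρ x) (S : Finset (Bits k)) (hS : x ∉ S) :
    ∃ g : Env → Matrix (Bits k) (Bits k) ℂ, InG g ∧ ∀ ρ, ∀ z ∈ S, (g ρ *ᵥ v ρ) z = 0 := by
  classical
  induction S using Finset.induction_on with
  | empty => exact ⟨_, InG.one, by simp⟩
  | insert y S hy ih =>
    simp only [Finset.mem_insert, not_or] at hS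
    obtain ⟨g, hg, h0⟩ := ih hS.2
    obtain ⟨g', hg', h0'⟩ := exists_eliminate hk hS.1 (hg.mulVec_cf hv)
    refine ⟨_, hg'.mul hg, fun ρ z hz => ?_⟩
    rw [← Matrix.mulVec_mulVec]
    by_cases hzy : z = y
    · rw [hzy, (h0' ρ).1]
    · have hzS : z ∈ S := by simpa [hzy] using hz
      rw [(h0' ρ).2 z (fun h => hS.2 (h ▸ hzS)) hzy, h0 ρ z hzS]

/-- Phases along any unit vector with closed-form coefficients, since a product of templates takes
the vector to a multiple of a basis vector. -/
theorem good_of_unit (hk : 0 < k) {v : Env → Bits k → ℂ} (hv : ∀ x, CFC fun ρ => v ρ x)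
    (h1 : ∀ ρ, star (v ρ) ⬝ᵥ v ρ = 1) : Good v := by
  classical
  set x : Bits k := fun _ => false
  obtain ⟨g, hg, h0⟩ := exists_eliminate_finset hk x hv (Finset.univ.erase x) (by simp)
  have hgv : ∀ ρ, g ρ *ᵥ v ρ = (g ρ *ᵥ v ρ) x • Pi.single x 1 := fun ρ => by
    funext z
    by_cases h : z = x
    · subst h; simp
    · rw [h0 ρ z (by simp [h])]
      simp [h]
  have hn : ∀ ρ, ‖(g ρ *ᵥ v ρ) x‖ = 1 := fun ρ => by
    have h2 := star_mulVec_dot (hg.unitary ρ) (v ρ) (v ρ)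
    rw [h1, hgv] at h2
    simp only [star_smul, dotProduct_smul, dotProduct_single, smul_eq_mul,
      Pi.star_apply, Pi.single_eq_same, star_one, mul_one, Pi.smul_apply] at h2
    rw [RCLike.star_def, Complex.mul_conj'] at h2
    have h3 : ‖(g ρ *ᵥ v ρ) x‖ ^ 2 = 1 := by exact_mod_cast h2
    exact (pow_eq_one_iff_of_nonneg (norm_nonneg _) (by norm_num)).1 h3
  intro u hu hu1
  have := (good_single hk x).map hg.star u hu hu1
  convert this using 2 with ρ
  have h4 : v ρ = (g ρ *ᵥ v ρ) x • (star (g ρ) *ᵥ Pi.single x 1) := by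
    rw [← Matrix.mulVec_smul, ← hgv, Matrix.mulVec_mulVec,
      Matrix.mem_unitaryGroup_iff'.1 (hg.unitary ρ), Matrix.one_mulVec]
  conv_lhs => rw [h4]
  rw [refl_smul _ (hn ρ)]

theorem dot_cf {v w : Env → Bits k → ℂ} (hv : ∀ x, CFC fun ρ => v ρ x)
    (hw : ∀ x, CFC fun ρ => w ρ x) : CFC fun ρ => star (v ρ) ⬝ᵥ w ρ := by
  simp only [dotProduct, Pi.star_apply]
  exact CFC.sum _ fun i => (hv i).conj.mul (hw i)

theorem dot_star_comm {α : Type*} [Fintype α] (a b : α → ℂ) : star (star a ⬝ᵥ b) = star b ⬝ᵥ a := by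
  rw [← Matrix.star_dotProduct_star, star_star, dotProduct_comm]

open scoped ComplexOrder in
theorem eq_zero_of_dot_self {α : Type*} [Fintype α] {d : α → ℂ} (h : star d ⬝ᵥ d = 0) : d = 0 :=
  dotProduct_star_self_eq_zero.1 h

/-- A unit vector is taken to another one by a single phase along their difference, which fixes
what is orthogonal to both. -/
theorem exists_householder (hk : 0 < k) {a b : Env → Bits k → ℂ} (ha : ∀ x, CFC fun ρ => a ρ x)
    (hb : ∀ x, CFC fun ρ => b ρ x) (ha1 : ∀ ρ, star (a ρ) ⬝ᵥ a ρ = 1)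
    (hb1 : ∀ ρ, star (b ρ) ⬝ᵥ b ρ = 1) :
    ∃ g : Env → Matrix (Bits k) (Bits k) ℂ, InG g ∧ ∀ ρ, g ρ *ᵥ a ρ = b ρ ∧
      ∀ w, star (a ρ) ⬝ᵥ w = 0 → star (b ρ) ⬝ᵥ w = 0 → g ρ *ᵥ w = w := by
  set z : Env → ℂ := fun ρ => star (a ρ) ⬝ᵥ b ρ with hz
  have hzc : CFC z := dot_cf ha hb
  -- the squared norm of `a - b`; a closed form may be tested for being zero, so the case `a = b` is
  -- treated on its own, with the phase `1` along the arbitrary unit vector `b`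
  set nd : Env → ℝ := fun ρ => 2 - ((z ρ).re + (z ρ).re) with hnd
  have hndc : CF nd := (CF.nat 2).sub (hzc.1.add hzc.1)
  have hdd : ∀ ρ, star (a ρ - b ρ) ⬝ᵥ (a ρ - b ρ) = (nd ρ : ℂ) := fun ρ => by
    have h1 : star (b ρ) ⬝ᵥ a ρ = star (z ρ) := (dot_star_comm _ _).symm
    rw [star_sub, sub_dotProduct, dotProduct_sub, dotProduct_sub, ha1, hb1, h1]
    apply Complex.ext <;> simp [hnd, hz] <;> ring
  have hab : ∀ ρ, nd ρ = 0 → a ρ = b ρ := fun ρ h => by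
    have := hdd ρ
    rw [h, Complex.ofReal_zero] at this
    exact sub_eq_zero.1 (eq_zero_of_dot_self this)
  have hndn : ∀ ρ, 0 ≤ nd ρ := fun ρ => by
    have h1 := hdd ρ
    have h2 : star (a ρ - b ρ) ⬝ᵥ (a ρ - b ρ) = ((∑ i, ‖(a ρ - b ρ) i‖ ^ 2 : ℝ) : ℂ) := by
      simp only [dotProduct, Pi.star_apply, RCLike.star_def, Complex.conj_mul']
      push_cast
      rfl
    rw [h2] at h1
    rw [← Complex.ofReal_inj.1 h1]
    positivity
  have hz1 : ∀ ρ, nd ρ ≠ 0 → 1 - z ρ ≠ 0 := fun ρ h h0 => h (by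
    have h2 : (z ρ).re = 1 := by rw [← sub_eq_zero.1 h0]; simp
    simp only [hnd, h2]; norm_num)
  have hgood : Good fun ρ i => if (nd ρ : ℂ) = 0 then b ρ i
      else (((√(nd ρ))⁻¹ : ℝ) : ℂ) * (a ρ i - b ρ i) := by
    refine good_of_unit hk (fun i => (CFC.ofReal hndc).ite_zero (hb i)
      ((CFC.ofReal hndc.sqrt.inv).mul ((ha i).sub (hb i)))) fun ρ => ?_
    by_cases h : (nd ρ : ℂ) = 0
    · simpa only [h, if_true] using hb1 ρ
    · simp only [h, if_false]
      have h5 : (fun i => (((√(nd ρ))⁻¹ : ℝ) : ℂ) * (a ρ i - b ρ i)) =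
          (((√(nd ρ))⁻¹ : ℝ) : ℂ) • (a ρ - b ρ) := rfl
      rw [h5, star_smul, smul_dotProduct, dotProduct_smul, hdd, RCLike.star_def,
          Complex.conj_ofReal,
        smul_eq_mul, smul_eq_mul, ← Complex.ofReal_mul, ← Complex.ofReal_mul]
      have h6 : nd ρ ≠ 0 := by simpa using h
      have h7 : √(nd ρ) ≠ 0 := by
        rw [Real.sqrt_ne_zero (hndn ρ)]; exact h6
      rw [← Complex.ofReal_one, Complex.ofReal_inj]
      nth_rewrite 3 [← Real.mul_self_sqrt (hndn ρ)]
      field_simp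
  -- the phase is `-(1 - z) / (1 - z̄)` with `z` the inner product of `a` and `b`; it takes `a` to
  -- `b` because `|a - b|² = (1 - z) + (1 - z̄)`
  have hg := hgood (fun ρ => if (nd ρ : ℂ) = 0 then 1 else -((1 - z ρ) * (1 - star (z ρ))⁻¹))
    ((CFC.ofReal hndc).ite_zero CFC.one ((CFC.one.sub hzc).mul (CFC.one.sub hzc.conj).inv).neg)
    (fun ρ => by
      split_ifs with h
      · simp
      · have h6 : nd ρ ≠ 0 := by simpa using h
        have h8 : 1 - star (z ρ) = star (1 - z ρ) := by simp
        rw [norm_neg, norm_mul, norm_inv, h8, norm_star]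
        exact mul_inv_cancel₀ (norm_ne_zero_iff.2 (hz1 ρ h6)))
  refine ⟨_, hg, fun ρ => ?_⟩
  by_cases h : (nd ρ : ℂ) = 0
  · simp only [h, if_true]
    have h6 : nd ρ = 0 := by simpa using h
    refine ⟨?_, fun w _ _ => ?_⟩ <;> rw [refl_mulVec] <;> simp [hab ρ h6]
  · simp only [h, if_false]
    have h6 : nd ρ ≠ 0 := by simpa using h
    have h5 : (fun i => (((√(nd ρ))⁻¹ : ℝ) : ℂ) * (a ρ i - b ρ i)) =
        (((√(nd ρ))⁻¹ : ℝ) : ℂ) • (a ρ - b ρ) := rfl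
    rw [h5]
    refine ⟨?_, fun w hw1 hw2 => ?_⟩
    · have h7 : √(nd ρ) ≠ 0 := by
        rw [Real.sqrt_ne_zero (hndn ρ)]; exact h6
      have h8 : 1 - star (z ρ) ≠ 0 := by
        have : 1 - star (z ρ) = star (1 - z ρ) := by simp
        rw [this, star_ne_zero]
        exact hz1 ρ h6
      have h1 : star (b ρ) ⬝ᵥ a ρ = star (z ρ) := (dot_star_comm _ _).symm
      have h9 : ((nd ρ : ℝ) : ℂ) = (1 - z ρ) + (1 - star (z ρ)) := by
        apply Complex.ext <;> simp [hnd] <;> ring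
      have h10 : (((√(nd ρ))⁻¹ : ℝ) : ℂ) * (((√(nd ρ))⁻¹ : ℝ) : ℂ) * (nd ρ : ℂ) = 1 := by
        rw [← Complex.ofReal_mul, ← Complex.ofReal_mul, ← Complex.ofReal_one, Complex.ofReal_inj]
        nth_rewrite 3 [← Real.mul_self_sqrt (hndn ρ)]
        field_simp
      have h11 : (1 - star (z ρ))⁻¹ * (1 - star (z ρ)) = 1 := inv_mul_cancel₀ h8
      rw [refl_mulVec, star_smul, smul_dotProduct, star_sub, sub_dotProduct, ha1, h1,
        RCLike.star_def, Complex.conj_ofReal]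
      rw [h9] at h10
      funext i
      simp only [Pi.add_apply, Pi.smul_apply, Pi.sub_apply, smul_eq_mul] at *
      generalize (((√(nd ρ))⁻¹ : ℝ) : ℂ) = r at *
      simp only [RCLike.star_def] at *
      generalize (starRingEnd ℂ) (z ρ) = z' at *
      generalize (1 - z')⁻¹ = q at *
      linear_combination (-(a ρ i - b ρ i)) * h10 - (a ρ i - b ρ i) * r * r * (1 - z ρ) * h11
    · rw [refl_mulVec, star_smul, smul_dotProduct, star_sub, sub_dotProduct, hw1, hw2]
      simp

/-- Elimination column by column: the vectors fixed so far are orthogonal to the next column and to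
the basis vector which it is taken to, and hence remain fixed. -/
theorem exists_fix_columns (hk : 0 < k) {U : Env → Matrix (Bits k) (Bits k) ℂ}
    (hU : ∀ ρ, U ρ ∈ Matrix.unitaryGroup (Bits k) ℂ) (hc : ∀ y x, CFC fun ρ => U ρ y x)
    (S : Finset (Bits k)) :
    ∃ g : Env → Matrix (Bits k) (Bits k) ℂ, InG g ∧
      ∀ ρ, ∀ x ∈ S, (g ρ * U ρ) *ᵥ Pi.single x 1 = Pi.single x 1 := by
  classical
  have hsc : ∀ x i : Bits k, CFC fun _ => (Pi.single x 1 : Bits k → ℂ) i := fun x i => by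
    simp only [Pi.single_apply]
    exact CFC.ite_one _
  have hs1 : ∀ x y : Bits k, star (Pi.single x 1 : Bits k → ℂ) ⬝ᵥ Pi.single y 1 =
      if y = x then 1 else 0 := fun x y => by
    simp [Pi.single_apply]
  induction S using Finset.induction_on with
  | empty => exact ⟨_, InG.one, by simp⟩
  | insert x S hx ih =>
    obtain ⟨g, hg, hfix⟩ := ih
    have hgU : ∀ ρ, g ρ * U ρ ∈ Matrix.unitaryGroup (Bits k) ℂ := fun ρ =>
      mul_mem (hg.unitary ρ) (hU ρ)
    obtain ⟨g', hg', h'⟩ := exists_householder hk (a := fun ρ => (g ρ * U ρ) *ᵥ Pi.single x 1)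
      (b := fun _ => Pi.single x 1) (fun i => by
        simp only [← Matrix.mulVec_mulVec]
        refine hg.mulVec_cf (v := fun ρ => U ρ *ᵥ Pi.single x 1) (fun j => ?_) i
        simp only [Matrix.mulVec_single_one]
        exact hc j x) (hsc x)
      (fun ρ => by rw [star_mulVec_dot (hgU ρ), hs1]; simp)
      (fun ρ => by rw [hs1]; simp)
    refine ⟨_, hg'.mul hg, fun ρ y hy => ?_⟩
    rw [mul_assoc, ← Matrix.mulVec_mulVec]
    rcases Finset.mem_insert.1 hy with rfl | hy
    · exact (h' ρ).1
    · have hyx : y ≠ x := fun h => hx (h ▸ hy)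
      rw [hfix ρ y hy]
      refine (h' ρ).2 _ ?_ ?_
      · rw [← hfix ρ y hy, star_mulVec_dot (hgU ρ), hs1, if_neg hyx]
      · rw [hs1, if_neg hyx]

/-- Every unitary on a block whose entries have closed forms is a product of one- and two-qubit
gates whose entries have closed forms. -/
theorem InG.of_unitary (hk : 0 < k) {U : Env → Matrix (Bits k) (Bits k) ℂ}
    (hU : ∀ ρ, U ρ ∈ Matrix.unitaryGroup (Bits k) ℂ) (hc : ∀ y x, CFC fun ρ => U ρ y x) :
    InG U := by
  classical
  obtain ⟨g, hg, h⟩ := exists_fix_columns hk hU hc Finset.univ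
  have h1 : ∀ ρ, U ρ = Star.star (g ρ) := fun ρ => by
    have h2 : g ρ * U ρ = 1 := by
      refine Matrix.ext_of_mulVec_single fun x => ?_
      rw [h ρ x (Finset.mem_univ x), Matrix.one_mulVec]
    rw [← one_mul (U ρ), ← Matrix.mem_unitaryGroup_iff'.1 (hg.unitary ρ), mul_assoc, h2, mul_one]
  have h3 : U = fun ρ => Star.star (g ρ) := funext h1
  rw [h3]
  exact hg.star

end ShallowLearning
end

section
open scoped Matrix
namespace ShallowLearning

/-! ### The block unitaries -/

variable {k : ℕ}

theorem sum_bits_prod (F : Fin k → Bool → ℂ) :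
    ∑ z : Bits k, ∏ j, F j (z j) = ∏ j, ∑ c, F j c := by
  rw [Finset.prod_univ_sum, Fintype.piFinset_univ]

/-- Rotation angle controlled by a bit. -/
noncomputable def ctrlAngle (θ : ℝ) (b : Bool) : ℝ := if b then θ else 0

theorem sum_star_expX (a b : ℝ) (y x : Bool) :
    ∑ c, star (expX a c y) * expX b c x = expX (b - a) y x := by
  rw [Fintype.sum_bool]
  simp only [expX, Real.cos_sub, Real.sin_sub, RCLike.star_def]
  have := Complex.I_mul_I
  cases y <;> cases x <;>
    simp [-Complex.ofReal_sin, -Complex.ofReal_cos] <;> ring_nf <;>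
    simp [-Complex.ofReal_sin, -Complex.ofReal_cos]

theorem cyclicA_eq (θ : ℝ) (y x : Bits k) :
    cyclicA k θ y x = ∏ j, expX (ctrlAngle θ (x ((finRotate k).symm j))) (y j) (x j) := rfl

/-- Inner products of the columns of `A`. -/
theorem gram_eq_prod (θ : ℝ) (y x : Bits k) :
    ((cyclicA k θ)ᴴ * cyclicA k θ) y x = ∏ j, expX (ctrlAngle θ (x ((finRotate k).symm j)) -
      ctrlAngle θ (y ((finRotate k).symm j))) (y j) (x j) := by
  simp only [Matrix.mul_apply, Matrix.conjTranspose_apply, cyclicA_eq, star_prod,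
    ← Finset.prod_mul_distrib]
  rw [sum_bits_prod fun j c => star (expX (ctrlAngle θ (y ((finRotate k).symm j))) c (y j)) *
    expX (ctrlAngle θ (x ((finRotate k).symm j))) c (x j)]
  simp only [sum_star_expX]

theorem compl_compl (x : Bits k) : x.compl.compl = x := by
  funext j
  simp [Bits.compl]

/-- Agreement of two strings that spreads from each position to the cyclically next one is
agreement everywhere or nowhere. -/
theorem eq_or_eq_compl {y x : Bits k}
    (h : ∀ j, y ((finRotate k).symm j) = x ((finRotate k).symm j) → y j = x j) :
    y = x ∨ y = x.compl := by
  rcases k with _ | k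
  · exact Or.inl (Subsingleton.elim _ _)
  by_cases hi : ∃ i, y i = x i
  · obtain ⟨i, hi⟩ := hi
    have hsucc : ∀ j : Fin k, y j.castSucc = x j.castSucc → y j.succ = x j.succ := fun j hj => by
      have h1 : (finRotate (k + 1)).symm j.succ = j.castSucc := by
        rw [Equiv.symm_apply_eq, finRotate_apply, Fin.coeSucc_eq_succ]
      exact h _ (by rw [h1]; exact hj)
    have hge : ∀ j, i ≤ j → y j = x j := fun j => by
      induction j using Fin.induction with
      | zero => exact fun h0 => by rwa [← le_antisymm h0 (Fin.zero_le i)]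
      | succ j ih =>
        intro hij
        rcases eq_or_lt_of_le hij with h2 | h2
        · rwa [← h2]
        · exact hsucc j (ih (Fin.le_castSucc_iff.2 h2))
    have h0 : y 0 = x 0 := by
      have h1 : (finRotate (k + 1)).symm 0 = Fin.last k := by
        rw [Equiv.symm_apply_eq, finRotate_last]
      exact h _ (by rw [h1]; exact hge _ (Fin.le_last i))
    left
    funext j
    induction j using Fin.induction with
    | zero => exact h0
    | succ j ih => exact hsucc j ih
  · right
    push Not at hi
    funext j
    have := hi j
    simp only [Bits.compl]
    generalize y j = a at this
    generalize x j = b at this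
    cases a <;> cases b <;> simp_all

/-- The overlap `⟨A x̄, A x⟩`. -/
noncomputable def overlap (θ : ℝ) (x : Bits k) : ℂ :=
  (-Complex.I) ^ (k + 2 * x.weight) * (Real.sin θ : ℂ) ^ k

theorem gram_self (θ : ℝ) (x : Bits k) : ((cyclicA k θ)ᴴ * cyclicA k θ) x x = 1 := by
  rw [gram_eq_prod]
  simp [expX]

theorem gram_compl (θ : ℝ) (x : Bits k) :
    ((cyclicA k θ)ᴴ * cyclicA k θ) x.compl x = overlap θ x := by
  rw [gram_eq_prod]
  have h1 : ∀ j, expX (ctrlAngle θ (x ((finRotate k).symm j)) -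
      ctrlAngle θ (x.compl ((finRotate k).symm j))) (x.compl j) (x j) =
      (fun i => (-Complex.I) * (Real.sin θ : ℂ) * (if x i then -1 else 1))
        ((finRotate k).symm j) := by
    intro j
    have h2 : x.compl j ≠ x j := by simp [Bits.compl]
    rw [expX, if_neg h2]
    simp only [ctrlAngle, Bits.compl]
    rcases Bool.eq_false_or_eq_true (x ((finRotate k).symm j)) with hb | hb <;> simp only [hb] <;>
      simp
  rw [Finset.prod_congr rfl fun j _ => h1 j, Equiv.prod_comp (finRotate k).symm fun i =>
    (-Complex.I) * (Real.sin θ : ℂ) * (if x i then -1 else 1), Finset.prod_mul_distrib,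
    Finset.prod_const, Finset.prod_ite, Finset.prod_const, Finset.prod_const_one, mul_one,
    Finset.card_univ, Fintype.card_fin, overlap, pow_add, pow_mul, mul_pow]
  have h3 : (-Complex.I) ^ 2 = -1 := by simp
  rw [h3]
  simp only [Bits.weight]
  ring

theorem gram_ne (θ : ℝ) {y x : Bits k} (h1 : y ≠ x) (h2 : y ≠ x.compl) :
    ((cyclicA k θ)ᴴ * cyclicA k θ) y x = 0 := by
  rw [gram_eq_prod]
  by_contra hne
  have h3 := Finset.prod_ne_zero_iff.1 hne
  have h5 : y = x ∨ y = x.compl := eq_or_eq_compl fun j hj => by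
    by_contra h4
    refine h3 j (Finset.mem_univ j) ?_
    rw [hj, sub_self, expX, if_neg h4]
    simp
  exact h5.elim h1 h2

theorem norm_overlap (θ : ℝ) (x : Bits k) : ‖overlap θ x‖ = |Real.sin θ| ^ k := by
  rw [overlap, norm_mul, norm_pow, norm_neg, Complex.norm_I, one_pow, one_mul, norm_pow,
    Complex.norm_real, Real.norm_eq_abs]

/-- The columns of `A` are orthonormal up to the overlaps of complementary columns, which
Gram-Schmidt removes. -/
theorem blockU_mem {θ : ℝ} (hθ : Real.sin θ ^ (2 * k) < 1) {B : Set (Bits k)}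
    (hB : IsHalf B) : blockU k θ B ∈ Matrix.unitaryGroup (Bits k) ℂ := by
  classical
  set G := (cyclicA k θ)ᴴ * cyclicA k θ with hG
  set N : ℂ := ((Real.sqrt (1 - Real.sin θ ^ (2 * k)) : ℝ) : ℂ)⁻¹ with hN
  have hNs : star N = N := by
    rw [hN, star_inv₀, RCLike.star_def, Complex.conj_ofReal]
  have hGs : ∀ y x, star (G y x) = G x y := fun y x => by
    rw [hG, ← Matrix.conjTranspose_apply, Matrix.conjTranspose_mul,
      Matrix.conjTranspose_conjTranspose]
  have habs : (|Real.sin θ| ^ k) ^ 2 = Real.sin θ ^ (2 * k) := by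
    rw [← pow_mul, mul_comm k 2, pow_mul, sq_abs, ← pow_mul]
  have hov : ∀ x : Bits k, star (overlap θ x) * overlap θ x =
      ((Real.sin θ ^ (2 * k) : ℝ) : ℂ) := fun x => by
    rw [RCLike.star_def, Complex.conj_mul', norm_overlap, ← Complex.ofReal_pow, habs]
  have hNN : N * N * (1 - ((Real.sin θ ^ (2 * k) : ℝ) : ℂ)) = 1 := by
    rw [hN, ← Complex.ofReal_one, ← Complex.ofReal_sub, ← Complex.ofReal_inv, ← Complex.ofReal_mul,
      ← Complex.ofReal_mul, Complex.ofReal_inj, ← mul_inv,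
      Real.mul_self_sqrt (by linarith), inv_mul_cancel₀ (by linarith)]
  have hxB : ∀ x, x ∉ B → x.compl ∈ B := fun x hx => by
    by_contra h
    exact hx ((hB x).2 h)
  have hBne : ∀ {y x}, y ∈ B → x ∈ B → y ≠ x.compl := fun hy hx h => (hB _).1 hx (h ▸ hy)
  have hBne' : ∀ {y x}, y ∉ B → x ∉ B → y ≠ x.compl := fun hy hx h => hy (h ▸ hxB _ hx)
  have hcol : ∀ x, x ∈ B → ∀ z, blockU k θ B z x = cyclicA k θ z x := fun x hx z => by
    simp only [blockU, if_pos hx]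
  have hcol' : ∀ x, x ∉ B → ∀ z, blockU k θ B z x =
      N * (cyclicA k θ z x - overlap θ x * cyclicA k θ z x.compl) := fun x hx z => by
    simp only [blockU, if_neg hx, overlap, hN]
  have hGsum : ∀ y x, ∑ z, star (cyclicA k θ z y) * cyclicA k θ z x = G y x := fun y x => by
    simp only [hG, Matrix.mul_apply, Matrix.conjTranspose_apply]
  -- the entries of `Uᴴ U`, according to which of the columns are kept; the remaining case, of two
  -- corrected columns, comes last
  have hBB : ∀ y x, y ∈ B → x ∈ B → ((blockU k θ B)ᴴ * blockU k θ B) y x =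
      (1 : Matrix (Bits k) (Bits k) ℂ) y x := by
    intro y x hy hx
    simp only [Matrix.mul_apply, Matrix.conjTranspose_apply, hcol y hy, hcol x hx, hGsum]
    by_cases h : y = x
    · rw [h, Matrix.one_apply_eq, hG, gram_self]
    · rw [Matrix.one_apply_ne h, hG, gram_ne θ h (hBne hy hx)]
  have hBn : ∀ y x, y ∈ B → x ∉ B → ((blockU k θ B)ᴴ * blockU k θ B) y x =
      (1 : Matrix (Bits k) (Bits k) ℂ) y x := by
    intro y x hy hx
    have hyx : y ≠ x := fun h => hx (h ▸ hy)
    have h1 : ((blockU k θ B)ᴴ * blockU k θ B) y x = N * (G y x - overlap θ x * G y x.compl) := by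
      simp only [Matrix.mul_apply, Matrix.conjTranspose_apply, hcol y hy, hcol' x hx, ← hGsum,
        Finset.mul_sum, ← Finset.sum_sub_distrib]
      refine Finset.sum_congr rfl fun z _ => ?_
      ring
    rw [h1, Matrix.one_apply_ne hyx]
    by_cases h : y = x.compl
    · rw [h, hG, gram_compl, gram_self, mul_one, sub_self, mul_zero]
    · rw [hG, gram_ne θ hyx h, gram_ne θ h (by rw [compl_compl]; exact hyx)]
      simp
  rw [Matrix.mem_unitaryGroup_iff', Matrix.star_eq_conjTranspose]
  ext y x
  by_cases hy : y ∈ B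
  · by_cases hx : x ∈ B
    · exact hBB y x hy hx
    · exact hBn y x hy hx
  · by_cases hx : x ∈ B
    · have h1 := congrArg star (hBn x y hx hy)
      rw [← Matrix.conjTranspose_apply, Matrix.conjTranspose_mul,
        Matrix.conjTranspose_conjTranspose] at h1
      rw [h1, ← Matrix.conjTranspose_apply, Matrix.conjTranspose_one]
    · have h1 : ((blockU k θ B)ᴴ * blockU k θ B) y x = N * N * (G y x - overlap θ x * G y x.compl -
          star (overlap θ y) * G y.compl x +
          star (overlap θ y) * overlap θ x * G y.compl x.compl) := by
        simp only [Matrix.mul_apply, Matrix.conjTranspose_apply, hcol' y hy, hcol' x hx, ← hGsum,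
          Finset.mul_sum, ← Finset.sum_sub_distrib, ← Finset.sum_add_distrib, star_mul', star_sub,
          hNs]
        refine Finset.sum_congr rfl fun z _ => ?_
        ring
      rw [h1]
      by_cases h : y = x
      · subst h
        have h2 : G y y.compl = star (overlap θ y) := by
          rw [← hGs, hG, gram_compl]
        rw [h2, hG, gram_self, gram_self, gram_compl, Matrix.one_apply_eq]
        linear_combination (-N * N) * hov y + hNN
      · have h2 : y ≠ x.compl := hBne' hy hx
        have h3 : y.compl ≠ x := fun h3 => hBne' hx hy h3.symm
        have h4 : y.compl ≠ x.compl := fun h4 => h (by rw [← compl_compl y, h4, compl_compl])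
        rw [hG, gram_ne θ h h2, gram_ne θ h2 (by rw [compl_compl]; exact h), gram_ne θ h3 h4,
          gram_ne θ h4 (by rw [compl_compl]; exact h3), Matrix.one_apply_ne h]
        ring

theorem norm_expX_le (φ : ℝ) (y x : Bool) : ‖expX φ y x‖ ≤ 1 := by
  unfold expX
  split_ifs
  · rw [Complex.norm_real]; exact Real.abs_cos_le_one φ
  · rw [norm_mul, Complex.norm_I, one_mul, Complex.norm_real]; exact Real.abs_sin_le_one φ

theorem norm_cyclicA_le (θ : ℝ) (y x : Bits k) : ‖cyclicA k θ y x‖ ≤ 1 := by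
  rw [cyclicA_eq, norm_prod]
  exact Finset.prod_le_one (fun _ _ => norm_nonneg _) fun _ _ => norm_expX_le _ _ _

/-- `U` is close to `A` when the overlaps are small. -/
theorem norm_blockU_sub_le {θ : ℝ} (B : Set (Bits k)) (hε : |Real.sin θ| ^ k ≤ 1 / 2)
    (y x : Bits k) : ‖blockU k θ B y x - cyclicA k θ y x‖ ≤ 2 * |Real.sin θ| ^ k := by
  classical
  set ε := |Real.sin θ| ^ k with hεd
  have hε0 : 0 ≤ ε := by positivity
  by_cases hx : x ∈ B
  · simp only [blockU, if_pos hx, sub_self, norm_zero]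
    linarith
  have h2k : Real.sin θ ^ (2 * k) = ε ^ 2 := by
    rw [hεd, ← pow_mul, mul_comm k 2, pow_mul, pow_mul, sq_abs]
  set N := Real.sqrt (1 - ε ^ 2) with hN
  have hN2 : N * N = 1 - ε ^ 2 := Real.mul_self_sqrt (by nlinarith)
  have hN0 : 0 ≤ N := Real.sqrt_nonneg _
  have hN1 : N ≤ 1 := by nlinarith
  have hNlow : 3 / 4 ≤ N := by nlinarith
  have hNpos : 0 < N := by linarith
  have hinv1 : N⁻¹ ≤ 4 / 3 := by
    rw [inv_le_comm₀ hNpos (by norm_num)]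
    linarith
  have hinv2 : 1 ≤ N⁻¹ := (one_le_inv₀ hNpos).2 hN1
  -- the error consists of the change of normalization and of the correction term
  have hinv3 : N⁻¹ - 1 ≤ 2 / 3 * ε := by
    have h1 : N⁻¹ * N = 1 := inv_mul_cancel₀ hNpos.ne'
    nlinarith
  have h1 : blockU k θ B y x - cyclicA k θ y x =
      ((N⁻¹ - 1 : ℝ) : ℂ) * cyclicA k θ y x -
        ((N⁻¹ : ℝ) : ℂ) * (overlap θ x * cyclicA k θ y x.compl) := by
    simp only [blockU, if_neg hx, h2k, overlap]
    push_cast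
    ring
  rw [h1]
  refine (norm_sub_le _ _).trans ?_
  rw [norm_mul, norm_mul, norm_mul, norm_overlap, Complex.norm_real, Complex.norm_real,
    Real.norm_of_nonneg (by linarith), Real.norm_of_nonneg (by linarith)]
  have hA := norm_cyclicA_le θ y x
  have hA' := norm_cyclicA_le θ y x.compl
  have e1 : (N⁻¹ - 1) * ‖cyclicA k θ y x‖ ≤ (N⁻¹ - 1) * 1 :=
    mul_le_mul_of_nonneg_left hA (by linarith)
  have e2 : N⁻¹ * (ε * ‖cyclicA k θ y x.compl‖) ≤ 4 / 3 * (ε * 1) := by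
    gcongr
  linarith

theorem sin_pow_lt_one (hk : 0 < k) {p : ℕ} (hp : 3 ≤ p) :
    Real.sin (Real.pi / p) ^ (2 * k) < 1 := by
  have hp' : (3 : ℝ) ≤ p := by exact_mod_cast hp
  have h0 : 0 < Real.pi / p := by positivity
  have h1 : Real.pi / p < Real.pi / 2 := by
    apply div_lt_div_of_pos_left Real.pi_pos <;> linarith
  have h2 := Real.cos_pos_of_mem_Ioo ⟨by linarith, h1⟩
  have h3 := Real.sin_sq_add_cos_sq (Real.pi / p)
  rw [pow_mul]
  exact pow_lt_one₀ (sq_nonneg _) (by nlinarith) hk.ne'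

/-- The permutation of the basis states effected by `C`. -/
def rotPerm (k : ℕ) : Equiv.Perm (Bits k) := Equiv.arrowCongr (finRotate k).symm (Equiv.refl Bool)

theorem cyclicC_eq (k : ℕ) : cyclicC k = permMat (rotPerm k) := rfl

theorem CFC.natPow_I (j : ℕ) : CFC fun _ => (-Complex.I) ^ j := CFC.I.neg.pow j

theorem CF.cosPiDiv : CF fun ρ => Real.cos (Real.pi / (ρ.1 1 : ℕ)) := by
  simpa [Tok.eval] using CF.cosPi (.const 1) (.reg 1 0)

theorem CF.sinPiDiv : CF fun ρ => Real.sin (Real.pi / (ρ.1 1 : ℕ)) := by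
  simpa [Tok.eval] using CF.sinPi (.const 1) (.reg 1 0)

theorem cyclicA_cf (y x : Bits k) : CFC fun ρ => cyclicA k (Real.pi / (ρ.1 1 : ℕ)) y x := by
  simp only [cyclicA_eq]
  refine CFC.prod _ fun j => ?_
  simp only [expX, ctrlAngle]
  cases x ((finRotate k).symm j)
  · simp only [Bool.false_eq_true, if_false, Real.cos_zero, Real.sin_zero, Complex.ofReal_zero,
      mul_zero, Complex.ofReal_one]
    exact CFC.ite _ CFC.one CFC.zero
  · simp only [if_true]
    exact CFC.ite _ (CFC.ofReal CF.cosPiDiv) (CFC.I.mul (CFC.ofReal CF.sinPiDiv))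

theorem blockU_cf (B : Set (Bits k)) (y x : Bits k) :
    CFC fun ρ => blockU k (Real.pi / (ρ.1 1 : ℕ)) B y x := by
  classical
  by_cases hx : x ∈ B
  · simpa only [blockU, if_pos hx] using cyclicA_cf y x
  · simp only [blockU, if_neg hx]
    exact (CFC.ofReal (CF.one.sub (CF.sinPiDiv.pow _)).sqrt).inv.mul ((cyclicA_cf y x).sub
      (((CFC.natPow_I _).mul ((CFC.ofReal CF.sinPiDiv).pow k)).mul (cyclicA_cf y _)))

theorem blockU_realizable (hk : 0 < k) {B : Set (Bits k)} (hB : IsHalf B) :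
    Realizable k fun ρ => (blockU k (Real.pi / (ρ.1 1 : ℕ)) B)ᴴ :=
  (InG.of_unitary hk (fun ρ => blockU_mem (sin_pow_lt_one hk ρ.2) hB)
    fun y x => blockU_cf B y x).realStar

theorem cyclicC_realizable (hk : 0 < k) : Realizable k fun _ => cyclicC k := by
  refine (InG.of_unitary hk (fun ρ => ?_) fun y x => ?_).real
  · rw [cyclicC_eq]
    exact permMat_mem _
  · exact CFC.ite_one _

end ShallowLearning
end

section
open scoped Matrix
namespace ShallowLearning

/-! ### Layer templates -/

/-- A layer obtained from one gate template by letting the numbers in registers `41` and `42`, which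
the template uses as wires, run through arithmetic progressions with differences `s₁` and `s₂`. -/
structure LayerTmpl : Type where
  count : Tok
  w₁ : Tok
  w₂ : Tok
  s₁ : ℕ
  s₂ : ℕ
  gate : GateTmpl

/-- The registers seen by the template of gate `j` of a layer. -/
def LayerTmpl.env (l : LayerTmpl) (ρ : ℕ → ℕ) (j : ℕ) : ℕ → ℕ :=
  Function.update (Function.update ρ 41 (l.w₁.eval ρ + j * l.s₁)) 42 (l.w₂.eval ρ + j * l.s₂)

/-- The descriptions of the gates of a layer. -/
def LayerTmpl.desc (l : LayerTmpl) (ρ : ℕ → ℕ) : List GateDesc :=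
  (List.range (l.count.eval ρ)).map fun j => l.gate.desc (l.env ρ j)

/-- The gates of a layer. -/
noncomputable def LayerTmpl.gates (l : LayerTmpl) (ρ : ℕ → ℕ) : List Gate :=
  (List.range (l.count.eval ρ)).map fun j => (l.gate.desc (l.env ρ j)).toGate

theorem flatten_toCircuit (Ls : List LayerTmpl) (ρ : ℕ → ℕ) :
    (CircuitDesc.toCircuit (Ls.map fun l => l.desc ρ)).flatten =
      Ls.flatMap fun l => l.gates ρ := by
  simp only [CircuitDesc.toCircuit, List.map_map, List.flatMap, LayerTmpl.gates, LayerTmpl.desc,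
    Function.comp_def]

/-- The gates of a layer are unitary one- and two-qubit gates on disjoint qubits. -/
def LayerTmpl.Ok (l : LayerTmpl) (q : ℕ) (ρ : ℕ → ℕ) : Prop :=
  (∀ j < l.count.eval ρ, (l.gate.desc (l.env ρ j)).toGate.arity ≤ 2 ∧
    (l.gate.desc (l.env ρ j)).toGate.IsValid q) ∧
  ∀ j j', j < j' → j' < l.count.eval ρ →
    Disjoint (Set.range (l.gate.desc (l.env ρ j)).toGate.wires)
      (Set.range (l.gate.desc (l.env ρ j')).toGate.wires)

theorem isValid_toCircuit {Ls : List LayerTmpl} {q : ℕ} {ρ : ℕ → ℕ}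
    (h : ∀ l ∈ Ls, l.Ok q ρ) : (CircuitDesc.toCircuit (Ls.map fun l => l.desc ρ)).IsValid q := by
  intro layer hl
  simp only [CircuitDesc.toCircuit, List.map_map, List.mem_map, Function.comp_apply] at hl
  obtain ⟨l, hl, rfl⟩ := hl
  obtain ⟨h1, h2⟩ := h l hl
  rw [LayerTmpl.desc, List.map_map]
  constructor
  · intro g hg
    obtain ⟨j, hj, rfl⟩ := List.mem_map.1 hg
    exact h1 j (List.mem_range.1 hj)
  · rw [List.pairwise_map]
    refine List.Pairwise.imp_of_mem ?_ List.pairwise_lt_range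
    intro j j' _ hj' hlt
    exact h2 j j' hlt (List.mem_range.1 hj')

theorem depth_toCircuit (Ls : List LayerTmpl) (ρ : ℕ → ℕ) :
    (CircuitDesc.toCircuit (Ls.map fun l => l.desc ρ)).depth = Ls.length := by
  simp [CircuitDesc.toCircuit, Circuit.depth]

theorem applyList_flatMap {q : ℕ} {ι : Type*} (js : List ι) (l : ι → List Gate) (G : ι → Gate)
    (h : ∀ j ∈ js, ∀ ψ : QState q, applyList (l j) ψ = (G j).apply ψ) (ψ : QState q) :
    applyList (js.flatMap l) ψ = applyList (js.map G) ψ := by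
  induction js generalizing ψ with
  | nil => rfl
  | cons j js ih =>
    rw [List.flatMap_cons, applyList_append, List.map_cons, applyList_cons, h j (by simp),
      ih fun j' hj' => h j' (by simp [hj'])]

/-! ### Preparation of the poor man's GHZ state -/

/-- A controlled negation. -/
noncomputable def cnotGate (c t : ℕ) : Gate :=
  ⟨2, ![c, t], permMat (cnotPerm (zero_ne_one : (0 : Fin 2) ≠ 1))⟩

theorem vec2_injective {c t : ℕ} (h : c ≠ t) : Function.Injective ![c, t] := by
  intro a b hab
  fin_cases a <;> fin_cases b <;> simp_all

theorem cnotGate_apply {q c t : ℕ} (hct : c ≠ t) (ψ : QState q) (x : Bits q) :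
    (cnotGate c t).apply ψ x =
      ψ fun v => xor (x v) (decide ((v : ℕ) = t) && x.at c) := by
  rw [Gate.apply_eq]
  change ∑ b : Bits 2, permMat (cnotPerm (zero_ne_one : (0 : Fin 2) ≠ 1)) (x.get ![c, t]) b *
    ψ (x.put ![c, t] b) = _
  simp only [permMat, ite_mul, one_mul, zero_mul]
  rw [Finset.sum_eq_single (cnotPerm (zero_ne_one : (0 : Fin 2) ≠ 1) (x.get ![c, t]))]
  · rw [if_pos]
    · congr 1
      funext v
      by_cases h1 : (v : ℕ) = t
      · rw [Bits.put_of_mem (vec2_injective hct) _ _ 1 v (by simpa using h1)]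
        subst h1
        simp [cnotPerm_apply, Bits.get, Bits.at_val, Bool.xor_comm]
      · by_cases h2 : (v : ℕ) = c
        · rw [Bits.put_of_mem (vec2_injective hct) _ _ 0 v (by simpa using h2)]
          subst h2
          simp [cnotPerm_apply, Bits.get, h1, Bits.at_val]
        · rw [Bits.put_of_notMem]
          · simp [h1]
          · simp [Ne.symm h1, Ne.symm h2, eq_comm, h1]
    · rw [← Equiv.Perm.mul_apply]
      nth_rewrite 1 [← cnotPerm_inv]
      simp
  · intro b _ hb
    rw [if_neg]
    intro h
    refine hb ?_
    rw [h, ← Equiv.Perm.mul_apply]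
    nth_rewrite 1 [← cnotPerm_inv]
    simp
  · simp

open Classical in
/-- The negations that a layer of `N` controlled negations, from control qubits `c₀ + j s₁` to
target qubits `t₀ + j s₂`, perform on the string `x`. -/
noncomputable def cnotMap {q : ℕ} (N c₀ s₁ t₀ s₂ : ℕ) (x : Bits q) : Bits q := fun v =>
  xor (x v) (decide (∃ j < N, t₀ + j * s₂ = v ∧ x.at (c₀ + j * s₁) = true))

theorem cnotMap_at_of_le {q N c₀ s₁ t₀ s₂ e : ℕ} (ht : ∀ j < N, t₀ + j * s₂ < e) (x : Bits q)
    {v : ℕ} (hv : e ≤ v) : (cnotMap N c₀ s₁ t₀ s₂ x).at v = x.at v := by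
  unfold Bits.at
  split_ifs with h
  · have : ¬ ∃ j < N, t₀ + j * s₂ = v ∧ x.at (c₀ + j * s₁) = true := by
      rintro ⟨j, hj, h1, -⟩
      have := ht j hj
      omega
    simp [cnotMap, this]
  · rfl

theorem cnotMap_at_of_lt {q N c₀ s₁ t₀ s₂ : ℕ} (x : Bits q) {v : ℕ} (hv : v < q) :
    (cnotMap N c₀ s₁ t₀ s₂ x).at v = xor (x.at v)
      (open Classical in decide (∃ j < N, t₀ + j * s₂ = v ∧ x.at (c₀ + j * s₁) = true)) := by
  rw [Bits.at_of_lt _ hv, Bits.at_of_lt _ hv]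
  rfl

/-- A layer of controlled negations whose control qubits all lie above its target qubits acts by
relabelling the basis states. -/
theorem applyList_cnot {q N c₀ s₁ t₀ s₂ e : ℕ} (ht : ∀ j < N, t₀ + j * s₂ < e)
    (hc : e ≤ c₀) (hinj : ∀ j < N, ∀ j' < N, t₀ + j * s₂ = t₀ + j' * s₂ → j = j') (ψ : QState q) :
    applyList ((List.range N).map fun j => cnotGate (c₀ + j * s₁) (t₀ + j * s₂)) ψ =
      fun x => ψ (cnotMap N c₀ s₁ t₀ s₂ x) := by
  classical
  induction N with
  | zero =>
    funext x
    have : cnotMap 0 c₀ s₁ t₀ s₂ x = x := by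
      funext v
      simp [cnotMap]
    rw [this]
    rfl
  | succ N ih =>
    funext x
    rw [List.range_succ, List.map_append, applyList_append,
      ih (fun j hj => ht j (by omega)) (fun j hj j' hj' => hinj j (by omega) j' (by omega))]
    simp only [List.map_cons, List.map_nil, applyList_cons, applyList_nil]
    have htN := ht N (by omega)
    rw [cnotGate_apply (by omega)]
    congr 1
    funext v
    have hat : ∀ j, Bits.at (fun v : Fin q => xor (x v) (decide ((v : ℕ) = t₀ + N * s₂) &&
        x.at (c₀ + N * s₁))) (c₀ + j * s₁) = x.at (c₀ + j * s₁) := fun j => by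
      unfold Bits.at
      split_ifs with h1 h2
      · have : c₀ + j * s₁ ≠ t₀ + N * s₂ := by omega
        simp [this]
      all_goals first | rfl | (have : c₀ + j * s₁ ≠ t₀ + N * s₂ := by omega); simp [this]
    simp only [cnotMap, hat]
    by_cases hv : (v : ℕ) = t₀ + N * s₂
    · have h1 : ¬ ∃ j < N, t₀ + j * s₂ = v ∧ x.at (c₀ + j * s₁) = true := by
        rintro ⟨j, hj, h1, -⟩
        have := hinj j (by omega) N (by omega) (by omega)
        omega
      have h2 : (∃ j < N + 1, t₀ + j * s₂ = v ∧ x.at (c₀ + j * s₁) = true) ↔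
          x.at (c₀ + N * s₁) = true := by
        constructor
        · rintro ⟨j, hj, h2, h3⟩
          rwa [← hinj j hj N (by omega) (by omega)]
        · intro h
          exact ⟨N, by omega, hv.symm, h⟩
      simp only [h1, h2]
      simp [hv]
    · have h2 : (∃ j < N + 1, t₀ + j * s₂ = v ∧ x.at (c₀ + j * s₁) = true) ↔
          ∃ j < N, t₀ + j * s₂ = v ∧ x.at (c₀ + j * s₁) = true := by
        constructor
        · rintro ⟨j, hj, h2, h3⟩
          refine ⟨j, ?_, h2, h3⟩
          rcases Nat.lt_succ_iff_lt_or_eq.1 hj with h4 | h4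
          · exact h4
          · exact absurd (by rw [← h2, h4]) hv
        · rintro ⟨j, hj, h⟩
          exact ⟨j, by omega, h⟩
      simp only [h2]
      simp [hv]

/-- The bit at a node of the tree. -/
def nodeBit {q : ℕ} (n : ℕ) (x : Bits q) (j : ℕ) : Bool :=
  if j = 0 then x.at (2 * n - 2) else x.at (n - 2 + j)

/-- The vertex bits are the shifted path parities exactly if every edge bit is the sum of the bits
at the two ends of the edge. -/
theorem bpm_condition_iff {n : ℕ} (hn : 1 < n) (z : Bits (2 * n - 1)) :
    (∀ i < n - 1, z.at (n - 1 + i) = xor (pathSum z.at (i + 1)) (z.at (2 * n - 2))) ↔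
      ∀ t < n - 1, z.at t = xor (nodeBit n z (t + 1)) (nodeBit n z (t / 2)) := by
  have hnode : ∀ i, nodeBit n z (i + 1) = z.at (n - 1 + i) := fun i => by
    rw [nodeBit, if_neg (by omega)]
    congr 1
    omega
  have hroot : nodeBit n z 0 = z.at (2 * n - 2) := rfl
  constructor
  · intro h
    have h1 : ∀ j < n, nodeBit n z j = xor (pathSum z.at j) (z.at (2 * n - 2)) := by
      intro j hj
      rcases j with _ | j
      · simp [hroot, pathSum]
      · rw [hnode, h j (by omega)]
    intro t ht
    rw [h1 _ (by omega), h1 _ (by omega), pathSum]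
    generalize pathSum z.at (t / 2) = a
    generalize z.at (2 * n - 2) = b
    generalize z.at t = c
    cases a <;> cases b <;> cases c <;> rfl
  · intro h i
    induction i using Nat.strong_induction_on with
    | _ i ih =>
      intro hi
      have h2 := h i hi
      have h3 : nodeBit n z (i / 2) = xor (pathSum z.at (i / 2)) (z.at (2 * n - 2)) := by
        rcases h4 : i / 2 with _ | j
        · simp [hroot, pathSum]
        · rw [hnode, ih j (by omega) (by omega)]
      rw [h3, hnode] at h2
      rw [pathSum, h2]
      generalize pathSum z.at (i / 2) = a
      generalize z.at (2 * n - 2) = b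
      generalize z.at (n - 1 + i) = c
      cases a <;> cases b <;> cases c <;> rfl

theorem zeroState_eq (q : ℕ) : zeroState q = prodVec q fun _ b => if b then 0 else 1 := by
  funext x
  rw [zeroState, prodVec]
  by_cases h : x = fun _ => false
  · subst h
    simp
  · rw [Pi.single_eq_of_ne h, eq_comm, Finset.prod_eq_zero_iff]
    by_contra! h2
    refine h (funext fun v => ?_)
    have := h2 v (Finset.mem_univ v)
    simpa using this

/-- Factors of the state after the first layer of Hadamard gates. -/
noncomputable def plusFactor (n v : ℕ) (b : Bool) : ℂ :=
  if n - 1 ≤ v ∧ v < 2 * n - 1 then 1 / (Real.sqrt 2 : ℂ) else if b then 0 else 1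

/-- The hypothesis of `applyList_prodVec` for one-qubit gates. -/
theorem gate1_prodVec_condition (w : ℕ) (U : Bool → Bool → ℂ) (f f' : ℕ → Bool → ℂ)
    (h : ∀ b, ∑ c, U b c * f w c = f' w b) (y : Bits 1) :
    ∑ b, (gate1 w U).mat y b * ∏ j, f ((gate1 w U).wires j) (b j) =
      ∏ j, f' ((gate1 w U).wires j) (y j) := by
  change ∑ b : Bits 1, U (y 0) (b 0) * ∏ j : Fin 1, f w (b j) = ∏ j : Fin 1, f' w (y j)
  rw [← (Equiv.funUnique (Fin 1) Bool).symm.sum_comp]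
  simpa using h (y 0)

theorem gate1_injective (w : ℕ) (U : Bool → Bool → ℂ) : Function.Injective (gate1 w U).wires :=
  fun i j _ => by
    have : Subsingleton (Fin (gate1 w U).arity) := inferInstanceAs (Subsingleton (Fin 1))
    exact Subsingleton.elim i j

theorem gate1_wires_lt {w q : ℕ} {U : Bool → Bool → ℂ} (h : w < q) :
    ∀ j, (gate1 w U).wires j < q := fun _ => h

theorem range_gate1 (w : ℕ) (U : Bool → Bool → ℂ) : Set.range (gate1 w U).wires = {w} := by
  have : Nonempty (Fin (gate1 w U).arity) := inferInstanceAs (Nonempty (Fin 1))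
  exact Set.range_const

/-- The Hadamard gates on all vertex qubits. -/
noncomputable def hadamardLayer (n : ℕ) : List Gate :=
  (List.range n).map fun i => gate1 (n - 1 + i) hadamard

theorem hadamardLayer_pairwise (n : ℕ) : (hadamardLayer n).Pairwise fun g g' =>
    Disjoint (Set.range g.wires) (Set.range g'.wires) := by
  rw [hadamardLayer, List.pairwise_map]
  refine List.pairwise_lt_range.imp fun {i j} h => ?_
  rw [range_gate1, range_gate1, Set.disjoint_singleton]
  omega

theorem hadamardLayer_zero (n : ℕ) (hn : 0 < n) :
    applyList (hadamardLayer n) (zeroState (2 * n - 1)) = prodVec (2 * n - 1) (plusFactor n) := by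
  rw [zeroState_eq]
  refine applyList_prodVec _ _ _ (hadamardLayer_pairwise n) ?_ ?_ ?_
  · intro g hg
    obtain ⟨i, hi, rfl⟩ := List.mem_map.1 hg
    have := List.mem_range.1 hi
    exact ⟨gate1_injective _ _, gate1_wires_lt (by omega)⟩
  · intro g hg
    obtain ⟨i, hi, rfl⟩ := List.mem_map.1 hg
    have := List.mem_range.1 hi
    refine gate1_prodVec_condition (n - 1 + i) hadamard (fun _ b => if b then 0 else 1)
      (plusFactor n) fun b => ?_
    rw [plusFactor, if_pos ⟨by omega, by omega⟩]
    simp [hadamard]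
  · intro v hv
    funext b
    rw [plusFactor]
    by_cases h : n - 1 ≤ v ∧ v < 2 * n - 1
    · refine absurd ?_ (hv (gate1 (n - 1 + (v - (n - 1))) hadamard) ?_)
      · rw [range_gate1, Set.mem_singleton_iff]
        omega
      · exact List.mem_map.2 ⟨v - (n - 1), List.mem_range.2 (by omega), rfl⟩
    · rw [if_neg h]

end ShallowLearning
end

section
open scoped Matrix
namespace ShallowLearning

theorem cnotMap_at_eq {q N c₀ s₁ t₀ s₂ : ℕ} (x : Bits q) {v : ℕ} (hv : v < q) (j : ℕ) (hj : j < N)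
    (hjv : t₀ + j * s₂ = v) (hinj : ∀ j' < N, t₀ + j' * s₂ = v → j' = j) :
    (cnotMap N c₀ s₁ t₀ s₂ x).at v = xor (x.at v) (x.at (c₀ + j * s₁)) := by
  classical
  rw [cnotMap_at_of_lt x hv]
  congr 1
  have h2 : (∃ j < N, t₀ + j * s₂ = v ∧ x.at (c₀ + j * s₁) = true) ↔
      x.at (c₀ + j * s₁) = true :=
    ⟨fun ⟨j', hj', h, h3⟩ => by rwa [← hinj j' hj' h], fun h => ⟨j, hj, hjv, h⟩⟩
  simp [h2]

theorem cnotMap_at_eq_self {q N c₀ s₁ t₀ s₂ : ℕ} (x : Bits q) {v : ℕ} (hv : v < q)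
    (h : ∀ j < N, t₀ + j * s₂ ≠ v) :
    (cnotMap N c₀ s₁ t₀ s₂ x).at v = x.at v := by
  classical
  rw [cnotMap_at_of_lt x hv]
  have h2 : ¬ (∃ j < N, t₀ + j * s₂ = v ∧ x.at (c₀ + j * s₁) = true) :=
    fun ⟨j', hj', h3, _⟩ => h j' hj' h3
  simp [h2]

theorem prodVec_plusFactor {n : ℕ} (hn : 0 < n) (x : Bits (2 * n - 1)) :
    prodVec (2 * n - 1) (plusFactor n) x =
      open Classical in
      if ∀ t < n - 1, x.at t = false then (1 / (Real.sqrt 2 : ℂ)) ^ n else 0 := by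
  classical
  have h1 : prodVec (2 * n - 1) (plusFactor n) x =
      ∏ v ∈ Finset.range ((n - 1) + n), plusFactor n v (x.at v) := by
    rw [show (n - 1) + n = 2 * n - 1 by omega, ← Fin.prod_univ_eq_prod_range
      (fun v => plusFactor n v (x.at v))]
    simp only [prodVec, Bits.at_val]
  rw [h1, Finset.prod_range_add]
  have h2 : ∏ i ∈ Finset.range n, plusFactor n (n - 1 + i) (x.at (n - 1 + i)) =
      (1 / (Real.sqrt 2 : ℂ)) ^ n := by
    rw [Finset.prod_congr rfl fun i hi => ?_, Finset.prod_const, Finset.card_range]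
    have := Finset.mem_range.1 hi
    rw [plusFactor, if_pos ⟨by omega, by omega⟩]
  rw [h2]
  split_ifs with h
  · rw [Finset.prod_eq_one, one_mul]
    intro v hv
    have hv' := Finset.mem_range.1 hv
    rw [plusFactor, if_neg (by omega), h v hv']
    simp
  · push Not at h
    obtain ⟨t, ht, hx⟩ := h
    rw [Finset.prod_eq_zero (Finset.mem_range.2 ht), zero_mul]
    rw [plusFactor, if_neg (by omega)]
    simpa using hx

/-- The layers of controlled negations which add to every edge bit the bits at its two ends: first
the child (for all edges at once), then the root (for the two edges at the root, one after the
other), then the other parents, separately for the edges to left and to right children. -/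
noncomputable def treeLayers (n : ℕ) : List Gate :=
  ((List.range (n - 1)).map fun j => cnotGate (n - 1 + j * 1) (0 + j * 1)) ++
  ((List.range 1).map fun j => cnotGate (2 * n - 2 + j * 1) (0 + j * 1)) ++
  ((List.range 1).map fun j => cnotGate (2 * n - 2 + j * 1) (1 + j * 1)) ++
  ((List.range ((n - 2) / 2)).map fun j => cnotGate (n - 1 + j * 1) (2 + j * 2)) ++
  (List.range ((n - 3) / 2)).map fun j => cnotGate (n - 1 + j * 1) (3 + j * 2)

/-- After the Hadamard gates the vertex bits are uniformly random and the edge bits vanish; the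
controlled negations then compute the edge bits from the vertex bits. -/
theorem treeLayers_apply {n : ℕ} (hn : 3 ≤ n) :
    applyList (treeLayers n) (applyList (hadamardLayer n) (zeroState (2 * n - 1))) =
      bpmState n := by
  rw [hadamardLayer_zero n (by omega), treeLayers]
  simp only [applyList_append]
  rw [applyList_cnot (e := n - 1) (by omega) (by omega) (by omega),
    applyList_cnot (e := n - 1) (by omega) (by omega) (by omega),
    applyList_cnot (e := n - 1) (by omega) (by omega) (by omega),
    applyList_cnot (e := n - 1) (by omega) (by omega) (by omega),
    applyList_cnot (e := n - 1) (by omega) (by omega) (by omega)]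
  funext x
  simp only
  -- the amplitude at `x` is that of the string `x1` from which the negations lead to `x`
  set x5 := cnotMap ((n - 3) / 2) (n - 1) 1 3 2 x with h5
  set x4 := cnotMap ((n - 2) / 2) (n - 1) 1 2 2 x5 with h4
  set x3 := cnotMap 1 (2 * n - 2) 1 1 1 x4 with h3
  set x2 := cnotMap 1 (2 * n - 2) 1 0 1 x3 with h2
  set x1 := cnotMap (n - 1) (n - 1) 1 0 1 x2 with h1
  have c5 : ∀ v, n - 1 ≤ v → x5.at v = x.at v := fun v hv =>
    cnotMap_at_of_le (by omega) x hv
  have c4 : ∀ v, n - 1 ≤ v → x4.at v = x.at v := fun v hv =>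
    (cnotMap_at_of_le (by omega) x5 hv).trans (c5 v hv)
  have c3 : ∀ v, n - 1 ≤ v → x3.at v = x.at v := fun v hv =>
    (cnotMap_at_of_le (e := n - 1) (by omega) x4 hv).trans (c4 v hv)
  have c2 : ∀ v, n - 1 ≤ v → x2.at v = x.at v := fun v hv =>
    (cnotMap_at_of_le (e := n - 1) (by omega) x3 hv).trans (c3 v hv)
  have key : ∀ t < n - 1, x1.at t = xor (x.at t) (xor (nodeBit n x (t + 1)) (nodeBit n x
      (t / 2))) := by
    intro t ht
    have e1 : x1.at t = xor (x2.at t) (nodeBit n x (t + 1)) := by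
      rw [h1, cnotMap_at_eq x2 (by omega) t ht (by omega) (by omega), c2 (n - 1 + t * 1)
          (by omega), nodeBit,
        if_neg (by omega)]
      congr 2
      omega
    have e2 : x2.at t = xor (x.at t) (nodeBit n x (t / 2)) := by
      rcases Nat.lt_or_ge t 1 with h0 | h0
      · rw [h2, cnotMap_at_eq x3 (by omega) 0 (by omega) (by omega) (by omega), c3 (2 *
          n - 2 + 0 * 1) (by omega), h3,
          cnotMap_at_eq_self _ (by omega) (by omega), h4,
          cnotMap_at_eq_self _ (by omega) (by omega), h5,
          cnotMap_at_eq_self _ (by omega) (by omega), nodeBit, if_pos (by omega)]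
        rfl
      rw [h2, cnotMap_at_eq_self _ (by omega) (by omega)]
      rcases Nat.lt_or_ge t 2 with h6 | h6
      · rw [h3, cnotMap_at_eq x4 (by omega) 0 (by omega) (by omega) (by omega), c4 (2 *
          n - 2 + 0 * 1) (by omega), h4,
          cnotMap_at_eq_self _ (by omega) (by omega), h5,
          cnotMap_at_eq_self _ (by omega) (by omega), nodeBit, if_pos (by omega)]
        rfl
      rw [h3, cnotMap_at_eq_self _ (by omega) (by omega), nodeBit, if_neg (by omega)]
      rcases Nat.mod_two_eq_zero_or_one t with h7 | h7
      · rw [h4, cnotMap_at_eq x5 (by omega) (t / 2 - 1) (by omega) (by omega) (by omega),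
          c5 (n - 1 + (t / 2 - 1) * 1) (by omega), h5, cnotMap_at_eq_self _ (by omega) (by omega)]
        congr 2
        omega
      · rw [h4, cnotMap_at_eq_self _ (by omega) (by omega), h5,
          cnotMap_at_eq x (by omega) (t / 2 - 1) (by omega) (by omega) (by omega)]
        congr 2
        omega
    rw [e1, e2]
    generalize x.at t = a
    generalize nodeBit n x (t / 2) = b
    generalize nodeBit n x (t + 1) = c
    cases a <;> cases b <;> cases c <;> rfl
  rw [prodVec_plusFactor (by omega), bpmState]
  have hiff : (∀ t < n - 1, x1.at t = false) ↔
      ∀ i < n - 1, x.at (n - 1 + i) = xor (pathSum x.at (i + 1)) (x.at (2 * n - 2)) := by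
    rw [bpm_condition_iff (by omega)]
    refine forall_congr' fun t => forall_congr' fun ht => ?_
    rw [key t ht]
    generalize x.at t = a
    generalize nodeBit n x (t / 2) = b
    generalize nodeBit n x (t + 1) = c
    cases a <;> cases b <;> cases c <;> simp
  have hpow : (1 / (Real.sqrt 2 : ℂ)) ^ (n - 1) * (1 / (Real.sqrt 2 : ℂ)) =
      (1 / (Real.sqrt 2 : ℂ)) ^ n := by
    rw [← pow_succ]
    congr 1
    omega
  rw [hpow]
  exact if_congr hiff rfl rfl

/-! ### The circuit as a list of layer templates -/

/-- The register contents from which the description of the circuit is written: `s` in register `9`,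
the index of the root qubit in `21`, the number of blocks before the last one in `22`, the first
qubit of the last block in `23`, and the numbers of edges below the root's children that lead to
left and to right children in `24` and `25`. -/
structure Setup (m n p s : ℕ) (ρ : ℕ → ℕ) : Prop where
  hm : 1 ≤ m
  hn : 4 ≤ n
  hmn : m ≤ n - 1
  hp : 3 ≤ p
  r0 : ρ 0 = n
  r1 : ρ 1 = p
  r4 : ρ 4 = n - 1
  r9 : ρ 9 = s
  r21 : ρ 21 = 2 * n - 2
  r22 : ρ 22 = (n - 1) / m - 1
  r23 : ρ 23 = n - 1 + ((n - 1) / m - 1) * m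
  r24 : ρ 24 = (n - 2) / 2
  r25 : ρ 25 = (n - 3) / 2

theorem LayerTmpl.env_of_lt (l : LayerTmpl) (ρ : ℕ → ℕ) (j : ℕ) {r : ℕ} (hr : r < 41) :
    l.env ρ j r = ρ r := by
  rw [env, Function.update_of_ne (by omega), Function.update_of_ne (by omega)]

theorem LayerTmpl.env_41 (l : LayerTmpl) (ρ : ℕ → ℕ) (j : ℕ) :
    l.env ρ j 41 = l.w₁.eval ρ + j * l.s₁ := by
  rw [env, Function.update_of_ne (by omega), Function.update_self]

theorem LayerTmpl.env_42 (l : LayerTmpl) (ρ : ℕ → ℕ) (j : ℕ) :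
    l.env ρ j 42 = l.w₂.eval ρ + j * l.s₂ := by
  rw [env, Function.update_self]

theorem gates_eq {l : LayerTmpl} {ρ : ℕ → ℕ} (hρ : 3 ≤ ρ 1) {G : Env → Gate}
    (hG : ∀ ρ : Env, (l.gate.desc ρ).toGate = G ρ) (j : ℕ) :
    (l.gate.desc (l.env ρ j)).toGate =
      G ⟨l.env ρ j, by rw [l.env_of_lt ρ j (by norm_num)]; exact hρ⟩ :=
  hG ⟨l.env ρ j, by rw [l.env_of_lt ρ j (by norm_num)]; exact hρ⟩

theorem hadamard_cf (y x : Bool) : CFC fun _ => hadamard y x := by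
  unfold hadamard
  refine CFC.div ?_ ?_
  · cases y <;> cases x <;> simp [CFC.one, CFC.one.neg]
  · have := CFC.ofReal (CF.nat 2).sqrt
    simpa using this

theorem exists_hadamardTmpl : ∃ g : GateTmpl, ∀ ρ : Env,
    (g.desc ρ).toGate = gate1 (ρ.1 41) hadamard :=
  exists_tmpl_one (.reg 41 0) (fun y x _ => hadamard y x) hadamard_cf

theorem exists_cnotTmpl : ∃ g : GateTmpl, ∀ ρ : Env,
    (g.desc ρ).toGate = cnotGate (ρ.1 41) (ρ.1 42) :=
  exists_tmpl_two (.reg 41 0) (.reg 42 0)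
    (fun y x _ => permMat (cnotPerm (zero_ne_one : (0 : Fin 2) ≠ 1)) y x) fun _ _ => CFC.ite_one _

/-- Rotation angle of the root qubit. -/
noncomputable def rootAngle (p s : ℕ) : ℝ := -(Real.pi / 4 - Real.pi * s / p)

theorem rootAngle_cf (y x : Bool) :
    CFC fun ρ => expX (rootAngle (ρ.1 1) (ρ.1 9)) y x := by
  have hc : CF fun ρ => Real.cos (rootAngle (ρ.1 1) (ρ.1 9)) := by
    have h1 := (CF.half.mul (CF.cosPi (.reg 9 0) (.reg 1 0))).add
      (CF.half.mul (CF.sinPi (.reg 9 0) (.reg 1 0)))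
    convert h1 using 2 with ρ
    rw [rootAngle, Real.cos_neg, Real.cos_sub, Real.cos_pi_div_four, Real.sin_pi_div_four,
      sqrt_half_eq]
    rfl
  have hs : CF fun ρ => Real.sin (rootAngle (ρ.1 1) (ρ.1 9)) := by
    have h1 := (CF.half.mul (CF.sinPi (.reg 9 0) (.reg 1 0))).sub
      (CF.half.mul (CF.cosPi (.reg 9 0) (.reg 1 0)))
    convert h1 using 2 with ρ
    rw [rootAngle, neg_sub, Real.sin_sub, Real.cos_pi_div_four, Real.sin_pi_div_four,
      sqrt_half_eq, mul_comm (√2 / 2), mul_comm (√2 / 2)]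
    rfl
  unfold expX
  exact CFC.ite _ (CFC.ofReal hc) (CFC.I.mul (CFC.ofReal hs))

theorem exists_rootTmpl : ∃ g : GateTmpl, ∀ ρ : Env,
    (g.desc ρ).toGate = gate1 (ρ.1 41) (expX (rootAngle (ρ.1 1) (ρ.1 9))) :=
  exists_tmpl_one (.reg 41 0) (fun y x ρ => expX (rootAngle (ρ.1 1) (ρ.1 9)) y x) rootAngle_cf

/-- The Hadamard gate as a one-qubit matrix. -/
noncomputable def hadamardMat : Matrix (Bits 1) (Bits 1) ℂ := fun y x => hadamard (y 0) (x 0)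

theorem hadamardMat_mem : hadamardMat ∈ Matrix.unitaryGroup (Bits 1) ℂ := by
  have h2 : (Real.sqrt 2 : ℂ) * (Real.sqrt 2 : ℂ) = 2 := by
    rw [← Complex.ofReal_mul, Real.mul_self_sqrt (by norm_num)]
    norm_num
  have h0 : (Real.sqrt 2 : ℂ) ≠ 0 := fun h => by rw [h] at h2; norm_num at h2
  refine Matrix.mem_unitaryGroup_iff.2 ?_
  ext y x
  rw [Matrix.mul_apply, ← (Equiv.funUnique (Fin 1) Bool).symm.sum_comp, Fintype.sum_bool,
    Matrix.one_apply]
  have hyx : y = x ↔ y 0 = x 0 := ⟨fun h => by rw [h], fun h => funext fun j => by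
    rw [Subsingleton.elim j 0, h]⟩
  simp only [Matrix.star_apply, Equiv.funUnique_symm_apply, hyx, uniqueElim_const, hadamardMat,
      hadamard]
  generalize y 0 = a
  generalize x 0 = b
  cases a <;> cases b <;> simp <;> field_simp <;>
    first | ring1 | linear_combination -h2

theorem hadamard_isValid {w q : ℕ} (h : w < q) : (gate1 w hadamard).IsValid q :=
  ⟨gate1_injective _ _, gate1_wires_lt h, hadamardMat_mem⟩

theorem expX_isValid {w q : ℕ} (h : w < q) (φ : ℝ) : (gate1 w (expX φ)).IsValid q :=
  ⟨gate1_injective _ _, gate1_wires_lt h, expMat_mem φ⟩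

theorem cnotGate_isValid {c t q : ℕ} (hct : c ≠ t) (hc : c < q) (ht : t < q) :
    (cnotGate c t).IsValid q := by
  refine ⟨vec2_injective hct, fun j => ?_, permMat_mem _⟩
  change (![c, t] : Fin 2 → ℕ) j < q
  have key : ∀ j : Fin 2, (![c, t] : Fin 2 → ℕ) j < q := fun j => by
    fin_cases j
    exacts [hc, ht]
  exact key j

theorem range_cnotGate (c t : ℕ) : Set.range (cnotGate c t).wires = {c, t} := by
  change Set.range (![c, t] : Fin 2 → ℕ) = {c, t}
  simp [Set.pair_comm]

theorem exists_hadamardLayer : ∃ l : LayerTmpl, ∀ {m n p s : ℕ} {ρ : ℕ → ℕ}, Setup m n p s ρ →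
    l.Ok (2 * n - 1) ρ ∧ l.gates ρ = hadamardLayer n := by
  obtain ⟨g, hg⟩ := exists_hadamardTmpl
  let l : LayerTmpl := ⟨.reg 0 0, .reg 4 0, .const 0, 1, 0, g⟩
  refine ⟨l, fun {m n p s ρ} h => ?_⟩
  have hn := h.hn
  have hgate : ∀ j, (l.gate.desc (l.env ρ j)).toGate = gate1 (n - 1 + j) hadamard := fun j => by
    rw [gates_eq (l := l) (h.r1 ▸ h.hp) hg j]
    simp only [l, LayerTmpl.env_41, Tok.eval, h.r4, add_zero, mul_one]
  have hc : l.count.eval ρ = n := by simp [l, Tok.eval, h.r0]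
  refine ⟨⟨fun j hj => ?_, fun j j' hjj hj' => ?_⟩, ?_⟩
  · rw [hc] at hj
    rw [hgate j]
    exact ⟨by simp [gate1], hadamard_isValid (by omega)⟩
  · rw [hgate, hgate, range_gate1, range_gate1, Set.disjoint_singleton]
    omega
  · rw [LayerTmpl.gates, hadamardLayer]
    rw [hc]
    exact List.map_congr_left fun j _ => hgate j

theorem exists_rootLayer : ∃ l : LayerTmpl, ∀ {m n p s : ℕ} {ρ : ℕ → ℕ}, Setup m n p s ρ →
    l.Ok (2 * n - 1) ρ ∧ l.gates ρ = [gate1 (2 * n - 2) (expX (rootAngle p s))] := by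
  obtain ⟨g, hg⟩ := exists_rootTmpl
  let l : LayerTmpl := ⟨.const 1, .reg 21 0, .const 0, 0, 0, g⟩
  refine ⟨l, fun {m n p s ρ} h => ?_⟩
  have hn := h.hn
  have hgate : ∀ j, (l.gate.desc (l.env ρ j)).toGate =
      gate1 (2 * n - 2) (expX (rootAngle p s)) := fun j => by
    rw [gates_eq (l := l) (h.r1 ▸ h.hp) hg j]
    simp only [l, LayerTmpl.env_41, Tok.eval, h.r21, add_zero, mul_zero]
    rw [LayerTmpl.env_of_lt _ _ _ (by norm_num), LayerTmpl.env_of_lt _ _ _ (by norm_num), h.r1,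
      h.r9]
  refine ⟨⟨fun j hj => ?_, fun j j' hjj hj' => ?_⟩, ?_⟩
  · rw [hgate j]
    exact ⟨by simp [gate1], expX_isValid (by omega) _⟩
  · simp only [l, Tok.eval] at hj'
    omega
  · rw [LayerTmpl.gates]
    have hc : l.count.eval ρ = 1 := rfl
    rw [hc]
    simp only [List.range_one, List.map_cons, List.map_nil, hgate]

/-- A layer of controlled negations, with the control qubits and the target qubits in arithmetic
progressions. -/
theorem exists_cnotLayer (N c₀ t₀ : Tok) (s₁ s₂ : ℕ) :
    ∃ l : LayerTmpl, ∀ {m n p s : ℕ} {ρ : ℕ → ℕ}, Setup m n p s ρ →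
    (∀ j < N.eval ρ, n - 1 ≤ c₀.eval ρ + j * s₁ ∧ c₀.eval ρ + j * s₁ < 2 * n - 1 ∧
      t₀.eval ρ + j * s₂ < n - 1) →
    (∀ j j', j < j' → j' < N.eval ρ → c₀.eval ρ + j * s₁ ≠ c₀.eval ρ + j' * s₁ ∧
      t₀.eval ρ + j * s₂ ≠ t₀.eval ρ + j' * s₂) →
    l.Ok (2 * n - 1) ρ ∧ l.gates ρ = (List.range (N.eval ρ)).map fun j =>
      cnotGate (c₀.eval ρ + j * s₁) (t₀.eval ρ + j * s₂) := by
  obtain ⟨g, hg⟩ := exists_cnotTmpl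
  let l : LayerTmpl := ⟨N, c₀, t₀, s₁, s₂, g⟩
  refine ⟨l, fun {m n p s ρ} h hb hd => ?_⟩
  have hgate : ∀ j, (l.gate.desc (l.env ρ j)).toGate =
      cnotGate (c₀.eval ρ + j * s₁) (t₀.eval ρ + j * s₂) := fun j => by
    rw [gates_eq (l := l) (h.r1 ▸ h.hp) hg j]
    simp only [l, LayerTmpl.env_41, LayerTmpl.env_42]
  refine ⟨⟨fun j hj => ?_, fun j j' hjj hj' => ?_⟩, ?_⟩
  · rw [hgate j]
    obtain ⟨h1, h2, h3⟩ := hb j hj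
    exact ⟨by simp [cnotGate], cnotGate_isValid (by omega) (by omega) (by omega)⟩
  · rw [hgate, hgate, range_cnotGate, range_cnotGate]
    change j' < N.eval ρ at hj'
    obtain ⟨h1, h2, h3⟩ := hb j (by omega)
    obtain ⟨h1', h2', h3'⟩ := hb j' hj'
    have := hd j j' hjj hj'
    simp only [Set.disjoint_insert_left, Set.disjoint_singleton_left, Set.mem_insert_iff,
      Set.mem_singleton_iff]
    omega
  · rw [LayerTmpl.gates]
    exact List.map_congr_left fun j _ => hgate j

theorem exists_treeLayers : ∃ Ls : List LayerTmpl, ∀ {m n p s : ℕ} {ρ : ℕ → ℕ}, Setup m n p s ρ →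
    (∀ l ∈ Ls, l.Ok (2 * n - 1) ρ) ∧ (Ls.flatMap fun l => l.gates ρ) = treeLayers n := by
  -- from all children, from the root twice, and from the parents of left and of right children
  obtain ⟨l1, h1⟩ := exists_cnotLayer (.reg 4 0) (.reg 4 0) (.const 0) 1 1
  obtain ⟨l2, h2⟩ := exists_cnotLayer (.const 1) (.reg 21 0) (.const 0) 1 1
  obtain ⟨l3, h3⟩ := exists_cnotLayer (.const 1) (.reg 21 0) (.const 1) 1 1
  obtain ⟨l4, h4⟩ := exists_cnotLayer (.reg 24 0) (.reg 4 0) (.const 2) 1 2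
  obtain ⟨l5, h5⟩ := exists_cnotLayer (.reg 25 0) (.reg 4 0) (.const 3) 1 2
  refine ⟨[l1, l2, l3, l4, l5], fun {m n p s ρ} h => ?_⟩
  have hn := h.hn
  simp only [Tok.eval, add_zero] at h1 h2 h3 h4 h5
  obtain ⟨o1, g1⟩ := h1 h (by rw [h.r4]; omega) (by rw [h.r4]; omega)
  obtain ⟨o2, g2⟩ := h2 h (by rw [h.r21]; omega) (by rw [h.r21]; omega)
  obtain ⟨o3, g3⟩ := h3 h (by rw [h.r21]; omega) (by rw [h.r21]; omega)
  obtain ⟨o4, g4⟩ := h4 h (by rw [h.r4, h.r24]; omega) (by rw [h.r4, h.r24]; omega)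
  obtain ⟨o5, g5⟩ := h5 h (by rw [h.r4, h.r25]; omega) (by rw [h.r4, h.r25]; omega)
  rw [h.r4] at g1
  rw [h.r21] at g2 g3
  rw [h.r4, h.r24] at g4
  rw [h.r4, h.r25] at g5
  refine ⟨fun l hl => ?_, ?_⟩
  · simp only [List.mem_cons, List.not_mem_nil, or_false] at hl
    rcases hl with rfl | rfl | rfl | rfl | rfl <;> assumption
  · simp only [List.flatMap_cons, List.flatMap_nil, g1, g2, g3, g4, g5, treeLayers,
      List.append_assoc, List.append_nil]

/-- The gates `M k` on all blocks, as layers of templates: the equal blocks in parallel, the last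
block on its own. -/
theorem exists_blockLayers {m r : ℕ} {M : (k : ℕ) → ℕ → Matrix (Bits k) (Bits k) ℂ}
    (hM : ∀ k, m ≤ k → Realizable k fun ρ => M k (ρ.1 1)) :
    ∃ Ls : List LayerTmpl, ∀ {n p s : ℕ} {ρ : ℕ → ℕ}, Setup m n p s ρ →
    n - 1 - ((n - 1) / m - 1) * m = m + r →
    (∀ l ∈ Ls, l.Ok (2 * n - 1) ρ) ∧ ∀ ψ : QState (2 * n - 1),
      applyList (Ls.flatMap fun l => l.gates ρ) ψ =
        applyList ((blocks n m).map fun b => ⟨b.2, fun j => n - 1 + b.1 + j, M b.2 p⟩) ψ := by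
  obtain ⟨L, hL⟩ := hM m le_rfl
  obtain ⟨L', hL'⟩ := hM (m + r) (by omega)
  set T : GateTmpl → LayerTmpl := fun g => ⟨.reg 22 0, .reg 4 0, .const 0, m, 0, g⟩ with hT
  set T' : GateTmpl → LayerTmpl := fun g => ⟨.const 1, .reg 23 0, .const 0, 0, 0, g⟩ with hT'
  refine ⟨L.map T ++ L'.map T', fun {n p s ρ} h hr => ?_⟩
  have hn := h.hn
  have hmn := h.hmn
  have hm := h.hm
  have hq1 : 1 ≤ (n - 1) / m := (Nat.one_le_div_iff (by omega)).2 hmn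
  have hqm : (n - 1) / m * m ≤ n - 1 := Nat.div_mul_le_self _ _
  set q := (n - 1) / m - 1 with hq
  have hqq : (n - 1) / m = q + 1 := by omega
  have hqm' : q * m + m ≤ n - 1 := by rw [hqq, Nat.succ_mul] at hqm; exact hqm
  have hbase : ∀ {j}, j < q → j * m + m ≤ q * m := fun {j} hj => by
    rw [← Nat.succ_mul]
    exact Nat.mul_le_mul_right m hj
  -- the register contents seen by the gates
  set E : ℕ → ℕ → ℕ := fun j => Function.update (Function.update ρ 41 (n - 1 + j * m)) 42 0 with hEd
  have henv : ∀ g j, (T g).env ρ j = E j := fun g j => by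
    simp [hT, hEd, LayerTmpl.env, Tok.eval, h.r4]
  have henv' : ∀ g, (T' g).env ρ 0 = E q := fun g => by
    simp [hT', hEd, LayerTmpl.env, Tok.eval, h.r23, hq]
  have hE1 : ∀ j, E j 1 = p := fun j => by simp [hEd, h.r1]
  have hE : ∀ j, 3 ≤ E j 1 := fun j => by rw [hE1]; exact h.hp
  have h41 : ∀ j, E j 41 = n - 1 + j * m := fun j => by simp [hEd]
  have hcount : ∀ g, (T g).count.eval ρ = q := fun g => by simp [hT, Tok.eval, h.r22, hq]
  have hcount' : ∀ g, (T' g).count.eval ρ = 1 := fun g => by simp [hT', Tok.eval]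
  have hgate : ∀ g ∈ L, ∀ j, (g.desc (E j)).toGate.arity ≤ 2 ∧
      Function.Injective (g.desc (E j)).toGate.wires ∧
      (∀ i, n - 1 + j * m ≤ (g.desc (E j)).toGate.wires i ∧
        (g.desc (E j)).toGate.wires i < n - 1 + j * m + m) ∧
      (g.desc (E j)).toGate.mat ∈ Matrix.unitaryGroup _ ℂ := fun g hg j => by
    have := (hL ⟨E j, hE j⟩).1 g hg
    simp only [h41] at this
    exact this
  have hgate' : ∀ g ∈ L', (g.desc (E q)).toGate.arity ≤ 2 ∧
      Function.Injective (g.desc (E q)).toGate.wires ∧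
      (∀ i, n - 1 + q * m ≤ (g.desc (E q)).toGate.wires i ∧
        (g.desc (E q)).toGate.wires i < n - 1 + q * m + (m + r)) ∧
      (g.desc (E q)).toGate.mat ∈ Matrix.unitaryGroup _ ℂ := fun g hg => by
    have := (hL' ⟨E q, hE q⟩).1 g hg
    simp only [h41] at this
    exact this
  have hdisj : ∀ g ∈ L, ∀ g' ∈ L, ∀ j j', j < j' →
      Disjoint (Set.range (g.desc (E j)).toGate.wires)
        (Set.range (g'.desc (E j')).toGate.wires) := by
    intro g hg g' hg' j j' hjj
    rw [Set.disjoint_left]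
    rintro w ⟨i, rfl⟩ ⟨i', hi'⟩
    have e1 := (hgate g hg j).2.2.1 i
    have e2 := (hgate g' hg' j').2.2.1 i'
    have e3 : j * m + m ≤ j' * m := by
      rw [← Nat.succ_mul]
      exact Nat.mul_le_mul_right m hjj
    omega
  constructor
  · intro l hl
    rcases List.mem_append.1 hl with hl | hl
    · obtain ⟨g, hg, rfl⟩ := List.mem_map.1 hl
      refine ⟨fun j hj => ?_, fun j j' hjj _ => ?_⟩
      · rw [hcount] at hj
        rw [henv]
        obtain ⟨e1, e2, e3, e4⟩ := hgate g hg j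
        refine ⟨e1, e2, fun i => ?_, e4⟩
        have := (e3 i).2
        have := hbase hj
        change (g.desc (E j)).toGate.wires i < 2 * n - 1
        omega
      · rw [henv, henv]
        exact hdisj g hg g hg j j' hjj
    · obtain ⟨g, hg, rfl⟩ := List.mem_map.1 hl
      refine ⟨fun j hj => ?_, fun j j' hjj hj' => ?_⟩
      · rw [hcount', Nat.lt_one_iff] at hj
        subst hj
        rw [henv']
        obtain ⟨e1, e2, e3, e4⟩ := hgate' g hg
        refine ⟨e1, e2, fun i => ?_, e4⟩
        have := (e3 i).2
        change (g.desc (E q)).toGate.wires i < 2 * n - 1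
        omega
      · rw [hcount'] at hj'
        omega
  · intro ψ
    have hblocks : blocks n m = ((List.range q).map fun j => (j * m, m)) ++ [(q * m, m + r)] := by
      rw [blocks, hqq, List.range_succ, List.map_append]
      congr 1
      · refine List.map_congr_left fun j hj => ?_
        have := List.mem_range.1 hj
        rw [if_neg (by omega)]
      · simp [hr]
    rw [hblocks, List.map_append, applyList_append, List.flatMap_append, applyList_append,
      List.flatMap_map, List.flatMap_map, List.map_map]
    have e1 : (L.flatMap fun g => (T g).gates ρ) = L.flatMap fun g => (List.range q).map fun j =>
        (g.desc (E j)).toGate := by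
      simp only [LayerTmpl.gates, hcount, henv]
      rfl
    have e2 : (L'.flatMap fun g => (T' g).gates ρ) = L'.map fun g => (g.desc (E q)).toGate := by
      simp only [LayerTmpl.gates, hcount', List.range_one, List.map_cons, List.map_nil, henv']
      exact List.map_eq_flatMap.symm
    -- layers of parallel gates, regrouped block by block
    rw [e1, e2, applyList_layers L (List.range q)
      (fun g j => (g.desc (E j)).toGate) (fun g hg j _ => (hgate g hg j).2.1)
      (List.pairwise_lt_range.imp fun {j j'} hjj g hg g' hg' => hdisj g hg g' hg' j j' hjj)]
    rw [applyList_flatMap (List.range q) _ (fun j => ⟨m, fun i => n - 1 + j * m + i, M m p⟩)]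
    · have h5 := (hL' ⟨E q, hE q⟩).2 (2 * n - 1) (by simp only [h41]; omega)
      simp only [h41, hE1] at h5
      rw [h5]
      rfl
    · intro j hj φ
      have := hbase (List.mem_range.1 hj)
      have h5 := (hL ⟨E j, hE j⟩).2 (2 * n - 1) (by simp only [h41]; omega) φ
      simp only [h41, hE1] at h5
      exact h5

/-- The target state is prepared from the all-zeros state by a number of layers which does not
depend on the number of qubits. -/
theorem exists_layers {B : (k : ℕ) → Set (Bits k)} (hB : ∀ k, 1 ≤ k → IsHalf (B k)) {m : ℕ}
    (hm : 1 ≤ m) (r : ℕ) :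
    ∃ Ls : List LayerTmpl, ∀ {n p s : ℕ} {ρ : ℕ → ℕ}, Setup m n p s ρ →
    n - 1 - ((n - 1) / m - 1) * m = m + r →
    (∀ l ∈ Ls, l.Ok (2 * n - 1) ρ) ∧
      (CircuitDesc.toCircuit (Ls.map fun l => l.desc ρ)).apply (zeroState (2 * n - 1)) =
        (targetLayers B m n p s).apply (bpmState n) := by
  -- the layers of Hadamard gates that begin the preparation and the target layers are the same
  obtain ⟨lh, hh⟩ := exists_hadamardLayer
  obtain ⟨Lt, ht⟩ := exists_treeLayers
  obtain ⟨lr, hr⟩ := exists_rootLayer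
  obtain ⟨Lu, hu⟩ := exists_blockLayers (m := m) (r := r)
    (M := fun k p => (blockU k (Real.pi / p) (B k))ᴴ)
    fun k hk => blockU_realizable (by omega) (hB k (by omega))
  obtain ⟨Lc, hc⟩ := exists_blockLayers (m := m) (r := r) (M := fun k _ => cyclicC k)
    fun k hk => cyclicC_realizable (by omega)
  refine ⟨lh :: Lt ++ lh :: lr :: Lu ++ Lc, fun {n p s ρ} h hk => ?_⟩
  obtain ⟨oh, gh⟩ := hh h
  obtain ⟨ot, gt⟩ := ht h
  obtain ⟨or', gr⟩ := hr h
  obtain ⟨ou, gu⟩ := hu h hk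
  obtain ⟨oc, gc⟩ := hc h hk
  refine ⟨fun l hl => ?_, ?_⟩
  · simp only [List.mem_append, List.mem_cons] at hl
    rcases hl with ((rfl | hl) | rfl | rfl | hl) | hl
    exacts [oh, ot l hl, oh, or', ou l hl, oc l hl]
  · change applyList (List.flatten _) _ = applyList (List.flatten _) _
    rw [flatten_toCircuit]
    simp only [List.flatMap_append, List.flatMap_cons, applyList_append, gh, gt, gr, gu, gc]
    rw [treeLayers_apply (by have := h.hn; omega)]
    simp only [targetLayers, List.flatten_cons, List.flatten_nil, List.append_nil,
      applyList_append, List.cons_append, applyList_cons, applyList_nil, rootAngle]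
    rfl

end ShallowLearning
end

section
open scoped Matrix
namespace ShallowLearning

/-! ### The blocks of vertex qubits -/

/-- The first position of the block containing position `i`. -/
def blockLo (n m i : ℕ) : ℕ := min (i / m) ((n - 1) / m - 1) * m

/-- The end (exclusive) of the block containing position `i`. -/
def blockHi (n m i : ℕ) : ℕ := if i / m + 1 < (n - 1) / m then blockLo n m i + m else n - 1

/-- The cyclic predecessor of position `i` within its block. -/
def blockPred (n m i : ℕ) : ℕ := if i = blockLo n m i then blockHi n m i - 1 else i - 1

section Blocks

variable {n m : ℕ}

theorem blockLo_blocks (hm : 1 ≤ m) {b : ℕ × ℕ} (hb : b ∈ blocks n m) {j : ℕ} (hj : j < b.2) :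
    blockLo n m (b.1 + j) = b.1 ∧ blockHi n m (b.1 + j) = b.1 + b.2 := by
  obtain ⟨t, ht, rfl⟩ := List.mem_map.1 hb
  have ht' := List.mem_range.1 ht
  have hq : (n - 1) / m * m ≤ n - 1 := Nat.div_mul_le_self _ _
  have htq : (t + 1) * m ≤ (n - 1) / m * m := Nat.mul_le_mul_right m ht'
  simp only at hj ⊢
  by_cases h : t + 1 = (n - 1) / m
  · rw [if_pos h] at hj ⊢
    have h1 : t ≤ (t * m + j) / m := by
      rw [Nat.le_div_iff_mul_le hm]
      omega
    rw [blockHi, blockLo, if_neg (by omega), min_eq_right (by omega),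
      show (n - 1) / m - 1 = t by omega]
    have : (t + 1) * m = t * m + m := by ring
    exact ⟨rfl, by omega⟩
  · rw [if_neg h] at hj ⊢
    have h1 : (t * m + j) / m = t := by
      rw [Nat.mul_comm, Nat.mul_add_div hm, Nat.div_eq_of_lt hj, add_zero]
    rw [blockHi, blockLo, h1, if_pos (by omega), min_eq_left (by omega)]
    exact ⟨rfl, rfl⟩

theorem mem_blocks_bounds (hm : 1 ≤ m) {b : ℕ × ℕ} (hb : b ∈ blocks n m) :
    b.1 + b.2 ≤ n - 1 ∧ m ≤ b.2 ∧ b.2 < 2 * m := by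
  obtain ⟨t, ht, rfl⟩ := List.mem_map.1 hb
  have ht' := List.mem_range.1 ht
  have hq : (n - 1) / m * m ≤ n - 1 := Nat.div_mul_le_self _ _
  have hq2 : n - 1 < (n - 1) / m * m + m := Nat.lt_div_mul_add hm
  have htq : (t + 1) * m ≤ (n - 1) / m * m := Nat.mul_le_mul_right m ht'
  have : (t + 1) * m = t * m + m := by ring
  simp only
  split_ifs with h
  · rw [← h] at hq2
    omega
  · omega

theorem exists_mem_blocks (hm : 1 ≤ m) (hmn : m ≤ n - 1) {i : ℕ} (hi : i < n - 1) :
    ∃ b ∈ blocks n m, ∃ j < b.2, i = b.1 + j := by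
  have hq1 : 1 ≤ (n - 1) / m := (Nat.le_div_iff_mul_le hm).2 (by omega)
  have h1 : i / m * m ≤ i := Nat.div_mul_le_self _ _
  have h2 : i < i / m * m + m := Nat.lt_div_mul_add hm
  have h3 : i / m ≤ (n - 1) / m := Nat.div_le_div_right hi.le
  rcases lt_or_ge (i / m + 1) ((n - 1) / m) with h | h
  · refine ⟨_, List.mem_map.2 ⟨i / m, List.mem_range.2 (by omega), rfl⟩, i - i / m * m, ?_, ?_⟩
    · simp only
      rw [if_neg (by omega)]
      omega
    · simp only
      omega
  · have h4 : ((n - 1) / m - 1) * m ≤ i / m * m := Nat.mul_le_mul_right m (by omega)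
    refine ⟨_, List.mem_map.2 ⟨(n - 1) / m - 1, List.mem_range.2 (by omega), rfl⟩,
      i - ((n - 1) / m - 1) * m, ?_, ?_⟩
    · simp only
      rw [if_pos (by omega)]
      omega
    · simp only
      omega

theorem block_bounds (hm : 1 ≤ m) (hmn : m ≤ n - 1) {i : ℕ} (hi : i < n - 1) :
    blockLo n m i ≤ i ∧ i < blockHi n m i ∧ blockHi n m i ≤ n - 1 := by
  obtain ⟨b, hb, j, hj, rfl⟩ := exists_mem_blocks hm hmn hi
  obtain ⟨h1, h2⟩ := blockLo_blocks hm hb hj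
  have := mem_blocks_bounds hm hb
  omega

theorem block_eq (hm : 1 ≤ m) (hmn : m ≤ n - 1) {i j : ℕ} (hi : i < n - 1)
    (h1 : blockLo n m i ≤ j) (h2 : j < blockHi n m i) :
    blockLo n m j = blockLo n m i ∧ blockHi n m j = blockHi n m i := by
  obtain ⟨b, hb, t, ht, rfl⟩ := exists_mem_blocks hm hmn hi
  obtain ⟨h3, h4⟩ := blockLo_blocks hm hb ht
  rw [h3] at h1 ⊢
  rw [h4] at h2 ⊢
  obtain ⟨h5, h6⟩ := blockLo_blocks hm hb (j := j - b.1) (by omega)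
  rw [show b.1 + (j - b.1) = j by omega] at h5 h6
  exact ⟨h5, h6⟩

theorem blockPred_bounds (hm : 1 ≤ m) (hmn : m ≤ n - 1) {i : ℕ} (hi : i < n - 1) :
    blockLo n m i ≤ blockPred n m i ∧ blockPred n m i < blockHi n m i := by
  have := block_bounds hm hmn hi
  rw [blockPred]
  split_ifs <;> omega

theorem blockPred_lt (hm : 1 ≤ m) (hmn : m ≤ n - 1) {i : ℕ} (hi : i < n - 1) :
    blockPred n m i < n - 1 := by
  have := block_bounds hm hmn hi
  have := blockPred_bounds hm hmn hi
  omega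

theorem blockPred_injOn (hm : 1 ≤ m) (hmn : m ≤ n - 1) :
    Set.InjOn (blockPred n m) (Finset.range (n - 1)) := by
  intro i hi j hj hij
  have hi' : i < n - 1 := by simpa using hi
  have hj' : j < n - 1 := by simpa using hj
  have b1 := blockPred_bounds hm hmn hi'
  have b2 := blockPred_bounds hm hmn hj'
  have e1 := block_eq hm hmn hi' b1.1 b1.2
  have e2 := block_eq hm hmn hj' b2.1 b2.2
  rw [hij, e2.1, e2.2] at e1
  have b3 := block_bounds hm hmn hi'
  have b4 := block_bounds hm hmn hj'
  rw [blockPred, blockPred] at hij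
  split_ifs at hij <;> omega

theorem prod_blockPred (hm : 1 ≤ m) (hmn : m ≤ n - 1) {E : Type*} [CommMonoid E] (F : ℕ → E) :
    ∏ i ∈ Finset.range (n - 1), F (blockPred n m i) = ∏ i ∈ Finset.range (n - 1), F i := by
  have hmaps : Set.MapsTo (blockPred n m) (Finset.range (n - 1)) (Finset.range (n - 1)) :=
    fun i hi => by simpa using blockPred_lt hm hmn (by simpa using hi)
  exact Finset.prod_nbij (blockPred n m) hmaps (blockPred_injOn hm hmn)
    (Finset.surjOn_of_injOn_of_card_le _ hmaps (blockPred_injOn hm hmn) le_rfl) fun _ _ => rfl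

/-- The cyclic rotation inside a block, in terms of positions. -/
theorem finRotate_symm_val (hm : 1 ≤ m) {b : ℕ × ℕ} (hb : b ∈ blocks n m) (j : Fin b.2) :
    b.1 + ((finRotate b.2).symm j : ℕ) = blockPred n m (b.1 + j) := by
  obtain ⟨h1, h2⟩ := blockLo_blocks hm hb j.2
  rw [blockPred, h1, h2]
  obtain ⟨k, hk⟩ : ∃ k, b.2 = k + 1 := ⟨b.2 - 1, by have := j.2; omega⟩
  obtain ⟨o, l⟩ := b
  simp only at hk
  subst hk
  simp only at j ⊢
  have h3 : finRotate (k + 1) ((finRotate (k + 1)).symm j) = j := Equiv.apply_symm_apply _ _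
  generalize (finRotate (k + 1)).symm j = t at h3
  have h4 := congrArg Fin.val h3
  rw [coe_finRotate] at h4
  have := t.2
  split_ifs at h4 with h5
  · rw [h5, Fin.val_last, ← h4, if_pos (by omega)]
    omega
  · have : (t : ℕ) ≠ k := fun h => h5 (Fin.ext h)
    rw [if_neg (by omega)]
    omega

theorem blocks_pairwise : (blocks n m).Pairwise fun b b' => b.1 + b.2 ≤ b'.1 := by
  rw [blocks, List.pairwise_map]
  refine List.Pairwise.imp_of_mem ?_ List.pairwise_lt_range
  intro t t' _ ht' hlt
  have := List.mem_range.1 ht'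
  have htq : (t + 1) * m ≤ t' * m := Nat.mul_le_mul_right m hlt
  have : (t + 1) * m = t * m + m := by ring
  simp only
  rw [if_neg (by omega)]
  omega

/-- The gates which act with the matrices `M k` on the blocks of length `k`. -/
noncomputable def blockGates (n m : ℕ) (M : (k : ℕ) → Matrix (Bits k) (Bits k) ℂ) : List Gate :=
  (blocks n m).map fun b => ⟨b.2, fun j => n - 1 + b.1 + j, M b.2⟩

variable {M : (k : ℕ) → Matrix (Bits k) (Bits k) ℂ}

theorem blockGates_wires (hm : 1 ≤ m) {g : Gate} (hg : g ∈ blockGates n m M) :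
    Function.Injective g.wires ∧ ∀ j, g.wires j < 2 * n - 2 := by
  obtain ⟨b, hb, rfl⟩ := List.mem_map.1 hg
  refine ⟨fun (i j : Fin b.2) h => Fin.ext ?_, fun j => ?_⟩
  · change n - 1 + b.1 + (i : ℕ) = n - 1 + b.1 + (j : ℕ) at h
    omega
  have h1 := mem_blocks_bounds hm hb
  have h2 : (j : ℕ) < b.2 := j.2
  change n - 1 + b.1 + (j : ℕ) < 2 * n - 2
  omega

theorem blockGates_pairwise : (blockGates n m M).Pairwise fun g g' =>
    Disjoint (Set.range g.wires) (Set.range g'.wires) := by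
  rw [blockGates, List.pairwise_map]
  refine blocks_pairwise.imp fun {b b'} h => ?_
  rw [Set.disjoint_left]
  rintro _ ⟨i, rfl⟩ ⟨j, hj⟩
  have h2 : (i : ℕ) < b.2 := i.2
  change n - 1 + b'.1 + (j : ℕ) = n - 1 + b.1 + (i : ℕ) at hj
  omega

theorem notMem_blockGates (hm : 1 ≤ m) (hmn : m ≤ n - 1) {v : ℕ}
    (hv : ∀ g ∈ blockGates n m M, v ∉ Set.range g.wires) : ¬ (n - 1 ≤ v ∧ v < 2 * n - 2) := by
  rintro ⟨h1, h2⟩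
  obtain ⟨b, hb, j, hj, h⟩ := exists_mem_blocks (n := n) hm hmn (i := v - (n - 1)) (by omega)
  refine hv _ (List.mem_map.2 ⟨b, hb, rfl⟩) ⟨(⟨j, hj⟩ : Fin b.2), ?_⟩
  change n - 1 + b.1 + j = v
  omega

end Blocks

/-! ### Amplitudes of the approximate target state -/

/-- `applyList_prodVec` for the adjoint of a layer. -/
theorem applyList_adj_prodVec {q : ℕ} (l : List Gate) (f f' : ℕ → Bool → ℂ)
    (hd : l.Pairwise fun g g' => Disjoint (Set.range g.wires) (Set.range g'.wires))
    (hv : ∀ g ∈ l, Function.Injective g.wires ∧ ∀ j, g.wires j < q)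
    (hin : ∀ g ∈ l, ∀ y, ∑ b, star (g.mat b y) * ∏ j, f (g.wires j) (b j) =
      ∏ j, f' (g.wires j) (y j))
    (hout : ∀ v, (∀ g ∈ l, v ∉ Set.range g.wires) → f' v = f v) :
    applyList (l.reverse.map Gate.adj) (prodVec q f) = prodVec q f' := by
  refine applyList_prodVec _ f f' ?_ ?_ ?_ ?_
  · rw [List.pairwise_map, List.pairwise_reverse]
    exact hd.imp fun h => h.symm
  · intro g hg
    obtain ⟨h, hh, rfl⟩ := List.mem_map.1 hg
    exact hv h (List.mem_reverse.1 hh)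
  · intro g hg
    obtain ⟨h, hh, rfl⟩ := List.mem_map.1 hg
    exact hin h (List.mem_reverse.1 hh)
  · intro v h
    exact hout v fun g hg => h g.adj (List.mem_map.2 ⟨g, List.mem_reverse.2 hg, rfl⟩)

/-- The sign `(-1)^b`. -/
def bitSign (b : Bool) : ℝ := if b then -1 else 1

theorem bitSign_xor (a b : Bool) : bitSign (xor a b) = bitSign a * bitSign b := by
  cases a <;> cases b <;> simp [bitSign]

/-- A rotation about the first axis followed by a Hadamard gate is a Hadamard gate followed by a
phase. -/
theorem sum_hadamard_expX (a : ℝ) (y x : Bool) :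
    ∑ c, hadamard y c * expX a c x =
      1 / (Real.sqrt 2 : ℂ) * (bitSign (y && x) : ℂ) * Complex.exp (Complex.I * (a *
          bitSign y)) := by
  have h1 : Complex.exp (Complex.I * (a * bitSign y)) =
      Real.cos a + Complex.I * (Real.sin a * bitSign y) := by
    rw [mul_comm, Complex.exp_mul_I]
    cases y <;> simp [bitSign, Complex.cos_neg, Complex.sin_neg] <;> ring
  rw [h1, Fintype.sum_bool]
  cases y <;> cases x <;> simp [bitSign, hadamard, expX] <;> ring

theorem star_hadamard (y x : Bool) : star (hadamard y x) = hadamard x y := by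
  cases y <;> cases x <;> simp [hadamard]

theorem star_expX (a : ℝ) (y x : Bool) : star (expX a y x) = expX (-a) x y := by
  cases y <;> cases x <;>
    simp [expX, -Complex.ofReal_cos, -Complex.ofReal_sin, Complex.conj_ofReal]

theorem pathSum_congr {d d' : ℕ → Bool} {v : ℕ} (h : ∀ t < v, d t = d' t) :
    pathSum d v = pathSum d' v := by
  induction v using Nat.strong_induction_on with
  | _ v ih =>
    rcases v with _ | t
    · simp [pathSum]
    · rw [pathSum, pathSum, h t (by omega), ih (t / 2) (by omega) fun t' ht' => h t' (by omega)]

/-- The gates that lead from the poor man's GHZ state to the target state, with `A_{k,θ}` in place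
of `U_{k,θ}` and with an arbitrary angle on the root qubit. -/
noncomputable def idealGates (n m : ℕ) (θ α : ℝ) : List Gate :=
  hadamardLayer n ++ (gate1 (2 * n - 2) (expX α) :: blockGates n m fun k => (cyclicA k θ)ᴴ) ++
    blockGates n m cyclicC

section Amplitude

variable {n m : ℕ} (θ α : ℝ) (y : ℕ → Bool)

/-- The string `C_k^{-1} y` on all blocks. -/
def shiftBack (n m : ℕ) (y : ℕ → Bool) (v : ℕ) : Bool :=
  if n - 1 ≤ v ∧ v < 2 * n - 2 then y (n - 1 + blockPred n m (v - (n - 1))) else y v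

/-- The angles of the rotations of the vertex qubits, when the controlling bits are fixed. -/
noncomputable def vertexAngle (n m : ℕ) (θ α : ℝ) (y : ℕ → Bool) (v : ℕ) : ℝ :=
  if v < 2 * n - 2 then
    ctrlAngle θ (shiftBack n m y (n - 1 + blockPred n m (v - (n - 1))))
  else -α

/-- The factors of the product vector obtained from the basis vector of `y` by applying the adjoints
of all gates. -/
noncomputable def braFactor (n m : ℕ) (θ α : ℝ) (y : ℕ → Bool) (v : ℕ) (c : Bool) : ℂ :=
  if n - 1 ≤ v ∧ v < 2 * n - 1 then
    1 / (Real.sqrt 2 : ℂ) * (bitSign (c && shiftBack n m y v) : ℂ) *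
      Complex.exp (Complex.I * (vertexAngle n m θ α y v * bitSign c))
  else if c = y v then 1 else 0

theorem prod_ite_eq_get {k : ℕ} (x z : Bits k) :
    ∏ j, (if x j = z j then (1 : ℂ) else 0) = if x = z then 1 else 0 := by
  rw [Finset.prod_ite_zero]
  simp [funext_iff]

/-- Since `A_{k,θ}` maps basis vectors to product vectors, the adjoints of the three layers take a
basis vector to a product vector. -/
theorem applyList_idealGates_adj (hn : 2 ≤ n) (hm : 1 ≤ m) (hmn : m ≤ n - 1) :
    applyList ((idealGates n m θ α).reverse.map Gate.adj)
      (prodVec (2 * n - 1) fun v b => if b = y v then 1 else 0) =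
      prodVec (2 * n - 1) (braFactor n m θ α y) := by
  set x := shiftBack n m y with hx
  have hxv : ∀ i < n - 1, x (n - 1 + i) = y (n - 1 + blockPred n m i) := fun i hi => by
    rw [hx, shiftBack, if_pos (by omega), Nat.add_sub_cancel_left]
  have hxr : x (2 * n - 2) = y (2 * n - 2) := by
    rw [hx, shiftBack, if_neg (by omega)]
  have hmem : ∀ {b : ℕ × ℕ}, b ∈ blocks n m → ∀ j : Fin b.2, n - 1 + b.1 + (j : ℕ) =
      n - 1 + (b.1 + j) ∧ b.1 + (j : ℕ) < n - 1 := fun {b} hb j => by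
    have := mem_blocks_bounds hm hb
    have := j.2
    omega
  simp only [idealGates, List.reverse_append, List.map_append, applyList_append]
  -- the inverse cyclic shifts
  rw [applyList_adj_prodVec (blockGates n m cyclicC) _ (fun v b => if b = x v then 1 else 0)
    blockGates_pairwise
    (fun g hg => ⟨(blockGates_wires hm hg).1, fun j => by
      have := (blockGates_wires hm hg).2 j; omega⟩) ?_ ?_]
  rotate_left
  · intro g hg z
    obtain ⟨b, hb, rfl⟩ := List.mem_map.1 hg
    have e1 : ∀ c : Bits b.2, (∏ j : Fin b.2, if c j = y (n - 1 + b.1 + j) then (1 : ℂ) else 0) =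
        if c = fun j : Fin b.2 => y (n - 1 + b.1 + j) then 1 else 0 := fun c => prod_ite_eq_get _ _
    change ∑ c : Bits b.2, star (cyclicC b.2 c z) *
      (∏ j : Fin b.2, if c j = y (n - 1 + b.1 + j) then (1 : ℂ) else 0) =
      ∏ j : Fin b.2, if z j = x (n - 1 + b.1 + j) then (1 : ℂ) else 0
    simp only [e1, mul_ite, mul_one, mul_zero, Finset.sum_ite_eq', Finset.mem_univ, if_true]
    rw [prod_ite_eq_get, cyclicC]
    have e2 : (fun j : Fin b.2 => y (n - 1 + b.1 + j)) = (fun j => z (finRotate b.2 j)) ↔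
        z = fun j : Fin b.2 => x (n - 1 + b.1 + j) := by
      have e3 : (fun j : Fin b.2 => x (n - 1 + b.1 + j)) =
          fun j : Fin b.2 => y (n - 1 + b.1 + ((finRotate b.2).symm j : Fin b.2)) := by
        funext j
        obtain ⟨h1, h2⟩ := hmem hb j
        rw [h1, hxv _ h2, ← finRotate_symm_val hm hb j, add_assoc]
      rw [e3]
      constructor
      · intro h
        funext j
        have := congrFun h ((finRotate b.2).symm j)
        simp only [Equiv.apply_symm_apply] at this
        exact this.symm
      · intro h
        funext j
        rw [h]
        simp only [Equiv.symm_apply_apply]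
    simp only [e2]
    split_ifs <;> simp
  · intro v hv
    have := notMem_blockGates hm hmn hv
    simp only [hx, shiftBack, if_neg this]
  -- the controlled rotations
  rw [applyList_adj_prodVec (gate1 (2 * n - 2) (expX α) :: blockGates n m fun k => (cyclicA k θ)ᴴ)
    _ (fun v b => if n - 1 ≤ v ∧ v < 2 * n - 1 then expX (vertexAngle n m θ α y v) b (x v)
      else if b = x v then 1 else 0) ?_ ?_ ?_ ?_]
  rotate_left
  · refine List.pairwise_cons.2 ⟨fun g hg => ?_, blockGates_pairwise⟩
    rw [range_gate1, Set.disjoint_singleton_left]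
    rintro ⟨j, hj⟩
    have := (blockGates_wires hm hg).2 j
    omega
  · intro g hg
    rcases List.mem_cons.1 hg with rfl | hg
    · exact ⟨gate1_injective _ _, gate1_wires_lt (by omega)⟩
    · exact ⟨(blockGates_wires hm hg).1, fun j => by
        have := (blockGates_wires hm hg).2 j; omega⟩
  · intro g hg z
    rcases List.mem_cons.1 hg with rfl | hg
    · refine gate1_prodVec_condition (2 * n - 2) (fun y x => star (expX α x y))
        (fun v b => if b = x v then 1 else 0) (fun v b => if n - 1 ≤ v ∧ v < 2 * n - 1 then
          expX (vertexAngle n m θ α y v) b (x v) else if b = x v then 1 else 0) (fun b => ?_) z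
      rw [if_pos (by omega), vertexAngle, if_neg (by omega)]
      simp only [mul_ite, mul_one, mul_zero, Finset.sum_ite_eq', Finset.mem_univ, if_true]
      exact star_expX _ _ _
    · obtain ⟨b, hb, rfl⟩ := List.mem_map.1 hg
      have e1 : ∀ c : Bits b.2, (∏ j : Fin b.2, if c j = x (n - 1 + b.1 + j) then (1 : ℂ) else 0) =
          if c = fun j : Fin b.2 => x (n - 1 + b.1 + j) then 1 else 0 :=
        fun c => prod_ite_eq_get _ _
      change ∑ c : Bits b.2, star ((cyclicA b.2 θ)ᴴ c z) *
        (∏ j : Fin b.2, if c j = x (n - 1 + b.1 + j) then (1 : ℂ) else 0) = _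
      simp only [e1, mul_ite, mul_one, mul_zero, Finset.sum_ite_eq', Finset.mem_univ, if_true]
      rw [Matrix.conjTranspose_apply, star_star, cyclicA_eq]
      refine Finset.prod_congr rfl fun j _ => ?_
      obtain ⟨h1, h2⟩ := hmem hb j
      rw [if_pos (by omega), vertexAngle, if_pos (by omega), h1, Nat.add_sub_cancel_left,
        ← finRotate_symm_val hm hb j, add_assoc]
  · intro v hv
    have h1 := notMem_blockGates hm hmn (v := v)
      (M := fun k => (cyclicA k θ)ᴴ) fun g hg => hv g (List.mem_cons_of_mem _ hg)
    have h2 := hv _ (List.mem_cons_self ..)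
    rw [range_gate1, Set.mem_singleton_iff] at h2
    funext b
    rw [if_neg (by omega)]
  -- the Hadamard gates
  refine applyList_adj_prodVec _ _ _ (hadamardLayer_pairwise n) ?_ ?_ ?_
  · intro g hg
    obtain ⟨i, hi, rfl⟩ := List.mem_map.1 hg
    have := List.mem_range.1 hi
    exact ⟨gate1_injective _ _, gate1_wires_lt (by omega)⟩
  · intro g hg z
    obtain ⟨i, hi, rfl⟩ := List.mem_map.1 hg
    have := List.mem_range.1 hi
    refine gate1_prodVec_condition (n - 1 + i) (fun y x => star (hadamard x y))
      (fun v b => if n - 1 ≤ v ∧ v < 2 * n - 1 then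
          expX (vertexAngle n m θ α y v) b (x v) else if b = x v then 1 else 0)
      (braFactor n m θ α y) (fun b => ?_) z
    simp only [star_hadamard]
    rw [braFactor, if_pos (by omega), ← sum_hadamard_expX]
    refine Finset.sum_congr rfl fun c _ => ?_
    rw [if_pos (by omega)]
  · intro v hv
    have h2 : ¬ (n - 1 ≤ v ∧ v < 2 * n - 1) := fun h => by
      refine hv (gate1 (n - 1 + (v - (n - 1))) hadamard)
        (List.mem_map.2 ⟨_, List.mem_range.2 (by omega), rfl⟩) ?_
      rw [range_gate1, Set.mem_singleton_iff]
      omega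
    funext b
    rw [braFactor, if_neg h2, if_neg h2, hx, shiftBack,
      if_neg (show ¬ (n - 1 ≤ v ∧ v < 2 * n - 2) by omega)]

end Amplitude

end ShallowLearning
end

section
open scoped Matrix
namespace ShallowLearning

/-! ### The Born distribution of the approximate target state -/

/-- The sum of the shifted vertex bits, each with the sign given by the parity of the edge bits on
the path to its node. -/
def treeSum (n m : ℕ) (y : ℕ → Bool) : ℤ :=
  ∑ i ∈ Finset.range (n - 1), if y (n - 1 + blockPred n m (blockPred n m i)) then
    (if pathSum y (i + 1) then -1 else 1) else 0

/-- The sign given by the parity of all vertex bits. -/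
def vertexSign (n : ℕ) (y : ℕ → Bool) : ℝ := ∏ i ∈ Finset.range n, bitSign (y (n - 1 + i))

/-- The Born distribution of the approximate target state. -/
noncomputable def idealDist (n m p s : ℕ) (y : ℕ → Bool) : ℝ :=
  (1 / 2) ^ (2 * n - 1) *
    (1 - vertexSign n y * Real.sin (2 * Real.pi * ((treeSum n m y : ℤ) - s) / p))

theorem bitSign_and_xor (a b c : Bool) :
    bitSign (xor a b && c) = bitSign (a && c) * bitSign (b && c) := by
  cases a <;> cases b <;> cases c <;> simp [bitSign]

theorem abs_bitSign (a : Bool) : |bitSign a| = 1 := by cases a <;> simp [bitSign]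

theorem abs_vertexSign (n : ℕ) (y : ℕ → Bool) : |vertexSign n y| = 1 := by
  rw [vertexSign, Finset.abs_prod]
  exact Finset.prod_eq_one fun i _ => abs_bitSign _

section Amplitude

variable {n m : ℕ}

/-- The basis vectors of the poor man's GHZ state with given edge bits. -/
def treeBits (n : ℕ) (y : ℕ → Bool) (r : Bool) (v : ℕ) : Bool :=
  if v < n - 1 then y v
  else if v < 2 * n - 2 then xor (pathSum y (v - (n - 1) + 1)) r else r

/-- The bra of an outcome `y`, pulled back through the approximate circuit, is a product vector;
this is its entry at the two basis vectors `r = 0, 1` of the tree state with the edge bits of `y`.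
The angles of the blocks add up to `± (θ * treeSum - α)`, and flipping all vertex bits costs the
sign `vertexSign`, because every vertex bit of `y` occurs exactly once after the cyclic shift. -/
theorem prod_braFactor (hn : 2 ≤ n) (hm : 1 ≤ m) (hmn : m ≤ n - 1) (θ α : ℝ) (y : ℕ → Bool)
    (r : Bool) :
    ∏ v : Fin (2 * n - 1), braFactor n m θ α y v (treeBits n y r v) =
      (1 / (Real.sqrt 2 : ℂ)) ^ n *
      ((∏ i ∈ Finset.range (n - 1),
        bitSign (pathSum y (i + 1) && shiftBack n m y (n - 1 + i)) : ℝ) : ℂ) *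
      ((if r then vertexSign n y else 1 : ℝ) : ℂ) *
      Complex.exp (Complex.I * (bitSign r * (θ * treeSum n m y - α) : ℝ)) := by
  set x := shiftBack n m y with hx
  have hxv : ∀ i < n - 1, x (n - 1 + i) = y (n - 1 + blockPred n m i) := fun i hi => by
    rw [hx, shiftBack, if_pos (by omega), Nat.add_sub_cancel_left]
  have hxr : x (2 * n - 2) = y (2 * n - 2) := by
    rw [hx, shiftBack, if_neg (by omega)]
  have h0 : ∏ v : Fin (2 * n - 1), braFactor n m θ α y v (treeBits n y r v) =
      ∏ v ∈ Finset.range ((n - 1) + ((n - 1) + 1)), braFactor n m θ α y v (treeBits n y r v) := by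
    rw [show (n - 1) + ((n - 1) + 1) = 2 * n - 1 by omega, ← Fin.prod_univ_eq_prod_range
      (fun v => braFactor n m θ α y v (treeBits n y r v))]
  rw [h0, Finset.prod_range_add, Finset.prod_range_succ, Finset.prod_eq_one fun t ht => ?_,
    one_mul]
  swap
  · have := Finset.mem_range.1 ht
    have e : treeBits n y r t = y t := if_pos this
    rw [braFactor, if_neg (show ¬ (n - 1 ≤ t ∧ t < 2 * n - 1) by omega), e, if_pos rfl]
  have h1 : ∀ i ∈ Finset.range (n - 1),
      braFactor n m θ α y (n - 1 + i) (treeBits n y r (n - 1 + i)) =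
      1 / (Real.sqrt 2 : ℂ) * ((bitSign (pathSum y (i + 1) && x (n - 1 + i)) : ℝ) : ℂ) *
        ((bitSign (r && y (n - 1 + blockPred n m i)) : ℝ) : ℂ) *
        Complex.exp (Complex.I * ((bitSign r * θ) * ((if y (n - 1 + blockPred n m
          (blockPred n m i)) then (if pathSum y (i + 1) then -1 else 1) else 0 : ℤ) : ℂ))) := by
    intro i hi
    have hi' := Finset.mem_range.1 hi
    rw [braFactor, if_pos (by omega), treeBits, if_neg (by omega), if_pos (by omega),
      Nat.add_sub_cancel_left, bitSign_and_xor, vertexAngle, if_pos (by omega),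
      Nat.add_sub_cancel_left, ← hx, hxv _ (blockPred_lt hm hmn hi'), hxv i hi', bitSign_xor]
    have h2 : ((ctrlAngle θ (y (n - 1 + blockPred n m (blockPred n m i))) : ℝ) : ℂ) *
        ((bitSign (pathSum y (i + 1)) * bitSign r : ℝ) : ℂ) =
        (bitSign r * θ) * ((if y (n - 1 + blockPred n m
          (blockPred n m i)) then (if pathSum y (i + 1) then -1 else 1) else 0 : ℤ) : ℂ) := by
      cases y (n - 1 + blockPred n m (blockPred n m i)) <;> cases pathSum y (i + 1) <;>
        cases r <;> simp [ctrlAngle, bitSign]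
    rw [h2]
    push_cast
    ring
  have h3 : braFactor n m θ α y (n - 1 + (n - 1)) (treeBits n y r (n - 1 + (n - 1))) =
      1 / (Real.sqrt 2 : ℂ) * ((bitSign (r && y (n - 1 + (n - 1))) : ℝ) : ℂ) *
        Complex.exp (Complex.I * (bitSign r * -α : ℝ)) := by
    rw [braFactor, if_pos (by omega), treeBits, if_neg (by omega), if_neg (by omega), vertexAngle,
      if_neg (by omega), ← hx, show n - 1 + (n - 1) = 2 * n - 2 by omega, hxr]
    push_cast
    ring_nf
  have h4 : (∏ i ∈ Finset.range (n - 1), bitSign (r && y (n - 1 + blockPred n m i))) *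
      bitSign (r && y (n - 1 + (n - 1))) = if r then vertexSign n y else 1 := by
    rw [prod_blockPred hm hmn fun i => bitSign (r && y (n - 1 + i)), ← Finset.prod_range_succ
      (fun i => bitSign (r && y (n - 1 + i))), Nat.sub_add_cancel (by omega)]
    cases r
    · exact Finset.prod_eq_one fun i _ => by simp [bitSign]
    · simp [vertexSign]
  rw [Finset.prod_congr rfl h1, h3, Finset.prod_mul_distrib, Finset.prod_mul_distrib,
    Finset.prod_mul_distrib, Finset.prod_const, Finset.card_range, ← Complex.exp_sum,
    ← Finset.mul_sum, ← Finset.mul_sum, ← h4]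
  have h5 : Complex.exp (Complex.I * (bitSign r * (θ * treeSum n m y - α) : ℝ)) =
      Complex.exp (Complex.I * ((bitSign r * θ) * (treeSum n m y : ℂ))) *
        Complex.exp (Complex.I * (bitSign r * -α : ℝ)) := by
    rw [← Complex.exp_add]
    congr 1
    push_cast
    ring
  rw [h5, treeSum]
  push_cast
  have h6 : (1 / (Real.sqrt 2 : ℂ)) ^ n = (1 / (Real.sqrt 2 : ℂ)) ^ (n - 1) * (1 /
      (Real.sqrt 2 : ℂ)) := by
    rw [← pow_succ, Nat.sub_add_cancel (by omega)]
  rw [h6]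
  ring

theorem treeBits_lt {y : ℕ → Bool} {r : Bool} {t : ℕ} (ht : t < n - 1) :
    treeBits n y r t = y t := by
  rw [treeBits, if_pos ht]

/-- Only two basis vectors with given edge bits occur in the poor man's GHZ state. -/
theorem sum_bpmState (hn : 2 ≤ n) (y : ℕ → Bool) (F : Bits (2 * n - 1) → ℂ)
    (hF : ∀ z : Bits (2 * n - 1), (∃ t < n - 1, z.at t ≠ y t) → F z = 0) :
    ∑ z, F z * bpmState n z = ∑ r, F (fun v => treeBits n y r v) * (1 / (Real.sqrt 2 : ℂ)) ^ n := by
  have hat : ∀ r, ∀ v < 2 * n - 1,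
      Bits.at (fun v : Fin (2 * n - 1) => treeBits n y r v) v = treeBits n y r v := fun r v hv => by
    rw [Bits.at_of_lt _ hv]
  have hroot : ∀ r, treeBits n y r (2 * n - 2) = r := fun r => by
    rw [treeBits, if_neg (by omega), if_neg (by omega)]
  have hb : ∀ r, bpmState n (fun v => treeBits n y r v) = (1 / (Real.sqrt 2 : ℂ)) ^ n := fun r => by
    rw [bpmState, if_pos, ← pow_succ, Nat.sub_add_cancel (by omega)]
    intro i hi
    rw [hat _ _ (by omega), hat _ _ (by omega), hroot, treeBits, if_neg (by omega),
      if_pos (by omega), Nat.add_sub_cancel_left]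
    rw [pathSum_congr (d := y) fun t ht => ?_]
    rw [hat _ _ (by omega), treeBits_lt (by omega)]
  suffices h : ∑ z, F z * bpmState n z =
      F (fun v => treeBits n y true v) * bpmState n (fun v => treeBits n y true v) +
        F (fun v => treeBits n y false v) * bpmState n (fun v => treeBits n y false v) by
    rw [h, hb, hb, Fintype.sum_bool]
  refine Fintype.sum_eq_add _ _ (fun h => ?_) fun z hz => ?_
  · have := congrFun h ⟨2 * n - 2, by omega⟩
    simp only [hroot] at this
    exact absurd this (by simp)
  · by_cases h1 : ∃ t < n - 1, z.at t ≠ y t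
    · rw [hF z h1, zero_mul]
    · push Not at h1
      rw [bpmState, if_neg, mul_zero]
      intro h2
      have h3 : z = fun v : Fin (2 * n - 1) => treeBits n y (z.at (2 * n - 2)) v := by
        funext v
        rw [← Bits.at_val z v]
        rcases lt_or_ge (v : ℕ) (n - 1) with h | h
        · rw [treeBits_lt h, h1 v h]
        · rcases lt_or_ge (v : ℕ) (2 * n - 2) with h' | h'
          · have h4 := h2 (v - (n - 1)) (by omega)
            rw [show n - 1 + ((v : ℕ) - (n - 1)) = v by omega] at h4
            rw [h4, treeBits, if_neg (by omega), if_pos h', pathSum_congr (d' := y) fun t ht =>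
              h1 t (by omega)]
          · rw [show (v : ℕ) = 2 * n - 2 by omega, hroot]
      cases hr : z.at (2 * n - 2)
      · exact hz.2 (by rw [h3, hr])
      · exact hz.1 (by rw [h3, hr])

theorem normSq_two_phases {P β : ℝ} (hP : |P| = 1) :
    ‖star (Complex.exp (Complex.I * (β : ℝ))) + P * star (Complex.exp (Complex.I * (-β : ℝ)))‖ ^ 2 =
      2 * (1 + P * Real.cos (2 * β)) := by
  have h1 : ∀ b : ℝ, star (Complex.exp (Complex.I * b)) = ⟨Real.cos b, -Real.sin b⟩ := fun b => by
    rw [mul_comm, Complex.exp_mul_I]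
    apply Complex.ext <;> simp [Complex.cos_ofReal_re, Complex.sin_ofReal_re]
  rw [h1, h1, ← Complex.normSq_eq_norm_sq, Complex.normSq_apply, Real.cos_two_mul]
  have h2 : P ^ 2 = 1 := by rw [← sq_abs, hP, one_pow]
  have h3 := Real.sin_sq_add_cos_sq β
  simp only [Complex.add_re, Complex.add_im, Complex.mul_re, Complex.mul_im, Complex.ofReal_re,
    Complex.ofReal_im, Real.cos_neg, Real.sin_neg, zero_mul, sub_zero, add_zero, neg_neg]
  linear_combination (Real.cos β ^ 2 + Real.sin β ^ 2) * h2 + (2 - 2 * P) * h3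

/-- The two branches of the tree state interfere with phases `exp (± i (θ * treeSum - α))` and
relative sign `vertexSign`, which gives the cosine. -/
theorem norm_idealGates (hn : 2 ≤ n) (hm : 1 ≤ m) (hmn : m ≤ n - 1) (θ α : ℝ)
    (y : Bits (2 * n - 1)) :
    ‖applyList (idealGates n m θ α) (bpmState n) y‖ ^ 2 = (1 / 2) ^ (2 * n - 1) *
      (1 + vertexSign n y.at * Real.cos (2 * (θ * treeSum n m y.at - α))) := by
  have hl : ∀ g ∈ idealGates n m θ α, Function.Injective g.wires ∧ ∀ j, g.wires j < 2 * n - 1 := by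
    intro g hg
    simp only [idealGates, hadamardLayer, List.mem_append, List.mem_cons, List.mem_map,
      List.mem_range] at hg
    rcases hg with (⟨i, hi, rfl⟩ | rfl | hg) | hg
    · exact ⟨gate1_injective _ _, gate1_wires_lt (by omega)⟩
    · exact ⟨gate1_injective _ _, gate1_wires_lt (by omega)⟩
    · exact ⟨(blockGates_wires hm hg).1, fun j => by have := (blockGates_wires hm hg).2 j; omega⟩
    · exact ⟨(blockGates_wires hm hg).1, fun j => by have := (blockGates_wires hm hg).2 j; omega⟩
  have hy : (Pi.single y 1 : QState (2 * n - 1)) =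
      prodVec (2 * n - 1) fun v b => if b = y.at v then 1 else 0 := by
    funext z
    simp only [prodVec, Bits.at_val]
    rw [prod_ite_eq_get, Pi.single_apply]
  have h1 : applyList (idealGates n m θ α) (bpmState n) y =
      star (Pi.single y 1 : QState (2 * n - 1)) ⬝ᵥ
        applyList (idealGates n m θ α) (bpmState n) := by
    rw [← Pi.single_star, star_one, single_dotProduct, one_mul]
  rw [h1, applyList_adjoint _ hl, hy, applyList_idealGates_adj θ α y.at hn hm hmn]
  have h2 : star (prodVec (2 * n - 1) (braFactor n m θ α y.at)) ⬝ᵥ bpmState n =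
      ∑ z : Bits (2 * n - 1), star (∏ v : Fin (2 * n - 1), braFactor n m θ α y.at v (z v)) *
        bpmState n z := rfl
  rw [h2, sum_bpmState hn y.at fun z => star (∏ v : Fin (2 * n - 1), braFactor n m θ α y.at v
      (z v))]
  swap
  · rintro z ⟨t, ht, hz⟩
    have : ∏ v : Fin (2 * n - 1), braFactor n m θ α y.at v (z v) = 0 := by
      refine Finset.prod_eq_zero (Finset.mem_univ ⟨t, by omega⟩) ?_
      rw [Bits.at_of_lt z (by omega)] at hz
      rw [braFactor, if_neg (by simp only; omega), if_neg hz]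
    simp only [this, star_zero]
  simp only [prod_braFactor hn hm hmn, Fintype.sum_bool, star_mul']
  set β := θ * treeSum n m y.at - α
  set E := ∏ i ∈ Finset.range (n - 1),
        bitSign (pathSum y.at (i + 1) && shiftBack n m y.at (n - 1 + i))
  set P := vertexSign n y.at
  have hs : ∀ a : ℝ, star (a : ℂ) = a := fun a => Complex.conj_ofReal a
  have h3 : star ((1 / (Real.sqrt 2 : ℂ)) ^ n) = (1 / (Real.sqrt 2 : ℂ)) ^ n := by
    rw [star_pow, star_div₀, star_one, hs]
  have h4 : ‖((1 / (Real.sqrt 2 : ℂ)) ^ n)‖ ^ 2 = (1 / 2) ^ n := by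
    rw [norm_pow, norm_div, norm_one, Complex.norm_real, Real.norm_eq_abs, ← pow_mul, mul_comm n 2,
      pow_mul, div_pow, sq_abs, Real.sq_sqrt (by norm_num), one_pow]
  have h5 : ‖(E : ℂ)‖ = 1 := by
    rw [Complex.norm_real, Real.norm_eq_abs, Finset.abs_prod]
    exact Finset.prod_eq_one fun i _ => abs_bitSign _
  simp only [h3, hs, bitSign, if_true]
  rw [show ∀ a b c d : ℂ, a * b * (P : ℝ) * c * a + a * b * ((if false =
      true then P else 1 : ℝ) : ℝ) * d * a =
    a * a * b * (d + P * c) from fun a b c d => by simp; ring]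
  rw [norm_mul, norm_mul, norm_mul, h5, mul_one, mul_pow, mul_pow, h4]
  have h6 := normSq_two_phases (P := P) (β := β) (abs_vertexSign _ _)
  simp only [Bool.false_eq_true, if_false, one_mul, neg_mul]
  rw [h6]
  have h7 : (1 / 2 : ℝ) ^ n * (1 / 2) ^ n = (1 / 2) ^ (2 * n - 1) * (1 / 2) := by
    rw [← pow_add, ← pow_succ]
    congr 1
    omega
  rw [h7]
  ring

/-- For the angle `π / 4 - π s / p` of the root qubit the cosine becomes a sine with period `p` in
the signed sum. -/
theorem norm_idealGates_eq_idealDist (hn : 2 ≤ n) (hm : 1 ≤ m) (hmn : m ≤ n - 1) {p : ℕ}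
    (hp : 0 < p) (s : ℕ) (y : Bits (2 * n - 1)) :
    ‖applyList (idealGates n m (Real.pi / p) (rootAngle p s)) (bpmState n) y‖ ^ 2 =
      idealDist n m p s y.at := by
  have hp' : (p : ℝ) ≠ 0 := by positivity
  rw [norm_idealGates hn hm hmn, idealDist, rootAngle]
  rw [show 2 * (Real.pi / p * (treeSum n m y.at : ℝ) - -(Real.pi / 4 - Real.pi * s / p)) =
    2 * Real.pi * ((treeSum n m y.at : ℤ) - s) / p + Real.pi / 2 by field_simp; ring,
    Real.cos_add_pi_div_two]
  ring

end Amplitude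

/-! ### Distance to the target state -/

theorem stateNorm_le_add_stateNorm_sub {q : ℕ} (φ ψ : QState q) :
    stateNorm φ ≤ stateNorm ψ + stateNorm (φ - ψ) := by
  have := stateNorm_add_le ψ (φ - ψ)
  rwa [add_sub_cancel] at this

theorem applyList_sub {q : ℕ} (l : List Gate) (φ ψ : QState q) :
    applyList l (φ - ψ) = applyList l φ - applyList l ψ := by
  induction l generalizing φ ψ with
  | nil => rfl
  | cons g l ih => rw [applyList_cons, applyList_cons, applyList_cons, Gate.apply_sub, ih]

/-- Replacing unitary gates by matrices which are close to them. The bound is stated in a form which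
can be iterated. -/
theorem stateNorm_perturb {q : ℕ} {ι : Type*} (js : List ι) (a : ι → ℕ) (w : ∀ i, Fin (a i) → ℕ)
    (U A : ∀ i, Matrix (Bits (a i)) (Bits (a i)) ℂ) {η : ℝ} (hη : 0 ≤ η)
    (hU : ∀ i ∈ js, (Gate.mk (a i) (w i) (U i)).IsValid q)
    (hA : ∀ i ∈ js, ∀ ψ : QState q,
      stateNorm ((Gate.mk (a i) (w i) (U i - A i)).apply ψ) ≤ η * stateNorm ψ)
    (u v : QState q) :
    stateNorm u + stateNorm (applyList (js.map fun i => ⟨a i, w i, U i⟩) u -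
      applyList (js.map fun i => ⟨a i, w i, A i⟩) v) ≤
      (1 + η) ^ js.length * (stateNorm u + stateNorm (u - v)) := by
  induction js generalizing u v with
  | nil => simp [applyList_nil]
  | cons i js ih =>
    have h1 := ih (fun i hi => hU i (List.mem_cons_of_mem _ hi))
      (fun i hi => hA i (List.mem_cons_of_mem _ hi)) ((Gate.mk (a i) (w i) (U i)).apply u)
      ((Gate.mk (a i) (w i) (A i)).apply v)
    have hi := hU i (List.mem_cons_self ..)
    rw [hi.stateNorm_apply] at h1
    simp only [List.map_cons, applyList_cons, List.length_cons]
    refine h1.trans ?_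
    rw [pow_succ, mul_assoc]
    refine mul_le_mul_of_nonneg_left ?_ (by positivity)
    have h2 : (Gate.mk (a i) (w i) (U i)).apply u - (Gate.mk (a i) (w i) (A i)).apply v =
        (Gate.mk (a i) (w i) (U i)).apply (u - v) +
          (Gate.mk (a i) (w i) (U i - A i)).apply v := by
      rw [Gate.apply_sub]
      funext x
      simp only [Pi.sub_apply, Pi.add_apply, Gate.apply_eq, Matrix.sub_apply, sub_mul,
        Finset.sum_sub_distrib]
      ring
    rw [h2]
    have h3 := stateNorm_add_le ((Gate.mk (a i) (w i) (U i)).apply (u - v))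
      ((Gate.mk (a i) (w i) (U i - A i)).apply v)
    rw [hi.stateNorm_apply] at h3
    have h4 := hA i (List.mem_cons_self ..) v
    have h5 : stateNorm v ≤ stateNorm u + stateNorm (u - v) := by
      have := stateNorm_add_le u (v - u)
      rw [add_sub_cancel] at this
      have h6 : stateNorm (v - u) = stateNorm (u - v) := by
        rw [stateNorm, stateNorm, WithLp.toLp_sub, WithLp.toLp_sub, norm_sub_rev]
      linarith
    have h7 := mul_le_mul_of_nonneg_left h5 hη
    linarith [stateNorm_nonneg u]

/-- Born distributions depend continuously on the state, by the Cauchy-Schwarz inequality. -/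
theorem sum_abs_born_sub_le {q : ℕ} (ψ φ : QState q) :
    ∑ x, |‖ψ x‖ ^ 2 - ‖φ x‖ ^ 2| ≤ stateNorm (ψ - φ) * (2 * stateNorm ψ + stateNorm (ψ - φ)) := by
  have h1 : ∀ x, |‖ψ x‖ ^ 2 - ‖φ x‖ ^ 2| ≤ ‖(ψ - φ) x‖ * (‖ψ x‖ + ‖φ x‖) := fun x => by
    rw [sq_sub_sq, abs_mul, abs_of_nonneg (by positivity), mul_comm]
    exact mul_le_mul_of_nonneg_right (abs_norm_sub_norm_le _ _) (by positivity)
  have h2 : ∑ x, ‖(ψ - φ) x‖ * (‖ψ x‖ + ‖φ x‖) ≤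
      stateNorm (ψ - φ) * stateNorm ψ + stateNorm (ψ - φ) * stateNorm φ := by
    simp only [mul_add, Finset.sum_add_distrib]
    have hcs : ∀ χ : QState q, ∑ x, ‖(ψ - φ) x‖ * ‖χ x‖ ≤ stateNorm (ψ - φ) * stateNorm χ :=
      fun χ => by
        refine abs_le_of_sq_le_sq' ?_ (mul_nonneg (stateNorm_nonneg _) (stateNorm_nonneg _)) |>.2
        rw [mul_pow, stateNorm_sq, stateNorm_sq]
        exact Finset.sum_mul_sq_le_sq_mul_sq _ _ _
    exact add_le_add (hcs ψ) (hcs φ)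
  have h3 : stateNorm φ ≤ stateNorm ψ + stateNorm (ψ - φ) := by
    have := stateNorm_le_add_stateNorm_sub φ ψ
    have h6 : stateNorm (φ - ψ) = stateNorm (ψ - φ) := by
      rw [stateNorm, stateNorm, WithLp.toLp_sub, WithLp.toLp_sub, norm_sub_rev]
    rwa [h6] at this
  calc _ ≤ _ := Finset.sum_le_sum fun x _ => h1 x
    _ ≤ _ := h2
    _ ≤ _ := by nlinarith [stateNorm_nonneg (ψ - φ)]

theorem stateNorm_zeroState (q : ℕ) : stateNorm (zeroState q) = 1 := by
  have h : stateNorm (zeroState q) ^ 2 = 1 := by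
    rw [stateNorm_sq, zeroState, Finset.sum_eq_single fun _ => false]
    · simp
    · intro x _ hx
      simp [hx]
    · simp
  exact (pow_eq_one_iff_of_nonneg (stateNorm_nonneg _) two_ne_zero).1 h

theorem stateNorm_bpmState {n : ℕ} (hn : 3 ≤ n) : stateNorm (bpmState n) = 1 := by
  rw [← treeLayers_apply hn, stateNorm_applyList, stateNorm_applyList, stateNorm_zeroState]
  · intro g hg
    obtain ⟨i, hi, rfl⟩ := List.mem_map.1 hg
    have := List.mem_range.1 hi
    exact hadamard_isValid (by omega)
  · intro g hg
    simp only [treeLayers, List.mem_append, List.mem_map, List.mem_range] at hg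
    rcases hg with (((⟨j, hj, rfl⟩ | ⟨j, hj, rfl⟩) | ⟨j, hj, rfl⟩) | ⟨j, hj, rfl⟩) | ⟨j, hj,
        rfl⟩ <;>
      exact cnotGate_isValid (by omega) (by omega) (by omega)

section Distance

variable {B : (k : ℕ) → Set (Bits k)} {n m p : ℕ}

theorem targetLayers_flatten (B : (k : ℕ) → Set (Bits k)) (n m p s : ℕ) :
    (targetLayers B m n p s).flatten = hadamardLayer n ++
      (gate1 (2 * n - 2) (expX (rootAngle p s)) ::
        blockGates n m fun k => (blockU k (Real.pi / p) (B k))ᴴ) ++ blockGates n m cyclicC := by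
  simp only [targetLayers, List.flatten_cons, List.flatten_nil, List.append_nil, List.append_assoc]
  rfl

theorem targetLayers_isValid (hB : ∀ k, 1 ≤ k → IsHalf (B k)) (hn : 3 ≤ n) (hm : 1 ≤ m)
    (hp : 3 ≤ p) (s : ℕ) : ∀ g ∈ (targetLayers B m n p s).flatten, g.IsValid (2 * n - 1) := by
  intro g hg
  rw [targetLayers_flatten] at hg
  simp only [hadamardLayer, List.mem_append, List.mem_cons, List.mem_map,
    List.mem_range] at hg
  rcases hg with (⟨i, hi, rfl⟩ | rfl | hg) | hg
  · exact hadamard_isValid (by omega)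
  · exact expX_isValid (by omega) _
  · have h1 := blockGates_wires hm hg
    refine ⟨h1.1, fun j => by have := h1.2 j; omega, ?_⟩
    obtain ⟨b, hb, rfl⟩ := List.mem_map.1 hg
    have h2 := (mem_blocks_bounds hm hb).2.1
    have h3 : 0 < b.2 := by omega
    exact Unitary.star_mem (blockU_mem (sin_pow_lt_one h3 hp) (hB b.2 h3))
  · have h1 := blockGates_wires hm hg
    refine ⟨h1.1, fun j => by have := h1.2 j; omega, ?_⟩
    obtain ⟨b, hb, rfl⟩ := List.mem_map.1 hg
    change cyclicC b.2 ∈ _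
    rw [cyclicC_eq]
    exact permMat_mem _

theorem sum_targetDist (hB : ∀ k, 1 ≤ k → IsHalf (B k)) (hn : 3 ≤ n) (hm : 1 ≤ m)
    (hp : 3 ≤ p) (s : ZMod p) : ∑ y, targetDist B m n p s y = 1 := by
  change ∑ y, ‖applyList (targetLayers B m n p s.val).flatten (bpmState n) y‖ ^ 2 = 1
  rw [← stateNorm_sq, stateNorm_applyList _ (targetLayers_isValid hB hn hm hp _),
    stateNorm_bpmState hn, one_pow]

/-- The target distribution is close to the Born distribution of the approximate target state. -/
theorem sum_abs_targetDist_sub_le (hB : ∀ k, 1 ≤ k → IsHalf (B k)) (hn : 3 ≤ n) (hm : 1 ≤ m)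
    (hmn : m ≤ n - 1) (hp : 3 ≤ p) (s : ZMod p) {ε : ℝ} (hε : Real.sin (Real.pi / p) ^ m ≤ ε)
    (hε' : ε ≤ 1 / 2) :
    ∑ y : Bits (2 * n - 1), |targetDist B m n p s y - idealDist n m p s.val y.at| ≤
      ((1 + 2 ^ (2 * m) * (2 * ε)) ^ n - 1) * (1 + (1 + 2 ^ (2 * m) * (2 * ε)) ^ n) := by
  set θ := Real.pi / p with hθ
  have hp0 : (0 : ℝ) < p := by positivity
  have hsin0 : 0 ≤ Real.sin θ := Real.sin_nonneg_of_nonneg_of_le_pi (by positivity)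
    (div_le_self Real.pi_pos.le (by exact_mod_cast (by omega : 1 ≤ p)))
  have hε0 : 0 ≤ ε := le_trans (by positivity) hε
  set η := 2 ^ (2 * m) * (2 * ε) with hη
  have hη0 : 0 ≤ η := by positivity
  set ψ := applyList (targetLayers B m n p s.val).flatten (bpmState n) with hψ
  set φ := applyList (idealGates n m θ (rootAngle p s.val)) (bpmState n) with hφ
  have hvalid := targetLayers_isValid hB hn hm hp s.val
  have hψ1 : stateNorm ψ = 1 := by
    rw [hψ, stateNorm_applyList _ hvalid, stateNorm_bpmState hn]
  -- the two circuits share the unitary cyclic shifts at the end and differ in the unitaries of the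
  -- at most `n` blocks only, each of which contributes a factor `1 + η`
  have hd : stateNorm (ψ - φ) ≤ (1 + η) ^ n - 1 := by
    rw [hψ, hφ, targetLayers_flatten, idealGates]
    rw [targetLayers_flatten] at hvalid
    rw [applyList_append, applyList_append (_ ++ _) (blockGates n m cyclicC), ← applyList_sub,
      stateNorm_applyList (blockGates n m cyclicC)]
    swap
    · exact fun g hg => hvalid g (List.mem_append_right _ hg)
    simp only [applyList_append, applyList_cons]
    set ξ := (gate1 (2 * n - 2) (expX (rootAngle p s.val))).apply
      (applyList (hadamardLayer n) (bpmState n)) with hξ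
    have hξ1 : stateNorm ξ = 1 := by
      rw [hξ, (expX_isValid (by omega) _).stateNorm_apply, stateNorm_applyList,
        stateNorm_bpmState hn]
      exact fun g hg => hvalid g (List.mem_append_left _ (List.mem_append_left _ hg))
    have h1 := stateNorm_perturb (q := 2 * n - 1) (blocks n m) (fun b => b.2)
      (fun b j => n - 1 + b.1 + j) (fun b => (blockU b.2 θ (B b.2))ᴴ)
      (fun b => (cyclicA b.2 θ)ᴴ) hη0
      (fun b hb => hvalid _ (List.mem_append_left _ (List.mem_append_right _
        (List.mem_cons_of_mem _ (List.mem_map.2 ⟨b, hb, rfl⟩))))) (fun b hb χ => ?_) ξ ξ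
    · have h0 : stateNorm (ξ - ξ) = 0 := by
        rw [sub_self, stateNorm, WithLp.toLp_zero, norm_zero]
      rw [hξ1, h0, add_zero, mul_one] at h1
      have h2 : (1 + η) ^ (blocks n m).length ≤ (1 + η) ^ n := by
        refine pow_le_pow_right₀ (by linarith) ?_
        rw [blocks, List.length_map, List.length_range]
        exact (Nat.div_le_self _ _).trans (Nat.sub_le _ _)
      rw [le_sub_iff_add_le']
      exact h1.trans h2
    · have hb' := mem_blocks_bounds hm hb
      -- a block has between `m` and `2 m - 1` qubits: the lower bound makes the overlap small, the
      -- upper bound controls the passage from matrix entries to the operator norm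
      have hs : |Real.sin θ| ^ b.2 ≤ ε := by
        rw [abs_of_nonneg hsin0]
        exact (pow_le_pow_of_le_one hsin0 (Real.sin_le_one _) hb'.2.1).trans hε
      have h3 := stateNorm_apply_le (q := 2 * n - 1)
        (g := ⟨b.2, fun j => n - 1 + b.1 + j, (blockU b.2 θ (B b.2))ᴴ - (cyclicA b.2 θ)ᴴ⟩)
        (blockGates_wires hm (M := fun k => (blockU k θ (B k))ᴴ - (cyclicA k θ)ᴴ)
          (List.mem_map.2 ⟨b, hb, rfl⟩)).1
        (fun j => ((blockGates_wires hm (M := fun k => (blockU k θ (B k))ᴴ - (cyclicA k θ)ᴴ)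
          (List.mem_map.2 ⟨b, hb, rfl⟩)).2 j).trans_le (by omega)) (e := 2 * ε) (by positivity)
              (fun y x => by
            change ‖star (blockU b.2 θ (B b.2) x y) - star (cyclicA b.2 θ x y)‖ ≤ _
            rw [← star_sub, norm_star]
            exact (norm_blockU_sub_le (B b.2) (hs.trans hε') x y).trans (by linarith)) χ
      refine h3.trans (mul_le_mul_of_nonneg_right ?_ (stateNorm_nonneg _))
      exact mul_le_mul_of_nonneg_right (pow_le_pow_right₀ (by norm_num) hb'.2.2.le) (by positivity)
  have h2 := sum_abs_born_sub_le ψ φ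
  rw [hψ1] at h2
  calc _ = ∑ x, |‖ψ x‖ ^ 2 - ‖φ x‖ ^ 2| := by
        refine Finset.sum_congr rfl fun y _ => ?_
        rw [hφ, norm_idealGates_eq_idealDist (by omega) hm hmn (by omega)]
        rfl
    _ ≤ _ := h2
    _ ≤ _ := by
      have := stateNorm_nonneg (ψ - φ)
      exact mul_le_mul hd (by linarith) (by linarith) (by linarith)

end Distance

end ShallowLearning
end

section
open scoped Matrix
namespace ShallowLearning

/-! ### Equidistribution of the signed sums -/

section Mixing

variable {n m p : ℕ}

theorem treeSum_congr (hm : 1 ≤ m) (hmn : m ≤ n - 1) {y y' : ℕ → Bool}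
    (h : ∀ v < 2 * n - 2, y v = y' v) : treeSum n m y = treeSum n m y' := by
  refine Finset.sum_congr rfl fun i hi => ?_
  have hi' := Finset.mem_range.1 hi
  have := blockPred_lt hm hmn (blockPred_lt hm hmn hi')
  rw [h _ (by omega), pathSum_congr fun t ht => h t (by omega)]

/-- The parity of the vertex bits is independent of the signed sum, because the root bit enters the
former only. -/
theorem sum_vertexSign_mul (hn : 2 ≤ n) (hm : 1 ≤ m) (hmn : m ≤ n - 1) (f : ℤ → ℝ) :
    ∑ y : Bits (2 * n - 1), vertexSign n y.at * f (treeSum n m y.at) = 0 := by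
  let r : Fin (2 * n - 1) := ⟨2 * n - 2, by omega⟩
  let flip : Bits (2 * n - 1) → Bits (2 * n - 1) := fun y => Function.update y r (!y r)
  have hflip : Function.Involutive flip := fun y => by simp [flip]
  have hat : ∀ y : Bits (2 * n - 1), ∀ v < 2 * n - 2, (flip y).at v = y.at v := fun y v hv => by
    rw [Bits.at_of_lt _ (by omega), Bits.at_of_lt _ (by omega)]
    exact Function.update_of_ne
        (fun h => by have := congrArg Fin.val h; simp only [r] at this; omega) _ _
  have hr : ∀ y : Bits (2 * n - 1), (flip y).at (2 * n - 2) = !y.at (2 * n - 2) := fun y => by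
    rw [Bits.at_of_lt _ (by omega), Bits.at_of_lt _ (by omega)]
    exact Function.update_self ..
  have h1 : ∀ y, vertexSign n (flip y).at * f (treeSum n m (flip y).at) =
      -(vertexSign n y.at * f (treeSum n m y.at)) := fun y => by
    rw [treeSum_congr hm hmn (hat y), vertexSign, vertexSign]
    obtain ⟨k, rfl⟩ : ∃ k, n = k + 1 := ⟨n - 1, by omega⟩
    rw [Finset.prod_range_succ, Finset.prod_range_succ,
      show k + 1 - 1 + k = 2 * (k + 1) - 2 by omega, hr,
      Finset.prod_congr rfl fun i hi => by
        have := Finset.mem_range.1 hi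
        rw [hat y (k + 1 - 1 + i) (by omega)]]
    have : ∀ b, bitSign (!b) = -bitSign b := fun b => by cases b <;> simp [bitSign]
    rw [this]
    ring
  have h2 := Equiv.sum_comp hflip.toPerm
    fun y : Bits (2 * n - 1) => vertexSign n y.at * f (treeSum n m y.at)
  simp only [Function.Involutive.coe_toPerm, h1, Finset.sum_neg_distrib] at h2
  linarith

/-- `|1 + exp (2 i a)| = 2 |cos a|`, and `a = π j / p` is at distance at least `π / p` from the
multiples of `π`. -/
theorem norm_one_add_stdAddChar_le [NeZero p] {j : ZMod p} (hj : j ≠ 0) :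
    ‖1 + ZMod.stdAddChar j‖ ≤ 2 * Real.cos (Real.pi / p) := by
  have hp : (0 : ℝ) < p := by exact_mod_cast Nat.pos_of_ne_zero (NeZero.ne p)
  have hv1 : 1 ≤ j.val := Nat.one_le_iff_ne_zero.2 ((ZMod.val_ne_zero j).2 hj)
  have hv2 : j.val + 1 ≤ p := j.val_lt
  have hv1' : (1 : ℝ) ≤ j.val := by exact_mod_cast hv1
  have hv2' : (j.val : ℝ) + 1 ≤ p := by exact_mod_cast hv2
  set a : ℝ := Real.pi * j.val / p with ha
  have h1 : ZMod.stdAddChar j = Complex.exp (a * Complex.I) * Complex.exp (a * Complex.I) := by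
    have h2 : (j : ZMod p) = ((j.val : ℤ) : ZMod p) := by simp
    rw [h2, ZMod.stdAddChar_coe, ← Complex.exp_add, ha]
    congr 1
    push_cast
    ring
  have h2 : 1 + ZMod.stdAddChar j = Complex.exp (a * Complex.I) * (2 * Real.cos a : ℝ) := by
    have h3 : Complex.exp (a * Complex.I) * Complex.exp (-(a * Complex.I)) = 1 := by
      rw [← Complex.exp_add, add_neg_cancel, Complex.exp_zero]
    rw [h1]
    push_cast
    rw [Complex.two_cos, ← h3, neg_mul]
    ring
  rw [h2, norm_mul, Complex.norm_exp_ofReal_mul_I, one_mul, Complex.norm_real, Real.norm_eq_abs,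
    abs_mul, abs_of_nonneg (by norm_num : (0 : ℝ) ≤ 2)]
  refine mul_le_mul_of_nonneg_left (abs_le.2 ⟨?_, ?_⟩) (by norm_num)
  · rw [← Real.cos_pi_sub]
    refine Real.cos_le_cos_of_nonneg_of_le_pi (by positivity) ?_ ?_
    · have : 0 ≤ Real.pi / p := by positivity
      linarith
    · rw [ha, le_sub_iff_add_le, ← add_div, div_le_iff₀ hp]
      nlinarith [Real.pi_pos]
  · refine Real.cos_le_cos_of_nonneg_of_le_pi (by positivity) ?_ ?_
    · rw [ha, div_le_iff₀ hp]
      nlinarith [Real.pi_pos]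
    · rw [ha]
      gcongr
      nlinarith [Real.pi_pos]

theorem addChar_map_sum {A : Type*} [AddCommMonoid A] (ψ : AddChar A ℂ) {ι : Type*} (s : Finset ι)
    (f : ι → A) : ψ (∑ i ∈ s, f i) = ∏ i ∈ s, ψ (f i) := by
  classical
  induction s using Finset.induction_on with
  | empty => simp
  | insert a s ha ih => rw [Finset.sum_insert ha, Finset.prod_insert ha, AddChar.map_add_eq_mul, ih]

/-- For fixed edge bits the signs in the signed sum are fixed, so that the character sum over the
vertex bits is a product: each of the `n - 1` vertex qubits below the root contributes a factor `1 +
χ (± j)`, and the root qubit a factor `2`. -/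
theorem norm_sum_stdAddChar_treeSum_le [NeZero p] (hn : 2 ≤ n) (hm : 1 ≤ m) (hmn : m ≤ n - 1)
    {j : ZMod p} (hj : j ≠ 0) :
    ‖∑ y : Bits (2 * n - 1), ZMod.stdAddChar (j * (treeSum n m y.at : ZMod p))‖ ≤
      2 ^ (2 * n - 1) * Real.cos (Real.pi / p) ^ (n - 1) := by
  classical
  -- the vertex bit at `i` enters the signed sum with the sign of node `τ i + 1`
  obtain ⟨τ, hτ⟩ : ∃ τ : ℕ → ℕ, ∀ i < n - 1, τ (blockPred n m (blockPred n m i)) = i := by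
    have hinj : Set.InjOn (fun i => blockPred n m (blockPred n m i)) (Finset.range (n - 1)) := by
      intro i hi i' hi' h
      have hi2 : i < n - 1 := by simpa using hi
      have hi3 : i' < n - 1 := by simpa using hi'
      exact blockPred_injOn hm hmn hi hi' (blockPred_injOn hm hmn
        (by simpa using blockPred_lt hm hmn hi2) (by simpa using blockPred_lt hm hmn hi3) h)
    exact ⟨_, fun i hi => hinj.leftInvOn_invFunOn (by simpa using hi)⟩
  -- the summand as a product over the qubits, for fixed edge bits
  let sg : (Bits (n - 1)) → ℕ → ℤ := fun e i => if pathSum e.at (i + 1) then -1 else 1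
  let F : Bits (n - 1) → ℕ → Bool → ℂ := fun e v c =>
    if v < n - 1 then (if c = e.at v then 1 else 0)
    else if v < 2 * n - 2 then
      (if c then ZMod.stdAddChar (j * (sg e (τ (v - (n - 1))) : ZMod p)) else 1)
    else 1
  have hF : ∀ y : Bits (2 * n - 1), ZMod.stdAddChar (j * (treeSum n m y.at : ZMod p)) =
      ∑ e : Bits (n - 1), ∏ v : Fin (2 * n - 1), F e v (y v) := by
    intro y
    have hsplit : ∀ e : Bits (n - 1), ∏ v : Fin (2 * n - 1), F e v (y v) =
        (∏ v ∈ Finset.range (n - 1), if y.at v = e.at v then (1 : ℂ) else 0) *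
        ∏ i ∈ Finset.range (n - 1), if y.at (n - 1 + i) then
          ZMod.stdAddChar (j * (sg e (τ i) : ZMod p)) else 1 := by
      intro e
      have h0 : ∏ v : Fin (2 * n - 1), F e v (y v) =
          ∏ v ∈ Finset.range ((n - 1) + ((n - 1) + 1)), F e v (y.at v) := by
        rw [show (n - 1) + ((n - 1) + 1) = 2 * n - 1 by omega, ← Fin.prod_univ_eq_prod_range
          (fun v => F e v (y.at v))]
        simp only [Bits.at_val]
      rw [h0, Finset.prod_range_add, Finset.prod_range_succ]
      congr 1
      · refine Finset.prod_congr rfl fun v hv => ?_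
        simp only [F, if_pos (Finset.mem_range.1 hv)]
      · simp only [F, if_neg (show ¬ n - 1 + (n - 1) < n - 1 by omega),
          if_neg (show ¬ n - 1 + (n - 1) < 2 * n - 2 by omega), mul_one]
        refine Finset.prod_congr rfl fun i hi => ?_
        have := Finset.mem_range.1 hi
        rw [if_neg (by omega), if_pos (by omega), Nat.add_sub_cancel_left]
    simp only [hsplit]
    rw [Finset.sum_eq_single fun v : Fin (n - 1) => y.at v]
    · rw [Finset.prod_eq_one, one_mul]
      · have h1 := prod_blockPred hm hmn fun i => if y.at (n - 1 + i) then
          ZMod.stdAddChar (j * (sg (fun v => y.at v) (τ i) : ZMod p)) else 1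
        have h2 := prod_blockPred hm hmn fun i => if y.at (n - 1 + blockPred n m i) then
          ZMod.stdAddChar (j * (sg (fun v => y.at v) (τ (blockPred n m i)) : ZMod p)) else 1
        rw [← h1, ← h2, treeSum, Int.cast_sum, Finset.mul_sum, addChar_map_sum]
        refine Finset.prod_congr rfl fun i hi => ?_
        have hi' := Finset.mem_range.1 hi
        rw [hτ i hi']
        have h3 : pathSum (Bits.at fun v : Fin (n - 1) => y.at v) (i + 1) = pathSum y.at (i + 1) :=
          pathSum_congr fun t ht => by rw [Bits.at_of_lt _ (by omega)]
        simp only [sg, h3]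
        split_ifs <;> simp
      · intro v hv
        rw [if_pos]
        rw [Bits.at_of_lt (q := n - 1) _ (Finset.mem_range.1 hv)]
    · intro e _ he
      obtain ⟨v, hv⟩ : ∃ v, e v ≠ y.at v := by
        by_contra! h
        exact he (funext h)
      rw [Finset.prod_eq_zero (Finset.mem_range.2 v.2), zero_mul]
      rw [if_neg]
      rw [Bits.at_val]
      exact fun h => hv h.symm
    · simp
  have hFn : ∀ e : Bits (n - 1), ‖∑ y : Bits (2 * n - 1), ∏ v : Fin (2 * n - 1), F e v (y v)‖ ≤
      2 * (2 * Real.cos (Real.pi / p)) ^ (n - 1) := by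
    intro e
    rw [sum_bits_prod fun v c => F e v c, norm_prod]
    have h0 : ∏ v : Fin (2 * n - 1), ‖∑ c, F e v c‖ =
        ∏ v ∈ Finset.range ((n - 1) + ((n - 1) + 1)), ‖∑ c, F e v c‖ := by
      rw [show (n - 1) + ((n - 1) + 1) = 2 * n - 1 by omega, ← Fin.prod_univ_eq_prod_range
        (fun v => ‖∑ c, F e v c‖)]
    rw [h0, Finset.prod_range_add, Finset.prod_range_succ, Finset.prod_eq_one, one_mul]
    · have h2 : ‖∑ c, F e (n - 1 + (n - 1)) c‖ = 2 := by
        simp only [F, if_neg (show ¬ n - 1 + (n - 1) < n - 1 by omega),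
          if_neg (show ¬ n - 1 + (n - 1) < 2 * n - 2 by omega)]
        simp
      rw [h2, mul_comm]
      refine mul_le_mul_of_nonneg_left ?_ (by norm_num)
      have h3 : (2 * Real.cos (Real.pi / p)) ^ (n - 1) =
          ∏ i ∈ Finset.range (n - 1), 2 * Real.cos (Real.pi / p) := by
        rw [Finset.prod_const, Finset.card_range]
      rw [h3]
      refine Finset.prod_le_prod (fun _ _ => norm_nonneg _) fun i hi => ?_
      have := Finset.mem_range.1 hi
      simp only [F, if_neg (show ¬ n - 1 + i < n - 1 by omega),
        if_pos (show n - 1 + i < 2 * n - 2 by omega), Fintype.sum_bool, if_true,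
        Bool.false_eq_true, if_false]
      rw [add_comm]
      refine norm_one_add_stdAddChar_le ?_
      simp only [sg]
      split_ifs <;> simpa using hj
    · intro v hv
      have := Finset.mem_range.1 hv
      simp only [F, if_pos this]
      cases e.at v <;> simp
  simp only [hF]
  rw [Finset.sum_comm]
  refine (norm_sum_le _ _).trans ((Finset.sum_le_sum fun e _ => hFn e).trans ?_)
  rw [Finset.sum_const, Finset.card_univ, Fintype.card_fun, Fintype.card_bool, Fintype.card_fin,
    nsmul_eq_mul, mul_pow]
  push_cast
  have : (2 : ℝ) ^ (2 * n - 1) = 2 ^ (n - 1) * (2 * 2 ^ (n - 1)) := by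
    rw [← pow_succ', ← pow_add]
    congr 1
    omega
  rw [this]
  exact le_of_eq (by ring)

/-- For uniformly random bits, the signed sum is nearly uniform modulo `p`. -/
theorem abs_sum_treeSum_sub_le [NeZero p] (hn : 2 ≤ n) (hm : 1 ≤ m) (hmn : m ≤ n - 1)
    {F : ZMod p → ℝ} (hF : ∀ r, |F r| ≤ 1) :
    |(1 / 2) ^ (2 * n - 1) * ∑ y : Bits (2 * n - 1), F (treeSum n m y.at : ZMod p) -
      1 / p * ∑ r, F r| ≤ p * |Real.cos (Real.pi / p)| ^ (n - 1) := by
  have hp : (0 : ℝ) < p := by exact_mod_cast Nat.pos_of_ne_zero (NeZero.ne p)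
  have hp' : (p : ℂ) ≠ 0 := by exact_mod_cast hp.ne'
  set T : Bits (2 * n - 1) → ZMod p := fun y => (treeSum n m y.at : ZMod p) with hT
  set χ : ZMod p → ℂ := fun x => ZMod.stdAddChar x with hχ
  have hind : ∀ x : ZMod p, ∑ j : ZMod p, χ (j * x) = if x = 0 then (p : ℂ) else 0 := fun x => by
    have := AddChar.sum_mulShift x (ZMod.isPrimitive_stdAddChar p)
    rw [this, ZMod.card]
    simp
  -- Fourier inversion of `F`
  have hexp : ∀ y, ((F (T y) : ℝ) : ℂ) =
      1 / p * ∑ r, (F r : ℂ) * ∑ j : ZMod p, χ (j * T y) * χ (-(j * r)) := fun y => by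
    have h1 : ∀ r, ∑ j : ZMod p, χ (j * T y) * χ (-(j * r)) =
        if T y = r then (p : ℂ) else 0 := fun r => by
      rw [← if_congr (sub_eq_zero (a := T y) (b := r)) rfl rfl, ← hind]
      refine Finset.sum_congr rfl fun j _ => ?_
      simp only [hχ]
      rw [← AddChar.map_add_eq_mul]
      congr 1
      ring
    simp only [h1, mul_ite, mul_zero, Finset.sum_ite_eq, Finset.mem_univ, if_true]
    field_simp
  -- the zero mode is the average of `F`; only the other modes are left
  have hmain : (((1 / 2) ^ (2 * n - 1) * ∑ y, F (T y) - 1 / p * ∑ r, F r : ℝ) : ℂ) =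
      1 / p * ∑ r, (F r : ℂ) * ∑ j ∈ Finset.univ.erase (0 : ZMod p),
        χ (-(j * r)) * ((1 / 2) ^ (2 * n - 1) * ∑ y, χ (j * T y)) := by
    have h1 : (((1 / 2) ^ (2 * n - 1) * ∑ y, F (T y) : ℝ) : ℂ) =
        1 / p * ∑ r, (F r : ℂ) * ∑ j : ZMod p,
          χ (-(j * r)) * ((1 / 2) ^ (2 * n - 1) * ∑ y, χ (j * T y)) := by
      push_cast
      simp only [hexp]
      rw [← Finset.mul_sum, mul_left_comm]
      congr 1
      rw [Finset.sum_comm, Finset.mul_sum]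
      refine Finset.sum_congr rfl fun r _ => ?_
      rw [← Finset.mul_sum, mul_left_comm]
      congr 1
      rw [Finset.sum_comm, Finset.mul_sum]
      refine Finset.sum_congr rfl fun j _ => ?_
      rw [← Finset.sum_mul]
      ring
    have h0 : ∀ r, χ (-((0 : ZMod p) * r)) * ((1 / 2) ^ (2 * n - 1) * ∑ y, χ (0 * T y)) = 1 :=
      fun r => by
        simp only [hχ, zero_mul, neg_zero, AddChar.map_zero_eq_one, Finset.sum_const,
          Finset.card_univ, Fintype.card_fun, Fintype.card_bool, Fintype.card_fin, nsmul_eq_mul,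
          one_mul, mul_one]
        push_cast
        rw [← mul_pow]
        norm_num
    rw [Complex.ofReal_sub, h1]
    simp only [← Finset.add_sum_erase Finset.univ _ (Finset.mem_univ (0 : ZMod p)), h0, mul_add,
      mul_one, Finset.sum_add_distrib]
    push_cast
    ring
  rw [← Real.norm_eq_abs, ← Complex.norm_real, hmain, norm_mul, norm_div, norm_one,
    Complex.norm_natCast]
  set κ := |Real.cos (Real.pi / p)| ^ (n - 1)
  have hχ1 : ∀ x, ‖χ x‖ = 1 := fun x => AddChar.norm_apply _ _
  have hb : ∀ r, ‖(F r : ℂ) * ∑ j ∈ Finset.univ.erase (0 : ZMod p),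
      χ (-(j * r)) * ((1 / 2) ^ (2 * n - 1) * ∑ y, χ (j * T y))‖ ≤ p * κ := fun r => by
    rw [norm_mul, Complex.norm_real, Real.norm_eq_abs]
    have h2 : ‖∑ j ∈ Finset.univ.erase (0 : ZMod p),
        χ (-(j * r)) * ((1 / 2) ^ (2 * n - 1) * ∑ y, χ (j * T y))‖ ≤ p * κ := by
      refine (norm_sum_le _ _).trans ?_
      have h3 : ∀ j ∈ Finset.univ.erase (0 : ZMod p),
          ‖χ (-(j * r)) * ((1 / 2) ^ (2 * n - 1) * ∑ y, χ (j * T y))‖ ≤ κ := fun j hj => by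
        rw [norm_mul, hχ1, one_mul, norm_mul, norm_pow, norm_div, norm_one, RCLike.norm_ofNat]
        have h4 := norm_sum_stdAddChar_treeSum_le (n := n) (m := m) hn hm hmn
          (Finset.ne_of_mem_erase hj)
        have h5 : Real.cos (Real.pi / p) ^ (n - 1) ≤ κ :=
          (le_abs_self _).trans_eq (abs_pow _ _)
        calc (1 / 2 : ℝ) ^ (2 * n - 1) * ‖∑ y, χ (j * T y)‖
            ≤ (1 / 2) ^ (2 * n - 1) * (2 ^ (2 * n - 1) * Real.cos (Real.pi / p) ^ (n - 1)) :=
              mul_le_mul_of_nonneg_left h4 (by positivity)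
          _ = Real.cos (Real.pi / p) ^ (n - 1) := by
              rw [← mul_assoc, ← mul_pow]
              norm_num
          _ ≤ κ := h5
      refine (Finset.sum_le_card_nsmul _ _ _ h3).trans ?_
      rw [nsmul_eq_mul]
      refine mul_le_mul_of_nonneg_right ?_ (by positivity)
      have := Finset.card_erase_le (s := (Finset.univ : Finset (ZMod p))) (a := 0)
      rw [Finset.card_univ, ZMod.card] at this
      exact_mod_cast this
    calc _ ≤ 1 * (p * κ) := mul_le_mul (hF r) h2 (norm_nonneg _) (by norm_num)
      _ = _ := one_mul _
  calc 1 / (p : ℝ) * ‖∑ r, (F r : ℂ) * ∑ j ∈ Finset.univ.erase (0 : ZMod p),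
        χ (-(j * r)) * ((1 / 2) ^ (2 * n - 1) * ∑ y, χ (j * T y))‖
      ≤ 1 / p * (p * (p * κ)) := by
        refine mul_le_mul_of_nonneg_left ((norm_sum_le _ _).trans ?_) (by positivity)
        refine (Finset.sum_le_card_nsmul _ _ _ fun r _ => hb r).trans ?_
        rw [nsmul_eq_mul, Finset.card_univ, ZMod.card]
    _ = p * κ := by field_simp

end Mixing

end ShallowLearning
end

section
open scoped Matrix
namespace ShallowLearning

/-! ### The expected scores -/

theorem cos_le_cos_of_mem {δ x : ℝ} (h0 : 0 ≤ δ) (h1 : δ ≤ x) (h2 : x ≤ 2 * Real.pi - δ) :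
    Real.cos x ≤ Real.cos δ := by
  rcases le_total x Real.pi with h | h
  · exact Real.cos_le_cos_of_nonneg_of_le_pi h0 h h1
  · rw [← Real.cos_two_pi_sub x]
    exact Real.cos_le_cos_of_nonneg_of_le_pi h0 (by linarith) (by linarith)

section Window

variable {p : ℕ} [NeZero p]

/-- The residues `1, …, (p - 1) / 2`, on which `sin (2 π x / p)` is positive. -/
def InWindow (x : ZMod p) : Prop := 1 ≤ x.val ∧ x.val ≤ (p - 1) / 2

instance (x : ZMod p) : Decidable (InWindow x) := inferInstanceAs (Decidable (_ ∧ _))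

/-- The function `sin (2 π x / p)` of a residue. -/
noncomputable def sinMod (x : ZMod p) : ℝ := Real.sin (2 * Real.pi * x.val / p)

theorem sinMod_intCast (z : ℤ) : sinMod (z : ZMod p) = Real.sin (2 * Real.pi * z / p) := by
  have hp : (p : ℝ) ≠ 0 := by exact_mod_cast NeZero.ne p
  have h1 : (((z : ZMod p).val : ℤ) : ℝ) = ((z % p : ℤ) : ℝ) := by rw [ZMod.val_intCast]
  have h2 : (z : ℝ) = ((z % p : ℤ) : ℝ) + p * ((z / p : ℤ) : ℝ) := by
    exact_mod_cast (Int.emod_add_mul_ediv z p).symm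
  rw [sinMod, h2, ← h1, Int.cast_natCast]
  rw [show 2 * Real.pi * (((z : ZMod p).val : ℝ) + p * ((z / p : ℤ) : ℝ)) / p =
    2 * Real.pi * ((z : ZMod p).val : ℝ) / p + ((z / p : ℤ) : ℝ) * (2 * Real.pi) by field_simp,
    Real.sin_add_int_mul_two_pi]

theorem abs_sinMod_le (x : ZMod p) : |sinMod x| ≤ 1 := Real.abs_sin_le_one _

theorem sum_window (hp : 3 ≤ p) (u : ZMod p) :
    ∑ x : ZMod p, (if InWindow x then sinMod (x + u) else 0) =
      ∑ k ∈ Finset.range ((p - 1) / 2), Real.sin (2 * Real.pi * (k + 1 + u.val) / p) := by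
  rw [← Finset.sum_filter]
  refine Finset.sum_nbij' (fun x => x.val - 1) (fun k => ((k + 1 : ℕ) : ZMod p)) ?_ ?_ ?_ ?_ ?_
  · intro x hx
    have := (Finset.mem_filter.1 hx).2
    rw [InWindow] at this
    exact Finset.mem_range.2 (by omega)
  · intro k hk
    have := Finset.mem_range.1 hk
    refine Finset.mem_filter.2 ⟨Finset.mem_univ _, ?_⟩
    rw [InWindow, ZMod.val_natCast_of_lt (by omega)]
    omega
  · intro x hx
    have := (Finset.mem_filter.1 hx).2.1
    rw [Nat.sub_add_cancel this, ZMod.natCast_zmod_val]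
  · intro k hk
    have := Finset.mem_range.1 hk
    rw [ZMod.val_natCast_of_lt (by omega), Nat.add_sub_cancel]
  · intro x hx
    have h1 := (Finset.mem_filter.1 hx).2.1
    have h2 : x + u = ((x.val + u.val : ℤ) : ZMod p) := by simp
    rw [h2, sinMod_intCast]
    have h3 : ((x.val - 1 : ℕ) : ℝ) = x.val - 1 := by push_cast [h1]; ring
    rw [h3]
    push_cast
    ring_nf

/-- The sum of the sines over a window of `(p - 1) / 2` consecutive residues, in closed form:
multiplied by `2 sin (π / p)` it telescopes. -/
theorem sum_sin_window (hp : Odd p) (u : ℝ) :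
    2 * Real.sin (Real.pi / p) *
      ∑ k ∈ Finset.range ((p - 1) / 2), Real.sin (2 * Real.pi * (k + 1 + u) / p) =
      Real.cos (2 * Real.pi * (u + 1 / 2) / p) + Real.cos (2 * Real.pi * u / p) := by
  have hp0 : (p : ℝ) ≠ 0 := by exact_mod_cast NeZero.ne p
  set f : ℕ → ℝ := fun k => Real.cos (2 * Real.pi * (k + u + 1 / 2) / p) with hf
  have h1 : ∀ k : ℕ, 2 * Real.sin (Real.pi / p) * Real.sin (2 * Real.pi * (k + 1 + u) / p) =
      f k - f (k + 1) := fun k => by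
    simp only [hf]
    rw [Real.cos_sub_cos]
    push_cast
    rw [show (2 * Real.pi * ((k : ℝ) + u + 1 / 2) / p + 2 * Real.pi *
        ((k : ℝ) + 1 + u + 1 / 2) / p) / 2 =
      2 * Real.pi * (k + 1 + u) / p by field_simp; ring,
      show (2 * Real.pi * ((k : ℝ) + u + 1 / 2) / p - 2 * Real.pi *
          ((k : ℝ) + 1 + u + 1 / 2) / p) / 2 =
      -(Real.pi / p) by field_simp; ring, Real.sin_neg]
    ring
  rw [Finset.mul_sum, Finset.sum_congr rfl fun k _ => h1 k, Finset.sum_range_sub']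
  obtain ⟨h, rfl⟩ := hp
  simp only [hf]
  rw [show (2 * h + 1 - 1) / 2 = h by omega]
  have h2 : 2 * Real.pi * ((h : ℝ) + u + 1 / 2) / ((2 * h + 1 : ℕ) : ℝ) =
      2 * Real.pi * u / ((2 * h + 1 : ℕ) : ℝ) + Real.pi := by
    field_simp
    push_cast
    ring
  rw [h2, Real.cos_add_pi]
  push_cast
  ring_nf

/-- The window aligned with the zero of the sine has the largest sum. -/
theorem sum_window_sub_le (hp : 3 ≤ p) (hodd : Odd p) {u : ZMod p} (hu : u ≠ 0) :
    ∑ x : ZMod p, (if InWindow x then sinMod (x + u) else 0) -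
      ∑ x : ZMod p, (if InWindow x then sinMod (x + 0) else 0) ≤ -(2 / p) := by
  have hp0 : (0 : ℝ) < p := by positivity
  have hp3 : (3 : ℝ) ≤ p := by exact_mod_cast hp
  have hpi := Real.pi_pos
  rw [sum_window hp, sum_window hp, ZMod.val_zero]
  have e1 := sum_sin_window hodd (u.val : ℝ)
  have e0 := sum_sin_window hodd ((0 : ℕ) : ℝ)
  set Hu := ∑ k ∈ Finset.range ((p - 1) / 2), Real.sin (2 * Real.pi * (k + 1 + u.val) / p)
  set H0 := ∑ k ∈ Finset.range ((p - 1) / 2), Real.sin (2 * Real.pi * (k + 1 + (0 : ℕ)) / p)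
  have hv1 : (1 : ℝ) ≤ u.val := by
    exact_mod_cast Nat.one_le_iff_ne_zero.2 ((ZMod.val_ne_zero u).2 hu)
  have hv2 : (u.val : ℝ) + 1 ≤ p := by exact_mod_cast u.val_lt
  have hθ : Real.pi / p ≤ Real.pi / 2 := by gcongr; linarith
  have hs : 2 / p ≤ Real.sin (Real.pi / p) := by
    have := Real.mul_le_sin (x := Real.pi / p) (by positivity) hθ
    calc (2 : ℝ) / p = 2 / Real.pi * (Real.pi / p) := by field_simp
      _ ≤ _ := this
  have hs0 : 0 < Real.sin (Real.pi / p) := lt_of_lt_of_le (by positivity) hs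
  -- for `u ≠ 0` both angles in the closed form stay away from the multiples of `2 π`
  have c1 : Real.cos (2 * Real.pi * u.val / p) ≤ Real.cos (2 * (Real.pi / p)) := by
    refine cos_le_cos_of_mem (by positivity) ?_ ?_
    · rw [le_div_iff₀ hp0]
      field_simp
      linarith
    · rw [div_le_iff₀ hp0]
      field_simp
      linarith
  have c2 : Real.cos (2 * Real.pi * (u.val + 1 / 2) / p) ≤ Real.cos (Real.pi / p) := by
    refine cos_le_cos_of_mem (by positivity) ?_ ?_
    · rw [le_div_iff₀ hp0]
      field_simp
      linarith
    · rw [div_le_iff₀ hp0]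
      field_simp
      linarith
  have c3 : Real.cos (2 * (Real.pi / p)) = 1 - 2 * Real.sin (Real.pi / p) ^ 2 := by
    rw [Real.cos_two_mul, Real.cos_sq']
    ring
  have c4 : Real.cos (2 * Real.pi * (((0 : ℕ) : ℝ) + 1 / 2) / p) = Real.cos (Real.pi / p) := by
    congr 1
    push_cast
    ring
  have c5 : Real.cos (2 * Real.pi * ((0 : ℕ) : ℝ) / p) = 1 := by simp
  rw [c4, c5] at e0
  have h : 2 * Real.sin (Real.pi / p) * (Hu - H0) ≤
      2 * Real.sin (Real.pi / p) * (-Real.sin (Real.pi / p)) := by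
    rw [mul_sub, e1, e0]
    nlinarith
  have := le_of_mul_le_mul_left h (by positivity)
  linarith

/-- The score of the candidate `t` on a sample. -/
noncomputable def score (n m : ℕ) (t : ZMod p) (y : ℕ → Bool) : ℝ :=
  if InWindow ((treeSum n m y : ZMod p) - t) then -vertexSign n y else 0

theorem abs_score_le (n m : ℕ) (t : ZMod p) (y : ℕ → Bool) : |score n m t y| ≤ 1 := by
  rw [score]
  split_ifs
  · rw [abs_neg, abs_vertexSign]
  · simp

/-- The constant part of the approximate target distribution does not contribute to the expected
scores, because the parity of the vertex bits is unbiased; in the other part the two parities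
cancel. -/
theorem sum_idealDist_score_sub {n m : ℕ} (hn : 2 ≤ n) (hm : 1 ≤ m) (hmn : m ≤ n - 1)
    (s t : ZMod p) :
    ∑ y : Bits (2 * n - 1), idealDist n m p s.val y.at * (score n m t y.at - score n m s y.at) =
      (1 / 2) ^ (2 * n - 1) * ∑ y : Bits (2 * n - 1),
        ((if InWindow ((treeSum n m y.at : ZMod p) - t) then 1 else 0) -
          (if InWindow ((treeSum n m y.at : ZMod p) - s) then 1 else 0)) *
          sinMod ((treeSum n m y.at : ZMod p) - s) := by
  set f : ℤ → ℝ := fun z => (if InWindow ((z : ZMod p) - t) then 1 else 0) -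
    (if InWindow ((z : ZMod p) - s) then 1 else 0) with hf
  have h1 : ∀ y : Bits (2 * n - 1), idealDist n m p s.val y.at *
      (score n m t y.at - score n m s y.at) =
      (1 / 2) ^ (2 * n - 1) * (f (treeSum n m y.at) * sinMod ((treeSum n m y.at : ZMod p) - s)) -
      (1 / 2) ^ (2 * n - 1) * (vertexSign n y.at * f (treeSum n m y.at)) := fun y => by
    have h2 : score n m t y.at - score n m s y.at = -(vertexSign n y.at * f
        (treeSum n m y.at)) := by
      simp only [score, hf]
      split_ifs <;> ring
    have h3 : sinMod ((treeSum n m y.at : ZMod p) - s) =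
        Real.sin (2 * Real.pi * ((treeSum n m y.at : ℤ) - s.val) / p) := by
      have := sinMod_intCast (p := p) (treeSum n m y.at - (s.val : ℤ))
      push_cast at this
      rw [ZMod.natCast_zmod_val] at this
      exact this
    have h4 : vertexSign n y.at * vertexSign n y.at = 1 := by
      rw [← sq, ← sq_abs, abs_vertexSign, one_pow]
    rw [h2, h3, idealDist]
    linear_combination (1 / 2) ^ (2 * n - 1) * f (treeSum n m y.at) *
      Real.sin (2 * Real.pi * ((treeSum n m y.at : ℤ) - s.val) / p) * h4
  simp only [h1]
  rw [Finset.sum_sub_distrib, ← Finset.mul_sum, ← Finset.mul_sum, sum_vertexSign_mul hn hm hmn,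
    mul_zero, sub_zero]

/-- The correct candidate has the largest expected score, for every distribution which is close to
that of the approximate target state. -/
theorem sum_score_sub_le {n m : ℕ} (hn : 2 ≤ n) (hm : 1 ≤ m) (hmn : m ≤ n - 1)
    (hp : 3 ≤ p) (hodd : Odd p) {s t : ZMod p} (hst : t ≠ s) {D : Bits (2 * n - 1) → ℝ} {e : ℝ}
    (hD : ∑ y : Bits (2 * n - 1), |D y - idealDist n m p s.val y.at| ≤ e)
    (he : 2 * e + p * |Real.cos (Real.pi / p)| ^ (n - 1) ≤ 1 / p ^ 2) :
    ∑ y : Bits (2 * n - 1), D y * (score n m t y.at - score n m s y.at) ≤ -(1 / p ^ 2) := by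
  have hp0 : (0 : ℝ) < p := by positivity
  set F : ZMod p → ℝ := fun r => ((if InWindow (r - t) then 1 else 0) -
    (if InWindow (r - s) then 1 else 0)) * sinMod (r - s) with hFd
  have hF : ∀ r, |F r| ≤ 1 := fun r => by
    simp only [hFd]
    rw [abs_mul]
    refine mul_le_one₀ ?_ (abs_nonneg _) (abs_sinMod_le _)
    split_ifs <;> simp
  have h1 := abs_le.1 (abs_sum_treeSum_sub_le hn hm hmn hF)
  -- for a uniformly distributed residue, the gap between the expected scores is at least `2 / p ^
  -- 2`
  have h2 : ∑ r, F r ≤ -(2 / p) := by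
    have e1 : ∑ r, F r = ∑ x : ZMod p, (if InWindow x then sinMod (x + (t - s)) else 0) -
        ∑ x : ZMod p, (if InWindow x then sinMod (x + 0) else 0) := by
      rw [← Equiv.sum_comp (Equiv.subRight t) fun x => if InWindow x then sinMod (x +
          (t - s)) else 0,
        ← Equiv.sum_comp (Equiv.subRight s) fun x => if InWindow x then sinMod (x + 0) else 0,
        ← Finset.sum_sub_distrib]
      refine Finset.sum_congr rfl fun r _ => ?_
      simp only [Equiv.subRight_apply, hFd, sub_add_sub_cancel, add_zero]
      split_ifs <;> ring
    rw [e1]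
    exact sum_window_sub_le hp hodd (sub_ne_zero.2 hst)
  have h3 : 1 / p * ∑ r, F r ≤ -(2 / p ^ 2) := by
    calc 1 / p * ∑ r, F r ≤ 1 / p * -(2 / p) := mul_le_mul_of_nonneg_left h2 (by positivity)
      _ = -(2 / p ^ 2) := by ring
  have h4 := sum_idealDist_score_sub hn hm hmn s t
  -- the difference of two scores has absolute value at most `2`
  have h5 : ∑ y : Bits (2 * n - 1), D y * (score n m t y.at - score n m s y.at) -
      ∑ y : Bits (2 * n - 1), idealDist n m p s.val y.at * (score n m t y.at - score n m s y.at) ≤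
      2 * e := by
    rw [← Finset.sum_sub_distrib]
    calc _ ≤ ∑ y : Bits (2 * n - 1), 2 * |D y - idealDist n m p s.val y.at| := by
          refine Finset.sum_le_sum fun y _ => ?_
          rw [← sub_mul]
          refine (le_abs_self _).trans ?_
          rw [abs_mul, mul_comm]
          refine mul_le_mul_of_nonneg_right ?_ (abs_nonneg _)
          refine (abs_sub _ _).trans ?_
          linarith [abs_score_le n m t y.at, abs_score_le n m s y.at]
      _ ≤ _ := by
        rw [← Finset.mul_sum]
        linarith
  have h6 : (2 : ℝ) / p ^ 2 = 2 * (1 / p ^ 2) := by ring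
  rw [h4] at h5
  linarith [h1.2]

end Window

/-! ### Concentration -/

section Concentration

variable {α : Type*} [Fintype α]

theorem sum_prod_eq_pow (g : α → ℝ) (M : ℕ) : ∑ ω : Fin M → α, ∏ i, g (ω i) = (∑ a, g a) ^ M := by
  classical
  rw [← Fintype.piFinset_univ, Finset.sum_prod_piFinset, Finset.prod_const, Finset.card_univ,
    Fintype.card_fin]

theorem iidProb_mono {D : α → ℝ} (hD : ∀ a, 0 ≤ D a) {M : ℕ} {E E' : Set (Fin M → α)}
    (h : E ⊆ E') : iidProb D M E ≤ iidProb D M E' := by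
  refine Finset.sum_le_sum fun ω _ => ?_
  exact Set.indicator_le_indicator_of_subset h (fun ω => Finset.prod_nonneg fun i _ => hD _) ω

/-- Markov's inequality for the exponential moment. -/
theorem iidProb_le_pow {D : α → ℝ} (hD : ∀ a, 0 ≤ D a) (hD1 : ∑ a, D a = 1) (M : ℕ) {Y : α → ℝ}
    (hY : ∀ a, |Y a| ≤ 2) {γ : ℝ} (hγ0 : 0 ≤ γ) (hγ : γ ≤ 1) (hm : ∑ a, D a * Y a ≤ -γ) :
    iidProb D M {ω | 0 ≤ ∑ i, Y (ω i)} ≤ (1 - γ ^ 2 / 16) ^ M := by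
  -- the exponent which minimises the bound `1 - l γ + 4 l ^ 2`
  set l := γ / 8 with hl
  have h1 : ∑ a, D a * Real.exp (l * Y a) ≤ 1 - γ ^ 2 / 16 := by
    have h2 : ∀ a, Real.exp (l * Y a) ≤ 1 + l * Y a + 4 * l ^ 2 := fun a => by
      have hY2 := abs_le.1 (hY a)
      have h3 : |l * Y a| ≤ 1 := by
        rw [abs_mul, abs_of_nonneg (by positivity)]
        nlinarith [hY a, abs_nonneg (Y a)]
      have h4 := (abs_le.1 (Real.abs_exp_sub_one_sub_id_le h3)).2
      have h5 : (l * Y a) ^ 2 ≤ 4 * l ^ 2 := by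
        rw [mul_pow, mul_comm]
        exact mul_le_mul_of_nonneg_right (by nlinarith) (sq_nonneg l)
      linarith
    calc _ ≤ ∑ a, D a * (1 + l * Y a + 4 * l ^ 2) :=
          Finset.sum_le_sum fun a _ => mul_le_mul_of_nonneg_left (h2 a) (hD a)
      _ = (∑ a, D a) * (1 + 4 * l ^ 2) + l * ∑ a, D a * Y a := by
          rw [Finset.sum_mul, Finset.mul_sum, ← Finset.sum_add_distrib]
          exact Finset.sum_congr rfl fun a _ => by ring
      _ ≤ 1 * (1 + 4 * l ^ 2) + l * (-γ) := by
          rw [hD1]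
          have := mul_le_mul_of_nonneg_left hm (by positivity : 0 ≤ l)
          linarith
      _ = _ := by rw [hl]; ring
  have h0 : 0 ≤ ∑ a, D a * Real.exp (l * Y a) :=
    Finset.sum_nonneg fun a _ => mul_nonneg (hD a) (Real.exp_pos _).le
  calc iidProb D M {ω | 0 ≤ ∑ i, Y (ω i)} ≤ ∑ ω : Fin M → α, ∏ i, D (ω i) * Real.exp (l * Y
      (ω i)) := by
        refine Finset.sum_le_sum fun ω _ => ?_
        have h3 : 0 ≤ ∏ i, D (ω i) := Finset.prod_nonneg fun i _ => hD _
        rw [Finset.prod_mul_distrib, ← Real.exp_sum, ← Finset.mul_sum]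
        by_cases hω : 0 ≤ ∑ i, Y (ω i)
        · rw [Set.indicator_of_mem (by exact hω)]
          refine le_mul_of_one_le_right h3 (Real.one_le_exp ?_)
          positivity
        · rw [Set.indicator_of_notMem (by exact hω)]
          positivity
    _ = (∑ a, D a * Real.exp (l * Y a)) ^ M := sum_prod_eq_pow (fun a => D a * Real.exp (l * Y a)) M
    _ ≤ _ := pow_le_pow_left₀ h0 h1 M

theorem iidProb_union_le {D : α → ℝ} (hD : ∀ a, 0 ≤ D a) {M : ℕ} {ι : Type*} (T : Finset ι)
    (E : ι → Set (Fin M → α)) : iidProb D M (⋃ t ∈ T, E t) ≤ ∑ t ∈ T, iidProb D M (E t) := by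
  simp only [iidProb]
  rw [Finset.sum_comm]
  refine Finset.sum_le_sum fun ω _ => ?_
  have h0 : 0 ≤ ∏ i, D (ω i) := Finset.prod_nonneg fun i _ => hD _
  by_cases h : ω ∈ ⋃ t ∈ T, E t
  · rw [Set.indicator_of_mem h]
    simp only [Set.mem_iUnion] at h
    obtain ⟨t, ht, hω⟩ := h
    rw [← Set.indicator_of_mem hω fun ω => ∏ i, D (ω i)]
    exact Finset.single_le_sum (f := fun t => (E t).indicator (fun ω => ∏ i, D (ω i)) ω)
      (fun t _ => Set.indicator_nonneg (fun ω _ => Finset.prod_nonneg fun i _ => hD _) ω) ht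
  · rw [Set.indicator_of_notMem h]
    exact Finset.sum_nonneg fun t _ =>
      Set.indicator_nonneg (fun ω _ => Finset.prod_nonneg fun i _ => hD _) ω

theorem iidProb_compl {D : α → ℝ} (hD1 : ∑ a, D a = 1) {M : ℕ} (E : Set (Fin M → α)) :
    iidProb D M Eᶜ = 1 - iidProb D M E := by
  have h : ∑ ω : Fin M → α, ∏ i, D (ω i) = 1 := by rw [sum_prod_eq_pow, hD1, one_pow]
  rw [← h, iidProb, iidProb, ← Finset.sum_sub_distrib]
  refine Finset.sum_congr rfl fun ω _ => ?_
  by_cases hω : ω ∈ E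
  · rw [Set.indicator_of_mem hω, Set.indicator_of_notMem (Set.notMem_compl_iff.2 hω), sub_self]
  · rw [Set.indicator_of_notMem hω, Set.indicator_of_mem hω, sub_zero]

/-- With high probability the candidate with the largest total score is the correct one: each of the
fewer than `p` wrong candidates wins with probability at most `δ / p`. -/
theorem one_sub_le_iidProb {p : ℕ} [NeZero p] {n m : ℕ} {s : ZMod p}
    {D : Bits (2 * n - 1) → ℝ} (hD : ∀ a, 0 ≤ D a) (hD1 : ∑ a, D a = 1)
    (hgap : ∀ t ≠ s, ∑ y : Bits (2 * n - 1), D y * (score n m t y.at - score n m s y.at) ≤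
      -(1 / p ^ 2))
    {δ : ℝ} (hδ : 0 < δ) {M : ℕ} (hM : 16 * (p : ℝ) ^ 4 * Real.log (p / δ) ≤ M) :
    1 - δ ≤ iidProb D M {ω | ∀ t ≠ s,
      ∑ i, score n m t (ω i).at < ∑ i, score n m s (ω i).at} := by
  classical
  have hp0 : (0 : ℝ) < p := by exact_mod_cast Nat.pos_of_ne_zero (NeZero.ne p)
  have hp1 : (1 : ℝ) ≤ p := by exact_mod_cast Nat.pos_of_ne_zero (NeZero.ne p)
  set γ : ℝ := 1 / p ^ 2 with hγ
  have hγ0 : 0 ≤ γ := by positivity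
  have hγ1 : γ ≤ 1 := by
    rw [hγ, div_le_one (by positivity)]
    exact one_le_pow₀ hp1
  have h1 : ∀ t ∈ Finset.univ.erase s, iidProb D M
      {ω | 0 ≤ ∑ i, (score n m t (ω i).at - score n m s (ω i).at)} ≤ δ / p := by
    intro t ht
    refine (iidProb_le_pow hD hD1 M (Y := fun y => score n m t y.at - score n m s y.at)
        (fun y => ?_)
      hγ0 hγ1 (hgap t (Finset.ne_of_mem_erase ht))).trans ?_
    · refine (abs_sub _ _).trans ?_
      linarith [abs_score_le n m t y.at, abs_score_le n m s y.at]
    · have h2 : (1 - γ ^ 2 / 16) ^ M ≤ Real.exp (-(γ ^ 2 / 16)) ^ M :=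
        pow_le_pow_left₀ (by nlinarith) (by linarith [Real.add_one_le_exp (-(γ ^ 2 / 16))]) M
      refine h2.trans ?_
      rw [← Real.exp_nat_mul, ← Real.exp_log (show 0 < δ / p by positivity), Real.exp_le_exp]
      have h3 : Real.log (δ / p) = -Real.log (p / δ) := by
        rw [← Real.log_inv, inv_div]
      rw [h3, mul_neg, neg_le_neg_iff]
      have h4 : γ ^ 2 * p ^ 4 = 1 := by
        rw [hγ]
        field_simp
      have h5 := mul_le_mul_of_nonneg_left hM (by positivity : 0 ≤ γ ^ 2)
      have h6 : γ ^ 2 * (16 * (p : ℝ) ^ 4 * Real.log (p / δ)) = 16 * Real.log (p / δ) := by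
        rw [← mul_assoc, mul_left_comm (γ ^ 2), h4, mul_one]
      linarith
  have h2 : iidProb D M (⋃ t ∈ Finset.univ.erase s,
      {ω | 0 ≤ ∑ i, (score n m t (ω i).at - score n m s (ω i).at)}) ≤ δ := by
    refine (iidProb_union_le hD _ _).trans ((Finset.sum_le_card_nsmul _ _ _ h1).trans ?_)
    rw [nsmul_eq_mul]
    have h3 : ((Finset.univ.erase s).card : ℝ) ≤ p := by
      have := Finset.card_erase_le (s := (Finset.univ : Finset (ZMod p))) (a := s)
      rw [Finset.card_univ, ZMod.card] at this
      exact_mod_cast this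
    calc _ ≤ p * (δ / p) := mul_le_mul_of_nonneg_right h3 (by positivity)
      _ = δ := by field_simp
  have h3 := iidProb_compl hD1 (⋃ t ∈ Finset.univ.erase s,
      {ω : Fin M → Bits (2 * n - 1) | 0 ≤ ∑ i, (score n m t (ω i).at - score n m s (ω i).at)})
  have h4 : (⋃ t ∈ Finset.univ.erase s,
      {ω : Fin M → Bits (2 * n - 1) | 0 ≤ ∑ i, (score n m t (ω i).at - score n m s (ω i).at)})ᶜ ⊆
      {ω | ∀ t ≠ s, ∑ i, score n m t (ω i).at < ∑ i, score n m s (ω i).at} := by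
    intro ω hω t ht
    simp only [Set.mem_compl_iff, Set.mem_iUnion, Set.mem_ofPred_eq, not_exists, not_le] at hω
    have := hω t (Finset.mem_erase.2 ⟨ht, Finset.mem_univ _⟩)
    rw [Finset.sum_sub_distrib] at this
    linarith
  have := iidProb_mono hD h4
  linarith

end Concentration

end ShallowLearning
end

section
open scoped Matrix
namespace ShallowLearning

/-! ### Programs and their running times -/

/-- Started in `σ`, the program `P` halts after at most `T` steps in a state which satisfies `Q`. -/
def Reach (P : Program) (σ : RamState) (T : ℕ) (Q : RamState → Prop) : Prop :=
  ∃ t τ, Exec P σ t τ ∧ t ≤ T ∧ Q τ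

theorem Reach.mono {P : Program} {σ : RamState} {T T' : ℕ} {Q Q' : RamState → Prop}
    (h : Reach P σ T Q) (hT : T ≤ T') (hQ : ∀ τ, Q τ → Q' τ) : Reach P σ T' Q' := by
  obtain ⟨t, τ, h1, h2, h3⟩ := h
  exact ⟨t, τ, h1, h2.trans hT, hQ τ h3⟩

theorem Reach.seq {P P' : Program} {σ : RamState} {T T' : ℕ} {Q Q' : RamState → Prop}
    (h : Reach P σ T Q) (h' : ∀ τ, Q τ → Reach P' τ T' Q') :
    Reach (.seq P P') σ (T + T') Q' := by
  obtain ⟨t, τ, h1, h2, h3⟩ := h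
  obtain ⟨t', τ', h1', h2', h3'⟩ := h' τ h3
  exact ⟨t + t', τ', .seq h1 h1', Nat.add_le_add h2 h2', h3'⟩

/-- A loop whose register counts down, with an invariant indexed by the number of rounds done. -/
theorem Reach.loop {r : ℕ} {P : Program} {σ : RamState} (N T : ℕ) (I : ℕ → RamState → Prop)
    (h0 : I 0 σ) (hN : σ.reg r = N)
    (step : ∀ k < N, ∀ τ, I k τ → τ.reg r = N - k →
      Reach P τ T fun υ => I (k + 1) υ ∧ υ.reg r = N - (k + 1)) :
    Reach (.loop r P) σ (N * (T + 1) + 1) (I N) := by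
  suffices h : ∀ j ≤ N, ∀ τ, I (N - j) τ → τ.reg r = j →
      Reach (.loop r P) τ (j * (T + 1) + 1) (I N) from
    h N le_rfl σ (by simpa using h0) hN
  intro j
  induction j with
  | zero => exact fun _ τ hI hr => ⟨1, τ, Exec.loop_stop hr, by omega, by simpa using hI⟩
  | succ j ih =>
    intro hj τ hI hr
    obtain ⟨t, υ, h1, h2, h3, h4⟩ := step (N - (j + 1)) (by omega) τ hI (by omega)
    obtain ⟨t', φ, h1', h2', h3'⟩ := ih (by omega) υ
      (by rwa [show N - j = N - (j + 1) + 1 by omega]) (by omega)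
    refine ⟨t + t' + 1, φ, .loop_step (by omega) h1 h1', ?_, h3'⟩
    have : (j + 1) * (T + 1) = j * (T + 1) + T + 1 := by ring
    omega

/-- Instructions without jumps. The instruction `sel r c a b` assigns `a` or `b` to `r`, according
to whether `c` is nonzero; it is implemented with the help of register `20`, which holds `0`. -/
inductive Instr : Type
  | con (r k : ℕ)
  | add (r a b : ℕ)
  | sub (r a b : ℕ)
  | ld (r a : ℕ)
  | st (a r : ℕ)
  | em (r : ℕ)
  | sel (r c a b : ℕ)

/-- The program which performs an instruction. -/
def Instr.prog : Instr → Program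
  | con r k => .const r k
  | add r a b => .plus r a b
  | sub r a b => .minus r a b
  | ld r a => .load r a
  | st a r => .store a r
  | em r => .emit r
  | sel r c a b => .cond c (.plus r a 20) (.plus r b 20)

/-- The effect of an instruction. -/
def Instr.eff : Instr → RamState → RamState
  | con r k, σ => { σ with reg := Function.update σ.reg r k }
  | add r a b, σ => { σ with reg := Function.update σ.reg r (σ.reg a + σ.reg b) }
  | sub r a b, σ => { σ with reg := Function.update σ.reg r (σ.reg a - σ.reg b) }
  | ld r a, σ => { σ with reg := Function.update σ.reg r (σ.mem (σ.reg a)) }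
  | st a r, σ => { σ with mem := Function.update σ.mem (σ.reg a) (σ.reg r) }
  | em r, σ => { σ with out := σ.out ++ [σ.reg r] }
  | sel r c a b, σ =>
      { σ with reg := Function.update σ.reg r (if σ.reg c = 0 then σ.reg b else σ.reg a) }

/-- The instruction does not write to any register in `S`. -/
def Instr.Keeps (S : ℕ → Prop) : Instr → Prop
  | con r _ | add r _ _ | sub r _ _ | ld r _ | sel r _ _ _ => ¬ S r
  | st _ _ | em _ => True

instance (S : ℕ → Prop) [DecidablePred S] (i : Instr) : Decidable (i.Keeps S) := by
  cases i <;> (unfold Instr.Keeps; infer_instance)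

theorem Instr.Keeps.reg_eff {S : ℕ → Prop} {i : Instr} (h : i.Keeps S) (σ : RamState) {r : ℕ}
    (hr : S r) : (i.eff σ).reg r = σ.reg r := by
  cases i <;> first
    | rfl
    | exact Function.update_of_ne (ne_of_mem_of_not_mem (s := {r | S r}) hr h) _ _

/-- The program which performs a list of instructions. The empty list has to be some program, and
assigning `0` to register `20`, which holds `0` anyway, changes nothing. -/
def blockProg : List Instr → Program
  | [] => .const 20 0
  | i :: l => .seq i.prog (blockProg l)

/-- The effect of a list of instructions. -/
def runBlock (l : List Instr) (σ : RamState) : RamState := l.foldl (fun σ i => i.eff σ) σ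

theorem runBlock_cons (i : Instr) (l : List Instr) (σ : RamState) :
    runBlock (i :: l) σ = runBlock l (i.eff σ) := rfl

theorem runBlock_append (l l' : List Instr) (σ : RamState) :
    runBlock (l ++ l') σ = runBlock l' (runBlock l σ) := List.foldl_append

theorem reg_runBlock {S : ℕ → Prop} {l : List Instr} (h : ∀ i ∈ l, i.Keeps S) (σ : RamState) {r : ℕ}
    (hr : S r) : (runBlock l σ).reg r = σ.reg r := by
  induction l generalizing σ with
  | nil => rfl
  | cons i l ih =>
    rw [runBlock_cons, ih (fun i hi => h i (List.mem_cons_of_mem _ hi)),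
      (h i (List.mem_cons_self ..)).reg_eff σ hr]

theorem Instr.exec_prog (i : Instr) (σ : RamState) (h : σ.reg 20 = 0) :
    ∃ t, Exec i.prog σ t (i.eff σ) ∧ t ≤ 2 := by
  cases i with
  | con r k => exact ⟨1, .const .., by omega⟩
  | add r a b => exact ⟨1, .plus .., by omega⟩
  | sub r a b => exact ⟨1, .minus .., by omega⟩
  | ld r a => exact ⟨1, .load .., by omega⟩
  | st a r => exact ⟨1, .store .., by omega⟩
  | em r => exact ⟨1, .emit .., by omega⟩
  | sel r c a b =>
    refine ⟨2, ?_, le_rfl⟩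
    by_cases hc : σ.reg c = 0
    · have := Exec.cond_false (P := .plus r a 20) hc (Exec.plus σ r b 20)
      rw [h, add_zero] at this
      simp only [Instr.eff, if_pos hc]
      exact this
    · have := Exec.cond_true (Q := .plus r b 20) hc (Exec.plus σ r a 20)
      rw [h, add_zero] at this
      simp only [Instr.eff, if_neg hc]
      exact this

theorem reach_block (l : List Instr) (hl : ∀ i ∈ l, i.Keeps (· = 20)) (σ : RamState)
    (h : σ.reg 20 = 0) : Reach (blockProg l) σ (2 * l.length + 1) (· = runBlock l σ) := by
  induction l generalizing σ with
  | nil =>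
    refine ⟨1, _, .const σ 20 0, le_rfl, ?_⟩
    rw [← h, Function.update_eq_self]
    rfl
  | cons i l ih =>
    have h2 := (hl i (List.mem_cons_self ..)).reg_eff σ (r := 20) rfl
    obtain ⟨t, h3, h4⟩ := i.exec_prog σ h
    refine (Reach.seq (Q := (· = i.eff σ)) (T' := 2 * l.length + 1) ⟨t, _, h3, h4, rfl⟩ ?_).mono
      ?_ fun _ h => h
    · rintro τ rfl
      exact ih (fun i hi => hl i (List.mem_cons_of_mem _ hi)) _ (h2.trans h)
    · simp only [List.length_cons]
      omega

/-! ### Writing circuit descriptions -/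

/-- A bound on the registers mentioned. -/
def Tok.size : Tok → ℕ
  | const _ => 0
  | reg r _ => r + 1

theorem Tok.eval_congr {R : ℕ} {ρ ρ' : ℕ → ℕ} (h : ∀ r < R, ρ r = ρ' r) {t : Tok}
    (ht : t.size ≤ R) : t.eval ρ = t.eval ρ' := by
  cases t with
  | const k => rfl
  | reg r k =>
    rw [Tok.size] at ht
    rw [Tok.eval, Tok.eval, h r ht]

/-- Assign the number denoted by a token to register `d`. -/
def evalTok (d : ℕ) : Tok → List Instr
  | .const k => [.con d k]
  | .reg r k => [.con d k, .add d r d]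

theorem runBlock_evalTok {d : ℕ} {t : Tok} (ht : t.size ≤ d) (σ : RamState) :
    runBlock (evalTok d t) σ = { σ with reg := Function.update σ.reg d (t.eval σ.reg) } := by
  cases t with
  | const k => rfl
  | reg r k =>
    have hr : r ≠ d := by
      rw [Tok.size] at ht
      omega
    simp [evalTok, runBlock, Instr.eff, Tok.eval, hr]

theorem evalTok_keeps {S : ℕ → Prop} {d : ℕ} (hd : ¬ S d) (t : Tok) :
    ∀ i ∈ evalTok d t, i.Keeps S := by
  cases t <;> simp [evalTok, Instr.Keeps, hd]

/-- Write the numbers denoted by a list of tokens. -/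
def emitToks (R : ℕ) (l : List Tok) : List Instr := l.flatMap fun t => evalTok R t ++ [.em R]

theorem emitToks_keeps {S : ℕ → Prop} {R : ℕ} (hR : ¬ S R) (l : List Tok) :
    ∀ i ∈ emitToks R l, i.Keeps S := by
  intro i hi
  obtain ⟨t, _, hi⟩ := List.mem_flatMap.1 hi
  rcases List.mem_append.1 hi with hi | hi
  · exact evalTok_keeps hR t i hi
  · rw [List.mem_singleton.1 hi]
    trivial

theorem out_runBlock_emitToks {R : ℕ} {l : List Tok} (hl : ∀ t ∈ l, t.size ≤ R) (σ : RamState) :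
    (runBlock (emitToks R l) σ).out = σ.out ++ l.map (Tok.eval σ.reg) := by
  induction l generalizing σ with
  | nil => simp [emitToks, runBlock]
  | cons t l ih =>
    have h1 : emitToks R (t :: l) = evalTok R t ++ ([.em R] ++ emitToks R l) := by
      simp [emitToks]
    have ht := hl t (List.mem_cons_self ..)
    rw [h1, runBlock_append, runBlock_append, ih fun t ht => hl t (List.mem_cons_of_mem _ ht),
      runBlock_evalTok ht]
    simp only [runBlock, List.foldl_cons, List.foldl_nil, Instr.eff, Function.update_self,
      List.map_cons, List.append_assoc, List.singleton_append]
    congr 2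
    refine List.map_congr_left fun u hu => Tok.eval_congr (R := R) (fun r hr => ?_)
      (hl u (List.mem_cons_of_mem _ hu))
    exact Function.update_of_ne hr.ne _ _

/-- A bound on the registers mentioned. -/
def LayerTmpl.size (l : LayerTmpl) : ℕ :=
  l.count.size + l.w₁.size + l.w₂.size + (l.gate.toks.map Tok.size).sum

/-- Write the number of gates, and load the first wires into registers `41` and `42`, the number of
gates into register `R + 3`, and the differences of the wires into registers `R + 5` and `R + 6`. -/
def layerInit (R : ℕ) (l : LayerTmpl) : List Instr :=
  evalTok (R + 1) l.w₁ ++ evalTok (R + 2) l.w₂ ++ evalTok (R + 3) l.count ++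
    [.em (R + 3), .add 41 (R + 1) 20, .add 42 (R + 2) 20, .con (R + 4) 1, .con (R + 5) l.s₁,
      .con (R + 6) l.s₂]

/-- Write one gate, and pass to the wires of the next one. -/
def layerBody (R : ℕ) (l : LayerTmpl) : List Instr :=
  emitToks R l.gate.toks ++
    [.add 41 41 (R + 5), .add 42 42 (R + 6), .sub (R + 3) (R + 3) (R + 4)]

/-- Write the description of a layer, using the registers from `R` on for the computation. -/
def layerProg (R : ℕ) (l : LayerTmpl) : Program :=
  .seq (blockProg (layerInit R l)) (.seq (.loop (R + 3) (blockProg (layerBody R l)))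
    (blockProg [.con 41 0, .con 42 0]))

/-- The constant part of the time for writing a layer. -/
def LayerTmpl.cost (l : LayerTmpl) : ℕ := 6 * l.gate.toks.length + 40

/-- A layer is written in time proportional to its number of gates; registers below `R` are left as
they were. -/
theorem reach_layerProg {R : ℕ} (hR : 43 ≤ R) {l : LayerTmpl} (hl : l.size ≤ R) {σ : RamState}
    (h20 : σ.reg 20 = 0) (h41 : σ.reg 41 = 0) (h42 : σ.reg 42 = 0) :
    Reach (layerProg R l) σ ((l.count.eval σ.reg + 1) * l.cost) fun τ =>
      τ.out = σ.out ++ (l.desc σ.reg).length :: (l.desc σ.reg).flatMap GateDesc.encode ∧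
      ∀ r < R, τ.reg r = σ.reg r := by
  set ρ := σ.reg with hρ
  set N := l.count.eval ρ with hN
  have hsz : l.count.size ≤ R ∧ l.w₁.size ≤ R ∧ l.w₂.size ≤ R := by
    rw [LayerTmpl.size] at hl
    omega
  have htoks : ∀ t ∈ l.gate.toks, t.size ≤ R := fun t ht => by
    have h1 := List.single_le_sum (l := l.gate.toks.map Tok.size) (by simp) _
      (List.mem_map.2 ⟨t, ht, rfl⟩)
    rw [LayerTmpl.size] at hl
    omega
  have hlen : ∀ d t, (evalTok d t).length ≤ 2 := fun d t => by cases t <;> simp [evalTok]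
  -- the initialisation
  have hkeep1 : ∀ i ∈ layerInit R l, i.Keeps (· = 20) := by
    intro i hi
    simp only [layerInit, List.mem_append] at hi
    rcases hi with ((hi | hi) | hi) | hi
    · exact evalTok_keeps (by omega) _ i hi
    · exact evalTok_keeps (by omega) _ i hi
    · exact evalTok_keeps (by omega) _ i hi
    · simp only [List.mem_cons, List.not_mem_nil, or_false] at hi
      rcases hi with rfl | rfl | rfl | rfl | rfl | rfl <;> simp only [Instr.Keeps] <;> omega
  have hinit : runBlock (layerInit R l) σ =
      { σ with
        reg := Function.update (Function.update (Function.update (Function.update (Function.update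
          (Function.update (Function.update (Function.update ρ (R + 1) (l.w₁.eval ρ))
            (R + 2) (l.w₂.eval ρ)) (R + 3) N) 41 (l.w₁.eval ρ)) 42 (l.w₂.eval ρ)) (R + 4) 1)
            (R + 5) l.s₁) (R + 6) l.s₂
        out := σ.out ++ [N] } := by
    rw [layerInit, runBlock_append, runBlock_append, runBlock_append,
      runBlock_evalTok (by omega), runBlock_evalTok (by omega), runBlock_evalTok (by omega)]
    have e1 : l.w₂.eval (Function.update ρ (R + 1) (l.w₁.eval ρ)) = l.w₂.eval ρ :=
      Tok.eval_congr (R := R) (fun r hr => Function.update_of_ne (by omega) _ _) hsz.2.2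
    have e2 : l.count.eval (Function.update (Function.update ρ (R + 1) (l.w₁.eval ρ)) (R + 2)
        (l.w₂.eval ρ)) = N :=
      Tok.eval_congr (R := R) (fun r hr => by
        rw [Function.update_of_ne (by omega), Function.update_of_ne (by omega)]) hsz.1
    simp only [← hρ, e1, e2]
    have n1 : R + 1 ≠ R + 2 := by omega
    have n2 : R + 1 ≠ R + 3 := by omega
    have n3 : R + 2 ≠ R + 3 := by omega
    have n4 : R + 2 ≠ 41 := by omega
    have n5 : (20 : ℕ) ≠ R + 1 := by omega
    have n6 : (20 : ℕ) ≠ R + 2 := by omega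
    have n7 : (20 : ℕ) ≠ R + 3 := by omega
    have n8 : (20 : ℕ) ≠ 41 := by omega
    have h20' : ρ 20 = 0 := h20
    simp only [runBlock, List.foldl_cons, List.foldl_nil, Instr.eff, Function.update_self,
      Function.update_of_ne n1, Function.update_of_ne n2, Function.update_of_ne n3,
      Function.update_of_ne n4, Function.update_of_ne n5, Function.update_of_ne n6,
      Function.update_of_ne n7, Function.update_of_ne n8, h20', add_zero]
  -- the loop
  let I : ℕ → RamState → Prop := fun k τ =>
    τ.out = σ.out ++ N :: ((List.range k).map fun j => l.gate.desc (l.env ρ j)).flatMap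
      GateDesc.encode ∧
    (∀ r < R, r ≠ 41 → r ≠ 42 → τ.reg r = ρ r) ∧ τ.reg 41 = l.w₁.eval ρ + k * l.s₁ ∧
    τ.reg 42 = l.w₂.eval ρ + k * l.s₂ ∧ τ.reg (R + 4) = 1 ∧ τ.reg (R + 5) = l.s₁ ∧
    τ.reg (R + 6) = l.s₂
  have hkeep2 : ∀ i ∈ layerBody R l, i.Keeps (· = 20) := by
    intro i hi
    simp only [layerBody, List.mem_append] at hi
    rcases hi with hi | hi
    · exact emitToks_keeps (by omega) _ i hi
    · simp only [List.mem_cons, List.not_mem_nil, or_false] at hi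
      rcases hi with rfl | rfl | rfl <;> simp only [Instr.Keeps] <;> omega
  have hstep : ∀ k < N, ∀ τ, I k τ → τ.reg (R + 3) = N - k →
      Reach (blockProg (layerBody R l)) τ (2 * (layerBody R l).length + 1) fun υ =>
        I (k + 1) υ ∧ υ.reg (R + 3) = N - (k + 1) := by
    rintro k hk τ ⟨i1, i2, i3, i4, i5, i6, i7⟩ hr
    refine (reach_block _ hkeep2 τ ((i2 20 (by omega) (by omega) (by omega)).trans h20)).mono
      le_rfl ?_
    rintro υ rfl
    set φ := runBlock (emitToks R l.gate.toks) τ with hφ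
    have hφr : ∀ r, r ≠ R → φ.reg r = τ.reg r := fun r hr =>
      reg_runBlock (S := (· ≠ R)) (emitToks_keeps (by simp) _) τ hr
    have hφo : φ.out = τ.out ++ (l.gate.desc (l.env ρ k)).encode := by
      rw [hφ, out_runBlock_emitToks htoks, l.gate.enc]
      congr 1
      refine List.map_congr_left fun t ht => Tok.eval_congr (R := R) (fun r hr => ?_) (htoks t ht)
      rw [LayerTmpl.env]
      by_cases h42 : r = 42
      · rw [h42, Function.update_self, i4]
      · rw [Function.update_of_ne h42]
        by_cases h41 : r = 41
        · rw [h41, Function.update_self, i3]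
        · rw [Function.update_of_ne h41, i2 r hr h41 h42]
    have hυ : runBlock (layerBody R l) τ = { φ with
        reg := Function.update (Function.update (Function.update φ.reg 41 (φ.reg 41 + φ.reg
            (R + 5)))
          42 (φ.reg 42 + φ.reg (R + 6))) (R + 3) (φ.reg (R + 3) - φ.reg (R + 4)) } := by
      rw [layerBody, runBlock_append, ← hφ]
      have n1 : (42 : ℕ) ≠ 41 := by omega
      have n2 : R + 6 ≠ 41 := by omega
      have n3 : R + 3 ≠ 41 := by omega
      have n4 : R + 3 ≠ 42 := by omega
      have n5 : R + 4 ≠ 41 := by omega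
      have n6 : R + 4 ≠ 42 := by omega
      simp only [runBlock, List.foldl_cons, List.foldl_nil, Instr.eff,
        Function.update_of_ne n1, Function.update_of_ne n2, Function.update_of_ne n3,
        Function.update_of_ne n4, Function.update_of_ne n5, Function.update_of_ne n6]
    rw [hυ]
    refine ⟨⟨?_, fun r hr h41 h42 => ?_, ?_, ?_, ?_, ?_, ?_⟩, ?_⟩
    · simp only [hφo, i1]
      rw [List.range_succ]
      simp
    · simp only
      rw [Function.update_of_ne (by omega), Function.update_of_ne h42, Function.update_of_ne h41,
        hφr r (by omega), i2 r hr h41 h42]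
    · simp only
      rw [Function.update_of_ne (by omega), Function.update_of_ne (by omega), Function.update_self,
        hφr _ (by omega), hφr _ (by omega), i3, i6]
      ring
    · simp only
      rw [Function.update_of_ne (by omega), Function.update_self,
        hφr _ (by omega), hφr _ (by omega), i4, i7]
      ring
    · simp only
      rw [Function.update_of_ne (by omega), Function.update_of_ne (by omega),
        Function.update_of_ne (by omega), hφr _ (by omega), i5]
    · simp only
      rw [Function.update_of_ne (by omega), Function.update_of_ne (by omega),
        Function.update_of_ne (by omega), hφr _ (by omega), i6]
    · simp only
      rw [Function.update_of_ne (by omega), Function.update_of_ne (by omega),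
        Function.update_of_ne (by omega), hφr _ (by omega), i7]
    · simp only
      rw [Function.update_self, hφr _ (by omega), hφr _ (by omega), hr, i5]
      omega
  have hlenInit : (layerInit R l).length ≤ 12 := by
    have h1 := hlen (R + 1) l.w₁
    have h2 := hlen (R + 2) l.w₂
    have h3 := hlen (R + 3) l.count
    simp only [layerInit, List.length_append, List.length_cons, List.length_nil]
    omega
  have hlenBody : (layerBody R l).length ≤ 3 * l.gate.toks.length + 3 := by
    have h1 : ∀ ts : List Tok, (emitToks R ts).length ≤ 3 * ts.length := fun ts => by
      induction ts with
      | nil => simp [emitToks]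
      | cons t ts ih =>
        have := hlen R t
        rw [emitToks] at ih ⊢
        simp only [List.flatMap_cons, List.length_append, List.length_cons, List.length_nil] at ih ⊢
        omega
    have := h1 l.gate.toks
    simp only [layerBody, List.length_append, List.length_cons, List.length_nil]
    omega
  refine (Reach.seq (reach_block _ hkeep1 σ h20) (T' := N * (2 * (layerBody R l).length + 1 + 1) + 1
    + 5) ?_).mono ?_ fun _ h => h
  · rintro _ rfl
    rw [hinit]
    refine Reach.seq (Reach.loop N _ I ⟨by simp, ?_, ?_, ?_, ?_, ?_, ?_⟩ ?_ hstep) ?_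
    · intro r hr h41 h42
      simp only
      rw [Function.update_of_ne (by omega), Function.update_of_ne (by omega),
        Function.update_of_ne (by omega), Function.update_of_ne (by omega),
        Function.update_of_ne (by omega), Function.update_of_ne (by omega),
        Function.update_of_ne (by omega), Function.update_of_ne (by omega)]
    · simp only
      rw [Function.update_of_ne (by omega), Function.update_of_ne (by omega),
        Function.update_of_ne (by omega), Function.update_of_ne (by omega), Function.update_self,
        zero_mul, add_zero]
    · simp only
      rw [Function.update_of_ne (by omega), Function.update_of_ne (by omega),
        Function.update_of_ne (by omega), Function.update_self, zero_mul, add_zero]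
    · simp
    · simp
    · simp
    · simp only
      rw [Function.update_of_ne (by omega), Function.update_of_ne (by omega),
        Function.update_of_ne (by omega), Function.update_of_ne (by omega),
        Function.update_of_ne (by omega), Function.update_self]
    · rintro τ ⟨i1, i2, -⟩
      refine (reach_block [.con 41 0, .con 42 0] (by decide) τ
        ((i2 20 (by omega) (by omega) (by omega)).trans h20)).mono le_rfl ?_
      rintro υ rfl
      refine ⟨?_, fun r hr => ?_⟩
      · simp only [runBlock, List.foldl_cons, List.foldl_nil, Instr.eff, i1]
        simp only [LayerTmpl.desc, List.length_map, List.length_range, ← hN]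
      · simp only [runBlock, List.foldl_cons, List.foldl_nil, Instr.eff]
        by_cases h42' : r = 42
        · rw [h42', Function.update_self]
          exact h42.symm
        · rw [Function.update_of_ne h42']
          by_cases h41' : r = 41
          · rw [h41', Function.update_self]
            exact h41.symm
          · rw [Function.update_of_ne h41', i2 r hr h41' h42']
  · have h1 : N * (2 * (layerBody R l).length + 1 + 1) ≤ N * (6 * l.gate.toks.length + 40) :=
      Nat.mul_le_mul_left N (by omega)
    rw [LayerTmpl.cost, Nat.add_mul, one_mul]
    omega

/-- Write the descriptions of all layers. -/
def layersProg (R : ℕ) : List LayerTmpl → Program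
  | [] => blockProg []
  | l :: Ls => .seq (layerProg R l) (layersProg R Ls)

/-- All layers are written for the same register contents `ρ`, since every layer restores the
registers below `R`. -/
theorem reach_layersProg {R : ℕ} (hR : 43 ≤ R) {Ls : List LayerTmpl} (hl : ∀ l ∈ Ls, l.size ≤ R)
    {C : ℕ} {ρ : ℕ → ℕ} (h20 : ρ 20 = 0) (h41 : ρ 41 = 0) (h42 : ρ 42 = 0)
    (hC : ∀ l ∈ Ls, l.count.eval ρ ≤ C) {σ : RamState} (hσ : ∀ r < R, σ.reg r = ρ r) :
    Reach (layersProg R Ls) σ ((C + 1) * (Ls.map LayerTmpl.cost).sum + 1) fun τ =>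
      τ.out = σ.out ++ (Ls.map fun l => l.desc ρ).flatMap fun layer =>
        layer.length :: layer.flatMap GateDesc.encode := by
  induction Ls generalizing σ with
  | nil =>
    refine (reach_block [] (by simp) σ ((hσ 20 (by omega)).trans h20)).mono (by simp) ?_
    rintro τ rfl
    simp
  | cons l Ls ih =>
    have hl1 := hl l (List.mem_cons_self ..)
    have hsz : l.count.size ≤ R ∧ l.w₁.size ≤ R ∧ l.w₂.size ≤ R := by
      rw [LayerTmpl.size] at hl1
      omega
    have htoks : ∀ t ∈ l.gate.toks, t.size ≤ R := fun t ht => by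
      have h1 := List.single_le_sum (l := l.gate.toks.map Tok.size) (by simp) _
        (List.mem_map.2 ⟨t, ht, rfl⟩)
      rw [LayerTmpl.size] at hl1
      omega
    have e1 : l.count.eval σ.reg = l.count.eval ρ := Tok.eval_congr hσ hsz.1
    have e2 : (l.desc σ.reg).length = (l.desc ρ).length := by
      simp only [LayerTmpl.desc, List.length_map, List.length_range, e1]
    have e3 : (l.desc σ.reg).flatMap GateDesc.encode = (l.desc ρ).flatMap GateDesc.encode := by
      simp only [LayerTmpl.desc, e1, List.flatMap_map]
      congr 1
      funext j
      rw [l.gate.enc, l.gate.enc]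
      refine List.map_congr_left fun t ht => Tok.eval_congr (R := R) (fun r hr => ?_) (htoks t ht)
      rw [LayerTmpl.env, LayerTmpl.env, Tok.eval_congr hσ hsz.2.1, Tok.eval_congr hσ hsz.2.2]
      by_cases h42 : r = 42
      · rw [h42, Function.update_self, Function.update_self]
      · rw [Function.update_of_ne h42, Function.update_of_ne h42]
        by_cases h41 : r = 41
        · rw [h41, Function.update_self, Function.update_self]
        · rw [Function.update_of_ne h41, Function.update_of_ne h41, hσ r hr]
    have h1 := reach_layerProg hR hl1 ((hσ 20 (by omega)).trans h20)
      ((hσ 41 (by omega)).trans h41) ((hσ 42 (by omega)).trans h42)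
    refine (h1.seq (T' := (C + 1) * (Ls.map LayerTmpl.cost).sum + 1) ?_).mono ?_ fun _ h => h
    · rintro τ ⟨ho, hr⟩
      refine (ih (fun l h => hl l (List.mem_cons_of_mem _ h))
        (fun l h => hC l (List.mem_cons_of_mem _ h))
        (fun r h => (hr r h).trans (hσ r h))).mono le_rfl ?_
      intro υ hυ
      rw [hυ, ho, e2, e3]
      simp
    · have h2 := hC l (List.mem_cons_self ..)
      have h3 : (l.count.eval σ.reg + 1) * l.cost ≤ (C + 1) * l.cost :=
        Nat.mul_le_mul_right _ (by omega)
      simp only [List.map_cons, List.sum_cons, Nat.mul_add]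
      omega

/-- A layer of gates on disjoint qubits has at most as many gates as there are qubits. -/
theorem LayerTmpl.Ok.count_le {l : LayerTmpl} {q : ℕ} {ρ : ℕ → ℕ} (h : l.Ok q ρ) :
    l.count.eval ρ ≤ q := by
  have hpos : ∀ g : GateDesc, 0 < g.toGate.arity := fun g => by cases g <;> simp [GateDesc.toGate]
  let w : ℕ → ℕ := fun j => (l.gate.desc (l.env ρ j)).toGate.wires ⟨0, hpos _⟩
  have h1 : Set.MapsTo w (Finset.range (l.count.eval ρ)) (Finset.range q) := fun j hj => by
    simpa using (h.1 j (by simpa using hj)).2.2.1 _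
  have h2 : Set.InjOn w (Finset.range (l.count.eval ρ)) := by
    intro j hj j' hj' hw
    by_contra hne
    rcases Nat.lt_or_gt_of_ne hne with hlt | hlt
    · exact Set.disjoint_left.1 (h.2 j j' hlt (by simpa using hj')) ⟨_, rfl⟩ ⟨_, hw.symm⟩
    · exact Set.disjoint_left.1 (h.2 j' j hlt (by simpa using hj)) ⟨_, rfl⟩ ⟨_, hw⟩
  simpa using Finset.card_le_card_of_injOn w h1 h2

end ShallowLearning
end

section
open scoped Matrix
namespace ShallowLearning

/-! ### Evaluating a sample -/

/-- One round of the program which evaluates a sample. The sample starts at the address in register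
`6`, the parities of the paths to the nodes are stored from the address in register `7` on, and the
running values of the signed sum modulo `p` and of the parity of the vertex bits are kept in
registers `100` and `101`. Register `103` counts the rounds, `104` and `105` hold its quotient and
remainder by `2`, and `106` the beginning of the current block. -/
def sampleBody : List Instr :=
  [.add 110 6 103, .ld 110 110, .add 111 7 104, .ld 111 111, .sub 112 3 111, .sel 112 110 112 111,
   .sub 114 5 106, .add 115 106 27, .sel 116 114 115 4, .sub 116 116 3,
   .sub 117 103 106, .sub 118 103 3, .sel 118 117 118 116,
   .sub 117 118 106, .sub 119 118 3, .sel 118 117 119 116,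
   .add 119 6 4, .add 118 119 118, .ld 118 118,
   .add 117 100 1, .sub 117 117 3, .add 121 100 3, .sel 117 112 117 121, .sel 100 118 117 100,
   .add 117 100 3, .sub 117 117 1, .sub 121 100 1, .sel 100 117 121 100,
   .add 119 119 103, .ld 119 119, .sub 117 3 101, .sel 101 119 117 101,
   .sub 117 115 103, .sub 117 117 3, .sel 117 117 106 115, .sel 106 114 117 106,
   .add 117 104 3, .sel 104 105 117 104, .sub 105 3 105,
   .add 113 7 103, .add 113 113 3, .st 113 112,
   .add 103 103 3, .sub 102 102 3]

theorem sampleBody_spec (σ : RamState) {n p m A Z L k i2 tg o S par d hp c h o' t1 t2 b w : ℕ}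
    (h1 : σ.reg 1 = p) (h3 : σ.reg 3 = 1) (h4 : σ.reg 4 = n - 1) (h5 : σ.reg 5 = L)
    (h6 : σ.reg 6 = A) (h7 : σ.reg 7 = Z) (h27 : σ.reg 27 = m) (h100 : σ.reg 100 = S)
    (h101 : σ.reg 101 = par) (h102 : σ.reg 102 = c) (h103 : σ.reg 103 = k) (h104 : σ.reg 104 = i2)
    (h105 : σ.reg 105 = tg) (h106 : σ.reg 106 = o)
    (hd : σ.mem (A + k) = d) (hhp : σ.mem (Z + i2) = hp)
    (hh : (if d = 0 then hp else 1 - hp) = h)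
    (ho' : (if L - o = 0 then n - 1 else o + m) = o')
    (ht1 : (if k - o = 0 then o' - 1 else k - 1) = t1)
    (ht2 : (if t1 - o = 0 then o' - 1 else t1 - 1) = t2)
    (hb : σ.mem (A + (n - 1) + t2) = b) (hw : σ.mem (A + (n - 1) + k) = w) :
    (runBlock sampleBody σ).reg 102 = c - 1 ∧ (runBlock sampleBody σ).reg 103 = k + 1 ∧
    (runBlock sampleBody σ).reg 104 = (if tg = 0 then i2 else i2 + 1) ∧
    (runBlock sampleBody σ).reg 105 = 1 - tg ∧
    (runBlock sampleBody σ).reg 106 =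
      (if L - o = 0 then o else if o + m - k - 1 = 0 then o + m else o) ∧
    (∀ S', S' = (if b = 0 then S else if h = 0 then S + 1 else S + p - 1) →
      (runBlock sampleBody σ).reg 100 = if S' + 1 - p = 0 then S' else S' - p) ∧
    (runBlock sampleBody σ).reg 101 = (if w = 0 then par else 1 - par) ∧
    (runBlock sampleBody σ).mem = Function.update σ.mem (Z + k + 1) h ∧
    (runBlock sampleBody σ).out = σ.out := by
  subst hh ho' ht1 ht2 hb hw hd hhp h5 h6 h7 h27 h100 h101 h102 h103 h104 h105 h106
  rw [← h4, ← h3, ← h1]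
  refine ⟨rfl, rfl, rfl, rfl, rfl, ?_, rfl, rfl, rfl⟩
  rintro _ rfl
  rfl

/-- The contribution of node `i + 1` to the signed sum, as a natural number modulo `p`. -/
def treeCoeff (n m p : ℕ) (y : ℕ → Bool) (i : ℕ) : ℕ :=
  if y (n - 1 + blockPred n m (blockPred n m i)) then (if pathSum y
      (i + 1) then p - 1 else 1) else 0

/-- The test for the last block, with truncated subtraction. -/
theorem blockLo_eq_iff {n m : ℕ} (hm : 1 ≤ m) (i : ℕ) :
    ((n - 1) / m - 1) * m - blockLo n m i = 0 ↔ (n - 1) / m ≤ i / m + 1 := by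
  rw [Nat.sub_eq_zero_iff_le, blockLo, Nat.mul_le_mul_right_iff hm, le_min_iff]
  generalize i / m = a
  generalize (n - 1) / m = b
  omega

theorem blockHi_eq {n m : ℕ} (hm : 1 ≤ m) (i : ℕ) : blockHi n m i =
    if ((n - 1) / m - 1) * m - blockLo n m i = 0 then n - 1 else blockLo n m i + m := by
  rw [blockHi, if_congr (blockLo_eq_iff hm i) rfl rfl]
  split_ifs <;> first | rfl | omega

theorem blockLo_succ {n m : ℕ} (hm : 1 ≤ m) (i : ℕ) : blockLo n m (i + 1) =
    if ((n - 1) / m - 1) * m - blockLo n m i = 0 then blockLo n m i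
    else if blockLo n m i + m - i - 1 = 0 then blockLo n m i + m else blockLo n m i := by
  rw [if_congr (blockLo_eq_iff hm i) rfl rfl]
  have h0 : i / m ≤ (i + 1) / m := Nat.div_le_div_right (by omega)
  have h1 : i / m * m ≤ i := Nat.div_mul_le_self _ _
  have h2 : i < i / m * m + m := Nat.lt_div_mul_add hm
  split_ifs with h3 h4
  · have h5 : (n - 1) / m - 1 ≤ i / m := Nat.sub_le_of_le_add h3
    rw [blockLo, blockLo, min_eq_right h5, min_eq_right (h5.trans h0)]
  · rw [blockLo, min_eq_left (by omega)] at h4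
    have h5 : (i + 1) / m = i / m + 1 := by
      rw [show i + 1 = (i / m + 1) * m by rw [Nat.add_mul, one_mul]; omega,
        Nat.mul_div_cancel _ hm]
    rw [blockLo, blockLo, h5, min_eq_left (by omega), min_eq_left (by omega), Nat.add_mul, one_mul]
  · rw [blockLo, min_eq_left (by omega)] at h4
    have h5 : (i + 1) / m = i / m := by
      apply Nat.div_eq_of_lt_le
      · omega
      · rw [Nat.add_mul, one_mul]
        omega
    rw [blockLo, blockLo, h5]

/-- Reset the counters and the running values. -/
def samplePre : List Instr :=
  [.con 100 0, .con 101 0, .con 103 0, .con 104 0, .con 105 0, .con 106 0, .add 102 4 20]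

/-- Include the root bit in the parity. -/
def samplePost : List Instr :=
  [.add 110 6 21, .ld 110 110, .sub 111 3 101, .sel 101 110 111 101]

/-- Compute the signed sum modulo `p` and the parity of the vertex bits of a sample. -/
def sampleProg : Program :=
  .seq (blockProg samplePre) (.seq (.loop 102 (blockProg sampleBody)) (blockProg samplePost))

/-- The registers and the memory contain what is needed to evaluate the sample `y`. -/
structure SampleState (n m p A Z : ℕ) (y : ℕ → Bool) (σ : RamState) : Prop where
  r1 : σ.reg 1 = p
  r3 : σ.reg 3 = 1
  r4 : σ.reg 4 = n - 1
  r5 : σ.reg 5 = ((n - 1) / m - 1) * m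
  r6 : σ.reg 6 = A
  r7 : σ.reg 7 = Z
  r20 : σ.reg 20 = 0
  r21 : σ.reg 21 = 2 * n - 2
  r27 : σ.reg 27 = m
  mem : ∀ v < 2 * n - 1, σ.mem (A + v) = (y v).toNat
  le : A + (2 * n - 1) ≤ Z
  memZ : σ.mem Z = 0

/-- A sample is evaluated in linear time. The only part of the memory which is written lies behind
the address `Z`, where the parities of the paths are stored. -/
theorem reach_sampleProg {n m p A Z : ℕ} {y : ℕ → Bool} {σ : RamState} (hn : 2 ≤ n) (hm : 1 ≤ m)
    (hmn : m ≤ n - 1) (hp : 2 ≤ p) (h : SampleState n m p A Z y σ) :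
    Reach sampleProg σ (100 * n) fun τ =>
      (∀ r < 100, τ.reg r = σ.reg r) ∧ (∀ a ≤ Z, τ.mem a = σ.mem a) ∧ τ.out = σ.out ∧
      τ.reg 100 = (∑ i ∈ Finset.range (n - 1), treeCoeff n m p y i) % p ∧
      τ.reg 101 = (∑ i ∈ Finset.range n, (y (n - 1 + i)).toNat) % 2 := by
  -- after `k` rounds, the first `k` terms of both sums have been added, and the parities of the
  -- paths to the nodes up to `k` are in the memory; the parent of node `k + 1` is node `k / 2`
  let I : ℕ → RamState → Prop := fun k τ =>
    (∀ r < 100, τ.reg r = σ.reg r) ∧ (∀ a < Z, τ.mem a = σ.mem a) ∧ τ.out = σ.out ∧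
    τ.reg 100 = (∑ i ∈ Finset.range k, treeCoeff n m p y i) % p ∧
    τ.reg 101 = (∑ i ∈ Finset.range k, (y (n - 1 + i)).toNat) % 2 ∧
    τ.reg 103 = k ∧ τ.reg 104 = k / 2 ∧ τ.reg 105 = k % 2 ∧ τ.reg 106 = blockLo n m k ∧
    ∀ v ≤ k, τ.mem (Z + v) = (pathSum y v).toNat
  have hstep : ∀ k < n - 1, ∀ τ, I k τ → τ.reg 102 = n - 1 - k →
      Reach (blockProg sampleBody) τ 90 fun υ => I (k + 1) υ ∧ υ.reg 102 = n - 1 - (k + 1) := by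
    rintro k hk τ ⟨hr, hmem, hout, h100, h101, h103, h104, h105, h106, hZ⟩ h102
    refine (reach_block sampleBody (by decide) τ ((hr 20 (by omega)).trans h.r20)).mono (by decide)
      ?_
    rintro υ rfl
    have hp1 := blockPred_lt hm hmn hk
    have hp2 := blockPred_lt hm hmn hp1
    have hb1 := block_bounds hm hmn hk
    have hb2 := block_eq hm hmn hk (blockPred_bounds hm hmn hk).1 (blockPred_bounds hm hmn hk).2
    have hb3 := blockPred_bounds hm hmn hk
    have hle := h.le
    obtain ⟨e102, e103, e104, e105, e106, e100, e101, emem, eout⟩ := sampleBody_spec τ (n := n)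
      (h := (pathSum y (k + 1)).toNat) (o' := blockHi n m k) (t1 := blockPred n m k)
      (t2 := blockPred n m (blockPred n m k))
      ((hr 1 (by omega)).trans h.r1) ((hr 3 (by omega)).trans h.r3) ((hr 4 (by omega)).trans h.r4)
      ((hr 5 (by omega)).trans h.r5) ((hr 6 (by omega)).trans h.r6) ((hr 7 (by omega)).trans h.r7)
      ((hr 27 (by omega)).trans h.r27) h100 h101 h102 h103 h104 h105 h106
      ((hmem _ (by omega)).trans (h.mem k (by omega))) (hZ (k / 2) (by omega))
      (by
        rw [pathSum]
        cases y k <;> cases pathSum y (k / 2) <;> rfl)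
      (blockHi_eq hm k).symm
      (by
        rw [blockPred]
        refine if_congr ?_ rfl rfl
        omega)
      (by
        conv_rhs => rw [blockPred, hb2.1, hb2.2]
        refine if_congr ?_ rfl rfl
        omega)
      ((hmem _ (by omega)).trans ((congrArg σ.mem (add_assoc _ _ _)).trans
        (h.mem (n - 1 + blockPred n m (blockPred n m k)) (by omega))))
      ((hmem _ (by omega)).trans ((congrArg σ.mem (add_assoc _ _ _)).trans
        (h.mem (n - 1 + k) (by omega))))
    refine ⟨⟨fun r hr' => ?_, fun a ha => ?_, eout.trans hout, ?_, ?_, e103, ?_, ?_, ?_,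
      fun v hv => ?_⟩, ?_⟩
    · rw [reg_runBlock (S := (· < 100)) (by decide) τ hr', hr r hr']
    · rw [emem, Function.update_of_ne (by omega), hmem a ha]
    · rw [e100 _ rfl, Finset.sum_range_succ, Nat.add_mod]
      set S := (∑ i ∈ Finset.range k, treeCoeff n m p y i) % p
      have hS : S < p := Nat.mod_lt _ (by omega)
      have hc : treeCoeff n m p y k < p := by
        rw [treeCoeff]
        split_ifs <;> omega
      rw [Nat.mod_eq_of_lt hc]
      have hc2 : (if (y (n - 1 + blockPred n m (blockPred n m k))).toNat = 0 then S
          else if (pathSum y (k + 1)).toNat = 0 then S + 1 else S + p - 1) =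
          S + treeCoeff n m p y k := by
        rw [treeCoeff]
        cases y (n - 1 + blockPred n m (blockPred n m k)) <;> cases pathSum y (k + 1) <;> simp
        omega
      rw [hc2]
      split_ifs with h5
      · rw [Nat.mod_eq_of_lt (by omega)]
      · rw [Nat.mod_eq_sub_mod (by omega), Nat.mod_eq_of_lt (by omega)]
    · rw [e101, Finset.sum_range_succ]
      cases y (n - 1 + k) <;> simp <;> omega
    · rw [e104]
      split_ifs <;> omega
    · rw [e105]
      omega
    · rw [e106, blockLo_succ hm]
    · rw [emem]
      rcases Nat.lt_or_ge k v with h5 | h5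
      · rw [show v = k + 1 by omega, ← add_assoc, Function.update_self]
      · rw [Function.update_of_ne (by omega), hZ v h5]
    · rw [e102]
      omega
  refine ((reach_block samplePre (by decide) σ h.r20).seq (T' := (n - 1) * (90 + 1) + 1 + 9)
    ?_).mono ?_ fun _ h => h
  · rintro _ rfl
    refine Reach.seq (Reach.loop (n - 1) 90 I ⟨fun r hr => ?_, fun a _ => rfl, rfl, ?_, ?_, rfl,
      rfl, rfl, ?_, fun v hv => ?_⟩ ?_ hstep) ?_
    · exact reg_runBlock (S := (· < 100)) (by decide) σ hr
    · simp [runBlock, samplePre, Instr.eff]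
    · simp [runBlock, samplePre, Instr.eff]
    · simp [runBlock, samplePre, Instr.eff, blockLo]
    · rw [Nat.le_zero.1 hv]
      have : (runBlock samplePre σ).mem (Z + 0) = σ.mem Z := rfl
      rw [this, h.memZ]
      simp [pathSum]
    · change σ.reg 4 + σ.reg 20 = n - 1
      rw [h.r4, h.r20, add_zero]
    · rintro τ ⟨hr, hmem, hout, h100, h101, -, -, -, -, hZ⟩
      refine (reach_block samplePost (by decide) τ ((hr 20 (by omega)).trans h.r20)).mono
          (by decide)
        ?_
      rintro υ rfl
      refine ⟨fun r hr' => ?_, fun a ha => ?_, hout, h100, ?_⟩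
      · rw [reg_runBlock (S := (· < 100)) (by decide) τ hr', hr r hr']
      · change τ.mem a = _
        rcases Nat.lt_or_ge a Z with h5 | h5
        · exact hmem a h5
        · have := hZ 0 (by omega)
          rw [show a = Z by omega, h.memZ]
          simpa [pathSum] using this
      · have hle := h.le
        have h5 : (runBlock samplePost τ).reg 101 = if τ.mem (τ.reg 6 + τ.reg 21) = 0 then τ.reg 101
          else τ.reg 3 - τ.reg 101 := rfl
        rw [h5, hr 6 (by omega), hr 21 (by omega), hr 3 (by omega), h.r6, h.r21, h.r3,
          hmem _ (by omega), h.mem _ (by omega), h101]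
        obtain ⟨l, rfl⟩ : ∃ l, n = l + 1 := ⟨n - 1, by omega⟩
        rw [Finset.sum_range_succ, show l + 1 - 1 + l = 2 * (l + 1) - 2 by omega,
            Nat.add_sub_cancel]
        cases y (2 * (l + 1) - 2) <;> simp <;> omega
  · have : samplePre.length = 7 := rfl
    omega

end ShallowLearning
end

section
open scoped Matrix
namespace ShallowLearning

/-! ### Auxiliary quantities and the search for the best candidate -/

theorem reach_blockLoop {c : ℕ} {l : List Instr} {σ : RamState} (N : ℕ) (I : ℕ → RamState → Prop)
    (hl : ∀ i ∈ l, i.Keeps (· = 20)) (h0 : I 0 σ) (hN : σ.reg c = N)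
    (h20 : ∀ k τ, I k τ → τ.reg 20 = 0)
    (step : ∀ k < N, ∀ τ, I k τ → τ.reg c = N - k →
      I (k + 1) (runBlock l τ) ∧ (runBlock l τ).reg c = N - (k + 1)) :
    Reach (.loop c (blockProg l)) σ (N * (2 * l.length + 2) + 1) (I N) := by
  refine Reach.loop N _ I h0 hN fun k hk τ hI hr => ?_
  refine (reach_block l hl τ (h20 k τ hI)).mono le_rfl ?_
  rintro _ rfl
  exact step k hk τ hI hr

/-- One round of the multiplication of the number of samples by their length. -/
def memSizeBody : List Instr := [.add 7 7 8, .sub 14 14 3]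

/-- One round of the division by the length `m` of the blocks: the quotient is in register `22`, the
remainder in `28`, and `m` times the quotient in `5`. -/
def divBody : List Instr :=
  [.add 28 28 3, .sub 110 27 28, .add 111 22 3, .sel 22 110 22 111, .add 112 5 27, .sel 5 110 5 112,
   .sel 28 110 28 20, .sub 14 14 3]

/-- One round of a division by `2`, with the quotient in register `24` and the remainder in `28`. -/
def halfBody : List Instr := [.add 24 24 28, .sub 28 3 28, .sub 14 14 3]

/-- Compute the numbers of qubits and prepare the multiplication. -/
def setupA (m : ℕ) : List Instr :=
  [.con 3 1, .sub 4 0 3, .add 21 0 0, .sub 8 21 3, .sub 21 8 3, .con 27 m, .con 7 0, .add 14 2 20]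

/-- Prepare the division of `n - 1` by `m`. -/
def setupB : List Instr := [.con 22 0, .con 28 0, .con 5 0, .add 14 4 20]

/-- Store the results of the division and prepare the halving of `n - 2`. -/
def setupC : List Instr :=
  [.add 26 28 20, .sub 22 22 3, .sub 5 5 27, .add 23 4 5, .con 24 0, .con 28 0, .sub 14 4 3]

/-- Halve `n - 3`. -/
def setupD : List Instr := [.sub 110 3 28, .sub 25 24 110]

/-- Compute the size of the samples and the positions of the blocks. -/
def setupProg (m : ℕ) : Program :=
  .seq (blockProg (setupA m)) (.seq (.loop 14 (blockProg memSizeBody)) (.seq (blockProg setupB)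
    (.seq (.loop 14 (blockProg divBody)) (.seq (blockProg setupC)
      (.seq (.loop 14 (blockProg halfBody)) (blockProg setupD))))))

/-- The register contents after the preparations: the input, the constants `0` and `1`, the sizes of
the samples and of their parts, the position of the last block and the number of left-over qubits
in it, and the numbers of edges which are treated together when the tree state is prepared. -/
structure Prepared (n m p M : ℕ) (ρ : ℕ → ℕ) : Prop where
  r0 : ρ 0 = n
  r1 : ρ 1 = p
  r2 : ρ 2 = M
  r3 : ρ 3 = 1
  r4 : ρ 4 = n - 1
  r5 : ρ 5 = ((n - 1) / m - 1) * m
  r7 : ρ 7 = M * (2 * n - 1)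
  r8 : ρ 8 = 2 * n - 1
  r20 : ρ 20 = 0
  r21 : ρ 21 = 2 * n - 2
  r22 : ρ 22 = (n - 1) / m - 1
  r23 : ρ 23 = n - 1 + ((n - 1) / m - 1) * m
  r24 : ρ 24 = (n - 2) / 2
  r25 : ρ 25 = (n - 3) / 2
  r26 : ρ 26 = (n - 1) % m
  r27 : ρ 27 = m
  r41 : ρ 41 = 0
  r42 : ρ 42 = 0

theorem reach_setupProg {n m p M : ℕ} (hn : 3 ≤ n) (hm : 1 ≤ m) {σ : RamState} (h0 : σ.reg 0 = n)
    (h1 : σ.reg 1 = p) (h2 : σ.reg 2 = M) (h20 : σ.reg 20 = 0) (h41 : σ.reg 41 = 0)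
    (h42 : σ.reg 42 = 0) :
    Reach (setupProg m) σ (10 * M + 40 * n + 60) fun τ =>
      Prepared n m p M τ.reg ∧ τ.mem = σ.mem ∧ τ.out = σ.out := by
  -- the size of the samples
  let S1 : ℕ → Prop := fun r => r = 0 ∨ r = 1 ∨ r = 2 ∨ r = 20 ∨ r = 41 ∨ r = 42
  let I1 : ℕ → RamState → Prop := fun k τ =>
    (∀ r, S1 r → τ.reg r = σ.reg r) ∧ τ.mem = σ.mem ∧ τ.out = σ.out ∧ τ.reg 3 = 1 ∧
    τ.reg 4 = n - 1 ∧ τ.reg 8 = 2 * n - 1 ∧ τ.reg 21 = 2 * n - 2 ∧ τ.reg 27 = m ∧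
    τ.reg 7 = k * (2 * n - 1)
  have s1 : ∀ k < M, ∀ τ, I1 k τ → τ.reg 14 = M - k → I1 (k + 1) (runBlock memSizeBody τ) ∧
      (runBlock memSizeBody τ).reg 14 = M - (k + 1) := by
    rintro k hk τ ⟨i1, i2, i3, i4, i5, i6, i7, i8, i9⟩ hc
    refine ⟨⟨fun r hr => (reg_runBlock (S := S1) (by decide) τ hr).trans (i1 r hr), i2, i3, i4, i5,
      i6, i7, i8, ?_⟩, ?_⟩
    · change τ.reg 7 + τ.reg 8 = _
      rw [i9, i6, Nat.add_mul, one_mul]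
    · change τ.reg 14 - τ.reg 3 = _
      omega
  -- the division by the length of the blocks
  let S2 : ℕ → Prop := fun r => r = 0 ∨ r = 1 ∨ r = 2 ∨ r = 20 ∨ r = 41 ∨ r = 42 ∨ r = 3 ∨ r = 4 ∨
    r = 7 ∨ r = 8 ∨ r = 21 ∨ r = 27
  let I2 : RamState → ℕ → RamState → Prop := fun φ k τ =>
    (∀ r, S2 r → τ.reg r = φ.reg r) ∧ τ.mem = σ.mem ∧ τ.out = σ.out ∧
    τ.reg 22 = k / m ∧ τ.reg 28 = k % m ∧ τ.reg 5 = k / m * m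
  have s2 : ∀ φ, I1 M φ → ∀ k < n - 1, ∀ τ, I2 φ k τ → τ.reg 14 = n - 1 - k →
      I2 φ (k + 1) (runBlock divBody τ) ∧ (runBlock divBody τ).reg 14 = n - 1 - (k + 1) := by
    rintro φ ⟨i1, i2, i3, i4, i5, i6, i7, i8, i9⟩ k hk τ ⟨j1, j2, j3, j4, j5, j6⟩ hc
    have e3 : τ.reg 3 = 1 := (j1 3 (by decide)).trans i4
    have e27 : τ.reg 27 = m := (j1 27 (by decide)).trans i8
    have e20 : τ.reg 20 = 0 := (j1 20 (by decide)).trans ((i1 20 (by decide)).trans h20)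
    have hk1 : k % m < m := Nat.mod_lt _ hm
    have hk2 : k / m * m + k % m = k := Nat.div_add_mod' k m
    have hk3 : (m - (k % m + 1) = 0 ∧ (k + 1) / m = k / m + 1 ∧ (k + 1) % m = 0) ∨
        (m - (k % m + 1) ≠ 0 ∧ (k + 1) / m = k / m ∧ (k + 1) % m = k % m + 1) := by
      rcases Nat.lt_or_ge (k % m + 1) m with h | h
      · have h5 : k + 1 = m * (k / m) + (k % m + 1) := by rw [mul_comm]; omega
        refine Or.inr ⟨by omega, ?_, ?_⟩
        · rw [h5, Nat.mul_add_div hm, Nat.div_eq_of_lt h, add_zero]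
        · rw [h5, Nat.mul_add_mod, Nat.mod_eq_of_lt h]
      · have h5 : k + 1 = m * (k / m + 1) := by rw [Nat.mul_add, mul_comm m]; omega
        refine Or.inl ⟨by omega, ?_, ?_⟩
        · rw [h5, Nat.mul_div_cancel_left _ hm]
        · rw [h5, Nat.mul_mod_right]
    refine ⟨⟨fun r hr => (reg_runBlock (S := S2) (by decide) τ hr).trans (j1 r hr), j2, j3,
      ?_, ?_, ?_⟩, ?_⟩
    · change (if τ.reg 27 - (τ.reg 28 + τ.reg 3) = 0 then τ.reg 22 + τ.reg 3 else τ.reg 22) = _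
      rw [e27, j5, e3, j4]
      rcases hk3 with ⟨a, b, c⟩ | ⟨a, b, c⟩
      · rw [if_pos a, b]
      · rw [if_neg a, b]
    · change (if τ.reg 27 - (τ.reg 28 + τ.reg 3) = 0 then τ.reg 20 else τ.reg 28 + τ.reg 3) = _
      rw [e27, j5, e3, e20]
      rcases hk3 with ⟨a, b, c⟩ | ⟨a, b, c⟩
      · rw [if_pos a, c]
      · rw [if_neg a, c]
    · change (if τ.reg 27 - (τ.reg 28 + τ.reg 3) = 0 then τ.reg 5 + τ.reg 27 else τ.reg 5) = _
      rw [e27, j5, e3, j6]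
      rcases hk3 with ⟨a, b, c⟩ | ⟨a, b, c⟩
      · rw [if_pos a, b, Nat.add_mul, one_mul]
      · rw [if_neg a, b]
    · change τ.reg 14 - τ.reg 3 = _
      omega
  -- halving
  let S3 : ℕ → Prop := fun r => r = 0 ∨ r = 1 ∨ r = 2 ∨ r = 20 ∨ r = 41 ∨ r = 42 ∨ r = 3 ∨ r = 4 ∨
    r = 7 ∨ r = 8 ∨ r = 21 ∨ r = 27 ∨ r = 26 ∨ r = 22 ∨ r = 5 ∨ r = 23
  let I3 : RamState → ℕ → RamState → Prop := fun φ k τ =>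
    (∀ r, S3 r → τ.reg r = φ.reg r) ∧ τ.mem = σ.mem ∧ τ.out = σ.out ∧
    τ.reg 24 = k / 2 ∧ τ.reg 28 = k % 2
  have s3 : ∀ φ : RamState, φ.reg 3 = 1 → ∀ k < n - 2, ∀ τ, I3 φ k τ → τ.reg 14 = n - 2 - k →
      I3 φ (k + 1) (runBlock halfBody τ) ∧ (runBlock halfBody τ).reg 14 = n - 2 - (k + 1) := by
    rintro φ i3 k hk τ ⟨j1, j2, j3, j4, j5⟩ hc
    have e3 : τ.reg 3 = 1 := (j1 3 (by decide)).trans i3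
    refine ⟨⟨fun r hr => (reg_runBlock (S := S3) (by decide) τ hr).trans (j1 r hr), j2, j3,
      ?_, ?_⟩, ?_⟩
    · change τ.reg 24 + τ.reg 28 = _
      omega
    · change τ.reg 3 - τ.reg 28 = _
      omega
    · change τ.reg 14 - τ.reg 3 = _
      omega
  have hSA : (setupA m).length = 8 := rfl
  have hmA : ∀ i ∈ setupA m, i.Keeps (· = 20) := by simp [setupA, Instr.Keeps]
  have hmA' : ∀ i ∈ setupA m, i.Keeps S1 := by simp [setupA, Instr.Keeps, S1]
  have hT : (M * (2 * memSizeBody.length + 2) + 1) + (9 + (((n - 1) * (2 *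
      divBody.length + 2) + 1) +
      (15 + (((n - 2) * (2 * halfBody.length + 2) + 1) + 5)))) ≤ 10 * M + 40 * n + 43 := by
    have l1 : memSizeBody.length = 2 := rfl
    have l2 : divBody.length = 8 := rfl
    have l3 : halfBody.length = 3 := rfl
    rw [l1, l2, l3]
    omega
  refine ((reach_block (setupA m) hmA σ h20).seq ?_).mono
    (show _ + (10 * M + 40 * n + 43) ≤ _ by omega) fun _ h => h
  rintro _ rfl
  refine Reach.mono (Reach.seq (reach_blockLoop M I1 (by decide)
      ⟨fun r hr => reg_runBlock hmA' σ hr,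
    rfl, rfl, rfl, ?_, ?_, ?_, rfl, ?_⟩ ?_ ?_ s1) ?_) hT fun _ h => h
  · change σ.reg 0 - 1 = _
    rw [h0]
  · change σ.reg 0 + σ.reg 0 - 1 = _
    omega
  · change σ.reg 0 + σ.reg 0 - 1 - 1 = _
    omega
  · rw [zero_mul]
    rfl
  · change σ.reg 2 + σ.reg 20 = M
    omega
  · exact fun k τ hI => (hI.1 20 (by decide)).trans h20
  intro φ hφ
  have hφ' := hφ
  obtain ⟨i1, i2, i3, i4, i5, i6, i7, i8, i9⟩ := hφ'
  have hφ20 : φ.reg 20 = 0 := (i1 20 (by decide)).trans h20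
  refine Reach.seq (reach_block setupB (by decide) φ hφ20) ?_
  rintro _ rfl
  refine Reach.seq (reach_blockLoop (n - 1) (I2 φ) (by decide)
    ⟨fun r hr => reg_runBlock (S := S2) (by decide) φ hr, i2, i3, ?_, ?_, ?_⟩ ?_
    (fun k τ hI => (hI.1 20 (by decide)).trans hφ20) (s2 φ hφ)) ?_
  · rw [Nat.zero_div]
    rfl
  · rw [Nat.zero_mod]
    rfl
  · rw [Nat.zero_div, zero_mul]
    rfl
  · change φ.reg 4 + φ.reg 20 = _
    omega
  rintro χ ⟨j1, j2, j3, j4, j5, j6⟩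
  have hχ3 : χ.reg 3 = 1 := (j1 3 (by decide)).trans i4
  have hχ20 : χ.reg 20 = 0 := (j1 20 (by decide)).trans hφ20
  have hχ4 : χ.reg 4 = n - 1 := (j1 4 (by decide)).trans i5
  have hχ27 : χ.reg 27 = m := (j1 27 (by decide)).trans i8
  refine Reach.seq (reach_block setupC (by decide) χ hχ20) ?_
  rintro _ rfl
  set ξ := runBlock setupC χ with hξ
  have hξr : ∀ r, S2 r → ξ.reg r = χ.reg r := fun r hr => reg_runBlock (S := S2) (by decide) χ hr
  have hξ3 : ξ.reg 3 = 1 := hχ3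
  have hξ5 : ξ.reg 5 = ((n - 1) / m - 1) * m := by
    change χ.reg 5 - χ.reg 27 = _
    rw [j6, hχ27, Nat.sub_mul, one_mul]
  refine Reach.seq (reach_blockLoop (n - 2) (I3 ξ) (by decide)
    ⟨fun r hr => rfl, j2, j3, rfl, rfl⟩ ?_
    (fun k τ hI => (hI.1 20 (by decide)).trans hχ20) (s3 ξ hξ3)) ?_
  · change χ.reg 4 - χ.reg 3 = _
    omega
  rintro τ ⟨k1, k2, k3, k4, k5⟩
  have hτ : ∀ r, S2 r → τ.reg r = χ.reg r := fun r hr => by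
    have : S3 r := by
      simp only [S2] at hr
      simp only [S3]
      omega
    rw [k1 r this, hξr r hr]
  have hτ' : ∀ r, S1 r → τ.reg r = σ.reg r := fun r hr => by
    have : S2 r := by
      simp only [S1] at hr
      simp only [S2]
      omega
    rw [hτ r this, j1 r this, i1 r hr]
  refine (reach_block setupD (by decide) τ ((hτ 20 (by decide)).trans hχ20)).mono (by decide) ?_
  rintro _ rfl
  refine ⟨⟨(hτ' 0 (by decide)).trans h0, (hτ' 1 (by decide)).trans h1, (hτ' 2 (by decide)).trans h2,
    (hτ 3 (by decide)).trans hχ3, (hτ 4 (by decide)).trans hχ4, (k1 5 (by decide)).trans hξ5,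
    (hτ 7 (by decide)).trans ((j1 7 (by decide)).trans i9),
    (hτ 8 (by decide)).trans ((j1 8 (by decide)).trans i6), (hτ' 20 (by decide)).trans h20,
    (hτ 21 (by decide)).trans ((j1 21 (by decide)).trans i7), ?_, ?_, k4, ?_, ?_,
    (hτ 27 (by decide)).trans hχ27, (hτ' 41 (by decide)).trans h41,
    (hτ' 42 (by decide)).trans h42⟩, k2, k3⟩
  · refine (k1 22 (by decide)).trans ?_
    change χ.reg 22 - χ.reg 3 = _
    rw [j4, hχ3]
  · refine (k1 23 (by decide)).trans ?_
    change χ.reg 4 + ξ.reg 5 = _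
    rw [hχ4, hξ5]
  · change τ.reg 24 - (τ.reg 3 - τ.reg 28) = _
    have : τ.reg 3 = 1 := (hτ 3 (by decide)).trans hχ3
    omega
  · refine (k1 26 (by decide)).trans ?_
    change χ.reg 28 + χ.reg 20 = _
    rw [j5, hχ20, add_zero]

end ShallowLearning
end

section
open scoped Matrix
namespace ShallowLearning

/-- Add the score of the current sample to the total in register `11`, for the candidate `t` for
which register `12` holds `p - t`, and pass to the next sample. -/
def voteBlock : List Instr :=
  [.add 110 100 12, .add 111 110 3, .sub 111 111 1, .sub 112 110 1, .sel 110 111 112 110,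
   .add 111 110 110, .sub 111 1 111, .add 112 11 3, .sub 113 11 3, .sel 112 101 112 113,
   .sel 112 111 112 11, .sel 11 110 112 11, .add 6 6 8, .sub 15 15 3]

/-- Go to the first sample. The total starts at the number of samples, so that it stays nonnegative.
-/
def candInit : List Instr := [.con 6 0, .add 11 2 20, .add 15 2 20]

/-- Compare with the best candidate so far, and pass to the next candidate. -/
def candUpdate : List Instr :=
  [.sub 110 11 10, .sel 9 110 13 9, .sel 10 110 11 10, .add 13 13 3, .sub 12 12 3, .sub 14 14 3]

/-- Compute the total score of the candidate in register `13`, and update the best candidate, which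
is kept in register `9`, and its total score, which is kept in register `10`. -/
def candProg : Program :=
  .seq (blockProg candInit) (.seq (.loop 15 (.seq sampleProg (blockProg voteBlock)))
    (blockProg candUpdate))

/-- Start with the candidate `0`. -/
def searchInit : List Instr := [.con 9 0, .con 10 0, .con 13 0, .add 12 1 20, .add 14 1 20]

/-- Find the candidate with the largest total score. -/
def searchProg : Program := .seq (blockProg searchInit) (.loop 14 candProg)

/-- The score of the candidate `t` on the sample `y`, as computed by the program. -/
def voteInt (n m p t : ℕ) (y : ℕ → Bool) : ℤ :=
  if ((∑ i ∈ Finset.range (n - 1), treeCoeff n m p y i) + (p - t)) % p = 0 then 0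
  else if p - 2 * (((∑ i ∈ Finset.range (n - 1), treeCoeff n m p y i) + (p - t)) % p) = 0 then 0
  else if (∑ i ∈ Finset.range n, (y (n - 1 + i)).toNat) % 2 = 0 then -1 else 1

theorem abs_voteInt_le (n m p t : ℕ) (y : ℕ → Bool) : |voteInt n m p t y| ≤ 1 := by
  rw [voteInt]
  split_ifs <;> simp

theorem cast_treeCoeff_sum {p : ℕ} [NeZero p] (n m : ℕ) (y : ℕ → Bool) :
    ((∑ i ∈ Finset.range (n - 1), treeCoeff n m p y i : ℕ) : ZMod p) =
        (treeSum n m y : ZMod p) := by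
  rw [treeSum, Nat.cast_sum, Int.cast_sum]
  refine Finset.sum_congr rfl fun i _ => ?_
  rw [treeCoeff]
  split_ifs
  · rw [Nat.cast_sub (Nat.one_le_iff_ne_zero.2 (NeZero.ne p))]
    simp
  · simp
  · simp

theorem vertexSign_eq (n : ℕ) (y : ℕ → Bool) : vertexSign n y =
    if (∑ i ∈ Finset.range n, (y (n - 1 + i)).toNat) % 2 = 0 then 1 else -1 := by
  have h1 : ∀ k, ∏ i ∈ Finset.range k, bitSign (y (n - 1 + i)) =
      (-1) ^ (∑ i ∈ Finset.range k, (y (n - 1 + i)).toNat) := fun k => by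
    rw [← Finset.prod_pow_eq_pow_sum]
    refine Finset.prod_congr rfl fun i _ => ?_
    cases y (n - 1 + i) <;> simp [bitSign]
  rw [vertexSign, h1]
  split_ifs with h
  · exact (Nat.even_iff.2 h).neg_one_pow
  · exact (Nat.odd_iff.2 (by omega)).neg_one_pow

/-- The program tests for membership in the window with truncated subtraction: the residue `r` lies
in it when neither `r` nor `p - 2 r` is zero. -/
theorem cast_voteInt {p : ℕ} [NeZero p] (n m : ℕ) {t : ℕ} (ht : t < p) (y : ℕ → Bool) :
    (voteInt n m p t y : ℝ) = score n m (t : ZMod p) y := by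
  set r := ((∑ i ∈ Finset.range (n - 1), treeCoeff n m p y i) + (p - t)) % p with hr
  have h1 : ((treeSum n m y : ZMod p) - t).val = r := by
    rw [← cast_treeCoeff_sum]
    have h2 : (((∑ i ∈ Finset.range (n - 1), treeCoeff n m p y i : ℕ) : ZMod p) - (t : ZMod p)) =
        ((∑ i ∈ Finset.range (n - 1), treeCoeff n m p y i + (p - t) : ℕ) : ZMod p) := by
      push_cast [Nat.cast_sub ht.le]
      simp
      ring
    rw [h2, ZMod.val_natCast]
  have h3 : InWindow ((treeSum n m y : ZMod p) - (t : ZMod p)) ↔ ¬ r = 0 ∧ ¬ p - 2 * r = 0 := by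
    rw [InWindow, h1]
    omega
  rw [score, voteInt, vertexSign_eq, if_congr h3 rfl rfl, ← hr]
  by_cases h4 : r = 0
  · simp [h4]
  · by_cases h5 : p - 2 * r = 0
    · simp [h4, h5]
    · have h6 : ¬ r = 0 ∧ ¬ p - 2 * r = 0 := ⟨h4, h5⟩
      rw [if_pos h6, if_neg h4, if_neg h5]
      split_ifs <;> simp

/-- The first `k` steps of the search for the maximum of `W`: the largest positive value so far, and
where it is attained. -/
def scanMax (W : ℕ → ℕ) : ℕ → ℕ × ℕ
  | 0 => (0, 0)
  | k + 1 => if W k - (scanMax W k).1 = 0 then scanMax W k else (W k, k)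

/-- Ties do not matter when the maximum is strict. -/
theorem scanMax_eq {W : ℕ → ℕ} {p s : ℕ} (hp : 2 ≤ p) (hs : s < p)
    (h : ∀ t < p, t ≠ s → W t < W s) : (scanMax W p).2 = s := by
  have key : ∀ k, (∀ t < k, W t ≤ (scanMax W k).1) ∧
      (scanMax W k = (0, 0) ∨ (scanMax W k).2 < k ∧ (scanMax W k).1 = W (scanMax W k).2) := by
    intro k
    induction k with
    | zero => exact ⟨fun t ht => absurd ht (Nat.not_lt_zero t), Or.inl rfl⟩
    | succ k ih =>
      rw [scanMax]
      split_ifs with h1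
      · refine ⟨fun t ht => ?_, ih.2.imp id fun h => ⟨by omega, h.2⟩⟩
        rcases Nat.lt_succ_iff_lt_or_eq.1 ht with h2 | rfl
        · exact ih.1 t h2
        · omega
      · refine ⟨fun t ht => ?_, Or.inr ⟨Nat.lt_succ_self k, rfl⟩⟩
        rcases Nat.lt_succ_iff_lt_or_eq.1 ht with h2 | rfl
        · have := ih.1 t h2
          simp only
          omega
        · exact le_rfl
  obtain ⟨h1, h2⟩ := key p
  have h3 := h1 s hs
  rcases h2 with h2 | ⟨h2, h4⟩
  · obtain ⟨t, ht, hts⟩ : ∃ t < p, t ≠ s := ⟨if s = 0 then 1 else 0, by split_ifs <;> omega,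
      by split_ifs <;> omega⟩
    have := h t ht hts
    rw [h2] at h3
    omega
  · by_contra hne
    have := h _ h2 hne
    omega

/-- The total score of the candidate `t` on `M` samples, made positive by adding `M`. -/
def voteTotal (n m p M : ℕ) (ys : ℕ → ℕ → Bool) (t : ℕ) : ℕ :=
  (M + ∑ j ∈ Finset.range M, voteInt n m p t (ys j)).toNat

theorem neg_le_sum_voteInt (n m p t : ℕ) (ys : ℕ → ℕ → Bool) (k : ℕ) :
    -(k : ℤ) ≤ ∑ j ∈ Finset.range k, voteInt n m p t (ys j) := by
  have h : ∑ j ∈ Finset.range k, (-1 : ℤ) ≤ ∑ j ∈ Finset.range k, voteInt n m p t (ys j) :=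
    Finset.sum_le_sum fun j _ => (abs_le.1 (abs_voteInt_le n m p t (ys j))).1
  simpa using h

/-- The samples are in the memory, and the registers are prepared for the search. -/
structure SearchState (n m p M : ℕ) (ys : ℕ → ℕ → Bool) (σ : RamState) : Prop where
  prep : Prepared n m p M σ.reg
  mem : ∀ j < M, ∀ v < 2 * n - 1, σ.mem (j * (2 * n - 1) + v) = (ys j v).toNat
  memZ : σ.mem (M * (2 * n - 1)) = 0

theorem voteBlock_spec (σ : RamState) {p S q par W : ℕ} (h1 : σ.reg 1 = p) (h3 : σ.reg 3 = 1)
    (h100 : σ.reg 100 = S) (h12 : σ.reg 12 = q) (h101 : σ.reg 101 = par) (h11 : σ.reg 11 =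
        W) {r : ℕ}
    (hr : (if S + q + 1 - p = 0 then S + q else S + q - p) = r) :
    (runBlock voteBlock σ).reg 11 =
      (if r = 0 then W else if p - (r + r) = 0 then W else if par = 0 then W - 1 else W + 1) ∧
    (runBlock voteBlock σ).reg 6 = σ.reg 6 + σ.reg 8 ∧
    (runBlock voteBlock σ).reg 15 = σ.reg 15 - 1 := by
  subst hr h100 h12 h101 h11
  rw [← h3, ← h1]
  exact ⟨rfl, rfl, rfl⟩

theorem reach_candProg {n m p M t : ℕ} {ys : ℕ → ℕ → Bool} {σ : RamState} (hn : 2 ≤ n) (hm : 1 ≤ m)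
    (hmn : m ≤ n - 1) (hp : 2 ≤ p) (ht : t < p) (h : SearchState n m p M ys σ)
    (h12 : σ.reg 12 = p - t) (h13 : σ.reg 13 = t) :
    Reach candProg σ (M * (100 * n + 30) + 21) fun τ =>
      (∀ r < 100, r ≠ 6 ∧ r ≠ 9 ∧ r ≠ 10 ∧ r ≠ 11 ∧ r ≠ 12 ∧ r ≠ 13 ∧ r ≠ 14 ∧ r ≠ 15 →
        τ.reg r = σ.reg r) ∧ (∀ a ≤ M * (2 * n - 1), τ.mem a = σ.mem a) ∧ τ.out = σ.out ∧
      τ.reg 9 = (if voteTotal n m p M ys t - σ.reg 10 = 0 then σ.reg 9 else t) ∧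
      τ.reg 10 = (if voteTotal n m p M ys t - σ.reg 10 = 0 then σ.reg 10
        else voteTotal n m p M ys t) ∧
      τ.reg 12 = σ.reg 12 - 1 ∧ τ.reg 13 = σ.reg 13 + 1 ∧ τ.reg 14 = σ.reg 14 - 1 := by
  have hP := h.prep
  -- after `k` samples, register `6` points at the next sample and register `11` holds the total
  let J : ℕ → RamState → Prop := fun k τ =>
    (∀ r < 100, r ≠ 6 ∧ r ≠ 11 ∧ r ≠ 15 → τ.reg r = σ.reg r) ∧
    (∀ a ≤ M * (2 * n - 1), τ.mem a = σ.mem a) ∧ τ.out = σ.out ∧ τ.reg 6 = k * (2 * n - 1) ∧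
    (τ.reg 11 : ℤ) = M + ∑ j ∈ Finset.range k, voteInt n m p t (ys j)
  have hstep : ∀ k < M, ∀ τ, J k τ → τ.reg 15 = M - k →
      Reach (.seq sampleProg (blockProg voteBlock)) τ (100 * n + 29) fun υ =>
        J (k + 1) υ ∧ υ.reg 15 = M - (k + 1) := by
    rintro k hk τ ⟨j1, j2, j3, j4, j5⟩ hc
    have hkM : k * (2 * n - 1) + (2 * n - 1) ≤ M * (2 * n - 1) := by
      rw [← Nat.succ_mul]
      exact Nat.mul_le_mul_right _ hk
    have hS : SampleState n m p (k * (2 * n - 1)) (M * (2 * n - 1)) (ys k) τ :=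
      ⟨(j1 1 (by omega) (by omega)).trans hP.r1, (j1 3 (by omega) (by omega)).trans hP.r3,
        (j1 4 (by omega) (by omega)).trans hP.r4, (j1 5 (by omega) (by omega)).trans hP.r5, j4,
        (j1 7 (by omega) (by omega)).trans hP.r7, (j1 20 (by omega) (by omega)).trans hP.r20,
        (j1 21 (by omega) (by omega)).trans hP.r21, (j1 27 (by omega) (by omega)).trans hP.r27,
        fun v hv => (j2 _ (by omega)).trans (h.mem k hk v hv), hkM, (j2 _ le_rfl).trans h.memZ⟩
    refine (reach_sampleProg hn hm hmn hp hS).seq ?_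
    rintro φ ⟨f1, f2, f3, f4, f5⟩
    have e3 : φ.reg 3 = 1 := (f1 3 (by omega)).trans hS.r3
    have e8 : φ.reg 8 = 2 * n - 1 :=
      (f1 8 (by omega)).trans ((j1 8 (by omega) (by omega)).trans hP.r8)
    have e12 : φ.reg 12 = p - t :=
      (f1 12 (by omega)).trans ((j1 12 (by omega) (by omega)).trans h12)
    set S := ∑ i ∈ Finset.range (n - 1), treeCoeff n m p (ys k) i with hSd
    have hSp : S % p < p := Nat.mod_lt _ (by omega)
    have hr : (if S % p + (p - t) + 1 - p = 0 then S % p + (p - t) else S % p + (p - t) - p) =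
        (S + (p - t)) % p := by
      have h4 : (S + (p - t)) % p = (S % p + (p - t)) % p := (Nat.mod_add_mod _ _ _).symm
      rw [h4]
      split_ifs with h5
      · exact (Nat.mod_eq_of_lt (by omega)).symm
      · rw [Nat.mod_eq_sub_mod (a := S % p + (p - t)) (by omega),
          Nat.mod_eq_of_lt (a := S % p + (p - t) - p) (by omega)]
    obtain ⟨v11, v6, v15⟩ := voteBlock_spec φ ((f1 1 (by omega)).trans hS.r1) e3 f4 e12 f5 rfl hr
    refine (reach_block voteBlock (by decide) φ ((f1 20 (by omega)).trans hS.r20)).mono (by decide)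
      ?_
    rintro _ rfl
    refine ⟨⟨fun r hr1 hr2 => ?_, fun a ha => (f2 a ha).trans (j2 a ha), f3.trans j3, ?_, ?_⟩, ?_⟩
    · rw [reg_runBlock (S := fun r => r < 100 ∧ r ≠ 6 ∧ r ≠ 11 ∧ r ≠ 15) (by decide) φ ⟨hr1, hr2⟩,
        f1 r hr1, j1 r hr1 hr2]
    · rw [v6, f1 6 (by omega), j4, e8, Nat.add_mul, one_mul]
    · have hW : 1 ≤ φ.reg 11 := by
        have := neg_le_sum_voteInt n m p t ys k
        rw [f1 11 (by omega)]
        omega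
      have h6 : (φ.reg 11 : ℤ) = M + ∑ j ∈ Finset.range k, voteInt n m p t (ys j) := by
        rw [f1 11 (by omega), j5]
      rw [v11, Finset.sum_range_succ, voteInt, ← hSd, ← two_mul]
      split_ifs <;> push_cast [hW] <;> linarith
    · rw [v15, f1 15 (by omega), hc]
      omega
  refine ((reach_block candInit (by decide) σ hP.r20).seq
    (T' := M * (100 * n + 29 + 1) + 1 + 13) ?_).mono ?_ fun _ h => h
  · rintro _ rfl
    refine Reach.seq (Reach.loop M _ J ⟨fun r hr1 hr2 => ?_, fun a _ => rfl, rfl, ?_,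
        ?_⟩ ?_ hstep) ?_
    · exact reg_runBlock (S := fun r => r < 100 ∧ r ≠ 6 ∧ r ≠ 11 ∧ r ≠ 15) (by decide) σ ⟨hr1, hr2⟩
    · rw [zero_mul]
      rfl
    · have : (runBlock candInit σ).reg 11 = σ.reg 2 + σ.reg 20 := rfl
      rw [this, hP.r2, hP.r20]
      simp
    · change σ.reg 2 + σ.reg 20 = M
      rw [hP.r2, hP.r20, add_zero]
    · rintro τ ⟨j1, j2, j3, j4, j5⟩
      have hW : τ.reg 11 = voteTotal n m p M ys t := by
        rw [voteTotal, ← j5, Int.toNat_natCast]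
      refine (reach_block candUpdate (by decide) τ
        ((j1 20 (by omega) (by omega)).trans hP.r20)).mono (by decide) ?_
      rintro _ rfl
      have e3 : τ.reg 3 = 1 := (j1 3 (by omega) (by omega)).trans hP.r3
      refine ⟨fun r hr1 hr2 => ?_, j2, j3, ?_, ?_, ?_, ?_, ?_⟩
      · rw [reg_runBlock (S := fun r => r < 100 ∧ r ≠ 9 ∧ r ≠ 10 ∧ r ≠ 12 ∧ r ≠ 13 ∧ r ≠ 14)
          (by decide) τ (by omega), j1 r hr1 (by omega)]
      · have : (runBlock candUpdate τ).reg 9 =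
          if τ.reg 11 - τ.reg 10 = 0 then τ.reg 9 else τ.reg 13 := rfl
        rw [this, hW, j1 10 (by omega) (by omega), j1 9 (by omega) (by omega),
          j1 13 (by omega) (by omega), h13]
      · have : (runBlock candUpdate τ).reg 10 =
          if τ.reg 11 - τ.reg 10 = 0 then τ.reg 10 else τ.reg 11 := rfl
        rw [this, hW, j1 10 (by omega) (by omega)]
      · have : (runBlock candUpdate τ).reg 12 = τ.reg 12 - τ.reg 3 := rfl
        rw [this, e3, j1 12 (by omega) (by omega)]
      · have : (runBlock candUpdate τ).reg 13 = τ.reg 13 + τ.reg 3 := rfl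
        rw [this, e3, j1 13 (by omega) (by omega)]
      · have : (runBlock candUpdate τ).reg 14 = τ.reg 14 - τ.reg 3 := rfl
        rw [this, e3, j1 14 (by omega) (by omega)]
  · have h1 : candInit.length = 3 := rfl
    have h2 : 100 * n + 29 + 1 = 100 * n + 30 := rfl
    rw [h1, h2]
    omega

theorem reach_searchProg {n m p M : ℕ} {ys : ℕ → ℕ → Bool} {σ : RamState} (hn : 2 ≤ n) (hm : 1 ≤ m)
    (hmn : m ≤ n - 1) (hp : 2 ≤ p) (h : SearchState n m p M ys σ) :
    Reach searchProg σ (p * (M * (100 * n + 30) + 22) + 12) fun τ =>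
      Prepared n m p M τ.reg ∧ τ.out = σ.out ∧
        τ.reg 9 = (scanMax (voteTotal n m p M ys) p).2 := by
  have hP := h.prep
  -- after `k` candidates, registers `9` and `10` hold the best one and its total
  let K : ℕ → RamState → Prop := fun k τ =>
    (∀ r < 100, r ≠ 6 ∧ r ≠ 9 ∧ r ≠ 10 ∧ r ≠ 11 ∧ r ≠ 12 ∧ r ≠ 13 ∧ r ≠ 14 ∧ r ≠ 15 →
        τ.reg r = σ.reg r) ∧ (∀ a ≤ M * (2 * n - 1), τ.mem a = σ.mem a) ∧ τ.out = σ.out ∧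
    τ.reg 9 = (scanMax (voteTotal n m p M ys) k).2 ∧
    τ.reg 10 = (scanMax (voteTotal n m p M ys) k).1 ∧ τ.reg 12 = p - k ∧ τ.reg 13 = k
  have hprep : ∀ τ : RamState, (∀ r < 100, r ≠ 6 ∧ r ≠ 9 ∧ r ≠ 10 ∧ r ≠ 11 ∧ r ≠ 12 ∧ r ≠ 13 ∧
      r ≠ 14 ∧ r ≠ 15 → τ.reg r = σ.reg r) → Prepared n m p M τ.reg := fun τ hr =>
    ⟨(hr 0 (by omega) (by omega)).trans hP.r0, (hr 1 (by omega) (by omega)).trans hP.r1,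
      (hr 2 (by omega) (by omega)).trans hP.r2, (hr 3 (by omega) (by omega)).trans hP.r3,
      (hr 4 (by omega) (by omega)).trans hP.r4, (hr 5 (by omega) (by omega)).trans hP.r5,
      (hr 7 (by omega) (by omega)).trans hP.r7, (hr 8 (by omega) (by omega)).trans hP.r8,
      (hr 20 (by omega) (by omega)).trans hP.r20, (hr 21 (by omega) (by omega)).trans hP.r21,
      (hr 22 (by omega) (by omega)).trans hP.r22, (hr 23 (by omega) (by omega)).trans hP.r23,
      (hr 24 (by omega) (by omega)).trans hP.r24, (hr 25 (by omega) (by omega)).trans hP.r25,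
      (hr 26 (by omega) (by omega)).trans hP.r26, (hr 27 (by omega) (by omega)).trans hP.r27,
      (hr 41 (by omega) (by omega)).trans hP.r41, (hr 42 (by omega) (by omega)).trans hP.r42⟩
  have hstep : ∀ k < p, ∀ τ, K k τ → τ.reg 14 = p - k →
      Reach candProg τ (M * (100 * n + 30) + 21) fun υ => K (k + 1) υ ∧ υ.reg 14 = p - (k + 1) := by
    rintro k hk τ ⟨k1, k2, k3, k4, k5, k6, k7⟩ hc
    have hsize : ∀ j < M, j * (2 * n - 1) + (2 * n - 1) ≤ M * (2 * n - 1) := fun j hj => by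
      rw [← Nat.succ_mul]
      exact Nat.mul_le_mul_right _ hj
    refine (reach_candProg hn hm hmn hp hk ⟨hprep τ k1, fun j hj v hv => (k2 _ ?_).trans
      (h.mem j hj v hv), (k2 _ le_rfl).trans h.memZ⟩ k6 k7).mono le_rfl ?_
    · have := hsize j hj
      omega
    · rintro υ ⟨u1, u2, u3, u9, u10, u12, u13, u14⟩
      refine ⟨⟨fun r hr1 hr2 => (u1 r hr1 hr2).trans (k1 r hr1 hr2),
        fun a ha => (u2 a ha).trans (k2 a ha), u3.trans k3, ?_, ?_, ?_, ?_⟩, ?_⟩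
      · rw [u9, scanMax, k5, k4]
        split_ifs <;> rfl
      · rw [u10, scanMax, k5]
        split_ifs <;> rfl
      · omega
      · omega
      · omega
  refine ((reach_block searchInit (by decide) σ hP.r20).seq
    (T' := p * (M * (100 * n + 30) + 21 + 1) + 1) ?_).mono ?_ fun _ h => h
  · rintro _ rfl
    refine (Reach.loop (σ := runBlock searchInit σ) p _ K
      ⟨fun r hr1 hr2 => ?_, fun a _ => rfl, rfl, rfl, rfl, ?_, rfl⟩ ?_ hstep).mono le_rfl ?_
    · exact reg_runBlock (S := fun r => r < 100 ∧ r ≠ 6 ∧ r ≠ 9 ∧ r ≠ 10 ∧ r ≠ 11 ∧ r ≠ 12 ∧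
        r ≠ 13 ∧ r ≠ 14 ∧ r ≠ 15) (by decide) σ ⟨hr1, hr2⟩
    · change σ.reg 1 + σ.reg 20 = p - 0
      rw [hP.r1, hP.r20, add_zero, Nat.sub_zero]
    · change σ.reg 1 + σ.reg 20 = p
      rw [hP.r1, hP.r20, add_zero]
    · rintro τ ⟨k1, k2, k3, k4, -⟩
      exact ⟨hprep τ k1, k3, k4⟩
  · have h1 : searchInit.length = 5 := rfl
    have h2 : M * (100 * n + 30) + 21 + 1 = M * (100 * n + 30) + 22 := rfl
    rw [h1, h2]
    omega

/-! ### The learner -/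

/-- Run the program at the position given by register `26`. -/
def switchProg : List Program → Program
  | [] => blockProg []
  | P :: Ps => .cond 26 (.seq (blockProg [.sub 26 26 3]) (switchProg Ps)) P

theorem reach_switchProg {Ps : List Program} {i : ℕ} (hi : i < Ps.length) {σ : RamState}
    (h26 : σ.reg 26 = i) (h3 : σ.reg 3 = 1) (h20 : σ.reg 20 = 0) {T : ℕ} {Q : RamState → Prop}
    (h : Reach Ps[i] { σ with reg := Function.update σ.reg 26 0 } T Q) :
    Reach (switchProg Ps) σ (T + 4 * i + 1) Q := by
  induction Ps generalizing i σ with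
  | nil => exact absurd hi (Nat.not_lt_zero i)
  | cons P Ps ih =>
    rcases i with _ | i
    · have h7 : Function.update σ.reg 26 0 = σ.reg := Function.update_eq_self_iff.2 h26.symm
      rw [h7] at h
      obtain ⟨t, τ, h1, h2, h4⟩ := h
      exact ⟨t + 1, τ, .cond_false h26 h1, by omega, h4⟩
    · have h5 : Reach (.seq (blockProg [.sub 26 26 3]) (switchProg Ps)) σ (3 + (T + 4 *
        i + 1)) Q := by
        refine (reach_block [.sub 26 26 3] (by decide) σ h20).seq ?_
        rintro _ rfl
        refine ih (i := i) (by simpa using hi) ?_ h3 h20 ?_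
        · change σ.reg 26 - σ.reg 3 = i
          omega
        · have h6 : Function.update (runBlock [.sub 26 26 3] σ).reg 26 0 =
              Function.update σ.reg 26 0 := Function.update_idem _ _ _
          rw [h6]
          exact h
      obtain ⟨t, τ, h1, h2, h4⟩ := h5
      exact ⟨t + 1, τ, .cond_true (by omega) h1, by omega, h4⟩

/-- The program which finds the best candidate and writes it, followed by the description of the
circuit given by the layers for the length of the last block. -/
def learner (m R : ℕ) (Ls : ℕ → List LayerTmpl) : Program :=
  .seq (setupProg m) (.seq searchProg (.seq (blockProg [.em 9])
    (switchProg ((List.range m).map fun r =>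
      .seq (blockProg [.con R (Ls r).length, .em R]) (layersProg R (Ls r))))))

end ShallowLearning
end

section
open scoped Matrix
namespace ShallowLearning

/-- What the learner writes on the samples `ω`: the best candidate, and a valid circuit which
prepares the target state for this candidate. -/
theorem reach_learner {B : (k : ℕ) → Set (Bits k)} {m R : ℕ} {Ls : ℕ → List LayerTmpl}
    (hLs : ∀ r {n p s : ℕ} {ρ : ℕ → ℕ}, Setup m n p s ρ →
      n - 1 - ((n - 1) / m - 1) * m = m + r →
      (∀ l ∈ Ls r, l.Ok (2 * n - 1) ρ) ∧
        (CircuitDesc.toCircuit ((Ls r).map fun l => l.desc ρ)).apply (zeroState (2 * n - 1)) =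
          (targetLayers B m n p s).apply (bpmState n))
    (hR : 43 ≤ R) (hsize : ∀ r < m, ∀ l ∈ Ls r, l.size ≤ R) {A : ℕ}
    (hA : ∀ r < m, ((Ls r).map LayerTmpl.cost).sum ≤ A) {n p M : ℕ} (hn : 4 ≤ n) (hm : 1 ≤ m)
    (hmn : m ≤ n - 1) (hp : 3 ≤ p) (ω : Fin M → Bits (2 * n - 1)) {ys : ℕ → ℕ → Bool}
    (hys : ∀ j (hj : j < M), ys j = (ω ⟨j, hj⟩).at) {s : ℕ}
    (hs : (scanMax (voteTotal n m p M ys) p).2 = s) :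
    Reach (learner m R Ls) (initState n p M ω)
      (10 * M + 40 * n + 60 + (p * (M * (100 * n + 30) + 22) + 12 + (3 + (2 * n * A + 6 + 4 *
          m + 1))))
      fun τ => ∃ desc : CircuitDesc, τ.out = s :: desc.encode ∧
        desc.toCircuit.IsValid (2 * n - 1) ∧ desc.toCircuit.depth = (Ls ((n - 1) % m)).length ∧
        desc.toCircuit.apply (zeroState (2 * n - 1)) =
          (targetLayers B m n p s).apply (bpmState n) := by
  have hq : 0 < 2 * n - 1 := by omega
  have hrm : (n - 1) % m < m := Nat.mod_lt _ hm
  set r := (n - 1) % m with hr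
  -- the last block has `m` qubits and the `r` left-over ones
  have hlast : n - 1 - ((n - 1) / m - 1) * m = m + r := by
    have h1 : 1 ≤ (n - 1) / m := Nat.div_pos hmn hm
    have h2 := Nat.div_add_mod' (n - 1) m
    obtain ⟨k, hk⟩ := Nat.exists_eq_add_of_le' h1
    rw [hk, Nat.add_mul, one_mul, ← hr] at h2
    rw [hk, Nat.add_sub_cancel]
    omega
  refine (reach_setupProg (n := n) (p := p) (M := M) (by omega) hm rfl rfl rfl rfl rfl rfl).seq ?_
  rintro σ ⟨hP, hmem, hout⟩
  -- the samples lie one after the other at the beginning of the memory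
  have hS : SearchState n m p M ys σ := by
    refine ⟨hP, fun j hj v hv => ?_, ?_⟩
    · have h1 : (j * (2 * n - 1) + v) / (2 * n - 1) = j := by
        rw [Nat.mul_comm, Nat.mul_add_div hq, Nat.div_eq_of_lt hv, add_zero]
      have h2 : (j * (2 * n - 1) + v) % (2 * n - 1) = v := by
        rw [Nat.mul_comm, Nat.mul_add_mod, Nat.mod_eq_of_lt hv]
      rw [hmem, hys j hj]
      simp only [initState, h1, h2, hj, dite_true]
    · rw [hmem]
      simp [initState, Nat.mul_div_cancel _ hq]
  refine (reach_searchProg (by omega) hm hmn (by omega) hS).seq ?_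
  rintro τ ⟨hP', hout', h9⟩
  refine (reach_block [.em 9] (by decide) τ hP'.r20).seq ?_
  rintro _ rfl
  set υ := runBlock [.em 9] τ with hυ
  have hυr : υ.reg = τ.reg := rfl
  have hυo : υ.out = [s] := by
    have h1 : υ.out = τ.out ++ [τ.reg 9] := rfl
    rw [h1, hout', hout, h9, hs]
    rfl
  -- the program for `r` left-over qubits, entered with the best candidate in register `9`
  have key : Reach (.seq (blockProg [.con R (Ls r).length, .em R]) (layersProg R (Ls r)))
      { υ with reg := Function.update υ.reg 26 0 } (2 * n * A + 6) fun τ => ∃ desc : CircuitDesc,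
        τ.out = s :: desc.encode ∧ desc.toCircuit.IsValid (2 * n - 1) ∧
        desc.toCircuit.depth = (Ls r).length ∧ desc.toCircuit.apply (zeroState (2 * n - 1)) =
          (targetLayers B m n p s).apply (bpmState n) := by
    set φ : RamState := { υ with reg := Function.update υ.reg 26 0 } with hφ
    have hφr : ∀ i, i ≠ 26 → φ.reg i = τ.reg i := fun i hi => by
      rw [hφ]
      exact Function.update_of_ne hi _ _
    have h20 : φ.reg 20 = 0 := (hφr 20 (by omega)).trans hP'.r20
    have hkeep : ∀ S : ℕ → Prop, ¬ S R → ∀ i ∈ [Instr.con R (Ls r).length, .em R], i.Keeps S := by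
      intro S hS i hi
      simp only [List.mem_cons, List.not_mem_nil, or_false] at hi
      rcases hi with rfl | rfl
      · exact hS
      · trivial
    refine ((reach_block _ (hkeep _ (by omega)) φ h20).seq
      (T' := (2 * n - 1 + 1) * A + 1) ?_).mono ?_ fun _ h => h
    · rintro _ rfl
      set χ := runBlock [Instr.con R (Ls r).length, .em R] φ with hχ
      have hχr : ∀ i < 43, i ≠ 26 → χ.reg i = τ.reg i := fun i hi hi' =>
        (reg_runBlock (S := fun j => j < 43) (hkeep _ (by omega)) φ hi).trans (hφr i hi')
      have hχo : χ.out = [s, (Ls r).length] := by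
        have h1 : χ.out = υ.out ++ [Function.update φ.reg R (Ls r).length R] := rfl
        rw [h1, hυo, Function.update_self]
        rfl
      -- the registers on which the layers depend have not changed since the preparations
      have hsetup : Setup m n p s χ.reg :=
        ⟨hm, hn, hmn, hp, (hχr 0 (by omega) (by omega)).trans hP'.r0,
          (hχr 1 (by omega) (by omega)).trans hP'.r1, (hχr 4 (by omega) (by omega)).trans hP'.r4,
          (hχr 9 (by omega) (by omega)).trans (h9.trans hs),
          (hχr 21 (by omega) (by omega)).trans hP'.r21,
          (hχr 22 (by omega) (by omega)).trans hP'.r22,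
          (hχr 23 (by omega) (by omega)).trans hP'.r23,
          (hχr 24 (by omega) (by omega)).trans hP'.r24,
          (hχr 25 (by omega) (by omega)).trans hP'.r25⟩
      obtain ⟨hOk, happ⟩ := hLs r hsetup hlast
      refine (reach_layersProg hR (hsize r hrm) ((hχr 20 (by omega) (by omega)).trans hP'.r20)
        ((hχr 41 (by omega) (by omega)).trans hP'.r41)
        ((hχr 42 (by omega) (by omega)).trans hP'.r42) (fun l hl => (hOk l hl).count_le)
        fun _ _ => rfl).mono
        (Nat.add_le_add_right (Nat.mul_le_mul_left _ (hA r hrm)) 1) ?_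
      rintro ψ hψ
      refine ⟨(Ls r).map fun l => l.desc χ.reg, ?_, isValid_toCircuit hOk, depth_toCircuit _ _,
          happ⟩
      rw [hψ, hχo, CircuitDesc.encode, List.length_map]
      rfl
    · have h1 : 2 * n - 1 + 1 = 2 * n := by omega
      rw [h1]
      simp only [List.length_cons, List.length_nil]
      omega
  have hlen : r < ((List.range m).map fun r =>
      Program.seq (blockProg [.con R (Ls r).length, .em R]) (layersProg R (Ls r))).length := by
    simpa using hrm
  refine (reach_switchProg (σ := υ) hlen hP'.r26 hP'.r3 hP'.r20 (T := 2 * n * A + 6) ?_).mono ?_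
    fun _ h => h
  · rw [List.getElem_map, List.getElem_range]
    exact key
  · omega

end ShallowLearning
end

section
open scoped Matrix
namespace ShallowLearning

/-! ### Estimates for large moduli -/

/-- The upper bound on `p` says that `n` is large. -/
theorem le_of_le_mul_rpow_third {n p : ℕ} {K : ℝ} (hK : 0 < K)
    (h : (p : ℝ) ≤ K * (n : ℝ) ^ (1 / 3 : ℝ)) : (p / K) ^ 3 ≤ n := by
  have h1 : (p : ℝ) / K ≤ (n : ℝ) ^ (1 / 3 : ℝ) := by
    rw [div_le_iff₀ hK]
    linarith
  have h2 : ((n : ℝ) ^ (1 / 3 : ℝ)) ^ 3 = n := by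
    rw [← Real.rpow_natCast, ← Real.rpow_mul (Nat.cast_nonneg n)]
    norm_num
  rw [← h2]
  exact pow_le_pow_left₀ (by positivity) h1 3

/-- The lower bound on `p` bounds the `n` block errors: `n ≤ (p / a) ^ (1 / c)`, and the length of
the blocks leaves a factor `p ^ 4` to spare. -/
theorem mul_pi_div_pow_le {n p m : ℕ} {a c : ℝ} (ha : 0 < a) (hc : 0 < c) (hc' : c ≤ 1 / 3)
    (hm : 2 / c + 1 ≤ m) (hp : 1 ≤ p) (h : a * (n : ℝ) ^ c ≤ p) :
    n * (Real.pi / p) ^ m ≤ Real.pi ^ m / a ^ (1 / c) / p ^ 4 := by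
  have hp1 : (1 : ℝ) ≤ p := by exact_mod_cast hp
  have hp0 : (0 : ℝ) < p := by linarith
  have h1 : (n : ℝ) ≤ (p : ℝ) ^ (1 / c) / a ^ (1 / c) := by
    have h2 : (n : ℝ) ^ c ≤ p / a := by
      rw [le_div_iff₀ ha]
      linarith
    have h3 := Real.rpow_le_rpow (by positivity) h2 (one_div_pos.2 hc).le
    rwa [← Real.rpow_mul (Nat.cast_nonneg n), mul_one_div_cancel hc.ne', Real.rpow_one,
      Real.div_rpow hp0.le ha.le] at h3
  have h4 : (p : ℝ) ^ (1 / c) * p ^ 4 ≤ p ^ m := by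
    -- `m ≥ 2 / c + 1 ≥ 1 / c + 4`
    have h5 : 3 ≤ 1 / c := by
      rw [le_div_iff₀ hc]
      linarith
    have h6 : 2 / c = 2 * (1 / c) := by ring
    rw [← Real.rpow_natCast _ 4, ← Real.rpow_add hp0, ← Real.rpow_natCast _ m]
    refine Real.rpow_le_rpow_of_exponent_le hp1 ?_
    push_cast
    linarith
  have hA : 0 < a ^ (1 / c) := Real.rpow_pos_of_pos ha _
  rw [div_pow, div_div, le_div_iff₀ (by positivity)]
  calc n * (Real.pi ^ m / p ^ m) * (a ^ (1 / c) * p ^ 4)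
      ≤ ((p : ℝ) ^ (1 / c) / a ^ (1 / c)) * (Real.pi ^ m / p ^ m) * (a ^ (1 / c) * p ^ 4) := by
        gcongr
    _ = Real.pi ^ m / p ^ m * ((p : ℝ) ^ (1 / c) * p ^ 4) := by field_simp
    _ ≤ Real.pi ^ m / p ^ m * p ^ m := by gcongr
    _ = Real.pi ^ m := by field_simp

theorem one_add_pow_sub_one_mul_le {y : ℝ} {n : ℕ} (hy : 0 ≤ y) (hny : n * y ≤ 1) :
    ((1 + y) ^ n - 1) * (1 + (1 + y) ^ n) ≤ 8 * (n * y) := by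
  have h1 : (1 + y) ^ n ≤ 1 + 2 * (n * y) := by
    have h2 : (1 + y) ^ n ≤ Real.exp (n * y) := by
      rw [Real.exp_nat_mul]
      exact pow_le_pow_left₀ (by linarith) (by linarith [Real.add_one_le_exp y]) n
    have h0 : 0 ≤ n * y := by positivity
    have h3 := Real.abs_exp_sub_one_le (x := n * y) (by rwa [abs_of_nonneg h0])
    rw [abs_of_nonneg h0] at h3
    linarith [le_abs_self (Real.exp (n * y) - 1)]
  have h4 : 1 ≤ (1 + y) ^ n := one_le_pow₀ (by linarith)
  nlinarith

/-- The nonzero Fourier modes are exponentially small: `cos (π / p) ≤ exp (-2 / p ^ 2)`, and `n` is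
at least of the order of `p ^ 3`. -/
theorem mul_cos_pow_le {n p : ℕ} {K : ℝ} (hK : 0 < K) (hp : 3 ≤ p) (hpK : 48 * K ^ 12 ≤ p)
    (hn : 2 ≤ n) (h : (p / K) ^ 3 ≤ n) :
    p * |Real.cos (Real.pi / p)| ^ (n - 1) ≤ 1 / (2 * p ^ 2) := by
  have hp3 : (3 : ℝ) ≤ p := by exact_mod_cast hp
  have hp0 : (0 : ℝ) < p := by linarith
  have hθ : Real.pi / p ≤ Real.pi / 2 := by gcongr; linarith
  have hθ0 : 0 < Real.pi / p := by positivity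
  have h1 : |Real.cos (Real.pi / p)| ≤ Real.exp (-(2 / p ^ 2)) := by
    rw [abs_of_nonneg (Real.cos_nonneg_of_neg_pi_div_two_le_of_le (by linarith) hθ)]
    have h2 := Real.cos_le_one_sub_mul_cos_sq (x := Real.pi / p)
      (by rw [abs_of_pos hθ0]; linarith [Real.pi_pos])
    have h3 : 2 / Real.pi ^ 2 * (Real.pi / p) ^ 2 = 2 / p ^ 2 := by
      field_simp
    rw [h3] at h2
    linarith [Real.add_one_le_exp (-(2 / (p : ℝ) ^ 2))]
  have h4 : |Real.cos (Real.pi / p)| ^ (n - 1) ≤ Real.exp (-(p / K ^ 3)) := by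
    refine (pow_le_pow_left₀ (abs_nonneg _) h1 _).trans ?_
    rw [← Real.exp_nat_mul, Real.exp_le_exp, Nat.cast_sub (by omega), Nat.cast_one]
    have hn2 : (2 : ℝ) ≤ n := by exact_mod_cast hn
    have h5 : p / K ^ 3 = (p / K) ^ 3 / p ^ 2 := by field_simp
    have h6 : (p / K) ^ 3 / p ^ 2 ≤ 2 * (n - 1) / p ^ 2 := by
      gcongr
      linarith
    rw [h5]
    have h7 : ((n : ℝ) - 1) * -(2 / p ^ 2) = -(2 * (n - 1) / p ^ 2) := by ring
    rw [h7]
    linarith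
  -- `exp z ≥ z ^ 4 / 4!`, which exceeds `2 p ^ 3` as soon as `p ≥ 48 K ^ 12`
  have h8 : Real.exp (-(p / K ^ 3)) ≤ 1 / (2 * p ^ 3) := by
    have h9 := Real.pow_div_factorial_le_exp (p / K ^ 3) (by positivity) 4
    rw [Real.exp_neg, ← one_div]
    refine one_div_le_one_div_of_le (by positivity) (le_trans ?_ h9)
    have h10 : ((4).factorial : ℝ) = 24 := by norm_num [Nat.factorial]
    rw [h10, div_pow, div_div, le_div_iff₀ (by positivity)]
    calc 2 * (p : ℝ) ^ 3 * ((K ^ 3) ^ 4 * 24) = (p : ℝ) ^ 3 * (48 * K ^ 12) := by ring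
      _ ≤ (p : ℝ) ^ 3 * p := by gcongr
      _ = (p : ℝ) ^ 4 := by ring
  calc p * |Real.cos (Real.pi / p)| ^ (n - 1) ≤ p * (1 / (2 * p ^ 3)) := by
        gcongr
        exact h4.trans h8
    _ = 1 / (2 * p ^ 2) := by field_simp

/-- For large moduli, the target distribution is so close to the ideal one, and the contribution of
the other Fourier modes so small, that the scores separate the candidates. -/
theorem exists_forall_error_le {a K c : ℝ} (ha : 0 < a) (hK : 0 < K) (hc : 0 < c) (hc' : c ≤ 1 / 3)
    {m : ℕ} (hm : 2 / c + 1 ≤ m) :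
    ∃ p₀ : ℕ, ∀ n p : ℕ, p₀ ≤ p → a * (n : ℝ) ^ c ≤ p → (p : ℝ) ≤ K * (n : ℝ) ^ (1 / 3 : ℝ) →
      3 ≤ p ∧ 4 ≤ n ∧ m ≤ n - 1 ∧ (Real.pi / p) ^ m ≤ 1 / 2 ∧
      2 * (((1 + 2 ^ (2 * m) * (2 * (Real.pi / p) ^ m)) ^ n - 1) *
          (1 + (1 + 2 ^ (2 * m) * (2 * (Real.pi / p) ^ m)) ^ n)) +
        p * |Real.cos (Real.pi / p)| ^ (n - 1) ≤ 1 / p ^ 2 := by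
  set A := Real.pi ^ m / a ^ (1 / c) with hA
  have hA0 : 0 < A := div_pos (by positivity) (Real.rpow_pos_of_pos ha _)
  set A' := 2 ^ (2 * m) * 2 * A with hA'
  have hA'0 : 0 < A' := by positivity
  -- the summands serve, in turn, for `3 ≤ p`, for the distance to the approximate target
  -- distribution, for the Fourier modes, and for `m + 4 ≤ n`
  refine ⟨⌈3 + 32 * A' + 48 * K ^ 12 + K * (m + 4)⌉₊, fun n p hp h1 h2 => ?_⟩
  have hp1 : 3 + 32 * A' + 48 * K ^ 12 + K * (m + 4) ≤ p := (Nat.le_ceil _).trans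
      (by exact_mod_cast hp)
  have hK12 : 0 < 48 * K ^ 12 := by positivity
  have hKm : 0 < K * (m + 4) := by positivity
  have hp3 : (3 : ℝ) ≤ p := by linarith
  have hp3' : 3 ≤ p := by exact_mod_cast hp3
  have hp0 : (0 : ℝ) < p := by linarith
  have hn := le_of_le_mul_rpow_third hK h2
  have hnm : (m : ℝ) + 4 ≤ n := by
    have h3 : (m : ℝ) + 4 ≤ p / K := by
      rw [le_div_iff₀ hK]
      linarith
    refine h3.trans (le_trans ?_ hn)
    exact le_self_pow₀ (by linarith [(Nat.cast_nonneg m : (0 : ℝ) ≤ m)]) (by norm_num)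
  have hnm' : m + 4 ≤ n := by exact_mod_cast hnm
  have hε := mul_pi_div_pow_le ha hc hc' hm (by omega) h1
  set ε := (Real.pi / p) ^ m with hεd
  have hε0 : 0 ≤ ε := by positivity
  have hx : n * (2 ^ (2 * m) * (2 * ε)) ≤ A' / p ^ 4 := by
    calc n * (2 ^ (2 * m) * (2 * ε)) = 2 ^ (2 * m) * 2 * (n * ε) := by ring
      _ ≤ 2 ^ (2 * m) * 2 * (A / p ^ 4) := by gcongr
      _ = A' / p ^ 4 := by rw [hA']; ring
  have hx' : A' / p ^ 4 ≤ 1 / (32 * p ^ 2) := by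
    rw [div_le_div_iff₀ (by positivity) (by positivity)]
    have h4 : 32 * A' ≤ p ^ 2 := by nlinarith
    nlinarith [pow_pos hp0 2]
  have hx1 : 1 / (32 * (p : ℝ) ^ 2) ≤ 1 / 2 :=
    one_div_le_one_div_of_le (by norm_num) (by nlinarith)
  refine ⟨hp3', by omega, by omega, ?_, ?_⟩
  · refine le_trans ?_ (hx.trans (hx'.trans hx1))
    have h5 : (1 : ℝ) ≤ n := by exact_mod_cast (by omega : 1 ≤ n)
    have h6 : (1 : ℝ) ≤ 2 ^ (2 * m) := one_le_pow₀ (by norm_num)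
    calc ε ≤ 1 * (1 * (2 * ε)) := by linarith
      _ ≤ n * (2 ^ (2 * m) * (2 * ε)) := by gcongr
  · have h7 := one_add_pow_sub_one_mul_le (y := 2 ^ (2 * m) * (2 * ε)) (n := n) (by positivity)
      (by linarith)
    have h8 := mul_cos_pow_le hK hp3' (by linarith) (by omega) hn
    have h9 : 1 / (p : ℝ) ^ 2 = 16 * (1 / (32 * p ^ 2)) + 1 / (2 * p ^ 2) := by
      field_simp
      norm_num
    rw [h9]
    linarith

/-- The running time is polynomial. -/
theorem exists_time_le {K : ℝ} (hK : 0 < K) (A m : ℕ) :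
    ∃ T : ℕ, ∀ n p M : ℕ, ∀ δ : ℝ, 1 ≤ n → 1 ≤ p → 0 < δ → δ < 1 →
      (p : ℝ) ≤ K * (n : ℝ) ^ (1 / 3 : ℝ) → M = ⌈16 * (p : ℝ) ^ 4 * Real.log (p / δ)⌉₊ →
      ∀ t : ℕ, t ≤ 10 * M + 40 * n + 60 +
        (p * (M * (100 * n + 30) + 22) + 12 + (3 + (2 * n * A + 6 + 4 * m + 1))) →
      (t : ℝ) ≤ T * (n + Real.log (1 / δ)) ^ T := by
  -- every term of the running time is at most a constant times `k ^ 6 * x ^ 7`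
  set k := max K 1 with hk
  have hk1 : 1 ≤ k := le_max_right _ _
  have hkn : ∀ j, 1 ≤ k ^ j := fun j => one_le_pow₀ hk1
  refine ⟨⌈k ^ 6 * (5000 + 2 * A + 4 * m)⌉₊ + 7, fun n p M δ hn hp hδ hδ' hpK hM t ht => ?_⟩
  have hn1 : (1 : ℝ) ≤ n := by exact_mod_cast hn
  have hp1 : (1 : ℝ) ≤ p := by exact_mod_cast hp
  have hL : 0 ≤ Real.log (1 / δ) := Real.log_nonneg (by rw [le_div_iff₀ hδ]; linarith)
  set x := n + Real.log (1 / δ) with hx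
  have hx1 : 1 ≤ x := by linarith
  have hnx : (n : ℝ) ≤ x := by linarith
  have hxj : ∀ i j, i ≤ j → x ^ i ≤ x ^ j := fun i j h => pow_le_pow_right₀ hx1 h
  have hpx : (p : ℝ) ≤ k * x := by
    have h1 : (n : ℝ) ^ (1 / 3 : ℝ) ≤ n := by
      conv_rhs => rw [← Real.rpow_one (n : ℝ)]
      exact Real.rpow_le_rpow_of_exponent_le hn1 (by norm_num)
    calc (p : ℝ) ≤ K * (n : ℝ) ^ (1 / 3 : ℝ) := hpK
      _ ≤ k * n := mul_le_mul (le_max_left _ _) h1 (by positivity) (by linarith)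
      _ ≤ k * x := by gcongr
  have hlog : Real.log (p / δ) ≤ 2 * (k * x) := by
    have h2 : Real.log (p / δ) = Real.log p + Real.log (1 / δ) := by
      rw [← Real.log_mul (by positivity) (by positivity), mul_one_div]
    have h3 := Real.log_le_sub_one_of_pos (x := p) (by positivity)
    have h4 : x ≤ k * x := le_mul_of_one_le_left (by linarith) hk1
    rw [h2]
    linarith
  have hMx : (M : ℝ) ≤ 33 * (k ^ 5 * x ^ 5) := by
    have h5 : 0 ≤ Real.log (p / δ) := Real.log_nonneg (by rw [le_div_iff₀ hδ]; nlinarith)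
    have h6 := (Nat.ceil_lt_add_one (a := 16 * (p : ℝ) ^ 4 * Real.log (p / δ)) (by positivity)).le
    rw [← hM] at h6
    have h7 : 16 * (p : ℝ) ^ 4 * Real.log (p / δ) ≤ 16 * (k * x) ^ 4 * (2 * (k * x)) := by gcongr
    have h8 : 1 ≤ k ^ 5 * x ^ 5 := one_le_mul_of_one_le_of_one_le (hkn 5) (one_le_pow₀ hx1)
    have h9 : 16 * (k * x) ^ 4 * (2 * (k * x)) = 32 * (k ^ 5 * x ^ 5) := by ring
    linarith
  have ht' : (t : ℝ) ≤ 10 * M + 40 * n + 60 +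
      (p * (M * (100 * n + 30) + 22) + 12 + (3 + (2 * n * A + 6 + 4 * m + 1))) := by
    exact_mod_cast ht
  have hone : 1 ≤ k ^ 6 * x ^ 7 := one_le_mul_of_one_le_of_one_le (hkn 6) (one_le_pow₀ hx1)
  have hle : ∀ i j, i ≤ 6 → j ≤ 7 → k ^ i * x ^ j ≤ k ^ 6 * x ^ 7 := fun i j hi hj =>
    mul_le_mul (pow_le_pow_right₀ hk1 hi) (hxj j 7 hj) (by positivity) (by positivity)
  have hx0 : x ≤ k ^ 6 * x ^ 7 := by simpa using hle 0 1 (by norm_num) (by norm_num)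
  have hb1 : (M : ℝ) ≤ 33 * (k ^ 6 * x ^ 7) :=
    hMx.trans (by gcongr 33 * ?_; exact hle 5 5 (by norm_num) (by norm_num))
  have hb2 : (n : ℝ) ≤ k ^ 6 * x ^ 7 := hnx.trans hx0
  have hb3 : (p : ℝ) ≤ k ^ 6 * x ^ 7 := by
    simpa using hpx.trans (by simpa using hle 1 1 (by norm_num) (by norm_num))
  have hb4 : (p : ℝ) * (M * (100 * n + 30)) ≤ 4290 * (k ^ 6 * x ^ 7) := by
    calc (p : ℝ) * (M * (100 * n + 30)) ≤ (k * x) * (33 * (k ^ 5 * x ^ 5) * (100 * x + 30 *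
        x)) := by
          gcongr
          linarith
      _ = 4290 * (k ^ 6 * x ^ 7) := by ring
  have hb5 : (n : ℝ) * A ≤ k ^ 6 * x ^ 7 * A := by gcongr
  have hb6 : (m : ℝ) ≤ k ^ 6 * x ^ 7 * m := le_mul_of_one_le_left (by positivity) hone
  set T := ⌈k ^ 6 * (5000 + 2 * A + 4 * m)⌉₊ + 7 with hT
  have hTk : k ^ 6 * (5000 + 2 * A + 4 * m) ≤ (T : ℝ) := by
    rw [hT]
    push_cast
    linarith [Nat.le_ceil (k ^ 6 * (5000 + 2 * (A : ℝ) + 4 * m))]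
  calc (t : ℝ) ≤ k ^ 6 * (5000 + 2 * A + 4 * m) * x ^ 7 := by
        refine ht'.trans ?_
        have : k ^ 6 * (5000 + 2 * A + 4 * m) * x ^ 7 = 5000 * (k ^ 6 * x ^ 7) +
          2 * (k ^ 6 * x ^ 7 * A) + 4 * (k ^ 6 * x ^ 7 * m) := by ring
        rw [this]
        nlinarith
    _ ≤ T * x ^ T := by
        gcongr
        · exact Nat.le_add_left 7 _

/-! ### The candidate found -/

theorem cast_voteTotal {n m p M : ℕ} [NeZero p] {ω : Fin M → Bits (2 * n - 1)} {ys : ℕ → ℕ → Bool}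
    (hys : ∀ j (hj : j < M), ys j = (ω ⟨j, hj⟩).at) {t : ℕ} (ht : t < p) :
    (voteTotal n m p M ys t : ℝ) = M + ∑ i, score n m (t : ZMod p) (ω i).at := by
  have h1 : ((voteTotal n m p M ys t : ℤ) : ℝ) = M + ∑ j ∈ Finset.range M,
      (voteInt n m p t (ys j) : ℝ) := by
    rw [voteTotal, Int.toNat_of_nonneg (by linarith [neg_le_sum_voteInt n m p t ys M])]
    push_cast
    rfl
  rw [Int.cast_natCast] at h1
  rw [h1, Finset.sum_range]
  congr 1
  refine Finset.sum_congr rfl fun i _ => ?_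
  rw [cast_voteInt n m ht, hys i i.isLt]

theorem scanMax_voteTotal {n m p M : ℕ} [NeZero p] (hp : 2 ≤ p) {ω : Fin M → Bits (2 * n - 1)}
    {ys : ℕ → ℕ → Bool} (hys : ∀ j (hj : j < M), ys j = (ω ⟨j, hj⟩).at) {s : ZMod p}
    (h : ∀ t ≠ s, ∑ i, score n m t (ω i).at < ∑ i, score n m s (ω i).at) :
    (scanMax (voteTotal n m p M ys) p).2 = s.val := by
  refine scanMax_eq hp (ZMod.val_lt s) fun t ht hts => ?_
  have h1 : (t : ZMod p) ≠ s := fun h2 => hts (by rw [← h2, ZMod.val_cast_of_lt ht])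
  have h3 := h _ h1
  have h4 : (voteTotal n m p M ys t : ℝ) < voteTotal n m p M ys s.val := by
    rw [cast_voteTotal hys ht, cast_voteTotal hys (ZMod.val_lt s), ZMod.natCast_zmod_val]
    linarith
  exact_mod_cast h4

end ShallowLearning
end

section
open ShallowLearning

theorem mainTheorem2 :
    ∃ C : ℝ, 0 < C ∧
      ∀ c : ℝ, 0 < c → c ≤ 1 / 3 →
      ∀ B : (k : ℕ) → Set (ShallowLearning.Bits k),
        (∀ k, 1 ≤ k → ShallowLearning.IsHalf (B k)) →
      ∃ (learner : ShallowLearning.Program) (depthBound : ℕ),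
      ∀ a K : ℝ, 0 < a → 0 < K →
      ∃ p₀ T : ℕ,
      ∀ n p : ℕ, p.Prime → p₀ ≤ p → a * (n : ℝ) ^ c ≤ p → (p : ℝ) ≤ K * (n : ℝ) ^ (1 / 3 : ℝ) →
      ∀ (s : ZMod p) (δ : ℝ), 0 < δ → δ < 1 →
      ∀ M : ℕ, M = ⌈C * (p : ℝ) ^ 4 * Real.log (p / δ)⌉₊ →
        (∀ ω : Fin M → ShallowLearning.Bits (2 * n - 1),
          ∃ (t : ℕ) (o : List ℕ), learner.Runs n p ω t o ∧
            (t : ℝ) ≤ T * (n + Real.log (1 / δ)) ^ T) ∧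
        1 - δ ≤ ShallowLearning.iidProb
          (ShallowLearning.targetDist B ⌈2 / c + 1⌉₊ n p s) M
          {ω | ∃ (t : ℕ) (desc : ShallowLearning.CircuitDesc),
            learner.Runs n p ω t (s.val :: desc.encode) ∧
            desc.toCircuit.IsValid (2 * n - 1) ∧
            desc.toCircuit.depth ≤ depthBound ∧
            ShallowLearning.tvDist (ShallowLearning.targetDist B ⌈2 / c + 1⌉₊ n p s)
              (desc.toCircuit.bornDist (2 * n - 1)) = 0} := by
  refine ⟨16, by norm_num, fun c hc hc' B hB => ?_⟩
  set m := ⌈2 / c + 1⌉₊ with hm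
  have hmc : 2 / c + 1 ≤ m := Nat.le_ceil _
  have hm1 : 1 ≤ m := by
    have h1 : 0 < 2 / c := by positivity
    exact_mod_cast (show (1 : ℝ) ≤ m by linarith)
  -- for each number `r` of left-over qubits there is one program which writes the layers
  choose Ls hLs using exists_layers hB hm1
  set W : ℕ → ℕ := fun r => ((Ls r).map LayerTmpl.size).sum with hW
  set R := 43 + ∑ r ∈ Finset.range m, W r with hR
  have hsize : ∀ r < m, ∀ l ∈ Ls r, l.size ≤ R := fun r hr l hl => by
    have h1 : l.size ≤ W r := List.single_le_sum (by simp) _ (List.mem_map_of_mem hl)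
    have h2 := Finset.single_le_sum (f := W) (fun _ _ => Nat.zero_le _) (Finset.mem_range.2 hr)
    omega
  set A := ∑ r ∈ Finset.range m, ((Ls r).map LayerTmpl.cost).sum with hA
  have hA' : ∀ r < m, ((Ls r).map LayerTmpl.cost).sum ≤ A := fun r hr =>
    Finset.single_le_sum (f := fun r => ((Ls r).map LayerTmpl.cost).sum)
      (fun _ _ => Nat.zero_le _) (Finset.mem_range.2 hr)
  have hdepth : ∀ r < m, (Ls r).length ≤ ∑ r ∈ Finset.range m, (Ls r).length := fun r hr =>
    Finset.single_le_sum (f := fun r => (Ls r).length) (fun _ _ => Nat.zero_le _)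
      (Finset.mem_range.2 hr)
  refine ⟨learner m R Ls, ∑ r ∈ Finset.range m, (Ls r).length, fun a K ha hK => ?_⟩
  obtain ⟨p₀, hp₀⟩ := exists_forall_error_le ha hK hc hc' hmc
  obtain ⟨T, hT⟩ := exists_time_le hK A m
  refine ⟨p₀, T, fun n p hprime hp1 hp2 hp3 s δ hδ hδ' M hM => ?_⟩
  obtain ⟨h3p, h4n, hmn, hε, herr⟩ := hp₀ n p hp1 hp2 hp3
  have : NeZero p := ⟨hprime.ne_zero⟩
  have hodd : Odd p := hprime.odd_of_ne_two (by omega)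
  let ys : (Fin M → Bits (2 * n - 1)) → ℕ → ℕ → Bool := fun ω j =>
    if hj : j < M then (ω ⟨j, hj⟩).at else fun _ => false
  have hys : ∀ ω j (hj : j < M), ys ω j = (ω ⟨j, hj⟩).at := fun ω j hj => dif_pos hj
  constructor
  · intro ω
    obtain ⟨t, τ, h1, h2, -⟩ := reach_learner hLs (by omega) hsize hA' h4n hm1 hmn h3p ω (hys ω) rfl
    exact ⟨t, τ.out, ⟨τ, h1, rfl⟩, hT n p M δ (by omega) (by omega) hδ hδ' hp3 hM t h2⟩
  · have hD : ∀ y, 0 ≤ targetDist B m n p s y := fun y => sq_nonneg _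
    have hsin : Real.sin (Real.pi / p) ^ m ≤ (Real.pi / p) ^ m := by
      have hp1' : (1 : ℝ) ≤ p := by exact_mod_cast (by omega : 1 ≤ p)
      exact pow_le_pow_left₀ (Real.sin_nonneg_of_nonneg_of_le_pi (by positivity)
        (div_le_self Real.pi_pos.le hp1')) (Real.sin_le (by positivity)) m
    refine (one_sub_le_iidProb hD (sum_targetDist hB (by omega) hm1 h3p s) (fun t ht =>
      sum_score_sub_le (by omega) hm1 hmn h3p hodd ht
        (sum_abs_targetDist_sub_le hB (by omega) hm1 hmn h3p s hsin hε) herr) hδ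
      (by rw [hM]; exact Nat.le_ceil _)).trans (iidProb_mono hD fun ω hω => ?_)
    have hs := scanMax_voteTotal (by omega) (hys ω) hω
    obtain ⟨t, τ, h1, -, desc, h2, h5, h6, h7⟩ :=
      reach_learner hLs (by omega) hsize hA' h4n hm1 hmn h3p ω (hys ω) hs
    refine ⟨t, desc, ⟨τ, h1, h2⟩, h5, h6.trans_le (hdepth _ (Nat.mod_lt _ hm1)), ?_⟩
    rw [Circuit.bornDist, h7]
    simp [tvDist, targetDist]
end
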